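/- **Conventions.** Let $n\in\{1,2\}$. A ringed topos $(\mathcal T,\mathcal A)$ is the topos of sheaves on a small site with finite limits together with a sheaf $\mathcal A$ of commutative rings; a morphism $f:(\mathcal T,\mathcal A)\to(\mathcal T',\mathcal A')$ is given by a continuous functor of the sites in the opposite direction preserving finite limits, and a morphism of sheaves of rings $\mathcal A'\to f_*\mathcal A$. (Up to equivalence, every morphism and every composable pair of morphisms of ringed topoi is of this form.) An *$n$-filtered object* of an abelian category is an object $E$ with $n$ increasing filtrations $E^{(i)}=\{E^{(i)}_k\}_{k\in\mathbb Z}$, $1\le i\le n$, by subobjects (not necessarily exhaustive or separated); morphisms preserve all filtrations. ${\rm KF}^n$ is the category of complexes of $n$-filtered objects up to $n$-filtered homotopy, and ${\rm K}^{+}{\rm F}^n$, ${\rm K}^-{\rm F}^n$ are its full subcategories of bounded below, respectively bounded above, complexes. A morphism is an *$n$-filtered quasi-isomorphism* if it is a quasi-isomorphism on the underlying complexes and on all $\bigcap_{j=1}^n E^{(i_j)}_{k_j}$. Inverting these gives ${\rm DF}^n$, ${\rm D}^+{\rm F}^n$, ${\rm D}^-{\rm F}^n$. These constructions are applied to $\mathcal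 A$-modules and to modules over a commutative ring. For $n$-filtered complexes $E,F$ of $\mathcal A$-modules, ${\rm Hom}^\bullet_{\mathcal A}(E,F)$ is the complex with ${\rm Hom}^m=\prod_p{\rm Hom}_{\mathcal A}(E^p,F^{p+m})$, all $\mathcal A$-linear maps being allowed, filtered by ${\rm Hom}^{(i)}_k=\{u : u(E^{(i)}_l)\subset F^{(i)}_{l+k}\text{ for all } l\}$. For a ring morphism $\rho:B\to\Gamma(\mathcal T,\mathcal A)$, with $B$ a commutative ring, it is an $n$-filtered complex of $B$-modules. The functors $f_*$ and $f^*$ are applied to filtered modules by taking the images of $f_*E^{(i)}_k$ in $f_*E$ and of $f^*E^{(i)}_k$ in $f^*E$. Derived functors are understood in the sense of the universal property (Kan extension along the localization functors): $$Rf_*:{\rm D}^+{\rm F}^n(\mathcal A)\to{\rm D}^+{\rm F}^n(\mathcal A'),\qquad Lf^*:{\rm D}^-{\rm F}^n(\mathcal A')\to{\rm D}^-{\rm F}^n(\mathcal A),$$ $$R{\rm Hom}_{\mathcal A}:{\rm DF}^n(\mathcal A)^{\rm op}\times{\rm D}^+{\rm F}^n(\mathcal A)\to{\rm DF}^n(B).$$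 **Theorem (adjunction formula).** 1. The derived functors $Rf_*$, $Lf^*$ and $R{\rm Hom}_{\mathcal A}$ exist for every morphism $f$ of ringed topoi, every $(\mathcal T,\mathcal A)$ and every $B\to\Gamma(\mathcal T,\mathcal A)$. For ring morphisms $B\to B_1\to\Gamma(\mathcal T,\mathcal A)$, restriction of scalars induces a functor ${\rm DF}^n(B_1)\to{\rm DF}^n(B)$, which carries $R{\rm Hom}_{\mathcal A}$ with values in ${\rm DF}^n(B_1)$ to the one with values in ${\rm DF}^n(B)$, compatibly with the identification of the complexes ${\rm Hom}^\bullet_{\mathcal A}$. 2. Let $f:(\mathcal T,\mathcal A)\to(\mathcal T',\mathcal A')$ be a morphism of ringed topoi, let $B\to\Gamma(\mathcal T',\mathcal A')$ be a morphism of commutative rings (for example the identity), and let $B$ map to $\Gamma(\mathcal T,\mathcal A)$ through it and $\Gamma(\mathcal T',\mathcal A')\to\Gamma(\mathcal T,\mathcal A)$. Then there is exactly one morphism $$\theta_f:\ R{\rm Hom}_{\mathcal A}(Lf^*E,F)\longrightarrow R{\rm Hom}_{\mathcal A'}(E,Rf_*F)$$ in ${\rm DF}^n(B)$, functorial in $E\in{\rm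 D}^-{\rm F}^n(\mathcal A')$ and $F\in{\rm D}^+{\rm F}^n(\mathcal A)$, which is *canonical* in the following sense: for all complexes $E\in{\rm K}^-{\rm F}^n(\mathcal A')$ and $F\in{\rm K}^+{\rm F}^n(\mathcal A)$ the composite $${\rm Hom}^\bullet_{\mathcal A}(f^*E,F)\to R{\rm Hom}_{\mathcal A}(f^*E,F)\to R{\rm Hom}_{\mathcal A}(Lf^*E,F)\xrightarrow{\theta_f}R{\rm Hom}_{\mathcal A'}(E,Rf_*F)$$ equals the composite $${\rm Hom}^\bullet_{\mathcal A}(f^*E,F)\to{\rm Hom}^\bullet_{\mathcal A'}(E,f_*F)\to R{\rm Hom}_{\mathcal A'}(E,f_*F)\to R{\rm Hom}_{\mathcal A'}(E,Rf_*F),$$ whose first map is given by the adjunction $f^*\dashv f_*$ and whose other maps are the natural ones. Moreover $\theta_f$ is an isomorphism. In particular, for $B=\Gamma(\mathcal T',\mathcal A')$, $$R{\rm Hom}_{\mathcal A}(Lf^*E,F)\cong R{\rm Hom}_{\mathcal A'}(E,Rf_*F)\quad\text{in }{\rm DF}^n(\Gamma(\mathcal T',\mathcal A')).$$ 3. (Transitivity.)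 Let $g:(\mathcal T',\mathcal A')\to(\mathcal T'',\mathcal A'')$ be a further morphism, and let $B\to\Gamma(\mathcal T'',\mathcal A'')$ be given. There are isomorphisms $c_R:R(gf)_*\cong Rg_*Rf_*$ and $c_L:Lf^*Lg^*\cong L(gf)^*$ lying over the canonical isomorphisms $(gf)_*\cong g_*f_*$ and $f^*g^*\cong(gf)^*$, and with them, for all $E\in{\rm D}^-{\rm F}^n(\mathcal A'')$ and $F\in{\rm D}^+{\rm F}^n(\mathcal A)$, the composite $$R{\rm Hom}_{\mathcal A}(L(gf)^*E,F)\xrightarrow{c_L}R{\rm Hom}_{\mathcal A}(Lf^*Lg^*E,F)\xrightarrow{\theta_f}R{\rm Hom}_{\mathcal A'}(Lg^*E,Rf_*F)\xrightarrow{\theta_g}R{\rm Hom}_{\mathcal A''}(E,Rg_*Rf_*F)$$ equals $\theta_{gf}$ followed by the isomorphism $R{\rm Hom}_{\mathcal A''}(E,R(gf)_*F)\cong R{\rm Hom}_{\mathcal A''}(E,Rg_*Rf_*F)$ induced by $c_R$. -/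

import Mathlib

open CategoryTheory Limits Opposite

universe w w₁ u v u₁ u₂ u₃ v₁ v₂ v₃

noncomputable section

namespace MultiFiltered

section Obj

variable (n : ℕ) (𝒜 : Type u) [Category.{v} 𝒜]

/-- An object of `𝒜` with `n` increasing filtrations indexed by `ℤ`
(neither exhaustive nor separated in general). -/
structure FiltObj where
  /-- the underlying object -/
  obj : 𝒜
  /-- the `n` filtrations -/
  fil : Fin n → ℤ →o Subobject obj

end Obj

variable {n : ℕ} {𝒜 : Type u} [Category.{v} 𝒜] [Abelian 𝒜]

lemma factors_iff_comp_cokernel {X Y : 𝒜} (S : Subobject Y) (f : X ⟶ Y) :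
    S.Factors f ↔ f ≫ cokernel.π S.arrow = 0 := by
  constructor
  · intro h
    rw [← S.factorThru_arrow f h, Category.assoc, cokernel.condition, comp_zero]
  · intro h
    rw [Subobject.factors_iff]
    exact ⟨Abelian.monoLift S.arrow f h, Abelian.monoLift_comp S.arrow f h⟩

lemma factors_of_epi_comp {W X Y : 𝒜} (S : Subobject Y) (e : W ⟶ X) [Epi e] (f : X ⟶ Y)
    (h : S.Factors (e ≫ f)) : S.Factors f := by
  rw [factors_iff_comp_cokernel] at h ⊢
  rw [← cancel_epi e, ← Category.assoc, h, comp_zero]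

lemma image_factors_iff {W X Y : 𝒜} (S : Subobject Y) (p : W ⟶ X) (f : X ⟶ Y) :
    S.Factors ((imageSubobject p).arrow ≫ f) ↔ S.Factors (p ≫ f) := by
  constructor
  · intro h
    rw [← imageSubobject_arrow_comp p, Category.assoc]
    exact Subobject.factors_of_factors_right _ h
  · intro h
    refine factors_of_epi_comp S (factorThruImageSubobject p) _ ?_
    rwa [← Category.assoc, imageSubobject_arrow_comp]

lemma image_factors_self {W X : 𝒜} (p : W ⟶ X) : (imageSubobject p).Factors p := by
  rw [Subobject.factors_iff]
  exact ⟨factorThruImageSubobject p, imageSubobject_arrow_comp p⟩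

/-- The morphisms `X ⟶ Y` of underlying objects that map each step of each filtration of `X`
into the corresponding step for `Y`. -/
def homSubgroup (X Y : FiltObj n 𝒜) : AddSubgroup (X.obj ⟶ Y.obj) where
  carrier := {f | ∀ (i : Fin n) (k : ℤ), (Y.fil i k).Factors ((X.fil i k).arrow ≫ f)}
  zero_mem' := fun i k => by rw [comp_zero]; exact Subobject.factors_zero
  add_mem' := fun {f g} hf hg i k => by
    rw [Preadditive.comp_add]
    exact Subobject.factors_add _ _ (hf i k) (hg i k)
  neg_mem' := fun {f} hf i k => by
    have := hf i k
    rw [factors_iff_comp_cokernel] at this ⊢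
    simpa using this

/-- The additive category of `n`-filtered objects of `𝒜`. -/
instance : Category (FiltObj n 𝒜) where
  Hom X Y := homSubgroup X Y
  id X := ⟨𝟙 X.obj, fun i k => by
    rw [Category.comp_id]; exact Subobject.factors_self _⟩
  comp {X Y Z} f g := ⟨f.1 ≫ g.1, fun i k => by
    rw [← Category.assoc, ← Subobject.factorThru_arrow _ _ (f.2 i k), Category.assoc]
    exact Subobject.factors_of_factors_right _ (g.2 i k)⟩
  id_comp f := Subtype.ext (Category.id_comp _)
  comp_id f := Subtype.ext (Category.comp_id _)
  assoc f g h := Subtype.ext (Category.assoc _ _ _)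

lemma FiltObj.hom_ext {X Y : FiltObj n 𝒜} {f g : X ⟶ Y} (h : f.1 = g.1) : f = g :=
  Subtype.ext h

@[simp] lemma FiltObj.id_val (X : FiltObj n 𝒜) : (𝟙 X : X ⟶ X).1 = 𝟙 X.obj := rfl

@[simp] lemma FiltObj.comp_val {X Y Z : FiltObj n 𝒜} (f : X ⟶ Y) (g : Y ⟶ Z) :
    (f ≫ g).1 = f.1 ≫ g.1 := rfl

instance : Preadditive (FiltObj n 𝒜) where
  homGroup X Y := inferInstanceAs (AddCommGroup (homSubgroup X Y))
  add_comp _ _ _ _ _ _ := Subtype.ext (Preadditive.add_comp _ _ _ _ _ _)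
  comp_add _ _ _ _ _ _ := Subtype.ext (Preadditive.comp_add _ _ _ _ _ _)

@[simp] lemma FiltObj.add_val {X Y : FiltObj n 𝒜} (f g : X ⟶ Y) : (f + g).1 = f.1 + g.1 := rfl

@[simp] lemma FiltObj.zero_val (X Y : FiltObj n 𝒜) : (0 : X ⟶ Y).1 = 0 := rfl

/-- Forgetting the filtrations. -/
@[simps] def forget (n : ℕ) (𝒜 : Type u) [Category.{v} 𝒜] [Abelian 𝒜] : FiltObj n 𝒜 ⥤ 𝒜 where
  obj X := X.obj
  map f := f.1

instance : (forget n 𝒜).Additive where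

/-- The intersection `⋂ j, X^{(i j)}_{k j}` of `n` filtration steps. -/
def FiltObj.inter (X : FiltObj n 𝒜) (i : Fin n → Fin n) (k : Fin n → ℤ) : Subobject X.obj :=
  Finset.univ.inf fun j => X.fil (i j) (k j)

lemma FiltObj.inter_factors {X Y : FiltObj n 𝒜} (f : X ⟶ Y) (i : Fin n → Fin n)
    (k : Fin n → ℤ) : (Y.inter i k).Factors ((X.inter i k).arrow ≫ f.1) := by
  unfold inter
  rw [Subobject.finset_inf_factors]
  intro j _
  have h : X.inter i k ≤ X.fil (i j) (k j) := Finset.inf_le (Finset.mem_univ j)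
  have := Subobject.ofLE_arrow h
  unfold inter at this
  rw [← this, Category.assoc]
  exact Subobject.factors_of_factors_right _ (f.2 _ _)

/-- The functor `X ↦ ⋂ j, X^{(i j)}_{k j}`. -/
def inter (i : Fin n → Fin n) (k : Fin n → ℤ) : FiltObj n 𝒜 ⥤ 𝒜 where
  obj X := (X.inter i k : 𝒜)
  map {X Y} f := (Y.inter i k).factorThru _ (FiltObj.inter_factors f i k)
  map_id X := by
    rw [← cancel_mono (X.inter i k).arrow]; simp
  map_comp {X Y Z} f g := by
    rw [← cancel_mono (Z.inter i k).arrow]; simp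

instance (i : Fin n → Fin n) (k : Fin n → ℤ) : (inter (𝒜 := 𝒜) i k).Additive where
  map_add {X Y f g} := by
    apply (cancel_mono (Y.inter i k).arrow).1
    refine Eq.trans ?_ (Preadditive.add_comp _ _ _ _ _ _).symm
    simp [inter]
    rfl


/-! ### Filtered complexes and filtered derived categories -/

variable (n 𝒜) in
/-- The category of complexes of `n`-filtered objects up to `n`-filtered homotopy. -/
abbrev KF := HomotopyCategory (FiltObj n 𝒜) (ComplexShape.up ℤ)

variable (n 𝒜) in
/-- The `n`-filtered quasi-isomorphisms: quasi-isomorphisms on the underlying complexes and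
on all intersections of filtration steps. -/
def fqis : MorphismProperty (KF n 𝒜) := fun _ _ f =>
  HomotopyCategory.quasiIso 𝒜 _ (((forget n 𝒜).mapHomotopyCategory _).map f) ∧
  ∀ (i : Fin n → Fin n) (k : Fin n → ℤ),
    HomotopyCategory.quasiIso 𝒜 _ (((inter i k).mapHomotopyCategory _).map f)

variable (n 𝒜) in
/-- Complexes that vanish in all sufficiently small degrees. -/
def isBoundedBelow : ObjectProperty (KF n 𝒜) := fun K => ∃ N : ℤ, ∀ q < N, IsZero (K.as.X q)

variable (n 𝒜) in
/-- Complexes that vanish in all sufficiently large degrees. -/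
def isBoundedAbove : ObjectProperty (KF n 𝒜) := fun K => ∃ N : ℤ, ∀ q > N, IsZero (K.as.X q)

variable (n 𝒜) in
/-- The bounded below part of `KF`. -/
abbrev KFplus := (isBoundedBelow n 𝒜).FullSubcategory

variable (n 𝒜) in
/-- The bounded above part of `KF`. -/
abbrev KFminus := (isBoundedAbove n 𝒜).FullSubcategory

variable (n 𝒜) in
/-- The `n`-filtered quasi-isomorphisms between bounded below complexes. -/
abbrev fqisPlus : MorphismProperty (KFplus n 𝒜) := (fqis n 𝒜).inverseImage (isBoundedBelow n 𝒜).ι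

variable (n 𝒜) in
/-- The `n`-filtered quasi-isomorphisms between bounded above complexes. -/
abbrev fqisMinus : MorphismProperty (KFminus n 𝒜) :=
  (fqis n 𝒜).inverseImage (isBoundedAbove n 𝒜).ι

variable (n 𝒜) in
/-- The derived category of `n`-filtered complexes. -/
abbrev DF := (fqis n 𝒜).Localization

variable (n 𝒜) in
/-- The derived category of bounded below `n`-filtered complexes. -/
abbrev DFplus := (fqisPlus n 𝒜).Localization

variable (n 𝒜) in
/-- The derived category of bounded above `n`-filtered complexes. -/
abbrev DFminus := (fqisMinus n 𝒜).Localization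

variable (n 𝒜) in
/-- The localization functor. -/
abbrev Qh : KF n 𝒜 ⥤ DF n 𝒜 := (fqis n 𝒜).Q

variable (n 𝒜) in
/-- The localization functor for bounded below complexes. -/
abbrev Qplus : KFplus n 𝒜 ⥤ DFplus n 𝒜 := (fqisPlus n 𝒜).Q

variable (n 𝒜) in
/-- The localization functor for bounded above complexes. -/
abbrev Qminus : KFminus n 𝒜 ⥤ DFminus n 𝒜 := (fqisMinus n 𝒜).Q

lemma fqisMinus_isInvertedBy :
    (fqisMinus n 𝒜).IsInvertedBy ((isBoundedAbove n 𝒜).ι ⋙ Qh n 𝒜) := fun _ _ _ hf =>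
  (fqis n 𝒜).Q_inverts _ hf

variable (n 𝒜) in
/-- The functor from the bounded above derived category to the derived category
that is induced by the inclusion of complexes. -/
def inclMinus : DFminus n 𝒜 ⥤ DF n 𝒜 :=
  Localization.lift ((isBoundedAbove n 𝒜).ι ⋙ Qh n 𝒜) fqisMinus_isInvertedBy (Qminus n 𝒜)

variable (n 𝒜) in
/-- The compatibility of `inclMinus` with the inclusion of complexes. -/
def inclMinusIso : Qminus n 𝒜 ⋙ inclMinus n 𝒜 ≅ (isBoundedAbove n 𝒜).ι ⋙ Qh n 𝒜 :=
  Localization.fac ((isBoundedAbove n 𝒜).ι ⋙ Qh n 𝒜) fqisMinus_isInvertedBy (Qminus n 𝒜)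

instance : (fqis n 𝒜).ContainsIdentities where
  id_mem X :=
    ⟨((HomotopyCategory.quasiIso 𝒜 (.up ℤ)).inverseImage
        ((forget n 𝒜).mapHomotopyCategory _)).id_mem X, fun i k =>
      ((HomotopyCategory.quasiIso 𝒜 (.up ℤ)).inverseImage
        ((inter i k).mapHomotopyCategory _)).id_mem X⟩

section Map

variable {ℬ : Type u₁} [Category.{v₁} ℬ] [Abelian ℬ]

/-- The functor on `n`-filtered objects induced by an additive functor `G`: the `k`-th step of a
filtration of `G X` is the image of `G (X_k)` in `G X`. -/
@[simps] def mapFilt (n : ℕ) (G : 𝒜 ⥤ ℬ) : FiltObj n 𝒜 ⥤ FiltObj n ℬ where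
  obj X :=
    { obj := G.obj X.obj
      fil := fun i =>
        { toFun := fun k => imageSubobject (G.map (X.fil i k).arrow)
          monotone' := fun k l hkl => by
            have h := (X.fil i).monotone hkl
            have h' : (imageSubobject (G.map (X.fil i l).arrow)).Factors
                (imageSubobject (G.map (X.fil i k).arrow)).arrow := by
              rw [← Category.comp_id (imageSubobject (G.map (X.fil i k).arrow)).arrow,
                image_factors_iff, Category.comp_id,
                ← congrArg G.map (Subobject.ofLE_arrow h), G.map_comp]
              exact Subobject.factors_of_factors_right _ (image_factors_self _)
            exact Subobject.le_of_comm (Subobject.factorThru _ _ h')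
              (Subobject.factorThru_arrow _ _ h') } }
  map {X Y} f := ⟨G.map f.1, fun i k => by
    change (imageSubobject (G.map (Y.fil i k).arrow)).Factors
      ((imageSubobject (G.map (X.fil i k).arrow)).arrow ≫ G.map f.1)
    rw [image_factors_iff, ← G.map_comp, ← Subobject.factorThru_arrow _ _ (f.2 i k), G.map_comp]
    exact Subobject.factors_of_factors_right _ (image_factors_self _)⟩
  map_id X := Subtype.ext (G.map_id _)
  map_comp f g := Subtype.ext (G.map_comp _ _)

instance (G : 𝒜 ⥤ ℬ) [G.Additive] : (mapFilt n G).Additive where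
  map_add := Subtype.ext G.map_add

variable (n) in
/-- The functor induced by `G` on filtered complexes up to homotopy. -/
abbrev mapKF (G : 𝒜 ⥤ ℬ) [G.Additive] : KF n 𝒜 ⥤ KF n ℬ :=
  (mapFilt n G).mapHomotopyCategory _

lemma isZero_mapFilt (G : 𝒜 ⥤ ℬ) [G.Additive] {X : FiltObj n 𝒜} (h : IsZero X) :
    IsZero ((mapFilt n G).obj X) := by
  rw [IsZero.iff_id_eq_zero] at h ⊢
  rw [← (mapFilt n G).map_id, h, Functor.map_zero]

variable (n) in
/-- The functor induced by `G` on bounded below filtered complexes up to homotopy. -/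
abbrev mapKFplus (G : 𝒜 ⥤ ℬ) [G.Additive] : KFplus n 𝒜 ⥤ KFplus n ℬ :=
  ObjectProperty.lift _ ((isBoundedBelow n 𝒜).ι ⋙ mapKF n G)
    fun K => K.property.imp fun _ hN q hq => isZero_mapFilt G (hN q hq)

variable (n) in
/-- The functor induced by `G` on bounded above filtered complexes up to homotopy. -/
abbrev mapKFminus (G : 𝒜 ⥤ ℬ) [G.Additive] : KFminus n 𝒜 ⥤ KFminus n ℬ :=
  ObjectProperty.lift _ ((isBoundedAbove n 𝒜).ι ⋙ mapKF n G)
    fun K => K.property.imp fun _ hN q hq => isZero_mapFilt G (hN q hq)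

section Comp

variable {𝒞 : Type u₂} [Category.{v₂} 𝒞] [Abelian 𝒞]

/-- For `τ : T ⟶ H ⋙ G`, the induced transformation on filtered objects. -/
@[simps] def mapFiltToComp {H : 𝒜 ⥤ ℬ} {G : ℬ ⥤ 𝒞} {T : 𝒜 ⥤ 𝒞} (τ : T ⟶ H ⋙ G) :
    mapFilt n T ⟶ mapFilt n H ⋙ mapFilt n G where
  app X := ⟨τ.app X.obj, fun i k => by
    change (imageSubobject (G.map (imageSubobject (H.map (X.fil i k).arrow)).arrow)).Factors
      ((imageSubobject (T.map (X.fil i k).arrow)).arrow ≫ τ.app X.obj)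
    rw [image_factors_iff, τ.naturality, Functor.comp_map,
      ← congrArg G.map (imageSubobject_arrow_comp (H.map (X.fil i k).arrow)), G.map_comp,
      ← Category.assoc]
    exact Subobject.factors_of_factors_right _ (image_factors_self _)⟩
  naturality X Y f := Subtype.ext (τ.naturality f.1)

/-- For `σ : H ⋙ G ⟶ T` with `G` preserving epimorphisms, the induced transformation on
filtered objects. -/
@[simps] def mapFiltOfComp {H : 𝒜 ⥤ ℬ} {G : ℬ ⥤ 𝒞} {T : 𝒜 ⥤ 𝒞} [G.PreservesEpimorphisms]
    (σ : H ⋙ G ⟶ T) : mapFilt n H ⋙ mapFilt n G ⟶ mapFilt n T where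
  app X := ⟨σ.app X.obj, fun i k => by
    change (imageSubobject (T.map (X.fil i k).arrow)).Factors
      ((imageSubobject (G.map (imageSubobject (H.map (X.fil i k).arrow)).arrow)).arrow ≫
        σ.app X.obj)
    rw [image_factors_iff]
    refine factors_of_epi_comp _
      (G.map (factorThruImageSubobject (H.map (X.fil i k).arrow))) _ ?_
    rw [← Category.assoc, ← G.map_comp, imageSubobject_arrow_comp, ← Functor.comp_map,
      σ.naturality]
    exact Subobject.factors_of_factors_right _ (image_factors_self _)⟩
  naturality X Y f := Subtype.ext (σ.naturality f.1)

/-- For `τ : T ⟶ H ⋙ G`, the induced morphism on bounded below filtered complexes. -/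
def mapKFplusToComp {H : 𝒜 ⥤ ℬ} {G : ℬ ⥤ 𝒞} {T : 𝒜 ⥤ 𝒞} [H.Additive] [G.Additive] [T.Additive]
    (τ : T ⟶ H ⋙ G) (K : KFplus n 𝒜) :
    (mapKFplus n T).obj K ⟶ (mapKFplus n G).obj ((mapKFplus n H).obj K) :=
  ObjectProperty.homMk ((NatTrans.mapHomotopyCategory (mapFiltToComp τ) (.up ℤ)).app K.obj)

/-- For `σ : H ⋙ G ⟶ T`, the induced morphism on bounded above filtered complexes. -/
def mapKFminusOfComp {H : 𝒜 ⥤ ℬ} {G : ℬ ⥤ 𝒞} {T : 𝒜 ⥤ 𝒞} [G.PreservesEpimorphisms]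
    [H.Additive] [G.Additive] [T.Additive] (σ : H ⋙ G ⟶ T) (K : KFminus n 𝒜) :
    (mapKFminus n G).obj ((mapKFminus n H).obj K) ⟶ (mapKFminus n T).obj K :=
  ObjectProperty.homMk ((NatTrans.mapHomotopyCategory (mapFiltOfComp σ) (.up ℤ)).app K.obj)

end Comp

end Map


/-! ### The filtered complex of homomorphisms -/

section Hom

open CochainComplex HomComplex

/-- The underlying complex of a filtered complex. -/
abbrev und (E : CochainComplex (FiltObj n 𝒜) ℤ) : CochainComplex 𝒜 ℤ :=
  ((forget n 𝒜).mapHomologicalComplex _).obj E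

/-- The underlying morphism of a morphism of filtered complexes. -/
abbrev undMap {E F : CochainComplex (FiltObj n 𝒜) ℤ} (f : E ⟶ F) : und E ⟶ und F :=
  ((forget n 𝒜).mapHomologicalComplex _).map f

variable (B : Type w) [CommRing B]

section Module

variable {B}

/-- An object of `FiltObj n (ModuleCat B)` from a module with filtrations by submodules. -/
@[simps] def ofModule (M : Type v) [AddCommGroup M] [Module B M] (p : Fin n → ℤ →o Submodule B M) :
    FiltObj n (ModuleCat.{v} B) where
  obj := ModuleCat.of B M
  fil i := ⟨fun k => (ModuleCat.subobjectModule (ModuleCat.of B M)).symm (p i k),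
    fun _ _ h => (ModuleCat.subobjectModule (ModuleCat.of B M)).symm.monotone ((p i).monotone h)⟩

lemma submodule_factors {M N : Type v} [AddCommGroup M] [Module B M] [AddCommGroup N] [Module B N]
    (p : Submodule B M) (q : Submodule B N) (f : M →ₗ[B] N) (h : ∀ x ∈ p, f x ∈ q) :
    ((ModuleCat.subobjectModule (ModuleCat.of B N)).symm q).Factors
      (((ModuleCat.subobjectModule (ModuleCat.of B M)).symm p).arrow ≫ ModuleCat.ofHom f) := by
  have : Mono (ModuleCat.ofHom q.subtype) := (ModuleCat.mono_iff_injective _).2 q.injective_subtype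
  have : Mono (ModuleCat.ofHom p.subtype) := (ModuleCat.mono_iff_injective _).2 p.injective_subtype
  change (Subobject.mk (ModuleCat.ofHom q.subtype)).Factors
    ((Subobject.mk (ModuleCat.ofHom p.subtype)).arrow ≫ ModuleCat.ofHom f)
  rw [← Subobject.underlyingIso_hom_comp_eq_mk, Category.assoc]
  refine Subobject.factors_of_factors_right _ ?_
  rw [Subobject.mk_factors_iff]
  exact ⟨ModuleCat.ofHom (f.restrict h), rfl⟩

/-- A filtered linear map as a morphism of filtered objects. -/
def ofModuleHom {M N : Type v} [AddCommGroup M] [Module B M] [AddCommGroup N] [Module B N]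
    {p : Fin n → ℤ →o Submodule B M} {q : Fin n → ℤ →o Submodule B N} (f : M →ₗ[B] N)
    (h : ∀ i k, ∀ x ∈ p i k, f x ∈ q i k) : ofModule M p ⟶ ofModule N q :=
  ⟨ModuleCat.ofHom f, fun i k => submodule_factors _ _ f (h i k)⟩

end Module

variable [Linear B 𝒜]

/-- The morphisms of underlying objects that map the `l`-th step of the `i`-th filtration of `X`
into the `(l + k)`-th step for `Y`, for all `l`. -/
def homFil (X Y : FiltObj n 𝒜) (i : Fin n) (k : ℤ) : Submodule B (X.obj ⟶ Y.obj) where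
  carrier := {f | ∀ l : ℤ, (Y.fil i (l + k)).Factors ((X.fil i l).arrow ≫ f)}
  zero_mem' := fun l => by rw [comp_zero]; exact Subobject.factors_zero
  add_mem' := fun {a b} ha hb l => by
    rw [Preadditive.comp_add]
    exact Subobject.factors_add _ _ (ha l) (hb l)
  smul_mem' := fun c a ha l => by
    have := ha l
    rw [factors_iff_comp_cokernel] at this ⊢
    rw [Linear.comp_smul, Linear.smul_comp, this, smul_zero]

lemma homFil_mono (X Y : FiltObj n 𝒜) (i : Fin n) : Monotone (homFil B X Y i) :=
  fun _ _ hkl _ hz l =>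
    Subobject.factors_of_le _ ((Y.fil i).monotone (by omega)) (hz l)

lemma comp_mem_homFil {X Y Z : FiltObj n 𝒜} {i : Fin n} {k k' k'' : ℤ} {f : X.obj ⟶ Y.obj}
    {g : Y.obj ⟶ Z.obj} (hf : f ∈ homFil B X Y i k) (hg : g ∈ homFil B Y Z i k')
    (h : k + k' = k'') : f ≫ g ∈ homFil B X Z i k'' := fun l => by
  rw [← Category.assoc, ← Subobject.factorThru_arrow _ _ (hf l), Category.assoc, ← h, ← add_assoc]
  exact Subobject.factors_of_factors_right _ (hg (l + k))

lemma hom_mem_homFil {X Y : FiltObj n 𝒜} (f : X ⟶ Y) (i : Fin n) : f.1 ∈ homFil B X Y i 0 :=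
  fun l => by rw [add_zero]; exact f.2 i l

/-- The cochains of degree `m` in the `k`-th step of the `i`-th filtration. -/
def cochainFil (E F : CochainComplex (FiltObj n 𝒜) ℤ) (m : ℤ) (i : Fin n) (k : ℤ) :
    Submodule B (Cochain (und E) (und F) m) where
  carrier := {z | ∀ (p q : ℤ) (hpq : p + m = q), z.v p q hpq ∈ homFil B (E.X p) (F.X q) i k}
  zero_mem' := fun p q _ => (homFil B (E.X p) (F.X q) i k).zero_mem
  add_mem' := fun ha hb p q hpq =>
    (homFil B (E.X p) (F.X q) i k).add_mem (ha p q hpq) (hb p q hpq)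
  smul_mem' := fun c _ ha p q hpq => (homFil B (E.X p) (F.X q) i k).smul_mem c (ha p q hpq)

lemma cochainFil_mono (E F : CochainComplex (FiltObj n 𝒜) ℤ) (m : ℤ) (i : Fin n) :
    Monotone (cochainFil B E F m i) := fun _ _ hkl _ hz p q hpq =>
  homFil_mono B _ _ i hkl (hz p q hpq)

variable {B} in
lemma comp_mem_cochainFil {E F G : CochainComplex (FiltObj n 𝒜) ℤ} {m m' m'' : ℤ} {i : Fin n}
    {k k' k'' : ℤ} {z : Cochain (und E) (und F) m} {z' : Cochain (und F) (und G) m'}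
    (hz : z ∈ cochainFil B E F m i k) (hz' : z' ∈ cochainFil B F G m' i k') (h : m + m' = m'')
    (hk : k + k' = k'') : z.comp z' h ∈ cochainFil B E G m'' i k'' := fun p q hpq => by
  rw [Cochain.comp_v z z' h p (p + m) q rfl (by omega)]
  exact comp_mem_homFil B (hz p (p + m) rfl) (hz' (p + m) q (by omega)) hk

lemma ofHom_mem_cochainFil {E F : CochainComplex (FiltObj n 𝒜) ℤ} (f : E ⟶ F) (i : Fin n) :
    Cochain.ofHom (undMap f) ∈ cochainFil B E F 0 i 0 := fun p q hpq => by
  obtain rfl : p = q := by omega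
  rw [Cochain.ofHom_v]
  exact hom_mem_homFil B (f.f p) i

lemma ofHomotopy_mem_cochainFil {E F : CochainComplex (FiltObj n 𝒜) ℤ} {f g : E ⟶ F}
    (h : Homotopy f g) (i : Fin n) :
    Cochain.ofHomotopy ((forget n 𝒜).mapHomotopy h) ∈ cochainFil B E F (-1) i 0 :=
  fun p q _ => hom_mem_homFil B (h.hom p q) i

variable {B} in
lemma δ_mem_cochainFil {E F : CochainComplex (FiltObj n 𝒜) ℤ} {m m' : ℤ} {i : Fin n} {k : ℤ}
    {z : Cochain (und E) (und F) m} (hz : z ∈ cochainFil B E F m i k) :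
    δ m m' z ∈ cochainFil B E F m' i k := by
  by_cases h : m + 1 = m'
  · intro p q hpq
    rw [δ_v m m' h z p q hpq (q - 1) (p + 1) rfl rfl]
    refine (homFil B (E.X p) (F.X q) i k).add_mem
      (comp_mem_homFil B (hz p (q - 1) (by omega)) (hom_mem_homFil B (F.d (q - 1) q) i)
        (add_zero k)) ?_
    have := comp_mem_homFil B (hom_mem_homFil B (E.d p (p + 1)) i) (hz (p + 1) q (by omega))
      (zero_add k)
    rcases Int.units_eq_one_or m'.negOnePow with h | h <;> rw [h]
    · rw [one_smul]; exact this
    · rw [Units.neg_smul, one_smul]; exact (homFil B (E.X p) (F.X q) i k).neg_mem this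
  · rw [δ_shape _ _ h]
    exact Submodule.zero_mem _

/-- The filtered complex `Hom(E, F)`: in degree `m` it is the module of all families of morphisms
`E^p ⟶ F^(p + m)` of the underlying objects. -/
def homCx (E F : CochainComplex (FiltObj n 𝒜) ℤ) :
    CochainComplex (FiltObj n (ModuleCat.{v} B)) ℤ where
  X m := ofModule (Cochain (und E) (und F) m)
    fun i => ⟨cochainFil B E F m i, cochainFil_mono B E F m i⟩
  d _ _ := ofModuleHom (δ_hom B (und E) (und F) _ _) fun _ _ _ hz => δ_mem_cochainFil hz
  shape _ _ h := Subtype.ext (ModuleCat.hom_ext (LinearMap.ext fun z => δ_shape _ _ h z))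
  d_comp_d' _ _ _ _ _ :=
    Subtype.ext (ModuleCat.hom_ext (LinearMap.ext fun z => δ_δ _ _ _ z))

/-- The linear map `z ↦ b ∘ z ∘ a` on cochains. -/
@[simps] def compCochain {K K' L L' : CochainComplex 𝒜 ℤ} {r s m p m' : ℤ} (a : Cochain K' K r)
    (b : Cochain L L' s) (h : r + m = p) (h' : p + s = m') :
    Cochain K L m →ₗ[B] Cochain K' L' m' where
  toFun z := (a.comp z h).comp b h'
  map_add' z z' := by simp
  map_smul' c z := by simp

/-- The linear map `z ↦ b ∘ z ∘ a` for filtered cochains `a` and `b`. -/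
def compHom {E E' F F' : CochainComplex (FiltObj n 𝒜) ℤ} {r s m p m' : ℤ}
    (a : Cochain (und E') (und E) r) (b : Cochain (und F) (und F') s) (h : r + m = p)
    (h' : p + s = m') (ha : ∀ i, a ∈ cochainFil B E' E r i 0)
    (hb : ∀ i, b ∈ cochainFil B F F' s i 0) : (homCx B E F).X m ⟶ (homCx B E' F').X m' :=
  ofModuleHom (compCochain B a b h h') fun i k _ hz =>
    comp_mem_cochainFil (comp_mem_cochainFil (ha i) hz h (zero_add k)) (hb i) h' (add_zero k)

/-- The map `z ↦ g ∘ z ∘ f` on complexes of homomorphisms. -/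
def homCxMap {E E' F F' : CochainComplex (FiltObj n 𝒜) ℤ} (f : E' ⟶ E) (g : F ⟶ F') :
    homCx B E F ⟶ homCx B E' F' where
  f m := compHom B (Cochain.ofHom (undMap f)) (Cochain.ofHom (undMap g)) (zero_add m) (add_zero m)
    (ofHom_mem_cochainFil B f) (ofHom_mem_cochainFil B g)
  comm' m m' _ := Subtype.ext (ModuleCat.hom_ext (LinearMap.ext
    fun (z : Cochain (und E) (und F) m) => by
      change δ m m' (compCochain B (Cochain.ofHom (undMap f)) (Cochain.ofHom (undMap g))
          (zero_add m) (add_zero m) z) =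
        compCochain B (Cochain.ofHom (undMap f)) (Cochain.ofHom (undMap g))
          (zero_add m') (add_zero m') (δ m m' z)
      simp))

lemma homCx_hom_ext {E E' F F' : CochainComplex (FiltObj n 𝒜) ℤ} {m m' : ℤ}
    {f g : (homCx B E F).X m ⟶ (homCx B E' F').X m'}
    (h : ∀ z : Cochain (und E) (und F) m, (f.1.hom z : Cochain (und E') (und F') m') = g.1.hom z) :
    f = g :=
  Subtype.ext (ModuleCat.hom_ext (LinearMap.ext h))

lemma homCxMap_id (E F : CochainComplex (FiltObj n 𝒜) ℤ) :
    homCxMap B (𝟙 E) (𝟙 F) = 𝟙 (homCx B E F) := by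
  ext m : 1
  refine homCx_hom_ext B fun z => ?_
  change ((Cochain.ofHom (undMap (𝟙 E))).comp z (zero_add m)).comp
    (Cochain.ofHom (undMap (𝟙 F))) (add_zero m) = z
  simp

lemma homCxMap_comp {E E' E'' F F' F'' : CochainComplex (FiltObj n 𝒜) ℤ} (f : E' ⟶ E)
    (f' : E'' ⟶ E') (g : F ⟶ F') (g' : F' ⟶ F'') :
    homCxMap B (f' ≫ f) (g ≫ g') = homCxMap B f g ≫ homCxMap B f' g' := by
  ext m : 1
  refine homCx_hom_ext B fun z => ?_
  change ((Cochain.ofHom (undMap (f' ≫ f))).comp z (zero_add m)).comp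
    (Cochain.ofHom (undMap (g ≫ g'))) (add_zero m) =
    ((Cochain.ofHom (undMap f')).comp (((Cochain.ofHom (undMap f)).comp z (zero_add m)).comp
      (Cochain.ofHom (undMap g)) (add_zero m)) (zero_add m)).comp
      (Cochain.ofHom (undMap g')) (add_zero m)
  simp

lemma homotopy_left_aux {K K' L L' : CochainComplex 𝒜 ℤ} {φ φ' : K' ⟶ K} (h : Homotopy φ φ')
    (g : L ⟶ L') {m m₁ m₂ : ℤ} (h₁ : m + 1 = m₁) (h₂ : m₂ + 1 = m) (z : Cochain K L m) :
    ((Cochain.ofHom φ).comp z (zero_add m)).comp (Cochain.ofHom g) (add_zero m) =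
      ((m₁.negOnePow • Cochain.ofHomotopy h).comp (δ m m₁ z) (show -1 + m₁ = m by omega)).comp
          (Cochain.ofHom g) (add_zero m) +
        δ m₂ m (((m.negOnePow • Cochain.ofHomotopy h).comp z (show -1 + m = m₂ by omega)).comp
          (Cochain.ofHom g) (add_zero m₂)) +
      ((Cochain.ofHom φ').comp z (zero_add m)).comp (Cochain.ofHom g) (add_zero m) := by
  rw [δ_comp_ofHom]
  simp only [Cochain.units_smul_comp, δ_units_smul]
  rw [δ_comp _ z _ 0 m₁ m h₂ (by omega) h₁, δ_ofHomotopy]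
  subst h₁
  rw [Int.negOnePow_succ]
  simp [smul_smul]

lemma homotopy_right_aux {K K' L L' : CochainComplex 𝒜 ℤ} (f : K' ⟶ K) {φ φ' : L ⟶ L'}
    (h : Homotopy φ φ') {m m₁ m₂ : ℤ} (h₁ : m + 1 = m₁) (h₂ : m₂ + 1 = m) (z : Cochain K L m) :
    ((Cochain.ofHom f).comp z (zero_add m)).comp (Cochain.ofHom φ) (add_zero m) =
      ((Cochain.ofHom f).comp (δ m m₁ z) (zero_add m₁)).comp (Cochain.ofHomotopy h)
          (show m₁ + -1 = m by omega) +
        δ m₂ m (((Cochain.ofHom f).comp z (zero_add m)).comp (Cochain.ofHomotopy h)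
          (show m + -1 = m₂ by omega)) +
      ((Cochain.ofHom f).comp z (zero_add m)).comp (Cochain.ofHom φ') (add_zero m) := by
  rw [δ_comp _ (Cochain.ofHomotopy h) _ m₁ 0 m h₂ h₁ (by omega), δ_ofHomotopy, δ_ofHom_comp]
  simp

/-- A morphism given in each degree pair `(m, m - 1)`, extended by zero. -/
def degMinusOne {X Y : ℤ → FiltObj n (ModuleCat.{v} B)}
    (H : ∀ m m' : ℤ, m' + 1 = m → (X m ⟶ Y m')) (m m' : ℤ) : X m ⟶ Y m' :=
  if h : m' + 1 = m then H m m' h else 0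

/-- A homotopy `f ∼ f'` induces a homotopy between the maps on complexes of homomorphisms. -/
def homCxMapHomotopyLeft {E E' F F' : CochainComplex (FiltObj n 𝒜) ℤ} {f f' : E' ⟶ E}
    (h : Homotopy f f') (g : F ⟶ F') : Homotopy (homCxMap B f g) (homCxMap B f' g) where
  hom := degMinusOne B fun m _ hm => compHom B
    (m.negOnePow • Cochain.ofHomotopy ((forget n 𝒜).mapHomotopy h)) (Cochain.ofHom (undMap g))
    (show -1 + m = _ by omega) (add_zero _)
    (fun i => by
      rcases Int.units_eq_one_or m.negOnePow with h' | h' <;> rw [h']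
      · rw [one_smul]; exact ofHomotopy_mem_cochainFil B h i
      · rw [Units.neg_smul, one_smul]
        exact (cochainFil B _ _ _ _ _).neg_mem (ofHomotopy_mem_cochainFil B h i))
    (ofHom_mem_cochainFil B g)
  zero m m' hm := dif_neg hm
  comm m := by
    rw [dNext_eq _ (show (ComplexShape.up ℤ).Rel m (m + 1) from rfl),
      prevD_eq _ (show (ComplexShape.up ℤ).Rel (m - 1) m from by simp)]
    rw [degMinusOne, dif_pos rfl, degMinusOne, dif_pos (by omega)]
    refine homCx_hom_ext B fun z => ?_
    exact homotopy_left_aux _ _ rfl (by omega) z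

/-- A homotopy `g ∼ g'` induces a homotopy between the maps on complexes of homomorphisms. -/
def homCxMapHomotopyRight {E E' F F' : CochainComplex (FiltObj n 𝒜) ℤ} (f : E' ⟶ E)
    {g g' : F ⟶ F'} (h : Homotopy g g') : Homotopy (homCxMap B f g) (homCxMap B f g') where
  hom := degMinusOne B fun m _ hm => compHom B (Cochain.ofHom (undMap f))
    (Cochain.ofHomotopy ((forget n 𝒜).mapHomotopy h)) (zero_add m) (by omega)
    (ofHom_mem_cochainFil B f) (ofHomotopy_mem_cochainFil B h)
  zero m m' hm := dif_neg hm
  comm m := by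
    rw [dNext_eq _ (show (ComplexShape.up ℤ).Rel m (m + 1) from rfl),
      prevD_eq _ (show (ComplexShape.up ℤ).Rel (m - 1) m from by simp)]
    rw [degMinusOne, dif_pos rfl, degMinusOne, dif_pos (by omega)]
    refine homCx_hom_ext B fun z => ?_
    exact homotopy_right_aux _ _ rfl (by omega) z

lemma homCxMap_congr {E E' F F' : CochainComplex (FiltObj n 𝒜) ℤ} {f f' : E' ⟶ E} {g g' : F ⟶ F'}
    (hf : (HomotopyCategory.quotient _ _).map f = (HomotopyCategory.quotient _ _).map f')
    (hg : (HomotopyCategory.quotient _ _).map g = (HomotopyCategory.quotient _ _).map g') :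
    (HomotopyCategory.quotient _ _).map (homCxMap B f g) =
      (HomotopyCategory.quotient _ _).map (homCxMap B f' g') :=
  (HomotopyCategory.eq_of_homotopy _ _
    (homCxMapHomotopyLeft B (HomotopyCategory.homotopyOfEq _ _ hf) g)).trans
  (HomotopyCategory.eq_of_homotopy _ _
    (homCxMapHomotopyRight B f' (HomotopyCategory.homotopyOfEq _ _ hg)))

variable (n 𝒜) in
/-- The bifunctor `(E, F) ↦ Hom(E, F)` on filtered complexes up to homotopy. -/
def homFunctor : (KF n 𝒜)ᵒᵖ × KF n 𝒜 ⥤ KF n (ModuleCat.{v} B) where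
  obj P := (HomotopyCategory.quotient _ _).obj (homCx B P.1.unop.as P.2.as)
  map f := (HomotopyCategory.quotient _ _).map (homCxMap B (Quot.out f.1.unop) (Quot.out f.2))
  map_id P := by
    refine (homCxMap_congr B (f' := 𝟙 _) (g' := 𝟙 _) ?_ ?_).trans ?_
    · exact (HomotopyCategory.quotient_map_out _).trans ((HomotopyCategory.quotient _ _).map_id _).symm
    · exact (HomotopyCategory.quotient_map_out _).trans ((HomotopyCategory.quotient _ _).map_id _).symm
    · rw [homCxMap_id]; exact CategoryTheory.Functor.map_id _ _
  map_comp f g := by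
    refine (homCxMap_congr B (f' := Quot.out g.1.unop ≫ Quot.out f.1.unop)
      (g' := Quot.out f.2 ≫ Quot.out g.2) ?_ ?_).trans ?_
    · exact (HomotopyCategory.quotient_map_out _).trans
        (HomotopyCategory.quotient_map_out_comp_out g.1.unop f.1.unop).symm
    · exact (HomotopyCategory.quotient_map_out _).trans
        (HomotopyCategory.quotient_map_out_comp_out f.2 g.2).symm
    · rw [homCxMap_comp]; exact Functor.map_comp _ _ _

lemma homFunctor_map_quotient {E E' F F' : CochainComplex (FiltObj n 𝒜) ℤ} (f : E' ⟶ E)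
    (g : F ⟶ F') :
    (homFunctor n 𝒜 B).map (X := (op ((HomotopyCategory.quotient _ _).obj E),
        (HomotopyCategory.quotient _ _).obj F))
      (Y := (op ((HomotopyCategory.quotient _ _).obj E'), (HomotopyCategory.quotient _ _).obj F'))
      (((HomotopyCategory.quotient _ _).map f).op, (HomotopyCategory.quotient _ _).map g) =
      (HomotopyCategory.quotient _ _).map (homCxMap B f g) :=
  homCxMap_congr B (HomotopyCategory.quotient_map_out _) (HomotopyCategory.quotient_map_out _)

variable (n 𝒜) in
/-- The bifunctor `homFunctor` for bounded below second argument. -/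
abbrev homFunctorPlus : (KF n 𝒜)ᵒᵖ × KFplus n 𝒜 ⥤ KF n (ModuleCat.{v} B) :=
  (𝟭 _).prod (isBoundedBelow n 𝒜).ι ⋙ homFunctor n 𝒜 B

end Hom


section Adjunction

open CochainComplex HomComplex

variable {ℬ : Type u₁} [Category.{v} ℬ] [Abelian ℬ] (B : Type w) [CommRing B]
  [Linear B 𝒜] [Linear B ℬ] {L : ℬ ⥤ 𝒜} {R : 𝒜 ⥤ ℬ} (adj : L ⊣ R) [R.Additive]
  [R.Linear B]

/-- The functor on complexes induced by `mapFilt n G`. -/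
abbrev mapCF {𝒜 : Type u} [Category.{v} 𝒜] [Abelian 𝒜] {ℬ : Type u₁} [Category.{v₁} ℬ] [Abelian ℬ]
    (G : 𝒜 ⥤ ℬ) [G.Additive] (E : CochainComplex (FiltObj n 𝒜) ℤ) :
    CochainComplex (FiltObj n ℬ) ℤ :=
  ((mapFilt n G).mapHomologicalComplex _).obj E

/-- The adjunction bijection `Hom(L X, Y) → Hom(X, R Y)` as a linear map. -/
def adjLinear (X : ℬ) (Y : 𝒜) : (L.obj X ⟶ Y) →ₗ[B] (X ⟶ R.obj Y) where
  toFun := adj.homEquiv X Y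
  map_add' f g := by simp [Adjunction.homEquiv_unit]
  map_smul' c f := by simp [Adjunction.homEquiv_unit]

lemma adjLinear_mem_homFil {X : FiltObj n ℬ} {Y : FiltObj n 𝒜} {i : Fin n} {k : ℤ}
    {f : L.obj X.obj ⟶ Y.obj} (hf : f ∈ homFil B ((mapFilt n L).obj X) Y i k) :
    adjLinear B adj X.obj Y.obj f ∈ homFil B X ((mapFilt n R).obj Y) i k := fun l => by
  have h := hf l
  change (Y.fil i (l + k)).Factors ((imageSubobject (L.map (X.fil i l).arrow)).arrow ≫ f) at h
  rw [image_factors_iff] at h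
  change (imageSubobject (R.map (Y.fil i (l + k)).arrow)).Factors
    ((X.fil i l).arrow ≫ adj.homEquiv _ _ f)
  rw [← adj.homEquiv_naturality_left, ← Subobject.factorThru_arrow _ _ h,
    adj.homEquiv_naturality_right]
  exact Subobject.factors_of_factors_right _ (image_factors_self _)

variable [L.Additive]

/-- The adjunction map on cochains. -/
def adjCochain (E : CochainComplex (FiltObj n ℬ) ℤ) (F : CochainComplex (FiltObj n 𝒜) ℤ) (m : ℤ) :
    Cochain (und (mapCF L E)) (und F) m →ₗ[B] Cochain (und E) (und (mapCF R F)) m where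
  toFun z := Cochain.mk fun p q hpq => adjLinear B adj (E.X p).obj (F.X q).obj (z.v p q hpq)
  map_add' z z' := by
    ext p q hpq
    exact (adjLinear B adj (E.X p).obj (F.X q).obj).map_add (z.v p q hpq) (z'.v p q hpq)
  map_smul' c z := by
    ext p q hpq
    exact (adjLinear B adj (E.X p).obj (F.X q).obj).map_smul c (z.v p q hpq)

lemma adjCochain_v (E : CochainComplex (FiltObj n ℬ) ℤ) (F : CochainComplex (FiltObj n 𝒜) ℤ)
    {m : ℤ} (z : Cochain (und (mapCF L E)) (und F) m) (p q : ℤ) (hpq : p + m = q) :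
    (adjCochain B adj E F m z).v p q hpq =
      adjLinear B adj (E.X p).obj (F.X q).obj (z.v p q hpq) := rfl

/-- The adjunction map `Hom(L E, F) ⟶ Hom(E, R F)` on filtered complexes of homomorphisms. -/
def adjHomCx (E : CochainComplex (FiltObj n ℬ) ℤ) (F : CochainComplex (FiltObj n 𝒜) ℤ) :
    homCx B (mapCF L E) F ⟶ homCx B E (mapCF R F) where
  f m := ofModuleHom (adjCochain B adj E F m) fun _ _ _ hz p q hpq =>
    adjLinear_mem_homFil B adj (hz p q hpq)
  comm' m m' hm := Subtype.ext (ModuleCat.hom_ext (LinearMap.ext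
    fun (z : Cochain (und (mapCF L E)) (und F) m) => by
      change δ m m' (adjCochain B adj E F m z) = adjCochain B adj E F m' (δ m m' z)
      ext p q hpq
      rw [adjCochain_v, δ_v m m' hm _ p q hpq (q - 1) (p + 1) rfl rfl,
        δ_v m m' hm _ p q hpq (q - 1) (p + 1) rfl rfl, adjCochain_v, adjCochain_v]
      refine Eq.symm (((adjLinear B adj (E.X p).obj (F.X q).obj).map_add _ _).trans
        (congrArg₂ (· + ·) (adj.homEquiv_naturality_right _ _) ?_))
      rcases Int.units_eq_one_or m'.negOnePow with h | h <;> rw [h]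
      · rw [one_smul, one_smul]; exact adj.homEquiv_naturality_left _ _
      · rw [Units.neg_smul, one_smul, Units.neg_smul, one_smul]
        exact ((adjLinear B adj (E.X p).obj (F.X q).obj).map_neg _).trans
          (congrArg Neg.neg (adj.homEquiv_naturality_left _ _))))

/-- The adjunction map in the category of filtered complexes of modules up to homotopy. -/
def adjHom (E : KF n ℬ) (F : KF n 𝒜) :
    (homFunctor n 𝒜 B).obj (op ((mapKF n L).obj E), F) ⟶
      (homFunctor n ℬ B).obj (op E, (mapKF n R).obj F) :=
  (HomotopyCategory.quotient _ _).map (adjHomCx B adj E.as F.as)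

end Adjunction

section RestrictScalars

open CochainComplex HomComplex

variable {B : Type w} [CommRing B] {B₁ : Type w₁} [CommRing B₁] [Linear B 𝒜] [Linear B₁ 𝒜]
  (σ : B →+* B₁) (hσ : ∀ {X Y : 𝒜} (b : B) (f : X ⟶ Y), σ b • f = b • f)

lemma subobjectModule_symm_arrow_mem {M : Type v} [AddCommGroup M] [Module B M]
    (p : Submodule B M) (x : ((ModuleCat.subobjectModule (ModuleCat.of B M)).symm p :
      ModuleCat.{v} B)) :
    ((ModuleCat.subobjectModule (ModuleCat.of B M)).symm p).arrow.hom x ∈ p := by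
  have : Mono (ModuleCat.ofHom p.subtype) := (ModuleCat.mono_iff_injective _).2 p.injective_subtype
  have h : ((ModuleCat.subobjectModule (ModuleCat.of B M)).symm p).arrow =
      (Subobject.underlyingIso (ModuleCat.ofHom p.subtype)).hom ≫ ModuleCat.ofHom p.subtype :=
    (Subobject.underlyingIso_hom_comp_eq_mk _).symm
  rw [h]
  exact ((Subobject.underlyingIso (ModuleCat.ofHom p.subtype)).hom.hom x).2

lemma restrictScalars_factors {M : Type v} [AddCommGroup M] [Module B M] [Module B₁ M]
    (p : Submodule B₁ M) (q : Submodule B M)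
    (g : (ModuleCat.restrictScalars.{v} σ).obj (ModuleCat.of B₁ M) ⟶ ModuleCat.of B M)
    (hg : ∀ x : M, x ∈ p → g.hom x ∈ q) :
    ((ModuleCat.subobjectModule (ModuleCat.of B M)).symm q).Factors
      ((imageSubobject ((ModuleCat.restrictScalars.{v} σ).map
        ((ModuleCat.subobjectModule (ModuleCat.of B₁ M)).symm p).arrow)).arrow ≫ g) := by
  rw [image_factors_iff]
  have : Mono (ModuleCat.ofHom q.subtype) := (ModuleCat.mono_iff_injective _).2 q.injective_subtype
  exact (Subobject.mk_factors_iff (ModuleCat.ofHom q.subtype) _).2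
    ⟨ModuleCat.ofHom (X := (ModuleCat.restrictScalars.{v} σ).obj
        ((ModuleCat.subobjectModule (ModuleCat.of B₁ M)).symm p : ModuleCat.{v} B₁))
      (LinearMap.codRestrict q ((ModuleCat.restrictScalars.{v} σ).map
        ((ModuleCat.subobjectModule (ModuleCat.of B₁ M)).symm p).arrow ≫ g).hom
      fun x => hg _ (subobjectModule_symm_arrow_mem p x)), rfl⟩

/-- The cochains over `B₁`, regarded over `B`, are the cochains over `B`. -/
def resCochain (K L : CochainComplex 𝒜 ℤ) (m : ℤ) :
    (ModuleCat.restrictScalars.{v} σ).obj (ModuleCat.of B₁ (Cochain K L m)) ⟶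
      ModuleCat.of B (Cochain K L m) :=
  ModuleCat.ofHom
    (X := (ModuleCat.restrictScalars.{v} σ).obj (ModuleCat.of B₁ (Cochain K L m)))
    { toFun := fun z => (show Cochain K L m from z)
      map_add' := fun _ _ => rfl
      map_smul' := fun b z => by
        ext p q hpq
        exact hσ b (Cochain.v (show Cochain K L m from z) p q hpq) }

/-- The identification of the filtered complex of homomorphisms over `B₁`, regarded over `B`,
with the filtered complex of homomorphisms over `B`. -/
def resHomCx (E F : CochainComplex (FiltObj n 𝒜) ℤ) :
    mapCF (ModuleCat.restrictScalars.{v} σ) (homCx B₁ E F) ⟶ homCx B E F where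
  f m := ⟨resCochain σ hσ (und E) (und F) m, fun i k =>
    restrictScalars_factors σ (cochainFil B₁ E F m i k) (cochainFil B E F m i k) _
      fun _ hx => hx⟩
  comm' _ _ _ := rfl

/-- The identification `resHomCx` in the category of filtered complexes up to homotopy. -/
def resHom (E F : KF n 𝒜) :
    (mapKF n (ModuleCat.restrictScalars.{v} σ)).obj ((homFunctor n 𝒜 B₁).obj (op E, F)) ⟶
      (homFunctor n 𝒜 B).obj (op E, F) :=
  (HomotopyCategory.quotient _ _).map (resHomCx σ hσ E.as F.as)

end RestrictScalars

/-! ### Derived functors -/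

section Derived

instance : (fqisPlus n 𝒜).ContainsIdentities where
  id_mem X := (fqis n 𝒜).id_mem X.obj

/-- A right derived functor (in the sense of the universal property) of the functor on bounded
below filtered complexes that is induced by `G`. -/
structure RightDerived (n : ℕ) {𝒜 : Type u} [Category.{v} 𝒜] [Abelian 𝒜] {ℬ : Type u₁}
    [Category.{v₁} ℬ] [Abelian ℬ] (G : 𝒜 ⥤ ℬ) [G.Additive] where
  /-- the functor on derived categories -/
  functor : DFplus n 𝒜 ⥤ DFplus n ℬ
  /-- the comparison with the functor on complexes -/
  unit : mapKFplus n G ⋙ Qplus n ℬ ⟶ Qplus n 𝒜 ⋙ functor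
  isDerived : functor.IsRightDerivedFunctor unit (fqisPlus n 𝒜)

/-- A left derived functor (in the sense of the universal property) of the functor on bounded
above filtered complexes that is induced by `G`. -/
structure LeftDerived (n : ℕ) {𝒜 : Type u} [Category.{v} 𝒜] [Abelian 𝒜] {ℬ : Type u₁}
    [Category.{v₁} ℬ] [Abelian ℬ] (G : 𝒜 ⥤ ℬ) [G.Additive] where
  /-- the functor on derived categories -/
  functor : DFminus n 𝒜 ⥤ DFminus n ℬ
  /-- the comparison with the functor on complexes -/
  counit : Qminus n 𝒜 ⋙ functor ⟶ mapKFminus n G ⋙ Qminus n ℬ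
  isDerived : functor.IsLeftDerivedFunctor counit (fqisMinus n 𝒜)

/-- A right derived functor (in the sense of the universal property) of the bifunctor
`(E, F) ↦ Hom(E, F)`, with values in the derived category of filtered `B`-modules. -/
structure RHom (n : ℕ) (𝒜 : Type u) [Category.{v} 𝒜] [Abelian 𝒜] (B : Type w) [CommRing B]
    (lin : Linear B 𝒜) where
  /-- the functor on derived categories -/
  functor : (DF n 𝒜)ᵒᵖ × DFplus n 𝒜 ⥤ DF n (ModuleCat.{v} B)
  /-- the comparison with the functor on complexes -/
  unit : homFunctorPlus n 𝒜 B ⋙ Qh n (ModuleCat.{v} B) ⟶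
    (Qh n 𝒜).op.prod (Qplus n 𝒜) ⋙ functor
  isDerived : functor.IsRightDerivedFunctor unit ((fqis n 𝒜).op.prod (fqisPlus n 𝒜))

variable {ℬ : Type u₁} [Category.{v} ℬ] [Abelian ℬ] {B : Type w} [CommRing B]
  {lin : Linear B 𝒜} {lin' : Linear B ℬ} {L : ℬ ⥤ 𝒜} {R : 𝒜 ⥤ ℬ} [L.Additive] [R.Additive]

/-- The functor `(E, F) ↦ RHom(LL E, F)` for `E` bounded above and `F` bounded below. -/
abbrev rhomLeft (LL : LeftDerived n L) (H : RHom n 𝒜 B lin) :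
    (DFminus n ℬ)ᵒᵖ × DFplus n 𝒜 ⥤ DF n (ModuleCat.{v} B) :=
  (LL.functor ⋙ inclMinus n 𝒜).op.prod (𝟭 _) ⋙ H.functor

/-- The functor `(E, F) ↦ RHom(E, RR F)` for `E` bounded above and `F` bounded below. -/
abbrev rhomRight (RR : RightDerived n R) (H : RHom n ℬ B lin') :
    (DFminus n ℬ)ᵒᵖ × DFplus n 𝒜 ⥤ DF n (ModuleCat.{v} B) :=
  (inclMinus n ℬ).op.prod RR.functor ⋙ H.functor

/-- For filtered complexes `E` and `F`, the natural morphism `Hom(L E, F) ⟶ RHom(LL E, F)`. -/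
def toRhomLeft (LL : LeftDerived n L) (H : RHom n 𝒜 B lin) (E : KFminus n ℬ) (F : KFplus n 𝒜) :
    (Qh n (ModuleCat.{v} B)).obj ((homFunctor n 𝒜 B).obj (op ((mapKF n L).obj E.obj), F.obj)) ⟶
      (rhomLeft LL H).obj (op ((Qminus n ℬ).obj E), (Qplus n 𝒜).obj F) :=
  H.unit.app (op ((mapKF n L).obj E.obj), F) ≫
    H.functor.map (X := (op ((Qh n 𝒜).obj ((mapKF n L).obj E.obj)), (Qplus n 𝒜).obj F))
      (Y := (op ((inclMinus n 𝒜).obj (LL.functor.obj ((Qminus n ℬ).obj E))), (Qplus n 𝒜).obj F))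
      (((inclMinus n 𝒜).map (LL.counit.app E) ≫
        (inclMinusIso n 𝒜).hom.app ((mapKFminus n L).obj E)).op, 𝟙 _)

/-- For filtered complexes `E` and `F`, the natural morphism `Hom(E, R F) ⟶ RHom(E, RR F)`. -/
def toRhomRight (RR : RightDerived n R) (H : RHom n ℬ B lin') (E : KFminus n ℬ) (F : KFplus n 𝒜) :
    (Qh n (ModuleCat.{v} B)).obj ((homFunctor n ℬ B).obj (op E.obj, (mapKF n R).obj F.obj)) ⟶
      (rhomRight RR H).obj (op ((Qminus n ℬ).obj E), (Qplus n 𝒜).obj F) :=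
  H.unit.app (op E.obj, (mapKFplus n R).obj F) ≫
    H.functor.map (X := (op ((Qh n ℬ).obj E.obj), (Qplus n ℬ).obj ((mapKFplus n R).obj F)))
      (Y := (op ((inclMinus n ℬ).obj ((Qminus n ℬ).obj E)),
        RR.functor.obj ((Qplus n 𝒜).obj F)))
      (((inclMinusIso n ℬ).hom.app E).op, RR.unit.app F)

/-- A transformation `RHom(LL E, F) ⟶ RHom(E, RR F)` is canonical if, for all filtered complexes
`E` and `F`, it is compatible with the adjunction map `Hom(L E, F) ⟶ Hom(E, R F)`. -/
def IsCanonical (adj : L ⊣ R) (_ : R.Linear B) (LL : LeftDerived n L) (RR : RightDerived n R)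
    (H : RHom n 𝒜 B lin) (H' : RHom n ℬ B lin') (θ : rhomLeft LL H ⟶ rhomRight RR H') : Prop :=
  ∀ (E : KFminus n ℬ) (F : KFplus n 𝒜),
    toRhomLeft LL H E F ≫ θ.app (op ((Qminus n ℬ).obj E), (Qplus n 𝒜).obj F) =
      (Qh n (ModuleCat.{v} B)).map (adjHom B adj E.obj F.obj) ≫ toRhomRight RR H' E F

/-- A transformation between derived functors of `Hom` over `B₁` and over `B` is compatible with
restriction of scalars along `σ : B →+* B₁` if it lies over the identification of the filtered
complexes of homomorphisms. Here `r` is the functor induced by restriction of scalars. -/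
def RHom.IsRestriction {B₁ : Type w₁} [CommRing B₁] {lin₁ : Linear B₁ 𝒜} (σ : B →+* B₁)
    (hσ : ∀ {X Y : 𝒜} (b : B) (f : X ⟶ Y), σ b • f = b • f)
    {r : DF n (ModuleCat.{v} B₁) ⥤ DF n (ModuleCat.{v} B)}
    (e : Qh n (ModuleCat.{v} B₁) ⋙ r ≅
      mapKF n (ModuleCat.restrictScalars.{v} σ) ⋙ Qh n (ModuleCat.{v} B))
    (H₁ : RHom n 𝒜 B₁ lin₁) (H : RHom n 𝒜 B lin) (c : H₁.functor ⋙ r ⟶ H.functor) : Prop :=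
  ∀ (E : KF n 𝒜) (F : KFplus n 𝒜),
    r.map (H₁.unit.app (op E, F)) ≫ c.app (op ((Qh n 𝒜).obj E), (Qplus n 𝒜).obj F) =
      e.hom.app ((homFunctor n 𝒜 B₁).obj (op E, F.obj)) ≫
        (Qh n (ModuleCat.{v} B)).map (resHom σ hσ E F.obj) ≫ H.unit.app (op E, F)

section Comp

variable {𝒞 : Type u₂} [Category.{v} 𝒞] [Abelian 𝒞]

/-- A transformation `RT ⟶ RH ⋙ RG` between right derived functors lies over
`τ : T ⟶ H ⋙ G`. -/
def RightDerived.LiesOver {H : 𝒜 ⥤ ℬ} {G : ℬ ⥤ 𝒞} {T : 𝒜 ⥤ 𝒞} [H.Additive] [G.Additive]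
    [T.Additive] (τ : T ⟶ H ⋙ G) (RH : RightDerived n H) (RG : RightDerived n G)
    (RT : RightDerived n T) (c : RT.functor ⟶ RH.functor ⋙ RG.functor) : Prop :=
  ∀ K : KFplus n 𝒜,
    RT.unit.app K ≫ c.app ((Qplus n 𝒜).obj K) =
      (Qplus n 𝒞).map (mapKFplusToComp τ K) ≫ RG.unit.app ((mapKFplus n H).obj K) ≫
        RG.functor.map (RH.unit.app K)

/-- A transformation `LH ⋙ LG ⟶ LT` between left derived functors lies over
`σ : H ⋙ G ⟶ T`. -/
def LeftDerived.LiesOver {H : 𝒜 ⥤ ℬ} {G : ℬ ⥤ 𝒞} {T : 𝒜 ⥤ 𝒞} [G.PreservesEpimorphisms]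
    [H.Additive] [G.Additive] [T.Additive] (σ : H ⋙ G ⟶ T) (LH : LeftDerived n H)
    (LG : LeftDerived n G) (LT : LeftDerived n T)
    (c : LH.functor ⋙ LG.functor ⟶ LT.functor) : Prop :=
  ∀ K : KFminus n 𝒜,
    c.app ((Qminus n 𝒜).obj K) ≫ LT.counit.app K =
      LG.functor.map (LH.counit.app K) ≫ LG.counit.app ((mapKFminus n H).obj K) ≫
        (Qminus n 𝒞).map (mapKFminusOfComp σ K)

end Comp

end Derived

/-! ### Ringed topoi -/

/-- A ringed topos, presented by a small site with finite limits and a sheaf of commutative rings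
on it. -/
structure RingedTopos where
  /-- the underlying category of the site -/
  C : Type u
  [cat : SmallCategory C]
  [lim : HasFiniteLimits C]
  /-- the topology -/
  J : GrothendieckTopology C
  /-- the structure sheaf -/
  O : Sheaf J CommRingCat.{u}

namespace RingedTopos

attribute [instance] cat lim

/-- The structure sheaf as a sheaf of rings. -/
abbrev ring (X : RingedTopos.{u}) : Sheaf X.J RingCat.{u} :=
  (sheafCompose X.J (forget₂ CommRingCat.{u} RingCat.{u})).obj X.O

/-- The category of modules over the structure sheaf. -/
abbrev Mod (X : RingedTopos.{u}) := SheafOfModules.{u} X.ring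

/-- The ring of global sections of the structure sheaf. -/
abbrev Γ (X : RingedTopos.{u}) : CommRingCat.{u} := X.O.obj.obj (op (⊤_ X.C))

/-- The restriction of a global section to an object of the site. -/
def res (X : RingedTopos.{u}) (U : X.Cᵒᵖ) : X.Γ →+* X.ring.obj.obj U :=
  (X.O.obj.map (terminal.from U.unop).op).hom

lemma res_comm (X : RingedTopos.{u}) {U : X.Cᵒᵖ} (s : X.Γ) (r : X.ring.obj.obj U) :
    X.res U s * r = r * X.res U s :=
  mul_comm (G := X.O.obj.obj U) _ _

lemma map_res (X : RingedTopos.{u}) {U V : X.Cᵒᵖ} (i : U ⟶ V) (s : X.Γ) :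
    (X.ring.obj.map i).hom (X.res U s) = X.res V s := by
  change (X.O.obj.map i).hom ((X.O.obj.map (terminal.from U.unop).op).hom s) =
    (X.O.obj.map (terminal.from V.unop).op).hom s
  rw [← CommRingCat.comp_apply, ← X.O.obj.map_comp]
  congr 3
  exact Quiver.Hom.unop_inj (Subsingleton.elim _ _)

/-- The action of a global section on a module. -/
def globalSMul (X : RingedTopos.{u}) (s : X.Γ) (M : X.Mod) : M ⟶ M where
  val :=
    { app := fun U => ModuleCat.ofHom
        { toFun := fun x => X.res U s • x
          map_add' := fun x y => smul_add _ x y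
          map_smul' := fun r x => by
            rw [RingHom.id_apply, ← mul_smul, ← mul_smul, res_comm] }
      naturality := fun {U V} i => by
        ext x
        change X.res V s • M.val.map i x = M.val.map i (X.res U s • x)
        rw [PresheafOfModules.map_smul, map_res] }

/-- The ring morphism from global sections to the center of the category of modules. -/
def toCenter (X : RingedTopos.{u}) : X.Γ →+* CatCenter X.Mod where
  toFun s :=
    { app := fun M => X.globalSMul s M
      naturality := fun M N f => by
        ext U x
        exact ((f.val.app U).hom.map_smul (X.res U s) x).symm }
  map_one' := by
    ext M U x
    change X.res U 1 • x = x
    rw [map_one, one_smul]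
  map_mul' s t := by
    ext M U x
    change X.res U (s * t) • x = X.res U s • X.res U t • x
    rw [map_mul, mul_smul]
  map_zero' := by
    ext M U x
    change X.res U 0 • x = 0
    rw [map_zero, zero_smul]
  map_add' s t := by
    ext M U x
    change X.res U (s + t) • x = X.res U s • x + X.res U t • x
    rw [map_add, add_smul]

/-- A morphism of ringed topoi, presented by a morphism of sites (a continuous functor in the
opposite direction that preserves finite limits) and a morphism of sheaves of rings. -/
structure Hom (X X' : RingedTopos.{u}) where
  /-- the functor between the underlying categories -/
  F : X'.C ⥤ X.C
  [lex : PreservesFiniteLimits F]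
  [cont : F.IsContinuous X'.J X.J]
  /-- the morphism of sheaves of rings -/
  φ : X'.O ⟶ (F.sheafPushforwardContinuous CommRingCat.{u} X'.J X.J).obj X.O

namespace Hom

attribute [instance] lex cont

variable {X X' X'' : RingedTopos.{u}}

/-- The underlying morphism of sheaves of rings. -/
def ringMap (f : Hom X X') :
    X'.ring ⟶ (f.F.sheafPushforwardContinuous RingCat.{u} X'.J X.J).obj X.ring :=
  ⟨Functor.whiskerRight f.φ.hom (forget₂ CommRingCat.{u} RingCat.{u})⟩

/-- The direct image functor on modules. -/
abbrev push (f : Hom X X') : X.Mod ⥤ X'.Mod := SheafOfModules.pushforward.{u} f.ringMap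

instance (f : Hom X X') : f.push.Additive where

instance (f : Hom X X') : f.push.IsRightAdjoint := by
  let ψ : X'.ring.obj ⟶ f.F.op ⋙ X.ring.obj := f.ringMap.hom
  have h : (PresheafOfModules.pushforward.{u} ψ).IsRightAdjoint := inferInstance
  have : (PresheafOfModules.pushforward.{u} f.ringMap.hom).IsRightAdjoint := h
  exact (SheafOfModules.PullbackConstruction.adjunction.{u} f.ringMap).isRightAdjoint

/-- The inverse image functor on modules. -/
abbrev pull (f : Hom X X') : X'.Mod ⥤ X.Mod := SheafOfModules.pullback.{u} f.ringMap

/-- The adjunction between inverse and direct image. -/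
abbrev adj (f : Hom X X') : f.pull ⊣ f.push :=
  SheafOfModules.pullbackPushforwardAdjunction f.ringMap

instance (f : Hom X X') : f.pull.Additive := f.adj.left_adjoint_additive

instance (f : Hom X X') : f.pull.PreservesEpimorphisms :=
  Functor.preservesEpimorphisms_of_adjunction f.adj

/-- The map on global sections of the structure sheaves. -/
def mapΓ (f : Hom X X') : X'.Γ →+* X.Γ :=
  (X.O.obj.map (Quiver.Hom.op
    ((IsTerminal.isTerminalObj f.F _ terminalIsTerminal).from (⊤_ X.C)))).hom.comp
    (f.φ.hom.app (op (⊤_ X'.C))).hom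

lemma ringMap_res (f : Hom X X') (U : X'.Cᵒᵖ) (s : X'.Γ) :
    (f.ringMap.hom.app U).hom (X'.res U s) = X.res (op (f.F.obj U.unop)) (f.mapΓ s) := by
  change (f.φ.hom.app U).hom ((X'.O.obj.map (terminal.from U.unop).op).hom s) =
    (X.O.obj.map (terminal.from (f.F.obj U.unop)).op).hom
      ((X.O.obj.map (Quiver.Hom.op
        ((IsTerminal.isTerminalObj f.F _ terminalIsTerminal).from (⊤_ X.C)))).hom
        ((f.φ.hom.app (op (⊤_ X'.C))).hom s))
  have h := ConcreteCategory.congr_hom (f.φ.hom.naturality (terminal.from U.unop).op) s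
  refine h.trans ?_
  have h' (t : X.O.obj.obj (op (f.F.obj (⊤_ X'.C)))) :
      (X.O.obj.map (f.F.map (terminal.from U.unop)).op).hom t =
        (X.O.obj.map (terminal.from (f.F.obj U.unop)).op).hom ((X.O.obj.map (Quiver.Hom.op
          ((IsTerminal.isTerminalObj f.F _ terminalIsTerminal).from (⊤_ X.C)))).hom t) := by
    rw [← CommRingCat.comp_apply, ← X.O.obj.map_comp, ← op_comp]
    congr 4
    exact (IsTerminal.isTerminalObj f.F _ terminalIsTerminal).hom_ext _ _
  exact h' _

/-- Composition of morphisms of ringed topoi. -/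
def comp (f : Hom X X') (g : Hom X' X'') : Hom X X'' :=
  haveI : (g.F ⋙ f.F).IsContinuous X''.J X.J := Functor.isContinuous_comp _ _ _ X'.J _
  { F := g.F ⋙ f.F
    φ := g.φ ≫ (g.F.sheafPushforwardContinuous CommRingCat.{u} X''.J X'.J).map f.φ }

lemma mapΓ_comp (f : Hom X X') (g : Hom X' X'') : (f.comp g).mapΓ = f.mapΓ.comp g.mapΓ := by
  ext s
  let i := (IsTerminal.isTerminalObj g.F _ terminalIsTerminal).from (⊤_ X'.C)
  let j := (IsTerminal.isTerminalObj f.F _ terminalIsTerminal).from (⊤_ X.C)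
  let t : X'.O.obj.obj (op (g.F.obj (⊤_ X''.C))) := (g.φ.hom.app (op (⊤_ X''.C))).hom s
  have h : (f.φ.hom.app (op (⊤_ X'.C))).hom ((X'.O.obj.map i.op).hom t) =
      (X.O.obj.map (f.F.map i).op).hom ((f.φ.hom.app (op (g.F.obj (⊤_ X''.C)))).hom t) :=
    ConcreteCategory.congr_hom (f.φ.hom.naturality i.op) t
  have h' (r : X.O.obj.obj (op (f.F.obj (g.F.obj (⊤_ X''.C))))) :
      (X.O.obj.map (Quiver.Hom.op ((IsTerminal.isTerminalObj (g.F ⋙ f.F) _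
        terminalIsTerminal).from (⊤_ X.C)))).hom r =
      (X.O.obj.map j.op).hom ((X.O.obj.map (f.F.map i).op).hom r) := by
    rw [← CommRingCat.comp_apply, ← X.O.obj.map_comp, ← op_comp]
    congr 4
    exact (IsTerminal.isTerminalObj (g.F ⋙ f.F) _ terminalIsTerminal).hom_ext _ _
  exact (h' _).trans (congrArg (X.O.obj.map j.op).hom h.symm)

/-- The direct image functor of a composition. -/
def pushComp (f : Hom X X') (g : Hom X' X'') : f.push ⋙ g.push ≅ (f.comp g).push :=
  SheafOfModules.pushforwardComp g.ringMap f.ringMap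

/-- The inverse image functor of a composition. -/
def pullComp (f : Hom X X') (g : Hom X' X'') : g.pull ⋙ f.pull ≅ (f.comp g).pull :=
  Adjunction.leftAdjointCompIso g.adj f.adj (f.comp g).adj (pushComp f g)

end Hom

variable {B : Type w} [CommRing B]

/-- The `B`-linear structure on the category of modules over the structure sheaf of `X` that is
given by a ring morphism `ρ : B →+* Γ(X)`. -/
@[reducible] def linear (X : RingedTopos.{u}) (ρ : B →+* X.Γ) : Linear B X.Mod :=
  Linear.ofRingMorphism (X.toCenter.comp ρ)

lemma linear_comp (X : RingedTopos.{u}) {B₁ : Type w₁} [CommRing B₁] (σ : B →+* B₁)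
    (ρ : B₁ →+* X.Γ) {M N : X.Mod} (b : B) (f : M ⟶ N) :
    (letI := X.linear ρ; σ b • f) = (letI := X.linear (ρ.comp σ); b • f) := rfl

lemma Hom.push_linear {X X' : RingedTopos.{u}} (f : Hom X X') {ρ : B →+* X.Γ} {ρ' : B →+* X'.Γ}
    (h : f.mapΓ.comp ρ' = ρ) :
    letI := X.linear ρ
    letI := X'.linear ρ'
    f.push.Linear B := by
  let := X.linear ρ
  let := X'.linear ρ'
  refine ⟨fun {M N} g b => ?_⟩
  refine SheafOfModules.hom_ext (PresheafOfModules.hom_ext fun U => ?_)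
  refine ModuleCat.hom_ext (LinearMap.ext fun x => ?_)
  change (g.val.app (op (f.F.obj U.unop))).hom (X.res (op (f.F.obj U.unop)) (ρ b) •
      (show M.val.obj (op (f.F.obj U.unop)) from x)) =
    (g.val.app (op (f.F.obj U.unop))).hom
      ((show X.ring.obj.obj (op (f.F.obj U.unop)) from
        (f.ringMap.hom.app U).hom (X'.res U (ρ' b))) •
      (show M.val.obj (op (f.F.obj U.unop)) from x))
  rw [Hom.ringMap_res, ← h]
  rfl

/-- The derived functor of `Hom` for modules over the structure sheaf of `X`, with values in the
derived category of filtered `B`-modules. -/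
abbrev RHom (X : RingedTopos.{u}) (n : ℕ) (ρ : B →+* X.Γ) :=
  MultiFiltered.RHom n X.Mod B (X.linear ρ)

end RingedTopos
end MultiFiltered
end

noncomputable section
namespace MultiFiltered

/-! ### Derivability structures from calculus of fractions -/

section Derivability

variable {C : Type u} [Category.{v} C] {D : Type u₁} [Category.{v₁} D]

/-- Products of morphism properties with left calculus of fractions. -/
instance hasLeftCalculusOfFractions_prod (W₁ : MorphismProperty C) (W₂ : MorphismProperty D)
    [W₁.HasLeftCalculusOfFractions] [W₂.HasLeftCalculusOfFractions] :
    (W₁.prod W₂).HasLeftCalculusOfFractions where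
  id_mem X := ⟨W₁.id_mem _, W₂.id_mem _⟩
  comp_mem _ _ hf hg := ⟨W₁.comp_mem _ _ hf.1 hg.1, W₂.comp_mem _ _ hf.2 hg.2⟩
  exists_leftFraction X Y φ := by
    obtain ⟨ψ₁, h₁⟩ := MorphismProperty.HasLeftCalculusOfFractions.exists_leftFraction
      (MorphismProperty.RightFraction.mk (W := W₁) φ.s.1 φ.hs.1 φ.f.1)
    obtain ⟨ψ₂, h₂⟩ := MorphismProperty.HasLeftCalculusOfFractions.exists_leftFraction
      (MorphismProperty.RightFraction.mk (W := W₂) φ.s.2 φ.hs.2 φ.f.2)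
    exact ⟨{ Y' := (ψ₁.Y', ψ₂.Y'), f := (ψ₁.f, ψ₂.f), s := (ψ₁.s, ψ₂.s), hs := ⟨ψ₁.hs, ψ₂.hs⟩ },
      Prod.ext h₁ h₂⟩
  ext X' X Y f₁ f₂ s hs h := by
    obtain ⟨Y₁, t₁, ht₁, e₁⟩ := MorphismProperty.HasLeftCalculusOfFractions.ext
      f₁.1 f₂.1 s.1 hs.1 (congrArg Prod.fst h)
    obtain ⟨Y₂, t₂, ht₂, e₂⟩ := MorphismProperty.HasLeftCalculusOfFractions.ext
      f₁.2 f₂.2 s.2 hs.2 (congrArg Prod.snd h)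
    exact ⟨(Y₁, Y₂), (t₁, t₂), ⟨ht₁, ht₂⟩, Prod.ext e₁ e₂⟩

instance hasTwoOutOfThree_prod (W₁ : MorphismProperty C) (W₂ : MorphismProperty D)
    [W₁.HasTwoOutOfThreeProperty] [W₂.HasTwoOutOfThreeProperty] :
    (W₁.prod W₂).HasTwoOutOfThreeProperty where
  comp_mem _ _ hf hg := ⟨W₁.comp_mem _ _ hf.1 hg.1, W₂.comp_mem _ _ hf.2 hg.2⟩
  of_postcomp f g hg hfg :=
    ⟨W₁.of_postcomp f.1 g.1 hg.1 hfg.1, W₂.of_postcomp f.2 g.2 hg.2 hfg.2⟩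
  of_precomp f g hf hfg := ⟨W₁.of_precomp f.1 g.1 hf.1 hfg.1, W₂.of_precomp f.2 g.2 hf.2 hfg.2⟩

variable (W : MorphismProperty C) (P : ObjectProperty C)

/-- The inclusion of a full subcategory as a morphism of localizers. -/
@[reducible] def inclLocalizer : LocalizerMorphism (W.inverseImage P.ι) W where
  functor := P.ι
  map _ _ _ h := h

variable {W P} (hP : ∀ X, ∃ (X' : C) (w : X ⟶ X'), W w ∧ P X')

include hP

/-- Left fractions can be chosen with target in a subcategory of resolutions. -/
lemma hasLeftCalculusOfFractions_inverseImage [W.HasLeftCalculusOfFractions] :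
    (W.inverseImage P.ι).HasLeftCalculusOfFractions where
  id_mem X := W.id_mem _
  comp_mem _ _ hf hg := W.comp_mem _ _ hf hg
  exists_leftFraction X Y φ := by
    obtain ⟨ψ, h⟩ := MorphismProperty.HasLeftCalculusOfFractions.exists_leftFraction
      (MorphismProperty.RightFraction.mk (W := W) φ.s.hom φ.hs φ.f.hom)
    obtain ⟨Z, w, hw, hZ⟩ := hP ψ.Y'
    refine ⟨{ Y' := ⟨Z, hZ⟩, f := P.homMk (ψ.f ≫ w), s := P.homMk (ψ.s ≫ w),
              hs := W.comp_mem _ _ ψ.hs hw }, ?_⟩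
    ext
    dsimp at h ⊢
    rw [reassoc_of% h]
  ext X' X Y f₁ f₂ s hs h := by
    obtain ⟨Y₁, t₁, ht₁, e₁⟩ := MorphismProperty.HasLeftCalculusOfFractions.ext (W := W)
      f₁.hom f₂.hom s.hom hs (congrArg InducedCategory.Hom.hom h)
    obtain ⟨Z, w, hw, hZ⟩ := hP Y₁
    refine ⟨⟨Z, hZ⟩, P.homMk (t₁ ≫ w), W.comp_mem _ _ ht₁ hw, ?_⟩
    ext
    dsimp
    rw [reassoc_of% e₁]

/-- A left fraction between objects of `P` can be prolonged by a resolution of its middle object and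
then lies in `P`, which gives fullness. Prolonging in the same way a morphism that equalises two
maps gives faithfulness. Essential surjectivity holds because resolutions become invertible. -/
lemma isLocalizedEquivalence_inclLocalizer [W.HasLeftCalculusOfFractions] :
    (inclLocalizer W P).IsLocalizedEquivalence := by
  have := hasLeftCalculusOfFractions_inverseImage hP
  let Φ := inclLocalizer W P
  let L₁ := (W.inverseImage P.ι).Q
  let L₂ := W.Q
  let F := Φ.localizedFunctor L₁ L₂
  let : CatCommSq Φ.functor L₁ L₂ F := LocalizerMorphism.catCommSq Φ L₁ L₂
  let e : P.ι ⋙ L₂ ≅ L₁ ⋙ F := CatCommSq.iso Φ.functor L₁ L₂ F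
  have : L₁.EssSurj := Localization.essSurj L₁ (W.inverseImage P.ι)
  have : L₂.EssSurj := Localization.essSurj L₂ W
  have : F.Full := by
    refine F.full_of_comp_essSurj L₁ (fun X₁ X₂ φ ↦ ?_)
    obtain ⟨f, hf⟩ := Localization.exists_leftFraction L₂ W (e.hom.app X₁ ≫ φ ≫ e.inv.app X₂)
    obtain ⟨Z, w, hw, hZ⟩ := hP f.Y'
    let g : (W.inverseImage P.ι).LeftFraction X₁ X₂ :=
      { Y' := ⟨Z, hZ⟩
        f := P.homMk (f.f ≫ w)
        s := P.homMk (f.s ≫ w)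
        hs := W.comp_mem _ _ f.hs hw }
    have := Localization.inverts L₁ _ _ g.hs
    refine ⟨g.map L₁ (Localization.inverts _ _), ?_⟩
    rw [← cancel_mono (F.map (L₁.map g.s)), ← Functor.map_comp,
      MorphismProperty.LeftFraction.map_comp_map_s, ← cancel_epi (e.hom.app X₁)]
    have h₁ := e.hom.naturality g.f
    have h₂ := e.hom.naturality g.s
    have h₃ : (e.hom.app X₁ ≫ φ ≫ e.inv.app X₂) ≫ L₂.map f.s = L₂.map f.f := by
      rw [hf, MorphismProperty.LeftFraction.map_comp_map_s]
    dsimp only [Functor.comp_obj, Functor.comp_map] at h₁ h₂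
    rw [← h₁]
    have h₄ : F.map (L₁.map g.s) = e.inv.app X₂ ≫ L₂.map (P.ι.map g.s) ≫ e.hom.app _ := by
      rw [h₂, ← Category.assoc]; simp
    rw [h₄]
    have h₅ : L₂.map (P.ι.map g.s) = L₂.map f.s ≫ L₂.map w := L₂.map_comp _ _
    have h₆ : L₂.map (P.ι.map g.f) = L₂.map f.f ≫ L₂.map w := L₂.map_comp _ _
    rw [h₅, h₆, ← h₃]
    simp only [Category.assoc]
  have : F.Faithful := by
    refine F.faithful_of_comp_essSurj L₁ (fun X₁ X₂ φ φ' h ↦ ?_)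
    obtain ⟨f, h₁, h₂⟩ := Localization.exists_leftFraction₂ L₁ (W.inverseImage P.ι) φ φ'
    have := Localization.inverts L₁ _ _ f.hs
    have k₁ : φ ≫ L₁.map f.s = L₁.map f.f := by
      rw [h₁]; exact f.fst.map_comp_map_s L₁ (Localization.inverts _ _)
    have k₂ : φ' ≫ L₁.map f.s = L₁.map f.f' := by
      rw [h₂]; exact f.snd.map_comp_map_s L₁ (Localization.inverts _ _)
    rw [← cancel_mono (L₁.map f.s), k₁, k₂]
    have h₃ : F.map (L₁.map f.f) = F.map (L₁.map f.f') := by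
      rw [← k₁, ← k₂, F.map_comp, F.map_comp, h]
    have h₄ : L₂.map (P.ι.map f.f) = L₂.map (P.ι.map f.f') := by
      have n₁ := e.hom.naturality f.f
      have n₂ := e.hom.naturality f.f'
      dsimp only [Functor.comp_obj, Functor.comp_map] at n₁ n₂
      rw [← cancel_mono (e.hom.app _), n₁, n₂, h₃]
    rw [MorphismProperty.map_eq_iff_postcomp L₂ W] at h₄
    obtain ⟨Z, s, hs, h₅⟩ := h₄
    obtain ⟨Z', w, hw, hZ'⟩ := hP Z
    let t : f.Y' ⟶ (⟨Z', hZ'⟩ : P.FullSubcategory) := P.homMk (s ≫ w)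
    have := Localization.inverts L₁ (W.inverseImage P.ι) t (W.comp_mem _ _ hs hw)
    rw [← cancel_mono (L₁.map t), ← L₁.map_comp, ← L₁.map_comp]
    congr 1
    ext
    exact (reassoc_of% h₅) w
  have : F.EssSurj := ⟨fun Y => by
    let X := L₂.objPreimage Y
    obtain ⟨Z, w, hw, hZ⟩ := hP X
    have := Localization.inverts L₂ W w hw
    exact ⟨L₁.obj ⟨Z, hZ⟩, ⟨(e.app ⟨Z, hZ⟩).symm ≪≫ (asIso (L₂.map w)).symm ≪≫
      L₂.objObjPreimageIso Y⟩⟩⟩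
  have : F.IsEquivalence := {}
  exact LocalizerMorphism.IsLocalizedEquivalence.mk' Φ L₁ L₂ F

/-- A subcategory of resolutions is a right derivability structure. -/
lemma isRightDerivabilityStructure_inclLocalizer [W.HasLeftCalculusOfFractions]
    [W.HasTwoOutOfThreeProperty] : (inclLocalizer W P).IsRightDerivabilityStructure := by
  have := isLocalizedEquivalence_inclLocalizer hP
  have : (inclLocalizer W P).arrow.HasRightResolutions := fun f => by
    obtain ⟨Z, w, hw, hZ⟩ := hP f.left
    obtain ⟨ψ, h⟩ := MorphismProperty.HasLeftCalculusOfFractions.exists_leftFraction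
      (MorphismProperty.RightFraction.mk (W := W) w hw f.hom)
    obtain ⟨Z', w', hw', hZ'⟩ := hP ψ.Y'
    exact ⟨{
      X₁ := Arrow.mk (show (⟨Z, hZ⟩ : P.FullSubcategory) ⟶ ⟨Z', hZ'⟩ from P.homMk (ψ.f ≫ w'))
      w := Arrow.homMk w (ψ.s ≫ w') ((reassoc_of% h) w').symm
      hw := ⟨hw, W.comp_mem _ _ ψ.hs hw'⟩ }⟩
  -- Two resolutions of `X` both map to a third one: complete the span they form to a square by a
  -- left fraction and resolve its corner.
  have (X : C) : IsConnected ((inclLocalizer W P).RightResolution X) := by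
    obtain ⟨Z, w, hw, hZ⟩ := hP X
    have : Nonempty ((inclLocalizer W P).RightResolution X) := ⟨{ X₁ := ⟨Z, hZ⟩, w := w, hw := hw }⟩
    refine zigzag_isConnected fun R R' => ?_
    obtain ⟨ψ, h⟩ := MorphismProperty.HasLeftCalculusOfFractions.exists_leftFraction
      (MorphismProperty.RightFraction.mk (W := W) R.w R.hw R'.w)
    obtain ⟨Z', w', hw', hZ'⟩ := hP ψ.Y'
    let R'' : (inclLocalizer W P).RightResolution X :=
      { X₁ := ⟨Z', hZ'⟩
        w := R'.w ≫ ψ.s ≫ w'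
        hw := W.comp_mem _ _ R'.hw (W.comp_mem _ _ ψ.hs hw') }
    have h₁ : R ⟶ R'' := ⟨P.homMk (ψ.f ≫ w'), ((reassoc_of% h) w').symm⟩
    have h₂ : R' ⟶ R'' := ⟨P.homMk (ψ.s ≫ w'), rfl⟩
    exact (Zigzag.of_hom h₁).trans (Zigzag.of_inv h₂)
  exact LocalizerMorphism.IsRightDerivabilityStructure.mk' _

variable {H : Type u₂} [Category.{v₂} H] {F : C ⥤ H}

lemma hasRightDerivedFunctor_of_resolutions [W.HasLeftCalculusOfFractions]
    [W.HasTwoOutOfThreeProperty]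
    (hF : ∀ ⦃X Y : C⦄ (f : X ⟶ Y), P X → P Y → W f → IsIso (F.map f)) :
    F.HasRightDerivedFunctor W := by
  have := isRightDerivabilityStructure_inclLocalizer hP
  have h : (inclLocalizer W P).Derives F := fun X Y f hf => hF _ X.2 Y.2 hf
  have := h.hasPointwiseRightDerivedFunctor
  infer_instance

/-- This is the working criterion for everything below: to identify a composite as a derived
functor, it suffices to check its unit on resolving objects. -/
lemma isRightDerivedFunctor_iff_of_resolutions [W.HasLeftCalculusOfFractions]
    [W.HasTwoOutOfThreeProperty]
    (hF : ∀ ⦃X Y : C⦄ (f : X ⟶ Y), P X → P Y → W f → IsIso (F.map f))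
    {D : Type u₁} [Category.{v₁} D] {L : C ⥤ D} [L.IsLocalization W] {RF : D ⥤ H}
    (α : F ⟶ L ⋙ RF) :
    RF.IsRightDerivedFunctor α W ↔ ∀ X, P X → IsIso (α.app X) := by
  have := isRightDerivabilityStructure_inclLocalizer hP
  have h : (inclLocalizer W P).Derives F := fun X Y f hf => hF _ X.2 Y.2 hf
  rw [h.isRightDerivedFunctor_iff_isIso]
  exact ⟨fun h X hX => h ⟨X, hX⟩, fun h X => h _ X.2⟩

end Derivability

/-! ### Left derived functors by duality. -/

section Op

variable {C : Type u} [Category.{v} C] {D : Type u₁} [Category.{v₁} D]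
  {H : Type u₂} [Category.{v₂} H] {W : MorphismProperty C} {L : C ⥤ D} [L.IsLocalization W]

/-- The universal properties are terminality and initiality in comma categories that are opposite to
each other; both directions transport the factorisation and its uniqueness through `op`. -/
lemma isLeftDerivedFunctor_iff_op {F : C ⥤ H} {LF : D ⥤ H} (α : L ⋙ LF ⟶ F) :
    LF.IsLeftDerivedFunctor α W ↔
      LF.op.IsRightDerivedFunctor (L := L.op) (F := F.op) (NatTrans.op α) W.op := by
  constructor
  · intro h
    refine ⟨⟨⟨IsInitial.ofUniqueHom
      (fun Y => StructuredArrow.homMk (Functor.opHom D H |>.map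
        (LF.leftDerivedLift α W Y.right.unop
          (NatTrans.unop (F := F.op) (G := L.op ⋙ Y.right) Y.hom)).op) ?_) ?_⟩⟩⟩
    · ext X
      have := LF.leftDerived_fac_app α W Y.right.unop
          (NatTrans.unop (F := F.op) (G := L.op ⋙ Y.right) Y.hom) X.unop
      exact Quiver.Hom.unop_inj this
    · intro Y m
      ext X
      let m' : LF.op ⟶ Y.right := m.right
      have := LF.leftDerived_ext α W Y.right.unop
        (NatTrans.unop m') (LF.leftDerivedLift α W Y.right.unop
          (NatTrans.unop (F := F.op) (G := L.op ⋙ Y.right) Y.hom)) (by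
          rw [LF.leftDerived_fac]
          ext X
          have := NatTrans.congr_app (StructuredArrow.w m) (op X)
          exact Quiver.Hom.op_inj this)
      exact Quiver.Hom.unop_inj (NatTrans.congr_app this X.unop)
  · intro h
    refine ⟨⟨⟨IsTerminal.ofUniqueHom
      (fun Y => CostructuredArrow.homMk (NatTrans.removeOp
        (LF.op.rightDerivedDesc (L := L.op) (F := F.op) (NatTrans.op α) W.op Y.left.op
          (NatTrans.op (F := L ⋙ Y.left) (G := F) Y.hom))) ?_) ?_⟩⟩⟩
    · ext X
      have := LF.op.rightDerived_fac_app (L := L.op) (F := F.op) (NatTrans.op α) W.op Y.left.op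
          (NatTrans.op (F := L ⋙ Y.left) (G := F) Y.hom) (op X)
      exact Quiver.Hom.op_inj this
    · intro Y m
      ext X
      let m' : Y.left ⟶ LF := m.left
      have := LF.op.rightDerived_ext (L := L.op) (F := F.op) (NatTrans.op α) W.op Y.left.op
        (NatTrans.op m') (LF.op.rightDerivedDesc (L := L.op) (F := F.op) (NatTrans.op α) W.op
          Y.left.op (NatTrans.op (F := L ⋙ Y.left) (G := F) Y.hom)) (by
          refine Eq.trans ?_ (LF.op.rightDerived_fac (F := F.op) (L := L.op) (NatTrans.op α)
            W.op Y.left.op (NatTrans.op (F := L ⋙ Y.left) (G := F) Y.hom)).symm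
          ext X
          have := NatTrans.congr_app (CostructuredArrow.w m) X.unop
          exact Quiver.Hom.unop_inj this)
      exact Quiver.Hom.op_inj (NatTrans.congr_app this (op X))

variable {P : ObjectProperty C} (hP : ∀ X, ∃ (X' : C) (w : X' ⟶ X), W w ∧ P X')
  {F : C ⥤ H}

include hP in
lemma isLeftDerivedFunctor_iff_of_resolutions [W.HasRightCalculusOfFractions]
    [W.HasTwoOutOfThreeProperty]
    (hF : ∀ ⦃X Y : C⦄ (f : X ⟶ Y), P X → P Y → W f → IsIso (F.map f))
    {LF : D ⥤ H} (α : L ⋙ LF ⟶ F) :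
    LF.IsLeftDerivedFunctor α W ↔ ∀ X, P X → IsIso (α.app X) := by
  rw [isLeftDerivedFunctor_iff_op, isRightDerivedFunctor_iff_of_resolutions (P := P.op)]
  · constructor
    · intro h X hX
      have := h (op X) hX
      exact (isIso_op_iff (α.app X)).1 this
    · intro h X hX
      have := h X.unop hX
      exact (isIso_op_iff (α.app X.unop)).2 this
  · intro X
    obtain ⟨X', w, hw, hX'⟩ := hP X.unop
    exact ⟨op X', w.op, hw, hX'⟩
  · intro X Y f hX hY hf
    have := hF f.unop hY hX hf
    exact (isIso_op_iff (F.map f.unop)).2 this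

include hP in
lemma hasLeftDerivedFunctor_of_resolutions [W.HasRightCalculusOfFractions]
    [W.HasTwoOutOfThreeProperty]
    (hF : ∀ ⦃X Y : C⦄ (f : X ⟶ Y), P X → P Y → W f → IsIso (F.map f)) :
    F.HasLeftDerivedFunctor W := by
  have h : F.op.HasRightDerivedFunctor W.op := by
    refine hasRightDerivedFunctor_of_resolutions (P := P.op) ?_ ?_
    · intro X
      obtain ⟨X', w, hw, hX'⟩ := hP X.unop
      exact ⟨op X', w.op, hw, hX'⟩
    · intro X Y f hX hY hf
      have := hF f.unop hY hX hf
      exact (isIso_op_iff (F.map f.unop)).2 this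
  let G := F.op.totalRightDerived W.Q.op W.op
  let α := F.op.totalRightDerivedUnit W.Q.op W.op
  have : G.unop.IsLeftDerivedFunctor (L := W.Q) (F := F)
      (NatTrans.unop (F := F.op) (G := W.Q.op ⋙ G) α) W := by
    rw [isLeftDerivedFunctor_iff_op]
    exact inferInstanceAs (G.IsRightDerivedFunctor α W.op)
  exact Functor.HasLeftDerivedFunctor.mk' (F := F) (L := W.Q) (W := W) G.unop
    (NatTrans.unop (F := F.op) (G := W.Q.op ⋙ G) α)

end Op

/-! ### Quasi-isomorphisms relative to a family of functors -/

section Family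

open Pretriangulated ZeroObject

variable {𝒟 : Type u₁} [Category.{v₁} 𝒟] [Preadditive 𝒟] {𝒜 : Type u} [Category.{v} 𝒜] [Abelian 𝒜]

/-- The functor induced by an additive functor on complexes up to homotopy. -/
abbrev mapK {𝒟' : Type u₂} [Category.{v₂} 𝒟'] [Preadditive 𝒟'] (Λ : 𝒟 ⥤ 𝒟') [Λ.Additive] :
    HomotopyCategory 𝒟 (.up ℤ) ⥤ HomotopyCategory 𝒟' (.up ℤ) :=
  Λ.mapHomotopyCategory (.up ℤ)

/-- The complexes that become acyclic under `Λ`. -/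
def acyc (Λ : 𝒟 ⥤ 𝒜) [Λ.Additive] : ObjectProperty (HomotopyCategory 𝒟 (.up ℤ)) :=
  fun K => HomotopyCategory.subcategoryAcyclic 𝒜 ((mapK Λ).obj K)

/-- The morphisms that become quasi-isomorphisms under `Λ`. -/
def qis (Λ : 𝒟 ⥤ 𝒜) [Λ.Additive] : MorphismProperty (HomotopyCategory 𝒟 (.up ℤ)) :=
  (HomotopyCategory.quasiIso 𝒜 (.up ℤ)).inverseImage (mapK Λ)

lemma acyc_iff (Λ : 𝒟 ⥤ 𝒜) [Λ.Additive] (K : HomotopyCategory 𝒟 (.up ℤ)) :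
    acyc Λ K ↔ ((Λ.mapHomologicalComplex _).obj K.as).Acyclic :=
  HomotopyCategory.quotient_obj_mem_subcategoryAcyclic_iff_acyclic
    ((Λ.mapHomologicalComplex _).obj K.as)

lemma qis_quotient_iff (Λ : 𝒟 ⥤ 𝒜) [Λ.Additive] {K L : CochainComplex 𝒟 ℤ} (f : K ⟶ L) :
    qis Λ ((HomotopyCategory.quotient _ _).map f) ↔
      QuasiIso ((Λ.mapHomologicalComplex _).map f) :=
  (HomotopyCategory.quotient_map_mem_quasiIso_iff ((Λ.mapHomologicalComplex _).map f)).trans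
    (HomologicalComplex.mem_quasiIso_iff _)

lemma acyc_of_iso {Λ Λ' : 𝒟 ⥤ 𝒜} [Λ.Additive] [Λ'.Additive] (e : Λ ≅ Λ')
    {K : HomotopyCategory 𝒟 (.up ℤ)} (h : acyc Λ K) : acyc Λ' K :=
  (HomotopyCategory.subcategoryAcyclic 𝒜).prop_of_iso
    ⟨(NatTrans.mapHomotopyCategory e.hom (.up ℤ)).app K,
      (NatTrans.mapHomotopyCategory e.inv (.up ℤ)).app K, by
        rw [← NatTrans.comp_app, ← NatTrans.mapHomotopyCategory_comp]; simp, by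
        rw [← NatTrans.comp_app, ← NatTrans.mapHomotopyCategory_comp]; simp⟩ h

instance : (HomotopyCategory.quasiIso 𝒜 (.up ℤ)).HasTwoOutOfThreeProperty where
  of_postcomp f g hg hfg i := by
    have := hg i
    have := hfg i
    rw [Functor.map_comp] at this
    exact IsIso.of_isIso_comp_right _
      ((HomotopyCategory.homologyFunctor 𝒜 (.up ℤ) i).map g)
  of_precomp f g hf hfg i := by
    have := hf i
    have := hfg i
    rw [Functor.map_comp] at this
    exact IsIso.of_isIso_comp_left ((HomotopyCategory.homologyFunctor 𝒜 (.up ℤ) i).map f) _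

instance (Λ : 𝒟 ⥤ 𝒜) [Λ.Additive] : (qis Λ).HasTwoOutOfThreeProperty := by
  unfold qis
  infer_instance

/-- A short exact sequence of functors induces short exact sequences of complexes. -/
lemma shortExact_map {Λ₁ Λ₂ Λ₃ : 𝒟 ⥤ 𝒜} [Λ₁.Additive] [Λ₂.Additive] [Λ₃.Additive]
    (a : Λ₁ ⟶ Λ₂) (b : Λ₂ ⟶ Λ₃) (h : ∀ X, ∃ w : a.app X ≫ b.app X = 0,
      (ShortComplex.mk _ _ w).ShortExact) (K : CochainComplex 𝒟 ℤ) :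
    ∃ w, (ShortComplex.mk ((NatTrans.mapHomologicalComplex a (.up ℤ)).app K)
      ((NatTrans.mapHomologicalComplex b (.up ℤ)).app K) w).ShortExact := by
  have w : (NatTrans.mapHomologicalComplex a (.up ℤ)).app K ≫
      (NatTrans.mapHomologicalComplex b (.up ℤ)).app K = 0 := by
    ext i; exact (h (K.X i)).1
  refine ⟨w, HomologicalComplex.shortExact_of_degreewise_shortExact _ fun i => (h (K.X i)).2⟩

lemma isZero_homology_of_acyclic {K : CochainComplex 𝒜 ℤ} (h : K.Acyclic) (i : ℤ) :
    IsZero (K.homology i) := (HomologicalComplex.exactAt_iff_isZero_homology _ _).1 (h i)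

lemma quasiIso_of_acyclic {K L : CochainComplex 𝒜 ℤ} (f : K ⟶ L) (hK : K.Acyclic)
    (hL : L.Acyclic) : QuasiIso f := by
  rw [quasiIso_iff]
  intro i
  rw [quasiIsoAt_iff_isIso_homologyMap]
  exact ⟨0, (isZero_homology_of_acyclic hK i).eq_of_src _ _,
    (isZero_homology_of_acyclic hL i).eq_of_src _ _⟩

section

variable {Λ₁ Λ₂ Λ₃ : 𝒟 ⥤ 𝒜} [Λ₁.Additive] [Λ₂.Additive] [Λ₃.Additive]
    (a : Λ₁ ⟶ Λ₂) (b : Λ₂ ⟶ Λ₃) (h : ∀ X, ∃ w : a.app X ≫ b.app X = 0,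
      (ShortComplex.mk _ _ w).ShortExact) {K : HomotopyCategory 𝒟 (.up ℤ)}

include h

lemma acyc₁ (h₂ : acyc Λ₂ K) (h₃ : acyc Λ₃ K) : acyc Λ₁ K := by
  rw [acyc_iff] at *
  obtain ⟨w, hS⟩ := shortExact_map a b h K.as
  exact hS.acyclic_X₁ (quasiIso_of_acyclic _ h₂ h₃)

lemma acyc₂ (h₂ : acyc Λ₁ K) (h₃ : acyc Λ₃ K) : acyc Λ₂ K := by
  rw [acyc_iff] at *
  obtain ⟨w, hS⟩ := shortExact_map a b h K.as
  exact hS.acyclic_X₂ h₂ h₃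

lemma acyc₃ (h₂ : acyc Λ₁ K) (h₃ : acyc Λ₂ K) : acyc Λ₃ K := by
  rw [acyc_iff] at *
  obtain ⟨w, hS⟩ := shortExact_map a b h K.as
  exact hS.acyclic_X₃ (quasiIso_of_acyclic _ h₂ h₃)

end

variable {ι : Type w} (Λ : ι → 𝒟 ⥤ 𝒜) [∀ t, (Λ t).Additive]

/-- The complexes that become acyclic under all functors of a family. -/
def acycFam : ObjectProperty (HomotopyCategory 𝒟 (.up ℤ)) := fun K => ∀ t, acyc (Λ t) K

/-- The morphisms that become quasi-isomorphisms under all functors of a family. -/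
def qisFam : MorphismProperty (HomotopyCategory 𝒟 (.up ℤ)) := fun _ _ f => ∀ t, qis (Λ t) f

instance : (qisFam Λ).HasTwoOutOfThreeProperty where
  comp_mem f g hf hg t := (qis (Λ t)).comp_mem f g (hf t) (hg t)
  of_postcomp f g hf hg t := (qis (Λ t)).of_postcomp f g (hf t) (hg t)
  of_precomp f g hf hg t := (qis (Λ t)).of_precomp f g (hf t) (hg t)

variable [HasZeroObject 𝒟] [HasBinaryBiproducts 𝒟]

omit [HasZeroObject 𝒟] [HasBinaryBiproducts 𝒟] in
lemma qisFam_of_isIso {K L : HomotopyCategory 𝒟 (.up ℤ)} (f : K ⟶ L) [IsIso f] :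
    qisFam Λ f := fun t => by
  have : IsIso ((mapK (Λ t)).map f) := inferInstance
  exact MorphismProperty.of_isIso (HomotopyCategory.quasiIso 𝒜 (.up ℤ)) ((mapK (Λ t)).map f)

instance : (acycFam Λ).IsClosedUnderIsomorphisms where
  of_iso e h t := (HomotopyCategory.subcategoryAcyclic 𝒜).prop_of_iso ((mapK (Λ t)).mapIso e) (h t)

instance : (acycFam Λ).IsTriangulated where
  exists_zero := ⟨0, isZero_zero _, fun t =>
    (HomotopyCategory.subcategoryAcyclic 𝒜).prop_of_isZero
      ((mapK (Λ t)).map_isZero (isZero_zero _))⟩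
  isStableUnderShiftBy a := ⟨fun X hX t =>
    (HomotopyCategory.subcategoryAcyclic 𝒜).prop_of_iso
      (((mapK (Λ t)).commShiftIso a).symm.app X)
      ((HomotopyCategory.subcategoryAcyclic 𝒜).le_shift a _ (hX t))⟩
  toIsTriangulatedClosed₂ := ObjectProperty.IsTriangulatedClosed₂.mk' fun T hT h₁ h₃ t =>
    (HomotopyCategory.subcategoryAcyclic 𝒜).ext_of_isTriangulatedClosed₂ _
      ((mapK (Λ t)).map_distinguished T hT) (h₁ t) (h₃ t)

lemma qisFam_iff_of_distinguished (T : Triangle (HomotopyCategory 𝒟 (.up ℤ)))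
    (hT : T ∈ distTriang _) : qisFam Λ T.mor₁ ↔ acycFam Λ T.obj₃ := by
  refine forall_congr' fun t => ?_
  refine Iff.trans ?_ ((HomotopyCategory.subcategoryAcyclic 𝒜).trW_iff_of_distinguished _
    ((mapK (Λ t)).map_distinguished T hT))
  rw [← HomotopyCategory.quasiIso_eq_trW_subcategoryAcyclic]
  rfl

/-- A morphism belongs to the class exactly when its cone is acyclic for the whole family. Since
these cones form a triangulated subcategory, the calculus of fractions comes for free. -/
lemma qisFam_eq_trW : qisFam Λ = (acycFam Λ).trW := by
  ext K L f
  obtain ⟨Z, g, h, hT⟩ := distinguished_cocone_triangle f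
  exact (qisFam_iff_of_distinguished Λ _ hT).trans
    ((acycFam Λ).trW_iff_of_distinguished _ hT).symm

instance : (qisFam Λ).HasRightCalculusOfFractions := by
  rw [qisFam_eq_trW]; infer_instance

/-- Only the acyclic objects matter, so one may exchange a family of functors for another with the
same acyclic complexes. This is used to pass from intersections of steps to quotients by sums. -/
lemma qisFam_eq_of_acycFam_eq {ι' : Type w₁} {Λ' : ι' → 𝒟 ⥤ 𝒜} [∀ t, (Λ' t).Additive]
    (h : acycFam Λ = acycFam Λ') : qisFam Λ = qisFam Λ' := by
  rw [qisFam_eq_trW, qisFam_eq_trW, h]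

end Family

/-! ### The additive category of filtered objects -/

section Additive

open ZeroObject

variable {n : ℕ} {𝒜 : Type u} [Category.{v} 𝒜] [Abelian 𝒜]

lemma pullback_factors_iff {W X Y : 𝒜} (S : Subobject Y) (f : X ⟶ Y) (g : W ⟶ X) :
    ((Subobject.pullback f).obj S).Factors g ↔ S.Factors (g ≫ f) := by
  constructor
  · intro h
    rw [← Subobject.factorThru_arrow _ _ h, Category.assoc,
      ← (Subobject.isPullback f S).w, ← Category.assoc]
    exact Subobject.factors_comp_arrow _
  · intro h
    rw [Subobject.factors_iff]
    exact ⟨(Subobject.isPullback f S).lift (S.factorThru _ h) g (by simp),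
      (Subobject.isPullback f S).lift_snd _ _ _⟩

lemma isZero_of_obj {X : FiltObj n 𝒜} (h : IsZero X.obj) : IsZero X := by
  rw [IsZero.iff_id_eq_zero] at h ⊢
  exact FiltObj.hom_ext h

lemma isZero_obj {X : FiltObj n 𝒜} (h : IsZero X) : IsZero X.obj :=
  (forget n 𝒜).map_isZero h

instance : HasZeroObject (FiltObj n 𝒜) :=
  ⟨⟨0, fun _ => ⟨fun _ => ⊥, fun _ _ _ => le_rfl⟩⟩, isZero_of_obj (isZero_zero 𝒜)⟩

/-- The direct sum of two filtered objects. -/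
abbrev biprodFilt (X Y : FiltObj n 𝒜) : FiltObj n 𝒜 where
  obj := X.obj ⊞ Y.obj
  fil i := ⟨fun k => (Subobject.pullback biprod.fst).obj (X.fil i k) ⊓
    (Subobject.pullback biprod.snd).obj (Y.fil i k), fun _ _ h => inf_le_inf
      ((Subobject.pullback biprod.fst).monotone ((X.fil i).monotone h))
      ((Subobject.pullback biprod.snd).monotone ((Y.fil i).monotone h))⟩

lemma biprodFilt_factors (X Y : FiltObj n 𝒜) (i : Fin n) (k : ℤ) {W : 𝒜} (f : W ⟶ X.obj ⊞ Y.obj) :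
    ((biprodFilt X Y).fil i k).Factors f ↔
      (X.fil i k).Factors (f ≫ biprod.fst) ∧ (Y.fil i k).Factors (f ≫ biprod.snd) := by
  rw [← pullback_factors_iff, ← pullback_factors_iff]
  exact Subobject.inf_factors _

/-- The biproduct bicone of two filtered objects. -/
def biprodBicone (X Y : FiltObj n 𝒜) : BinaryBicone X Y where
  pt := biprodFilt X Y
  fst := ⟨biprod.fst, fun i k =>
    ((biprodFilt_factors X Y i k _).1 (Subobject.factors_self _)).1⟩
  snd := ⟨biprod.snd, fun i k =>
    ((biprodFilt_factors X Y i k _).1 (Subobject.factors_self _)).2⟩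
  inl := ⟨biprod.inl, fun i k => (biprodFilt_factors X Y i k _).2
    ⟨by simp [Subobject.factors_self], by simp [Subobject.factors_zero]⟩⟩
  inr := ⟨biprod.inr, fun i k => (biprodFilt_factors X Y i k _).2
    ⟨by simp [Subobject.factors_zero], by simp [Subobject.factors_self]⟩⟩
  inl_fst := FiltObj.hom_ext biprod.inl_fst
  inl_snd := FiltObj.hom_ext biprod.inl_snd
  inr_fst := FiltObj.hom_ext biprod.inr_fst
  inr_snd := FiltObj.hom_ext biprod.inr_snd

instance : HasBinaryBiproducts (FiltObj n 𝒜) where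
  has_binary_biproduct X Y := HasBinaryBiproduct.mk
    { bicone := biprodBicone X Y
      isBilimit := isBinaryBilimitOfTotal _ (FiltObj.hom_ext biprod.total) }

/-- The indices of the functors that detect filtered quasi-isomorphisms. -/
abbrev Steps (n : ℕ) := Option ((Fin n → Fin n) × (Fin n → ℤ))

variable (n 𝒜) in
/-- The functors that detect filtered quasi-isomorphisms. -/
def step : Steps n → FiltObj n 𝒜 ⥤ 𝒜
  | none => forget n 𝒜
  | some (i, k) => inter i k

instance (t : Steps n) : (step n 𝒜 t).Additive := by
  obtain _ | ⟨i, k⟩ := t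
  · exact inferInstanceAs (forget n 𝒜).Additive
  · exact inferInstanceAs (inter i k).Additive

lemma fqis_eq_qisFam : fqis n 𝒜 = qisFam (step n 𝒜) := by
  ext K L f
  constructor
  · rintro ⟨h₁, h₂⟩ (_ | ⟨i, k⟩)
    · exact h₁
    · exact h₂ i k
  · exact fun h => ⟨h none, fun i k => h (some (i, k))⟩

instance : (fqis n 𝒜).HasRightCalculusOfFractions := by
  rw [fqis_eq_qisFam]; infer_instance

instance : (fqis n 𝒜).HasTwoOutOfThreeProperty := by
  rw [fqis_eq_qisFam]; infer_instance

lemma fqis_of_isIso {K L : KF n 𝒜} (f : K ⟶ L) [IsIso f] : fqis n 𝒜 f := by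
  rw [fqis_eq_qisFam]; exact qisFam_of_isIso _ f

end Additive

/-! ### Functorial subobjects of filtered objects -/

section SubFam

open ZeroObject

variable {n : ℕ} {𝒜 : Type u} [Category.{v} 𝒜] [Abelian 𝒜]

lemma le_pullback_iff {X Y : 𝒜} (f : X ⟶ Y) (S : Subobject X) (T : Subobject Y) :
    S ≤ (Subobject.pullback f).obj T ↔ T.Factors (S.arrow ≫ f) := by
  rw [← pullback_factors_iff]
  exact ⟨fun h => Subobject.factors_of_le _ h (Subobject.factors_self _),
    Subobject.le_of_factors⟩

lemma sup_le_pullback {X Y : 𝒜} (f : X ⟶ Y) {S S' : Subobject X} {T T' : Subobject Y}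
    (h : S ≤ (Subobject.pullback f).obj T) (h' : S' ≤ (Subobject.pullback f).obj T') :
    S ⊔ S' ≤ (Subobject.pullback f).obj (T ⊔ T') :=
  sup_le (h.trans ((Subobject.pullback f).monotone le_sup_left))
    (h'.trans ((Subobject.pullback f).monotone le_sup_right))

lemma inf_le_pullback {X Y : 𝒜} (f : X ⟶ Y) {S S' : Subobject X} {T T' : Subobject Y}
    (h : S ≤ (Subobject.pullback f).obj T) (h' : S' ≤ (Subobject.pullback f).obj T') :
    S ⊓ S' ≤ (Subobject.pullback f).obj (T ⊓ T') := by
  rw [Subobject.inf_pullback]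
  exact inf_le_inf h h'

/-- The morphism on quotients by subobjects. -/
def quoMap {X Y : 𝒜} {S : Subobject X} {T : Subobject Y} (f : X ⟶ Y)
    (h : S ≤ (Subobject.pullback f).obj T) : cokernel S.arrow ⟶ cokernel T.arrow :=
  cokernel.desc _ (f ≫ cokernel.π _) (by
    rw [← Category.assoc, ← factors_iff_comp_cokernel, ← le_pullback_iff]; exact h)

@[simp]
lemma π_quoMap {X Y : 𝒜} {S : Subobject X} {T : Subobject Y} (f : X ⟶ Y)
    (h : S ≤ (Subobject.pullback f).obj T) :
    cokernel.π S.arrow ≫ quoMap f h = f ≫ cokernel.π T.arrow := cokernel.π_desc _ _ _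

lemma quoMap_comp {X Y Z : 𝒜} {S : Subobject X} {T : Subobject Y} {U : Subobject Z} (f : X ⟶ Y)
    (g : Y ⟶ Z) (k : X ⟶ Z) (hk : f ≫ g = k) (h : S ≤ (Subobject.pullback f).obj T)
    (h' : T ≤ (Subobject.pullback g).obj U) (h'' : S ≤ (Subobject.pullback k).obj U) :
    quoMap f h ≫ quoMap g h' = quoMap k h'' := by
  subst hk
  refine (cancel_epi (cokernel.π S.arrow)).1 ?_
  rw [← Category.assoc, π_quoMap, Category.assoc, π_quoMap, π_quoMap, Category.assoc]

lemma shortExact_cokernel {X Y : 𝒜} (f : X ⟶ Y) [Mono f] :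
    (ShortComplex.mk f (cokernel.π f) (cokernel.condition f)).ShortExact where
  exact := ShortComplex.exact_cokernel f
  mono_f := by assumption
  epi_g := by dsimp; infer_instance

variable (n 𝒜) in
/-- A functorial subobject of filtered objects. -/
@[ext] structure SubFam where
  /-- the subobject -/
  sub : ∀ X : FiltObj n 𝒜, Subobject X.obj
  le_pullback : ∀ {X Y : FiltObj n 𝒜} (f : X ⟶ Y), sub X ≤ (Subobject.pullback f.1).obj (sub Y)

namespace SubFam

lemma factors (S : SubFam n 𝒜) {X Y : FiltObj n 𝒜} (f : X ⟶ Y) :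
    (S.sub Y).Factors ((S.sub X).arrow ≫ f.1) := (le_pullback_iff _ _ _).1 (S.le_pullback f)

/-- The functor that sends a filtered object to the given subobject. -/
abbrev functor (S : SubFam n 𝒜) : FiltObj n 𝒜 ⥤ 𝒜 where
  obj X := (S.sub X : 𝒜)
  map {X Y} f := (S.sub Y).factorThru _ (S.factors f)
  map_id X := by rw [← cancel_mono (S.sub X).arrow]; simp
  map_comp {X Y Z} f g := by rw [← cancel_mono (S.sub Z).arrow]; simp

instance (S : SubFam n 𝒜) : S.functor.Additive where
  map_add {X Y f g} := by
    apply (cancel_mono (S.sub Y).arrow).1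
    refine Eq.trans ?_ (Preadditive.add_comp _ _ _ _ _ _).symm
    simp

/-- The functor that sends a filtered object to the quotient by the given subobject. -/
abbrev quot (S : SubFam n 𝒜) : FiltObj n 𝒜 ⥤ 𝒜 where
  obj X := cokernel (S.sub X).arrow
  map {X Y} f := quoMap f.1 (S.le_pullback f)
  map_id X := by rw [← cancel_epi (cokernel.π _)]; simp
  map_comp {X Y Z} f g := (cancel_epi (cokernel.π (S.sub X).arrow)).1 (by
    rw [← Category.assoc]; simp)

instance (S : SubFam n 𝒜) : S.quot.Additive where
  map_add {X Y f g} := (cancel_epi (cokernel.π (S.sub X).arrow)).1 (by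
    rw [Preadditive.comp_add]
    exact (π_quoMap _ (S.le_pullback (f + g))).trans ((Preadditive.add_comp _ _ _ _ _ _).trans
      (congrArg₂ (· + ·) (π_quoMap _ (S.le_pullback f)).symm
        (π_quoMap _ (S.le_pullback g)).symm)))

/-- The inclusion of a functorial subobject. -/
def incl (S : SubFam n 𝒜) : S.functor ⟶ forget n 𝒜 where
  app X := (S.sub X).arrow
  naturality _ Y f := Subobject.factorThru_arrow (S.sub Y) _ (S.factors f)

/-- The projection to the quotient. -/
def proj (S : SubFam n 𝒜) : forget n 𝒜 ⟶ S.quot where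
  app X := cokernel.π (S.sub X).arrow
  naturality _ _ f := (π_quoMap f.1 (S.le_pullback f)).symm

lemma shortExact (S : SubFam n 𝒜) (X : FiltObj n 𝒜) : ∃ w : S.incl.app X ≫ S.proj.app X = 0,
    (ShortComplex.mk _ _ w).ShortExact :=
  ⟨cokernel.condition _, shortExact_cokernel (S.sub X).arrow⟩

/-- The intersection of functorial subobjects. -/
instance : Min (SubFam n 𝒜) := ⟨fun S T =>
  ⟨fun X => S.sub X ⊓ T.sub X, fun f => inf_le_pullback _ (S.le_pullback f) (T.le_pullback f)⟩⟩

/-- The sum of functorial subobjects. -/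
instance : Max (SubFam n 𝒜) := ⟨fun S T =>
  ⟨fun X => S.sub X ⊔ T.sub X, fun f => sup_le_pullback _ (S.le_pullback f) (T.le_pullback f)⟩⟩

/-- The zero subobject. -/
instance : Bot (SubFam n 𝒜) := ⟨⟨fun _ => ⊥, fun _ => bot_le⟩⟩

lemma inf_sub (S T : SubFam n 𝒜) (X : FiltObj n 𝒜) : (S ⊓ T).sub X = S.sub X ⊓ T.sub X := rfl
lemma sup_sub (S T : SubFam n 𝒜) (X : FiltObj n 𝒜) : (S ⊔ T).sub X = S.sub X ⊔ T.sub X := rfl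

/-- An intersection of steps. -/
def inter (i : Fin n → Fin n) (k : Fin n → ℤ) : SubFam n 𝒜 :=
  ⟨fun X => X.inter i k, fun f => (le_pullback_iff _ _ _).2 (FiltObj.inter_factors f i k)⟩

/-- The direct sum of two functorial subobjects. -/
abbrev biprodFunctor (S T : SubFam n 𝒜) : FiltObj n 𝒜 ⥤ 𝒜 where
  obj X := S.functor.obj X ⊞ T.functor.obj X
  map f := biprod.map (S.functor.map f) (T.functor.map f)
  map_id X := by
    rw [S.functor.map_id, T.functor.map_id]; apply biprod.hom_ext <;> simp
  map_comp f g := by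
    rw [S.functor.map_comp, T.functor.map_comp]
    apply biprod.hom_ext <;> simp only [Category.assoc, biprod.map_fst, biprod.map_snd, biprod.map_fst_assoc,
      biprod.map_snd_assoc]

instance (S T : SubFam n 𝒜) : (S.biprodFunctor T).Additive where
  map_add {X Y f g} := by
    change biprod.map (S.functor.map (f + g)) (T.functor.map (f + g)) =
      biprod.map (S.functor.map f) (T.functor.map f) +
        biprod.map (S.functor.map g) (T.functor.map g)
    rw [S.functor.map_add, T.functor.map_add]
    apply biprod.hom_ext <;> simp only [biprod.map_fst, biprod.map_snd, Preadditive.add_comp,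
      Preadditive.comp_add]

section

variable {X : 𝒜} (S T : Subobject X)

/-- The image of the sum map contains both `S` and `T`, hence all of `S ⊔ T`. -/
lemma epi_desc_sup : Epi (biprod.desc (S.ofLE (S ⊔ T) le_sup_left)
    (T.ofLE (S ⊔ T) le_sup_right)) := by
  let g := biprod.desc (S.ofLE (S ⊔ T) le_sup_left) (T.ofLE (S ⊔ T) le_sup_right)
  let I := imageSubobject (g ≫ (S ⊔ T).arrow)
  have hS : S ≤ I := Subobject.le_of_factors (by
    have : S.arrow = biprod.inl ≫ g ≫ (S ⊔ T).arrow := by simp [g]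
    rw [this]
    exact Subobject.factors_of_factors_right _ (image_factors_self _))
  have hT : T ≤ I := Subobject.le_of_factors (by
    have : T.arrow = biprod.inr ≫ g ≫ (S ⊔ T).arrow := by simp [g]
    rw [this]
    exact Subobject.factors_of_factors_right _ (image_factors_self _))
  have hI : I ≤ S ⊔ T := imageSubobject_le _ g rfl
  have : IsIso (I.ofLE _ hI) :=
    ⟨(S ⊔ T).ofLE _ (sup_le hS hT), by simp, by simp⟩
  have : g = factorThruImageSubobject (g ≫ (S ⊔ T).arrow) ≫ I.ofLE _ hI := by
    rw [← cancel_mono (S ⊔ T).arrow]; simp [I]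
  change Epi g
  rw [this]
  infer_instance

/-- A pair in the kernel of the sum map has opposite components in `X`, so its first component lies
in both subobjects. This Mayer–Vietoris sequence links sums of steps to their intersections. -/
lemma shortExact_inf_sup : ∃ w : biprod.lift ((S ⊓ T).ofLE S inf_le_left)
      (-(S ⊓ T).ofLE T inf_le_right) ≫
      biprod.desc (S.ofLE (S ⊔ T) le_sup_left) (T.ofLE (S ⊔ T) le_sup_right) = 0,
    (ShortComplex.mk _ _ w).ShortExact := by
  have w : biprod.lift ((S ⊓ T).ofLE S inf_le_left) (-(S ⊓ T).ofLE T inf_le_right) ≫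
      biprod.desc (S.ofLE (S ⊔ T) le_sup_left) (T.ofLE (S ⊔ T) le_sup_right) = 0 := by
    rw [← cancel_mono (S ⊔ T).arrow]; simp
  have hm : Mono (biprod.lift ((S ⊓ T).ofLE S inf_le_left) (-(S ⊓ T).ofLE T inf_le_right)) := by
    have : Mono (biprod.lift ((S ⊓ T).ofLE S inf_le_left) (-(S ⊓ T).ofLE T inf_le_right) ≫
      biprod.fst) := by rw [biprod.lift_fst]; infer_instance
    exact mono_of_mono _ biprod.fst
  refine ⟨w, ?_⟩
  have hk : ∀ {W : 𝒜} (k : W ⟶ (S : 𝒜) ⊞ (T : 𝒜)), k ≫ biprod.desc (S.ofLE (S ⊔ T) le_sup_left)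
      (T.ofLE (S ⊔ T) le_sup_right) = 0 → ∃ l : W ⟶ (S ⊓ T : Subobject X),
      l ≫ biprod.lift ((S ⊓ T).ofLE S inf_le_left) (-(S ⊓ T).ofLE T inf_le_right) = k := by
    intro W k hk
    have hk' : k ≫ biprod.fst ≫ S.arrow + k ≫ biprod.snd ≫ T.arrow = 0 := by
      have := congrArg (· ≫ (S ⊔ T).arrow) hk
      rw [biprod.desc_eq] at this
      simpa using this
    have hf : (S ⊓ T).Factors (k ≫ biprod.fst ≫ S.arrow) := by
      rw [Subobject.inf_factors]
      refine ⟨by rw [← Category.assoc]; exact Subobject.factors_comp_arrow _, ?_⟩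
      rw [eq_neg_of_add_eq_zero_left hk', ← Category.assoc, ← Preadditive.neg_comp]
      exact Subobject.factors_comp_arrow _
    refine ⟨(S ⊓ T).factorThru _ hf, ?_⟩
    apply biprod.hom_ext
    · refine (cancel_mono S.arrow).1 ?_
      simp
    · refine (cancel_mono T.arrow).1 ?_
      simpa using (eq_neg_of_add_eq_zero_right hk').symm
  have := epi_desc_sup S T
  exact
    { exact := ShortComplex.exact_of_f_is_kernel _ (KernelFork.IsLimit.ofι' _ _
        fun k hk' => ⟨(hk k hk').choose, (hk k hk').choose_spec⟩) }

end

lemma shortExact_sup (S T : SubFam n 𝒜) : ∃ (a : (S ⊓ T).functor ⟶ S.biprodFunctor T)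
    (b : S.biprodFunctor T ⟶ (S ⊔ T).functor), ∀ X, ∃ w : a.app X ≫ b.app X = 0,
      (ShortComplex.mk _ _ w).ShortExact := by
  refine ⟨⟨fun X => biprod.lift ((S.sub X ⊓ T.sub X).ofLE _ inf_le_left)
      (-(S.sub X ⊓ T.sub X).ofLE _ inf_le_right), fun X Y f => ?_⟩,
    ⟨fun X => biprod.desc ((S.sub X).ofLE (S.sub X ⊔ T.sub X) le_sup_left)
      ((T.sub X).ofLE (S.sub X ⊔ T.sub X) le_sup_right), fun X Y f => ?_⟩,
    fun X => shortExact_inf_sup (S.sub X) (T.sub X)⟩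
  · dsimp only
    apply biprod.hom_ext
    · simp only [inf_sub, Category.assoc, biprod.lift_fst, biprod.map_fst, biprod.lift_fst_assoc]
      rw [← cancel_mono (S.sub Y).arrow]
      simp [Subobject.ofLE_arrow]
    · simp only [inf_sub, Category.assoc, biprod.lift_snd, biprod.map_snd, biprod.lift_snd_assoc]
      rw [← cancel_mono (T.sub Y).arrow]
      simp [Subobject.ofLE_arrow]
  · dsimp only
    apply biprod.hom_ext'
    · simp only [sup_sub, biprod.inl_map_assoc, biprod.inl_desc, biprod.inl_desc_assoc]
      rw [← cancel_mono (S.sub Y ⊔ T.sub Y).arrow]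
      simp [Subobject.ofLE_arrow, Subobject.ofLE_arrow_assoc]
    · simp only [sup_sub, biprod.inr_map_assoc, biprod.inr_desc, biprod.inr_desc_assoc]
      rw [← cancel_mono (S.sub Y ⊔ T.sub Y).arrow]
      simp [Subobject.ofLE_arrow, Subobject.ofLE_arrow_assoc]

variable {K : KF n 𝒜}

lemma acyc_of_isZero {Λ : FiltObj n 𝒜 ⥤ 𝒜} [Λ.Additive] (h : ∀ X, IsZero (Λ.obj X)) :
    acyc Λ K := by
  rw [acyc_iff]
  intro i
  rw [HomologicalComplex.exactAt_iff]
  exact ShortComplex.exact_of_isZero_X₂ _ (h _)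

lemma acyc_bot : acyc (⊥ : SubFam n 𝒜).functor K :=
  acyc_of_isZero fun _ => (isZero_zero 𝒜).of_iso Subobject.botCoeIsoZero

lemma acyc_biprod {S T : SubFam n 𝒜} (hS : acyc S.functor K) (hT : acyc T.functor K) :
    acyc (S.biprodFunctor T) K := by
  refine acyc₂ (Λ₁ := S.functor) (Λ₃ := T.functor) { app := fun X => biprod.inl }
    { app := fun X => biprod.snd } (fun X => ⟨biprod.inl_snd, ?_⟩) hS hT
  exact ShortComplex.Splitting.shortExact ⟨biprod.fst, biprod.inr, by simp, by simp, by simp⟩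

lemma acyc_sup {S T : SubFam n 𝒜} (hS : acyc S.functor K) (hT : acyc T.functor K)
    (h : acyc (S ⊓ T).functor K) : acyc (S ⊔ T).functor K := by
  obtain ⟨a, b, hab⟩ := shortExact_sup S T
  exact acyc₃ a b hab h (acyc_biprod hS hT)

lemma acyc_inf {S T : SubFam n 𝒜} (hS : acyc S.functor K) (hT : acyc T.functor K)
    (h : acyc (S ⊔ T).functor K) : acyc (S ⊓ T).functor K := by
  obtain ⟨a, b, hab⟩ := shortExact_sup S T
  exact acyc₁ a b hab (acyc_biprod hS hT) h

end SubFam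

/-! ### Quotients by sums of filtration steps -/

/-- The indices of sums of filtration steps. -/
def Sums (n : ℕ) := Fin n → WithBot ℤ

instance : PartialOrder (Sums n) := inferInstanceAs (PartialOrder (Fin n → WithBot ℤ))
instance : OrderBot (Sums n) := inferInstanceAs (OrderBot (Fin n → WithBot ℤ))

/-- The index of a single step. -/
def Sums.single (i : Fin n) (a : WithBot ℤ) : Sums n :=
  Function.update (⊥ : Fin n → WithBot ℤ) i a

/-- A filtration step, or zero. -/
def FiltObj.filBot (X : FiltObj n 𝒜) (i : Fin n) : WithBot ℤ →o Subobject X.obj where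
  toFun a := a.recBotCoe ⊥ (X.fil i)
  monotone' a b h := by
    induction a using WithBot.recBotCoe with
    | bot => exact bot_le
    | coe a =>
      induction b using WithBot.recBotCoe with
      | bot => simp at h
      | coe b => exact (X.fil i).monotone (WithBot.coe_le_coe.1 h)

lemma FiltObj.filBot_bot (X : FiltObj n 𝒜) (i : Fin n) : X.filBot i ⊥ = ⊥ := rfl

lemma FiltObj.filBot_coe (X : FiltObj n 𝒜) (i : Fin n) (k : ℤ) : X.filBot i k = X.fil i k := rfl

/-- A sum of filtration steps. -/
def FiltObj.sum (X : FiltObj n 𝒜) : Sums n →o Subobject X.obj where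
  toFun q := Finset.univ.sup fun i => X.filBot i (q i)
  monotone' _ _ h := Finset.sup_mono_fun fun i _ => (X.filBot i).monotone (h i)

lemma FiltObj.sum_le (X : FiltObj n 𝒜) {q : Sums n} {S : Subobject X.obj}
    (h : ∀ i, X.filBot i (q i) ≤ S) : X.sum q ≤ S :=
  Finset.sup_le (s := Finset.univ) (f := fun i => X.filBot i (q i)) fun i _ => h i

lemma FiltObj.le_sum (X : FiltObj n 𝒜) (q : Sums n) (i : Fin n) : X.filBot i (q i) ≤ X.sum q :=
  Finset.le_sup (f := fun i => X.filBot i (q i)) (Finset.mem_univ i)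

lemma FiltObj.filBot_le_pullback {X Y : FiltObj n 𝒜} (f : X ⟶ Y) (i : Fin n) (a : WithBot ℤ) :
    X.filBot i a ≤ (Subobject.pullback f.1).obj (Y.filBot i a) := by
  induction a using WithBot.recBotCoe with
  | bot => exact bot_le
  | coe a => exact (le_pullback_iff _ _ _).2 (f.2 i a)

/-- A filtration step, or zero, as a functorial subobject. -/
def SubFam.filBot (i : Fin n) (a : WithBot ℤ) : SubFam n 𝒜 :=
  ⟨fun X => X.filBot i a, fun f => FiltObj.filBot_le_pullback f i a⟩

/-- A sum of filtration steps as a functorial subobject. -/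
def SubFam.sum (q : Sums n) : SubFam n 𝒜 :=
  ⟨fun X => X.sum q, fun {X Y} f => X.sum_le fun i =>
    (FiltObj.filBot_le_pullback f i (q i)).trans
      ((Subobject.pullback f.1).monotone (Y.le_sum q i))⟩

variable (n 𝒜) in
/-- The quotient by a sum of filtration steps. -/
abbrev sumQuot (q : Sums n) : FiltObj n 𝒜 ⥤ 𝒜 := (SubFam.sum q).quot

lemma sum_bot (X : FiltObj n 𝒜) : X.sum ⊥ = ⊥ :=
  le_bot_iff.1 (X.sum_le fun _ => le_rfl)

lemma sum_single (X : FiltObj n 𝒜) (i : Fin n) (a : WithBot ℤ) :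
    X.sum (Sums.single i a) = X.filBot i a := by
  refine le_antisymm (X.sum_le fun j => ?_) ?_
  · by_cases h : j = i
    · subst h; rw [Sums.single, Function.update_self]
    · rw [Sums.single, Function.update_of_ne h]; exact bot_le
  · have := X.le_sum (Sums.single i a) i
    rwa [Sums.single, Function.update_self] at this

/-- For `n ≤ 2`, acyclicity of all intersections of filtration steps is equivalent to acyclicity
of the quotients by all sums of filtration steps. -/
lemma acycFam_step_eq (hn : 1 ≤ n) (hn' : n ≤ 2) :
    acycFam (step n 𝒜) = acycFam (sumQuot n 𝒜) := by
  ext K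
  have hbot : (SubFam.sum ⊥ : SubFam n 𝒜) = ⊥ := SubFam.ext (funext fun X => sum_bot X)
  have hsingle (i : Fin n) (a : WithBot ℤ) :
      (SubFam.sum (Sums.single i a) : SubFam n 𝒜) = SubFam.filBot i a :=
    SubFam.ext (funext fun X => sum_single X i a)
  -- The bound on `n` enters the whole proof through this lemma: with at most two filtrations a sum
  -- of steps has at most two terms, and one Mayer–Vietoris sequence computes it from the steps and
  -- their intersection.
  have hsum : ∀ q : Sums n, (∀ i a, acyc (SubFam.filBot (𝒜 := 𝒜) i a).functor K) →
      (∀ i j a b, i ≠ j → acyc (SubFam.filBot (𝒜 := 𝒜) i a ⊓ SubFam.filBot j b).functor K) →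
      acyc (SubFam.sum (𝒜 := 𝒜) q).functor K := by
    intro q h₁ h₂
    obtain rfl | rfl : n = 1 ∨ n = 2 := by omega
    · have : SubFam.sum (𝒜 := 𝒜) q = SubFam.filBot 0 (q 0) :=
        SubFam.ext (funext fun X => by simp [SubFam.sum, FiltObj.sum, SubFam.filBot])
      rw [this]
      exact h₁ _ _
    · have : SubFam.sum (𝒜 := 𝒜) q = SubFam.filBot 0 (q 0) ⊔ SubFam.filBot 1 (q 1) :=
        SubFam.ext (funext fun X => by
          rw [SubFam.sup_sub]
          simp [SubFam.sum, FiltObj.sum, SubFam.filBot, Finset.univ_fin2])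
      rw [this]
      exact SubFam.acyc_sup (h₁ _ _) (h₁ _ _) (h₂ _ _ _ _ (by decide))
  constructor
  · intro h q
    have hf : acyc (forget n 𝒜) K := h none
    have h₁ : ∀ i a, acyc (SubFam.filBot (𝒜 := 𝒜) i a).functor K := by
      intro i a
      induction a using WithBot.recBotCoe with
      | bot => exact SubFam.acyc_bot
      | coe a =>
        -- A single step is the intersection of `n` copies of itself.
        have : SubFam.inter (𝒜 := 𝒜) (fun _ => i) (fun _ => a) = SubFam.filBot i a :=
          SubFam.ext (funext fun X => by
            have : Nonempty (Fin n) := ⟨i⟩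
            exact Finset.inf_const (Finset.univ_nonempty (α := Fin n)) (X.fil i a))
        rw [← this]
        exact h (some (fun _ => i, fun _ => a))
    refine acyc₃ _ _ (SubFam.sum q).shortExact (hsum q h₁ ?_) hf
    intro i j a b hij
    induction a using WithBot.recBotCoe with
    | bot =>
      have : SubFam.filBot (𝒜 := 𝒜) i ⊥ ⊓ SubFam.filBot j b = ⊥ :=
        SubFam.ext (funext fun X => bot_inf_eq _)
      rw [this]; exact SubFam.acyc_bot
    | coe a =>
      induction b using WithBot.recBotCoe with
      | bot =>
        have : SubFam.filBot (𝒜 := 𝒜) i a ⊓ SubFam.filBot j ⊥ = ⊥ :=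
          SubFam.ext (funext fun X => inf_bot_eq _)
        rw [this]; exact SubFam.acyc_bot
      | coe b =>
        obtain rfl | rfl : n = 1 ∨ n = 2 := by omega
        · exact absurd (Subsingleton.elim i j) hij
        · have : SubFam.inter (𝒜 := 𝒜) ![i, j] ![a, b] = SubFam.filBot i a ⊓ SubFam.filBot j b :=
            SubFam.ext (funext fun X => by
              rw [SubFam.inf_sub]
              simp [SubFam.inter, FiltObj.inter, SubFam.filBot, FiltObj.filBot_coe, Finset.univ_fin2])
          rw [← this]
          exact h (some (![i, j], ![a, b]))
  · intro h
    -- The empty sum is zero, so the quotient at the index `⊥` recovers the underlying complex.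
    have hf : acyc (forget n 𝒜) K := by
      refine acyc₂ _ _ (SubFam.shortExact (SubFam.sum ⊥)) ?_ (h ⊥)
      rw [hbot]; exact SubFam.acyc_bot
    have hs (q : Sums n) : acyc (SubFam.sum (𝒜 := 𝒜) q).functor K :=
      acyc₁ _ _ (SubFam.shortExact (SubFam.sum q)) hf (h q)
    have h₁ : ∀ i a, acyc (SubFam.filBot (𝒜 := 𝒜) i a).functor K := fun i a => by
      rw [← hsingle]; exact hs _
    rintro (_ | ⟨i, k⟩)
    · exact hf
    · change acyc (SubFam.inter i k).functor K
      obtain rfl | rfl : n = 1 ∨ n = 2 := by omega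
      · have : SubFam.inter (𝒜 := 𝒜) i k = SubFam.filBot (i 0) (k 0) :=
          SubFam.ext (funext fun X => by
            simp [SubFam.inter, FiltObj.inter, SubFam.filBot, FiltObj.filBot_coe])
        rw [this]; exact h₁ _ _
      · have : SubFam.inter (𝒜 := 𝒜) i k =
            SubFam.filBot (i 0) (k 0) ⊓ SubFam.filBot (i 1) (k 1) :=
          SubFam.ext (funext fun X => by
            rw [SubFam.inf_sub]
            simp [SubFam.inter, FiltObj.inter, SubFam.filBot, FiltObj.filBot_coe, Finset.univ_fin2])
        rw [this]
        -- Two steps of the same filtration are nested and their intersection is the smaller one.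
        -- Steps of different filtrations have as their sum the sum indexed by `q`, and
        -- Mayer–Vietoris is read in the other direction.
        by_cases hi : i 0 = i 1
        · rw [hi]
          have (a b : ℤ) (hab : a ≤ b) : SubFam.filBot (𝒜 := 𝒜) (i 1) a ⊓ SubFam.filBot (i 1) b =
              SubFam.filBot (i 1) a := SubFam.ext (funext fun X =>
                inf_eq_left.2 ((X.fil (i 1)).monotone hab))
          have this' (a b : ℤ) (hab : b ≤ a) : SubFam.filBot (𝒜 := 𝒜) (i 1) a ⊓ SubFam.filBot (i 1) b =
              SubFam.filBot (i 1) b := SubFam.ext (funext fun X =>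
                inf_eq_right.2 ((X.fil (i 1)).monotone hab))
          rcases le_total (k 0) (k 1) with hk | hk
          · rw [this _ _ hk]; exact h₁ _ _
          · rw [this' _ _ hk]; exact h₁ _ _
        · refine SubFam.acyc_inf (h₁ _ _) (h₁ _ _) ?_
          let q : Sums 2 := fun j => if j = i 0 then k 0 else k 1
          have h₀ : q (i 0) = k 0 := if_pos rfl
          have h₁ : q (i 1) = k 1 := if_neg (Ne.symm hi)
          have : SubFam.filBot (𝒜 := 𝒜) (i 0) (k 0) ⊔ SubFam.filBot (i 1) (k 1) = SubFam.sum q :=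
            SubFam.ext (funext fun X => by
              refine le_antisymm (sup_le ?_ ?_) (X.sum_le fun j => ?_)
              · exact (congrArg (X.filBot (i 0)) h₀).symm.le.trans (X.le_sum q (i 0))
              · exact (congrArg (X.filBot (i 1)) h₁).symm.le.trans (X.le_sum q (i 1))
              · obtain rfl | rfl : j = i 0 ∨ j = i 1 := by omega
                · exact (congrArg (X.filBot (i 0)) h₀).le.trans le_sup_left
                · exact (congrArg (X.filBot (i 1)) h₁).le.trans le_sup_right)
          rw [this]; exact hs _

lemma fqis_eq_qisFam_sumQuot (hn : 1 ≤ n) (hn' : n ≤ 2) : fqis n 𝒜 = qisFam (sumQuot n 𝒜) := by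
  rw [fqis_eq_qisFam]
  exact qisFam_eq_of_acycFam_eq _ (acycFam_step_eq hn hn')

lemma sum_le_pullback_id (X : FiltObj n 𝒜) {q q' : Sums n} (h : q ≤ q') :
    X.sum q ≤ (Subobject.pullback (𝟙 X.obj)).obj (X.sum q') := by
  rw [Subobject.pullback_id]; exact X.sum.monotone h

variable (n 𝒜) in
/-- The diagram of quotients by sums of filtration steps. -/
abbrev kappa : FiltObj n 𝒜 ⥤ (Sums n ⥤ 𝒜) where
  obj X :=
    { obj := fun q => cokernel (X.sum q).arrow
      map := fun h => quoMap (𝟙 _) (sum_le_pullback_id X h.le)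
      map_id := fun q => by rw [← cancel_epi (cokernel.π _)]; simp
      map_comp := fun h h' => (quoMap_comp _ _ _ (Category.id_comp _) _ _ _).symm }
  map {X Y} f :=
    { app := fun q => (sumQuot n 𝒜 q).map f
      naturality := fun q q' h =>
        (quoMap_comp (𝟙 X.obj) f.1 f.1 (Category.id_comp _) (sum_le_pullback_id X h.le)
          ((SubFam.sum q').le_pullback f)
          (((SubFam.sum q).le_pullback f).trans
            ((Subobject.pullback f.1).monotone (Y.sum.monotone h.le)))).trans
        (quoMap_comp f.1 (𝟙 Y.obj) f.1 (Category.comp_id _) ((SubFam.sum q).le_pullback f)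
          (sum_le_pullback_id Y h.le) _).symm }
  map_id X := NatTrans.ext (funext fun q => (sumQuot n 𝒜 q).map_id X)
  map_comp f g := NatTrans.ext (funext fun q => (sumQuot n 𝒜 q).map_comp f g)

lemma kappa_π_map (X : FiltObj n 𝒜) {q q' : Sums n} (h : q ⟶ q') :
    cokernel.π (X.sum q).arrow ≫ ((kappa n 𝒜).obj X).map h = cokernel.π (X.sum q').arrow :=
  (π_quoMap (𝟙 X.obj) (sum_le_pullback_id X h.le)).trans (Category.id_comp _)

lemma kappa_π_app {X Y : FiltObj n 𝒜} (f : X ⟶ Y) (q : Sums n) :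
    cokernel.π (X.sum q).arrow ≫ ((kappa n 𝒜).map f).app q = f.1 ≫ cokernel.π (Y.sum q).arrow :=
  π_quoMap f.1 ((SubFam.sum q).le_pullback f)

instance : (kappa n 𝒜).Additive where
  map_add := NatTrans.ext (funext fun q => (sumQuot n 𝒜 q).map_add)

lemma isIso_π_sum_bot (X : FiltObj n 𝒜) : IsIso (cokernel.π (X.sum ⊥).arrow) := by
  have : (X.sum ⊥).arrow = 0 := by rw [sum_bot]; exact Subobject.bot_arrow
  rw [this]
  infer_instance

instance : (kappa n 𝒜).Faithful where
  map_injective {X Y f g} h := by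
    have := isIso_π_sum_bot Y
    apply FiltObj.hom_ext
    rw [← cancel_mono (cokernel.π (Y.sum ⊥).arrow), ← kappa_π_app, ← kappa_π_app, h]

/-- The component at `⊥` is a morphism of underlying objects and, all projections being
epimorphisms, determines the other components. The components at single steps say that this morphism
respects the filtrations. -/
instance : (kappa n 𝒜).Full where
  map_surjective {X Y} g := by
    have := isIso_π_sum_bot X
    have := isIso_π_sum_bot Y
    let f : X.obj ⟶ Y.obj := cokernel.π (X.sum ⊥).arrow ≫ g.app ⊥ ≫ inv (cokernel.π (Y.sum ⊥).arrow)
    have hf (q : Sums n) : cokernel.π (X.sum q).arrow ≫ g.app q =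
        f ≫ cokernel.π (Y.sum q).arrow := by
      let h : (⊥ : Sums n) ⟶ q := homOfLE bot_le
      rw [← kappa_π_map X h, Category.assoc, g.naturality, ← kappa_π_map Y h]
      dsimp only [f]
      rw [Category.assoc, Category.assoc, IsIso.inv_hom_id_assoc]
    let f' : X ⟶ Y := ⟨f, fun i k => ?_⟩
    · exact ⟨f', NatTrans.ext (funext fun q =>
        (cancel_epi (cokernel.π (X.sum q).arrow)).1 ((kappa_π_app f' q).trans (hf q).symm))⟩
    · have h := hf (Sums.single i k)
      have e : X.sum (Sums.single i (k : WithBot ℤ)) = X.fil i k := sum_single X i k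
      have e' : Y.sum (Sums.single i (k : WithBot ℤ)) = Y.fil i k := sum_single Y i k
      rw [← e, ← e', factors_iff_comp_cokernel, Category.assoc, ← h, ← Category.assoc,
        cokernel.condition, zero_comp]

end SubFam

/-! ### Injective filtered objects -/

section FunctorCategory

variable {𝒜 : Type u} [Category.{v} 𝒜] [Abelian 𝒜]

/-- The right adjoint of evaluation at `c` carries injectives to injectives. The product over all
`c` of such diagrams receives a map from `M` that is a monomorphism at each `c`. -/
lemma enoughInjectives_functor (T : Type) [SmallCategory T] [HasProducts.{0} 𝒜]
    [EnoughInjectives 𝒜] : EnoughInjectives (T ⥤ 𝒜) where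
  presentation M := by
    let J (c : T) : T ⥤ 𝒜 := (evaluationRightAdjoint 𝒜 c).obj (Injective.under (M.obj c))
    have (c : T) : Injective (J c) :=
      Injective.injective_of_adjoint (evaluationAdjunctionLeft 𝒜 c) _
    let φ (c : T) : M ⟶ J c :=
      (evaluationAdjunctionLeft 𝒜 c).homEquiv M _ (Injective.ι (M.obj c))
    have hφ (c : T) : (φ c).app c ≫ (evaluationAdjunctionLeft 𝒜 c).counit.app _ =
        Injective.ι (M.obj c) :=
      (Adjunction.homEquiv_counit _ _ _ _).symm.trans
        (((evaluationAdjunctionLeft 𝒜 c).homEquiv _ _).symm_apply_apply _)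
    have (c : T) : Mono ((Pi.lift φ).app c) := by
      have h : (Pi.lift φ).app c ≫ (Pi.π J c).app c = (φ c).app c := by
        rw [← NatTrans.comp_app, Pi.lift_π]
      have : Mono ((Pi.lift φ).app c ≫ (Pi.π J c).app c) := by
        rw [h]; exact mono_of_mono_fac (hφ c)
      exact mono_of_mono _ ((Pi.π J c).app c)
    exact ⟨⟨∏ᶜ J, inferInstance, Pi.lift φ, NatTrans.mono_of_mono_app _⟩⟩

/-- The extension of an object by zero outside an upper set. -/
abbrev upperObj {T : Type} [PartialOrder T] (U : UpperSet T) (M : 𝒜) : T ⥤ 𝒜 where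
  obj t := ∐ fun _ : PLift (t ∈ U) => M
  map {s t} h := Sigma.desc fun x => Sigma.ι (fun _ : PLift (t ∈ U) => M) ⟨U.upper h.le x.down⟩

/-- The inclusion of `upperObj U M` in the constant functor. -/
abbrev upperObjIncl {T : Type} [PartialOrder T] (U : UpperSet T) (M : 𝒜) :
    upperObj U M ⟶ (Functor.const T).obj M where
  app t := Sigma.desc fun _ => 𝟙 M
  naturality s t h := by
    refine Sigma.hom_ext _ _ fun x => ?_
    simp

instance {T : Type} [PartialOrder T] (U : UpperSet T) (M : 𝒜) : Mono (upperObjIncl U M) := by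
  have (t : T) : Mono ((upperObjIncl U M).app t) := by
    by_cases h : t ∈ U
    · have : (upperObjIncl U M).app t ≫ Sigma.ι (fun _ : PLift (t ∈ U) => M) ⟨h⟩ = 𝟙 _ :=
        Sigma.hom_ext _ _ fun x => by simp
      exact mono_of_mono_fac this
    · refine ⟨fun f g _ => ?_⟩
      have : IsZero ((upperObj U M).obj t) := by
        rw [IsZero.iff_id_eq_zero]
        exact Sigma.hom_ext _ _ fun x => absurd x.down h
      exact this.eq_of_tgt _ _
  exact NatTrans.mono_of_mono_app _

/-- The transition morphism from the smallest index. -/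
abbrev fromBot {T : Type} [PartialOrder T] [OrderBot T] (J : T ⥤ 𝒜) (q : T) : J.obj ⊥ ⟶ J.obj q :=
  J.map (homOfLE bot_le)

/-- A family that is compatible on the upper set is a morphism from a subobject of the constant
diagram. Injectivity extends it to the constant diagram, where the component at `⊥` determines all
the others. -/
lemma exists_extension_of_injective {T : Type} [PartialOrder T] [OrderBot T] (J : T ⥤ 𝒜)
    [Injective J] (U : UpperSet T) (M : 𝒜) (a : ∀ t, M ⟶ J.obj t)
    (ha : ∀ s t (h : s ≤ t), s ∈ U → a s ≫ J.map (homOfLE h) = a t) :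
    ∃ b : M ⟶ J.obj ⊥, ∀ t ∈ U, b ≫ fromBot J t = a t := by
  let g : upperObj U M ⟶ J :=
    { app := fun t => Sigma.desc fun _ => a t
      naturality := fun s t h => by
        refine Sigma.hom_ext _ _ fun x => ?_
        simp [← ha s t h.le x.down]
        rfl }
  obtain ⟨e, he⟩ := Injective.factors g (upperObjIncl U M)
  refine ⟨e.app ⊥, fun t ht => ?_⟩
  have h₁ := congrArg (fun z => Sigma.ι (fun _ : PLift (t ∈ U) => M) ⟨ht⟩ ≫ z)
    (NatTrans.congr_app he t)
  have h₂ : e.app t = a t := by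
    simpa [g] using h₁
  rw [← e.naturality, h₂]
  exact Category.id_comp _

/-- The transition morphisms out of `J.obj q` form a compatible family on the indices above `q`; its
extension is a section of `fromBot J q`. -/
lemma isSplitEpi_of_injective {T : Type} [PartialOrder T] [OrderBot T] (J : T ⥤ 𝒜)
    [Injective J] (q : T) : Epi (fromBot J q) := by
  classical
  obtain ⟨b, hb⟩ := exists_extension_of_injective J (UpperSet.Ici q) (J.obj q)
    (fun t => if h : q ≤ t then J.map (homOfLE h) else 0) (fun s t h hs => by
      rw [UpperSet.mem_Ici_iff] at hs
      rw [dif_pos hs, dif_pos (hs.trans h), ← J.map_comp]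
      rfl)
  have := hb q (UpperSet.mem_Ici_iff.2 le_rfl)
  rw [dif_pos le_rfl] at this
  have h' : b ≫ fromBot J q = 𝟙 _ := this.trans (J.map_id q)
  exact epi_of_epi_fac h'

/-- The kernel of the transition morphism from the smallest index. -/
def kerBot {T : Type} [PartialOrder T] [OrderBot T] (J : T ⥤ 𝒜) : T →o Subobject (J.obj ⊥) where
  toFun q := kernelSubobject (fromBot J q)
  monotone' q q' h := by
    refine Subobject.le_of_factors ((kernelSubobject_factors_iff _ _).2 ?_)
    have : fromBot J q' = fromBot J q ≫
      J.map (homOfLE h) := by rw [← J.map_comp]; rfl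
    rw [this, ← Category.assoc, kernelSubobject_arrow_comp, zero_comp]

lemma kerBot_factors_iff {T : Type} [PartialOrder T] [OrderBot T] (J : T ⥤ 𝒜) (q : T) {M : 𝒜}
    (f : M ⟶ J.obj ⊥) : (kerBot J q).Factors f ↔ f ≫ fromBot J q = 0 :=
  kernelSubobject_factors_iff _ _

lemma kerBot_arrow_comp {T : Type} [PartialOrder T] [OrderBot T] (J : T ⥤ 𝒜) (q : T) :
    (kerBot J q).arrow ≫ fromBot J q = 0 :=
  kernelSubobject_arrow_comp _

lemma kerBot_bot {T : Type} [PartialOrder T] [OrderBot T] (J : T ⥤ 𝒜) : kerBot J ⊥ = ⊥ := by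
  refine le_bot_iff.1 (Subobject.le_of_factors ?_)
  rw [Subobject.bot_factors_iff_zero]
  have := kerBot_arrow_comp J ⊥
  rwa [show fromBot J ⊥ = 𝟙 _ from J.map_id _, Category.comp_id] at this

/-- An element `x` of the kernel at `q` is split as `(x - b) + b`. Here `b` extends the family on
the indices above `q₁` or `q₂` that is zero above `q₂` and agrees with `x` elsewhere. The two
prescriptions are compatible since an index above both is above `q`, where `x` dies. -/
lemma kerBot_le_sup {T : Type} [PartialOrder T] [OrderBot T] (J : T ⥤ 𝒜) [Injective J]
    {q q₁ q₂ : T} (h : IsLUB {q₁, q₂} q) : kerBot J q ≤ kerBot J q₁ ⊔ kerBot J q₂ := by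
  classical
  have hq (t : T) : q ≤ t ↔ q₁ ≤ t ∧ q₂ ≤ t := by
    rw [isLUB_le_iff h]; simp [upperBounds]
  -- Upper sets are ordered by reverse inclusion, so this infimum is the union of the two sets.
  obtain ⟨b, hb⟩ := exists_extension_of_injective J (UpperSet.Ici q₁ ⊓ UpperSet.Ici q₂)
    (kerBot J q : 𝒜)
    (fun t => if q₂ ≤ t then 0 else (kerBot J q).arrow ≫ fromBot J t)
    (fun s t hst hs => by
      have hc : fromBot J s ≫ J.map (homOfLE hst) =
        fromBot J t := by rw [← J.map_comp]; rfl
      by_cases h₂ : q₂ ≤ s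
      · rw [if_pos h₂, if_pos (h₂.trans hst), zero_comp]
      · have h₁ : q₁ ≤ s := by
          rcases hs with hs | hs
          · exact hs
          · exact absurd hs h₂
        rw [if_neg h₂, Category.assoc, hc]
        split_ifs with h₃
        · exact (kerBot_factors_iff J t _).1 (Subobject.factors_of_le _
            ((kerBot J).monotone ((hq t).2 ⟨h₁.trans hst, h₃⟩)) (Subobject.factors_self _))
        · rfl)
  have h₂ : (kerBot J q₂).Factors b := by
    rw [kerBot_factors_iff, hb q₂ (Or.inr (UpperSet.mem_Ici_iff.2 le_rfl)), if_pos le_rfl]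
  have h₁ : (kerBot J q₁).Factors ((kerBot J q).arrow - b) := by
    rw [kerBot_factors_iff, Preadditive.sub_comp, hb q₁ (Or.inl (UpperSet.mem_Ici_iff.2 le_rfl))]
    split_ifs with h₃
    · rw [sub_zero, ← kerBot_factors_iff]
      exact Subobject.factors_of_le _ ((kerBot J).monotone ((hq q₁).2 ⟨le_rfl, h₃⟩))
        (Subobject.factors_self _)
    · exact sub_self _
  refine Subobject.le_of_factors ?_
  rw [← sub_add_cancel (kerBot J q).arrow b]
  exact Subobject.factors_add _ _ (Subobject.factors_of_le _ le_sup_left h₁)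
    (Subobject.factors_of_le _ le_sup_right h₂)

end FunctorCategory

/-! ### Injective diagrams come from filtered objects. -/

section Kappa

variable {n : ℕ} {𝒜 : Type u} [Category.{v} 𝒜] [Abelian 𝒜]

lemma Sums.single_le {i : Fin n} {a : WithBot ℤ} {q : Sums n} (h : a ≤ q i) :
    Sums.single i a ≤ q := fun j => by
  by_cases hj : j = i
  · subst hj; rw [Sums.single, Function.update_self]; exact h
  · rw [Sums.single, Function.update_of_ne hj]; exact bot_le

lemma Sums.single_mono (i : Fin n) : Monotone (Sums.single (n := n) i) := fun a b h =>
  Sums.single_le (by rw [Sums.single, Function.update_self]; exact h)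

lemma Sums.single_bot (i : Fin n) : Sums.single (n := n) i ⊥ = ⊥ :=
  le_bot_iff.1 (Sums.single_le bot_le)

/-- Replace the components outside a finite set by `⊥`. -/
def Sums.restrict (q : Sums n) (s : Finset (Fin n)) : Sums n := fun i => if i ∈ s then q i else ⊥

/-- Adjoining a component `j` replaces the index by its least upper bound with `Sums.single j (q
j)`, so `kerBot_le_sup` applies once for each component. -/
lemma kerBot_le_finset_sup (J : Sums n ⥤ 𝒜) [Injective J] (q : Sums n) (s : Finset (Fin n)) :
    kerBot J (q.restrict s) ≤ s.sup fun i => kerBot J (Sums.single i (q i)) := by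
  induction s using Finset.induction_on with
  | empty =>
    rw [Finset.sup_empty]
    have : q.restrict ∅ = ⊥ := funext fun i => if_neg (Finset.notMem_empty i)
    rw [this, kerBot_bot]
  | insert j s hj ih =>
    rw [Finset.sup_insert]
    refine (kerBot_le_sup J (q₁ := Sums.single j (q j))
      (q₂ := q.restrict s) ?_).trans (sup_le_sup_left ih _)
    constructor
    · rintro x (rfl | rfl)
      · exact Sums.single_le (if_pos (Finset.mem_insert_self j s)).ge
      · intro i
        by_cases h : i ∈ s
        · exact ((if_pos h).trans (if_pos (Finset.mem_insert_of_mem h)).symm).le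
        · exact (if_neg h).le.trans bot_le
    · intro t ht i
      have h₁ : Sums.single j (q j) ≤ t := ht (by simp)
      have h₂ : q.restrict s ≤ t := ht (by simp)
      have h₁ := h₁ i
      have h₂ := h₂ i
      by_cases hij : i = j
      · subst hij
        rw [Sums.single, Function.update_self] at h₁
        exact (if_pos (Finset.mem_insert_self i s)).le.trans h₁
      · by_cases h : i ∈ s
        · exact ((if_pos (Finset.mem_insert_of_mem h)).trans (if_pos h).symm).le.trans h₂
        · exact (if_neg (by simp [h, hij])).le.trans bot_le

/-- The filtered object given by a diagram indexed by `Sums n`. -/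
abbrev ofDiagram (J : Sums n ⥤ 𝒜) : FiltObj n 𝒜 where
  obj := J.obj ⊥
  fil i := ⟨fun k => kerBot J (Sums.single i k), fun _ _ h =>
    (kerBot J).monotone (Sums.single_mono i (WithBot.coe_le_coe.2 h))⟩

lemma ofDiagram_filBot (J : Sums n ⥤ 𝒜) (i : Fin n) (a : WithBot ℤ) :
    (ofDiagram J).filBot i a = kerBot J (Sums.single i a) := by
  induction a using WithBot.recBotCoe with
  | bot => rw [Sums.single_bot, kerBot_bot]; rfl
  | coe a => rfl

lemma ofDiagram_sum (J : Sums n ⥤ 𝒜) [Injective J] (q : Sums n) :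
    (ofDiagram J).sum q = kerBot J q := by
  refine le_antisymm ((ofDiagram J).sum_le fun i => ?_) ?_
  · rw [ofDiagram_filBot]
    exact (kerBot J).monotone (Sums.single_le le_rfl)
  · have := kerBot_le_finset_sup J q Finset.univ
    rw [show q.restrict Finset.univ = q from funext fun i => if_pos (Finset.mem_univ i)] at this
    refine this.trans (Finset.sup_le fun i _ => ?_)
    rw [← ofDiagram_filBot]
    exact (ofDiagram J).le_sum q i

/-- Each `J.obj q` is a quotient of `J.obj ⊥`, and the kernel is the sum of the kernels at the
single components of `q`. So the filtration of `J.obj ⊥` by the latter kernels has the given diagram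
as its quotients by sums. -/
lemma essImage_kappa_of_injective (J : Sums n ⥤ 𝒜) [Injective J] :
    (kappa n 𝒜).essImage J := by
  have h (q : Sums n) : ((ofDiagram J).sum q).arrow ≫ fromBot J q = 0 := by
    rw [ofDiagram_sum]; exact kerBot_arrow_comp J q
  let e : (kappa n 𝒜).obj (ofDiagram J) ⟶ J :=
    { app := fun q => cokernel.desc _ (J.map (homOfLE bot_le)) (h q)
      naturality := fun q q' hq => (cancel_epi (cokernel.π ((ofDiagram J).sum q).arrow)).1 (by
        rw [← Category.assoc, kappa_π_map, ← Category.assoc, cokernel.π_desc, cokernel.π_desc,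
          ← J.map_comp]
        rfl) }
  have (q : Sums n) : IsIso (e.app q) := by
    have := isSplitEpi_of_injective J q
    have : Epi (e.app q) := epi_of_epi_fac (cokernel.π_desc _ (J.map (homOfLE bot_le)) (h q))
    have : Mono (e.app q) := by
      refine (ShortComplex.exact_iff_mono_cokernel_desc
        (ShortComplex.mk ((ofDiagram J).sum q).arrow (fromBot J q) (h q))).1 ?_
      refine ShortComplex.exact_of_f_is_kernel _ (KernelFork.IsLimit.ofι' _ _ fun {M} k hk => ?_)
      have : ((ofDiagram J).sum q).Factors k := by
        rw [ofDiagram_sum, kerBot_factors_iff]; exact hk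
      exact ⟨Subobject.factorThru _ _ this, Subobject.factorThru_arrow _ _ this⟩
    exact isIso_of_mono_of_epi _
  have : IsIso e := NatIso.isIso_of_isIso_app _
  exact ⟨ofDiagram J, ⟨asIso e⟩⟩

end Kappa

/-! ### Injective resolutions -/

section Resolution

variable {n : ℕ} {𝒜 : Type u} [Category.{v} 𝒜] [Abelian 𝒜]

/-- Lift a complex along a fully faithful functor. -/
lemma exists_complex_of_essImage {𝒟 : Type u₁} [Category.{v₁} 𝒟] [Preadditive 𝒟] {ℰ : Type u₂}
    [Category.{v₂} ℰ] [Preadditive ℰ] (κ : 𝒟 ⥤ ℰ) [κ.Additive] [κ.Full] [κ.Faithful]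
    (L : CochainComplex ℰ ℤ) (hL : ∀ i, κ.essImage (L.X i)) :
    ∃ I : CochainComplex 𝒟 ℤ, Nonempty ((κ.mapHomologicalComplex _).obj I ≅ L) := by
  choose I e using hL
  let e (p : ℤ) : κ.obj (I p) ≅ L.X p := (e p).some
  let C : CochainComplex 𝒟 ℤ :=
    { X := I
      d := fun p q => κ.preimage ((e p).hom ≫ L.d p q ≫ (e q).inv)
      shape := fun p q h => κ.map_injective (by simp [L.shape p q h])
      d_comp_d' := fun p q r _ _ => κ.map_injective (by simp) }
  exact ⟨C, ⟨HomologicalComplex.Hom.isoOfComponents e fun p q _ => by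
    refine Eq.symm ((congrArg (· ≫ (e q).hom) (κ.map_preimage _)).trans ?_)
    simp
    rfl⟩⟩

variable (n 𝒜) in
/-- Bounded below complexes of injective filtered objects. -/
def injPlus : ObjectProperty (KFplus n 𝒜) := fun I =>
  ∀ p, Injective ((kappa n 𝒜).obj (I.obj.as.X p))

lemma fqis_quotient_iff_kappa (hn : 1 ≤ n) (hn' : n ≤ 2) {K L : CochainComplex (FiltObj n 𝒜) ℤ}
    (f : K ⟶ L) : fqis n 𝒜 ((HomotopyCategory.quotient _ _).map f) ↔
      QuasiIso (((kappa n 𝒜).mapHomologicalComplex _).map f) := by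
  rw [fqis_eq_qisFam_sumQuot hn hn', HomologicalComplex.quasiIso_iff_evaluation]
  exact forall_congr' fun q => qis_quotient_iff (sumQuot n 𝒜 q) f

lemma fqis_eq_qis_kappa (hn : 1 ≤ n) (hn' : n ≤ 2) : fqis n 𝒜 = qis (kappa n 𝒜) := by
  ext K L f
  obtain ⟨f, rfl⟩ := (HomotopyCategory.quotient _ _).map_surjective f
  exact (fqis_quotient_iff_kappa hn hn' f).trans (qis_quotient_iff (kappa n 𝒜) f).symm

/-- The diagram complex is resolved by injective diagrams in the abelian functor category. The
resolution and the map to it lift back because `kappa` is fully faithful and its image contains the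
injectives. -/
lemma exists_injective_resolution (hn : 1 ≤ n) (hn' : n ≤ 2) [HasProducts.{0} 𝒜]
    [EnoughInjectives 𝒜] (K : KFplus n 𝒜) :
    ∃ (I : KFplus n 𝒜) (w : K ⟶ I), fqisPlus n 𝒜 w ∧ injPlus n 𝒜 I := by
  have := enoughInjectives_functor (𝒜 := 𝒜) (Sums n)
  obtain ⟨N, hN⟩ := K.property
  let K' : CochainComplex (Sums n ⥤ 𝒜) ℤ := ((kappa n 𝒜).mapHomologicalComplex (.up ℤ)).obj K.obj.as
  have : K'.IsStrictlyGE N := by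
    rw [CochainComplex.isStrictlyGE_iff]
    intro i hi
    exact (kappa n 𝒜).map_isZero (hN i hi)
  obtain ⟨L, i, hi, hL, hLN⟩ :=
    CochainComplex.Plus.modelCategoryQuillen.exists_quasiIso_injective K' N
  obtain ⟨I, ⟨e⟩⟩ := exists_complex_of_essImage (kappa n 𝒜) L fun p =>
    essImage_kappa_of_injective (L.X p)
  obtain ⟨f, hf⟩ := ((kappa n 𝒜).mapHomologicalComplex (.up ℤ)).map_surjective (i ≫ e.inv)
  refine ⟨⟨(HomotopyCategory.quotient _ _).obj I, N, fun q hq => ?_⟩,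
    ObjectProperty.homMk ((HomotopyCategory.quotient _ _).map f), ?_, fun p => ?_⟩
  · have h₀ : IsZero (L.X q) := CochainComplex.isZero_of_isStrictlyGE L N q hq
    have : IsZero ((kappa n 𝒜).obj (I.X q)) :=
      h₀.of_iso ((HomologicalComplex.eval _ _ q).mapIso e)
    rw [IsZero.iff_id_eq_zero] at this ⊢
    refine (kappa n 𝒜).map_injective ?_
    exact ((kappa n 𝒜).map_id _).trans (this.trans ((kappa n 𝒜).map_zero _ _).symm)
  · refine (fqis_quotient_iff_kappa hn hn' f).2 ?_
    rw [hf]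
    infer_instance
  · exact Injective.of_iso ((HomologicalComplex.eval _ _ p).mapIso e).symm (hL p)

/-- Under `kappa` the complex `I` becomes a bounded below complex of injectives, which is
K-injective, and full faithfulness carries the bijection back. No bound is imposed on `X` and `Y`:
the first argument of the derived `Hom` is unbounded. -/
lemma bijective_comp_of_injPlus (hn : 1 ≤ n) (hn' : n ≤ 2) {X Y : KF n 𝒜} (s : X ⟶ Y)
    (hs : fqis n 𝒜 s) (I : KFplus n 𝒜) (hI : injPlus n 𝒜 I) :
    Function.Bijective fun g : Y ⟶ I.obj => s ≫ g := by
  obtain ⟨N, hN⟩ := I.property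
  let I' : CochainComplex (Sums n ⥤ 𝒜) ℤ := ((kappa n 𝒜).mapHomologicalComplex (.up ℤ)).obj I.obj.as
  have : I'.IsStrictlyGE N := by
    rw [CochainComplex.isStrictlyGE_iff]
    intro i hi
    exact (kappa n 𝒜).map_isZero (hN i hi)
  have (p : ℤ) : Injective (I'.X p) := hI p
  have := CochainComplex.isKInjective_of_injective I' N
  have hr := CochainComplex.IsKInjective.rightOrthogonal I'
  rw [← ObjectProperty.isLocal_trW, ← HomotopyCategory.quasiIso_eq_trW_subcategoryAcyclic] at hr
  rw [fqis_eq_qis_kappa hn hn'] at hs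
  have hb := hr _ hs
  constructor
  · intro g g' h
    refine (mapK (kappa n 𝒜)).map_injective (hb.1 ?_)
    change (mapK (kappa n 𝒜)).map s ≫ (mapK (kappa n 𝒜)).map g =
      (mapK (kappa n 𝒜)).map s ≫ (mapK (kappa n 𝒜)).map g'
    rw [← Functor.map_comp, ← Functor.map_comp]
    exact congrArg _ h
  · intro g
    obtain ⟨k, hk⟩ := hb.2 ((mapK (kappa n 𝒜)).map g)
    obtain ⟨k, rfl⟩ := (mapK (kappa n 𝒜)).map_surjective k
    refine ⟨k, (mapK (kappa n 𝒜)).map_injective ?_⟩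
    rw [Functor.map_comp]
    exact hk

lemma isIso_of_injPlus (hn : 1 ≤ n) (hn' : n ≤ 2) {I J : KFplus n 𝒜} (w : I ⟶ J)
    (hw : fqisPlus n 𝒜 w) (hI : injPlus n 𝒜 I) (hJ : injPlus n 𝒜 J) : IsIso w := by
  obtain ⟨r, hr⟩ := (bijective_comp_of_injPlus hn hn' w.hom hw I hI).2 (𝟙 _)
  refine ⟨ObjectProperty.homMk r, ObjectProperty.hom_ext _ hr, ObjectProperty.hom_ext _ ?_⟩
  refine (bijective_comp_of_injPlus hn hn' w.hom hw J hJ).1 ?_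
  change w.hom ≫ r ≫ w.hom = w.hom ≫ 𝟙 _
  rw [← Category.assoc]
  exact (congrArg (· ≫ w.hom) hr).trans <| (Category.id_comp _).trans (Category.comp_id _).symm

/-- After composition with an injective resolution of the target, morphisms extend uniquely along
filtered quasi-isomorphisms; this gives both axioms. -/
lemma hasLeftCalculusOfFractions_fqisPlus (hn : 1 ≤ n) (hn' : n ≤ 2) [HasProducts.{0} 𝒜]
    [EnoughInjectives 𝒜] : (fqisPlus n 𝒜).HasLeftCalculusOfFractions where
  exists_leftFraction {X Y} φ := by
    obtain ⟨I, t, ht, hI⟩ := exists_injective_resolution hn hn' Y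
    obtain ⟨g, hg⟩ := (bijective_comp_of_injPlus hn hn' φ.s.hom φ.hs I hI).2 (φ.f ≫ t).hom
    exact ⟨⟨ObjectProperty.homMk g, t, ht⟩, ObjectProperty.hom_ext _ hg.symm⟩
  ext {X' X Y} f g s hs h := by
    obtain ⟨I, t, ht, hI⟩ := exists_injective_resolution hn hn' Y
    refine ⟨I, t, ht, ObjectProperty.hom_ext _
      ((bijective_comp_of_injPlus hn hn' s.hom hs I hI).1 ?_)⟩
    change s.hom ≫ f.hom ≫ t.hom = s.hom ≫ g.hom ≫ t.hom
    rw [← Category.assoc, ← Category.assoc]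
    exact congrArg (· ≫ t.hom) (congrArg (fun z => z.hom) h)

instance : (fqisPlus n 𝒜).HasTwoOutOfThreeProperty :=
  inferInstanceAs ((fqis n 𝒜).inverseImage _).HasTwoOutOfThreeProperty

instance : (fqisMinus n 𝒜).HasTwoOutOfThreeProperty :=
  inferInstanceAs ((fqis n 𝒜).inverseImage _).HasTwoOutOfThreeProperty

end Resolution

/-! ### Presheaves of modules that are relatively injective -/

section RelInj

variable {C : Type u} [SmallCategory C] {R : Cᵒᵖ ⥤ RingCat.{u}}

/-- Presheaves of modules whose modules of sections are projective. -/
def ObjProj (P : PresheafOfModules.{u} R) : Prop := ∀ W, Projective (P.obj W)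

lemma ObjProj.free (F : Cᵒᵖ ⥤ Type u) : ObjProj (PresheafOfModules.freeObj (R := R) F) := fun W =>
  ModuleCat.projective_of_free (M := (ModuleCat.free (R.obj W)).obj (F.obj W))
    (ι := F.obj W) Finsupp.basisSingleOne

lemma ObjProj.freeYonedaCoproduct (M : PresheafOfModules.{u} R) :
    ObjProj M.freeYonedaCoproduct := fun W => by
  have (m : M.Elements) : Projective ((PresheafOfModules.evaluation R W).obj m.freeYoneda) :=
    ObjProj.free _ W
  exact Projective.of_iso (PreservesCoproduct.iso (PresheafOfModules.evaluation R W) _).symm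
    inferInstance

lemma ObjProj.exists_retraction {P M : PresheafOfModules.{u} R} (q : P ⟶ M) [Epi q]
    (hM : ObjProj M) (W : Cᵒᵖ) : ∃ r : P.obj W ⟶ (kernel q).obj W,
      (kernel.ι q).app W ≫ r = 𝟙 _ := by
  have h : (ShortComplex.mk (kernel.ι q) q (kernel.condition q)).ShortExact :=
    { exact := ShortComplex.exact_kernel q
      mono_f := inferInstanceAs (Mono (kernel.ι q))
      epi_g := inferInstanceAs (Epi q) }
  have h' := h.map_of_exact (PresheafOfModules.evaluation R W)
  have : Projective ((ShortComplex.mk (kernel.ι q) q (kernel.condition q)).map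
    (PresheafOfModules.evaluation R W)).X₃ := hM W
  exact ⟨h'.splittingOfProjective.r, h'.splittingOfProjective.f_r⟩

lemma ObjProj.kernel {P M : PresheafOfModules.{u} R} (q : P ⟶ M) [Epi q]
    (hP : ObjProj P) (hM : ObjProj M) : ObjProj (kernel q) := fun W => by
  obtain ⟨r, hr⟩ := ObjProj.exists_retraction q hM W
  have := hP W
  exact Retract.projective ⟨(Limits.kernel.ι q).app W, r, hr⟩

/-- Presheaves of modules that are injective relatively to kernels of epimorphisms between
objectwise projective presheaves of modules. -/
def RelInj (G : PresheafOfModules.{u} R) : Prop :=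
  ∀ ⦃P M : PresheafOfModules.{u} R⦄ (q : P ⟶ M) [Epi q], ObjProj P → ObjProj M →
    ∀ φ : kernel q ⟶ G, ∃ ψ : P ⟶ G, kernel.ι q ≫ ψ = φ

/-- Over a cover `q` of `K` by free presheaves on representables a lift `ξ` is obtained by choosing
sections. Its restriction to the kernel of `q` lands in `S.X₁` and, by relative injectivity, extends
to some `η` on the cover. After subtracting `η` the lift vanishes on the kernel and descends to `K`.
-/
lemma exists_lift_of_relInj (S : ShortComplex (PresheafOfModules.{u} R)) (hS : S.Exact) [Mono S.f]
    (hG : RelInj S.X₁) {K : PresheafOfModules.{u} R} (hK : ObjProj K) (φ : K ⟶ S.X₃)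
    (hφ : ∀ (W : Cᵒᵖ) (x : K.obj W), ∃ y : S.X₂.obj W, S.g.app W y = φ.app W x) :
    ∃ l : K ⟶ S.X₂, l ≫ S.g = φ := by
  choose y hy using hφ
  let q := K.fromFreeYonedaCoproduct
  let ξ : K.freeYonedaCoproduct ⟶ S.X₂ :=
    Sigma.desc fun m => PresheafOfModules.freeYonedaEquiv.symm (y m.1 m.2)
  have hξ : ξ ≫ S.g = q ≫ φ := by
    refine Sigma.hom_ext _ _ fun m => ?_
    rw [Sigma.ι_desc_assoc, ← Category.assoc, PresheafOfModules.ι_fromFreeYonedaCoproduct]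
    apply PresheafOfModules.freeYonedaEquiv.injective
    rw [PresheafOfModules.freeYonedaEquiv_comp, PresheafOfModules.freeYonedaEquiv_comp,
      Equiv.apply_symm_apply]
    exact (hy _ _).trans (congrArg _ (Equiv.apply_symm_apply _ _).symm)
  have h₀ : (kernel.ι q ≫ ξ) ≫ S.g = 0 := by
    rw [Category.assoc, hξ, ← Category.assoc, kernel.condition, zero_comp]
  obtain ⟨η, hη⟩ := hG q (ObjProj.freeYonedaCoproduct K) hK (hS.lift _ h₀)
  have h₁ : kernel.ι q ≫ (ξ - η ≫ S.f) = 0 := by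
    rw [Preadditive.comp_sub, ← Category.assoc, hη, hS.lift_f, sub_self]
  refine ⟨Abelian.epiDesc q _ h₁, ?_⟩
  rw [← cancel_epi q, ← Category.assoc, Abelian.comp_epiDesc, Preadditive.sub_comp, hξ,
    Category.assoc, S.zero, comp_zero, sub_zero]

end RelInj

/-! ### Modules on a ringed topos: Grothendieck property and local surjectivity. -/

namespace RingedTopos

variable (X : RingedTopos.{u})

/-- The category of presheaves of modules over the structure sheaf. -/
abbrev PMod := PresheafOfModules.{u} X.ring.obj

/-- The inclusion of sheaves in presheaves. -/
abbrev toPMod : X.Mod ⥤ X.PMod := SheafOfModules.forget X.ring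

/-- The associated sheaf functor on presheaves of modules. -/
abbrev sh : X.PMod ⥤ X.Mod := PresheafOfModules.sheafification (𝟙 X.ring.obj)

/-- The adjunction between `sh` and the inclusion. -/
def shAdj : X.sh ⊣ X.toPMod := PresheafOfModules.sheafificationAdjunction (𝟙 X.ring.obj)

instance : AB5OfSize.{u, u} X.PMod where
  ofShape J _ _ := by
    have : HasExactColimitsOfShape J (X.Cᵒᵖ ⥤ AddCommGrpCat.{u}) := inferInstance
    exact HasExactColimitsOfShape.domain_of_functor J (PresheafOfModules.toPresheaf X.ring.obj)

instance : HasSeparator X.Mod where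
  hasSeparator := by
    let S : X.C → X.Mod := fun U => X.sh.obj ((PresheafOfModules.free X.ring.obj).obj (yoneda.obj U))
    have hS : (ObjectProperty.ofObj S).IsSeparating := by
      intro F G f g hfg
      refine X.toPMod.map_injective (PresheafOfModules.freeYoneda.isSeparating _ _ _ ?_)
      rintro _ ⟨U⟩ a
      apply (X.shAdj.homEquiv _ _).symm.injective
      rw [X.shAdj.homEquiv_naturality_right_symm, X.shAdj.homEquiv_naturality_right_symm]
      exact hfg _ (ObjectProperty.ofObj_apply _ U) _
    exact ⟨∐ S, hS.isSeparator_coproduct⟩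

instance : IsGrothendieckAbelian.{u} X.Mod where
  ab5OfSize := ⟨fun J _ _ => X.shAdj.hasExactColimitsOfShape J⟩

/-- Factor `p` as a presheaf epimorphism `e` followed by a presheaf monomorphism `m`. The
sheafification of `m` is mono and epi, hence invertible, and that of `e` is an epimorphism of
abelian sheaves. -/
lemma isLocallySurjective_of_epi {N N' : X.Mod} (p : N ⟶ N') [Epi p] :
    Sheaf.IsLocallySurjective ((SheafOfModules.toSheaf X.ring).map p) := by
  rw [Sheaf.isLocallySurjective_iff_epi' AddCommGrpCat.{u}]
  let e := factorThruImage (X.toPMod.map p)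
  let m := image.ι (X.toPMod.map p)
  have hem : e ≫ m = X.toPMod.map p := image.fac _
  have hp : X.sh.map e ≫ X.sh.map m = X.sh.map (X.toPMod.map p) := by rw [← X.sh.map_comp, hem]
  have hc : X.sh.map (X.toPMod.map p) ≫ X.shAdj.counit.app N' = X.shAdj.counit.app N ≫ p :=
    X.shAdj.counit.naturality p
  have : Epi (X.sh.map e ≫ X.sh.map m) := by
    have : X.sh.map (X.toPMod.map p) = X.shAdj.counit.app N ≫ p ≫ inv (X.shAdj.counit.app N') := by
      rw [← Category.assoc, ← hc, Category.assoc, IsIso.hom_inv_id, Category.comp_id]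
    rw [hp, this]
    infer_instance
  have : Epi (X.sh.map m) := epi_of_epi (X.sh.map e) _
  have : IsIso (X.sh.map m) := isIso_of_mono_of_epi _
  have h : p = inv (X.shAdj.counit.app N) ≫ X.sh.map e ≫ X.sh.map m ≫ X.shAdj.counit.app N' := by
    rw [← Category.assoc (X.sh.map e), hp, hc, IsIso.inv_hom_id_assoc]
  rw [h, Functor.map_comp, Functor.map_comp, Functor.map_comp]
  have : Epi ((SheafOfModules.toSheaf X.ring).map (X.sh.map e)) :=
    inferInstanceAs (Epi ((PresheafOfModules.toPresheaf X.ring.obj ⋙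
      presheafToSheaf X.J AddCommGrpCat.{u}).map e))
  infer_instance

end RingedTopos

/-! ### Sheaves of modules that are acyclic for sections and direct images. -/

namespace RingedTopos

variable {X X' X'' : RingedTopos.{u}}

/-- The identity morphism of a ringed topos. -/
def Hom.id (X : RingedTopos.{u}) : Hom X X :=
  haveI : (𝟭 X.C).IsContinuous X.J X.J := Functor.isContinuous_id _
  { F := 𝟭 X.C
    φ := ⟨𝟙 X.O.obj⟩ }

/-- The direct image of a sheaf of modules as a presheaf of modules. -/
abbrev Hom.pushP (f : Hom X X') : X.Mod ⥤ X'.PMod := f.push ⋙ X'.toPMod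

instance (f : Hom X X') : f.push.IsRightAdjoint := f.adj.isRightAdjoint

instance (f : Hom X X') : PreservesFiniteLimits f.push :=
  have : PreservesLimitsOfSize.{0, 0} f.push := f.adj.rightAdjoint_preservesLimits
  ⟨fun _ _ _ => inferInstance⟩

instance (f : Hom X X') : PreservesFiniteColimits f.pull :=
  have : PreservesColimitsOfSize.{0, 0} f.pull := f.adj.leftAdjoint_preservesColimits
  ⟨fun _ _ _ => inferInstance⟩

/-- Sheaves of modules all of whose direct images are relatively injective as presheaves. -/
def Good (G : X.Mod) : Prop := ∀ ⦃X' : RingedTopos.{u}⦄ (f : Hom X X'), RelInj (f.pushP.obj G)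

lemma Good.push {G : X.Mod} (h : Good G) (f : Hom X X') : Good (f.push.obj G) :=
  fun _ g => h (f.comp g)

lemma Good.relInj {G : X.Mod} (h : Good G) : RelInj (X.toPMod.obj G) := h (Hom.id X)

lemma isSheafFor (N : X.Mod) {U : X.C} (R : Sieve U) (hR : R ∈ X.J U) :
    R.arrows.IsSheafFor (N.val.presheaf ⋙ CategoryTheory.forget _) :=
  (isSheaf_iff_isSheaf_of_type _ _).1
    ((Presheaf.isSheaf_iff_isSheaf_forget X.J _ (CategoryTheory.forget _)).1 N.isSheaf) R hR

/-- A section `s` lifts locally on a covering sieve. It defines a morphism from the free presheaf on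
that sieve, which is objectwise free, and relative injectivity of `S.X₁` lifts this morphism to
`S.X₂`. The lift is a compatible family and glues; in effect a first Čech cohomology group vanishes.
-/
lemma surjective_app_of_good (S : ShortComplex X.Mod) (hS : S.ShortExact) (hG : Good S.X₁)
    (U : X.Cᵒᵖ) : Function.Surjective (S.g.val.app U) := by
  intro s
  have := hS.epi_g
  have := hS.mono_f
  have hloc := X.isLocallySurjective_of_epi S.g
  let R : Sieve U.unop := Presheaf.imageSieve ((PresheafOfModules.toPresheaf _).map S.g.val) s
  have hR : R ∈ X.J U.unop := hloc.imageSieve_mem s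
  let α : R.functor ⟶ S.X₃.val.presheaf ⋙ CategoryTheory.forget _ :=
    { app := fun W => TypeCat.ofHom fun v => S.X₃.val.map v.1.op s
      naturality := fun W W' i => by
        ext v
        exact PresheafOfModules.map_comp_apply S.X₃.val v.1.op i s }
  let φ : PresheafOfModules.freeObj R.functor ⟶ S.X₃.val := PresheafOfModules.freeObjDesc α
  have : Mono (S.map X.toPMod).f := inferInstanceAs (Mono (X.toPMod.map S.f))
  have hφ (W : X.Cᵒᵖ) (v : R.functor.obj W) :
      φ.app W (ModuleCat.freeMk v) = S.X₃.val.map v.1.op s := by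
    exact ModuleCat.freeDesc_apply _ _
  have hex : (S.map X.toPMod).Exact := hS.exact.map_of_mono_of_preservesKernel _ inferInstance inferInstance
  obtain ⟨l, hl⟩ := exists_lift_of_relInj (S.map X.toPMod) hex hG.relInj
    (ObjProj.free R.functor) φ (fun W x => by
      induction x using Finsupp.induction_linear with
      | zero => exact ⟨0, (map_zero _).trans (map_zero _).symm⟩
      | add x y hx hy =>
        obtain ⟨a, ha⟩ := hx
        obtain ⟨b, hb⟩ := hy
        exact ⟨a + b, (map_add _ _ _).trans ((congrArg₂ (· + ·) ha hb).trans (map_add _ _ _).symm)⟩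
      | single v r =>
        obtain ⟨t, ht⟩ := v.2
        let t' : S.X₂.val.obj W := t
        refine ⟨r • t', ((S.g.val.app W).hom.map_smul r t').trans ((congrArg (r • ·) ?_).trans
          (((φ.app W).hom.map_smul r (ModuleCat.freeMk v)).symm.trans
            (congrArg _ (Finsupp.smul_single_one v r))))⟩
        exact ht.trans (hφ W v).symm)
  let t : R.arrows.FamilyOfElements (S.X₂.val.presheaf ⋙ CategoryTheory.forget _) :=
    fun V v hv => l.app (op V) (ModuleCat.freeMk (⟨v, hv⟩ : R.functor.obj (op V)))
  have ht : t.Compatible := by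
    rw [Presieve.compatible_iff_sieveCompatible]
    intro V W v w hv
    refine Eq.trans ?_ (PresheafOfModules.naturality_apply l w.op _)
    refine congrArg (l.app (op W)) ?_
    exact (ModuleCat.freeDesc_apply (R := X.ring.obj.obj (op V))
      (M := (ModuleCat.restrictScalars (X.ring.obj.map w.op).hom).obj
        ((ModuleCat.free (X.ring.obj.obj (op W))).obj (R.functor.obj (op W))))
      (TypeCat.ofHom fun x => ModuleCat.freeMk (R.functor.map w.op x))
      (⟨v, hv⟩ : R.functor.obj (op V))).symm
  obtain ⟨y, hy, -⟩ := isSheafFor S.X₂ R hR t ht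
  refine ⟨y, ?_⟩
  refine (isSheafFor S.X₃ R hR).isSeparatedFor.ext fun V v hv => ?_
  refine (PresheafOfModules.naturality_apply S.g.val v.op y).symm.trans ?_
  refine (congrArg (S.g.val.app (op V)) (hy v hv)).trans ?_
  refine Eq.trans ?_ (hφ (op V) ⟨v, hv⟩)
  exact congrArg (fun z => z.app (op V) (ModuleCat.freeMk (⟨v, hv⟩ : R.functor.obj (op V)))) hl

end RingedTopos

/-! ### Extension of scalars and coinduced presheaves of modules -/

section ExtendScalars

variable {A B : Type u} [Ring A] [Ring B] (ρ : A →+* B)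

/-- Restriction leaves underlying abelian groups unchanged and so preserves limits; the special
adjoint functor theorem applies. Only the universal property of extension of scalars is used below.
-/
instance isRightAdjoint_restrictScalars : (ModuleCat.restrictScalars.{u} ρ).IsRightAdjoint := by
  have : PreservesLimits (ModuleCat.restrictScalars.{u} ρ ⋙ forget₂ (ModuleCat.{u} A) Ab.{u}) :=
    inferInstanceAs (PreservesLimits (forget₂ (ModuleCat.{u} B) Ab.{u}))
  have := preservesLimits_of_reflects_of_preserves (ModuleCat.restrictScalars.{u} ρ)
    (forget₂ (ModuleCat.{u} A) Ab.{u})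
  exact isRightAdjoint_of_preservesLimits_of_isCoseparating
    (isCoseparator_coseparator (ModuleCat.{u} B)) _

/-- Extension of scalars, as a left adjoint of the restriction of scalars. -/
def ext : ModuleCat.{u} A ⥤ ModuleCat.{u} B := (ModuleCat.restrictScalars.{u} ρ).leftAdjoint

/-- The adjunction between extension and restriction of scalars. -/
def extAdj : ext ρ ⊣ ModuleCat.restrictScalars.{u} ρ := Adjunction.ofIsRightAdjoint _

/-- The universal semilinear map. -/
def extUnit {M : ModuleCat.{u} A} (x : M) : (ext ρ).obj M := ((extAdj ρ).unit.app M).hom x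

variable {ρ}

lemma extUnit_smul {M : ModuleCat.{u} A} (a : A) (x : M) :
    extUnit ρ (a • x) = ρ a • extUnit ρ x := ((extAdj ρ).unit.app M).hom.map_smul a x

lemma extUnit_add {M : ModuleCat.{u} A} (x y : M) :
    extUnit ρ (x + y) = extUnit ρ x + extUnit ρ y := ((extAdj ρ).unit.app M).hom.map_add x y

/-- The linear map out of the extension of scalars given by a semilinear map. -/
def extDesc {M : ModuleCat.{u} A} {N : ModuleCat.{u} B} (g : M → N)
    (h : ∀ x y, g (x + y) = g x + g y) (h' : ∀ a x, g (a • x) = ρ a • g x) :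
    (ext ρ).obj M ⟶ N :=
  ((extAdj ρ).homEquiv M N).symm (ModuleCat.ofHom
    (Y := (ModuleCat.restrictScalars.{u} ρ).obj N) ⟨⟨g, h⟩, h'⟩)

@[simp]
lemma extDesc_unit {M : ModuleCat.{u} A} {N : ModuleCat.{u} B} (g : M → N)
    (h : ∀ x y, g (x + y) = g x + g y) (h' : ∀ a x, g (a • x) = ρ a • g x) (x : M) :
    (extDesc g h h').hom (extUnit ρ x) = g x := by
  have := ((extAdj ρ).homEquiv M N).apply_symm_apply (ModuleCat.ofHom
    (Y := (ModuleCat.restrictScalars.{u} ρ).obj N) ⟨⟨g, h⟩, h'⟩)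
  rw [Adjunction.homEquiv_unit] at this
  exact congrArg (fun z => z.hom x) this

lemma ext_hom_ext {M : ModuleCat.{u} A} {N : ModuleCat.{u} B} {f g : (ext ρ).obj M ⟶ N}
    (h : ∀ x, f.hom (extUnit ρ x) = g.hom (extUnit ρ x)) : f = g := by
  apply ((extAdj ρ).homEquiv M N).injective
  rw [Adjunction.homEquiv_unit, Adjunction.homEquiv_unit]
  exact ModuleCat.hom_ext (LinearMap.ext h)

lemma ext_map_unit {M M' : ModuleCat.{u} A} (f : M ⟶ M') (x : M) :
    ((ext ρ).map f).hom (extUnit ρ x) = extUnit ρ (f.hom x) :=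
  congrArg (fun z => z.hom x) ((extAdj ρ).unit.naturality f).symm

end ExtendScalars

section Coind

variable {C : Type u} [SmallCategory C] {R : Cᵒᵖ ⥤ RingCat.{u}}

/-- The presheaf of modules coinduced by a family of modules. -/
def coind (E : ∀ V, ModuleCat.{u} (R.obj V)) : PresheafOfModules.{u} R where
  obj U := ModuleCat.of (R.obj U)
    (∀ (V : Cᵒᵖ) (v : U ⟶ V), (ModuleCat.restrictScalars (R.map v).hom).obj (E V))
  map {U U'} i := ModuleCat.ofHom (Y := (ModuleCat.restrictScalars (R.map i).hom).obj (ModuleCat.of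
      (R.obj U') (∀ (V : Cᵒᵖ) (v : U' ⟶ V), (ModuleCat.restrictScalars (R.map v).hom).obj (E V))))
    { toFun := fun φ V v => (φ V (i ≫ v) : E V)
      map_add' := fun _ _ => rfl
      map_smul' := fun r φ => by
        funext V v
        change (R.map (i ≫ v)).hom r • (φ V (i ≫ v) : E V) =
          (R.map v).hom ((R.map i).hom r) • (φ V (i ≫ v) : E V)
        rw [R.map_comp]
        rfl }
  map_id U := by
    refine ModuleCat.hom_ext (LinearMap.ext fun φ => ?_)
    funext V v
    change (φ V (𝟙 U ≫ v) : E V) = φ V v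
    rw [Category.id_comp]
  map_comp i j := by
    refine ModuleCat.hom_ext (LinearMap.ext fun φ => ?_)
    funext V v
    change (φ V ((i ≫ j) ≫ v) : E V) = φ V (i ≫ j ≫ v)
    rw [Category.assoc]

/-- A presheaf of modules embeds in a coinduced one. -/
lemma exists_mono_coind (N : PresheafOfModules.{u} R) : ∃ (E : ∀ V, ModuleCat.{u} (R.obj V))
    (_ : ∀ V, Injective (E V)) (j : N ⟶ coind E), Mono j := by
  let E (V : Cᵒᵖ) : ModuleCat.{u} (R.obj V) := Injective.under (N.obj V)
  let ι (V : Cᵒᵖ) : N.obj V ⟶ E V := Injective.ι (N.obj V)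
  let j : N ⟶ coind E :=
    { app := fun U => ModuleCat.ofHom (Y := (coind E).obj U)
        { toFun := fun x V v => (ι V).hom ((N.map v).hom x)
          map_add' := fun x y => by
            funext V v
            exact (congrArg (ι V).hom (map_add (N.map v).hom x y)).trans (map_add (ι V).hom _ _)
          map_smul' := fun r x => by
            funext V v
            refine (congrArg (ι V).hom (N.map_smul v r x)).trans ?_
            exact (ι V).hom.map_smul _ _ }
      naturality := fun {U U'} i => by
        refine ModuleCat.hom_ext (LinearMap.ext fun x => ?_)
        funext V v
        exact congrArg (ι V).hom (N.map_comp_apply i v x).symm }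
  refine ⟨E, fun V => inferInstance, j, PresheafOfModules.mono_of_injective fun U x y h => ?_⟩
  have h' : (ι U).hom ((N.map (𝟙 U)).hom x) = (ι U).hom ((N.map (𝟙 U)).hom y) :=
    congrFun (congrFun h U) (𝟙 U)
  have h'' := (ModuleCat.mono_iff_injective (ι U)).1 inferInstance h'
  have e (z : N.obj U) : (N.map (𝟙 U)).hom z = z := by
    rw [N.map_id]; rfl
  rwa [e, e] at h''

end Coind

/-! ### Stalks of inverse images as filtered colimits of extensions of scalars. -/

section Extension

variable {C D : Type u} [SmallCategory C] [SmallCategory D] {R : Cᵒᵖ ⥤ RingCat.{u}}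
  {S : Dᵒᵖ ⥤ RingCat.{u}} {F : D ⥤ C} (ψ : S ⟶ F.op ⋙ R) (V : C)

/-- The ring morphisms to the stalk at the tip of a cone. -/
abbrev stalkRing (d : (StructuredArrow V F)ᵒᵖ) :
    S.obj (op d.unop.right) →+* R.obj (op V) :=
  (R.map d.unop.hom.op).hom.comp (ψ.app (op d.unop.right)).hom

lemma stalkRing_map {d d' : (StructuredArrow V F)ᵒᵖ} (i : d ⟶ d') (r : S.obj (op d.unop.right)) :
    stalkRing ψ V d' ((S.map i.unop.right.op).hom r) = stalkRing ψ V d r := by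
  have h₁ := ConcreteCategory.congr_hom (ψ.naturality i.unop.right.op) r
  have h₂ : R.map (F.map i.unop.right).op ≫ R.map d'.unop.hom.op = R.map d.unop.hom.op := by
    rw [← R.map_comp, ← op_comp, StructuredArrow.w]
  refine (congrArg (R.map d'.unop.hom.op).hom h₁).trans ?_
  exact ConcreteCategory.congr_hom h₂ ((ψ.app (op d.unop.right)).hom r)

/-- The diagram of extensions of scalars whose colimit is a stalk of the inverse image. -/
def stalkDiagram (P : PresheafOfModules.{u} S) :
    (StructuredArrow V F)ᵒᵖ ⥤ ModuleCat.{u} (R.obj (op V)) where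
  obj d := (ext (stalkRing ψ V d)).obj (P.obj (op d.unop.right))
  map {d d'} i := extDesc (fun x => extUnit (stalkRing ψ V d') ((P.map i.unop.right.op).hom x))
    (fun x y => (congrArg _ (map_add (P.map i.unop.right.op).hom x y)).trans (extUnit_add _ _))
    (fun a x => by
      refine (congrArg _ (P.map_smul i.unop.right.op a x)).trans ((extUnit_smul _ _).trans ?_)
      rw [stalkRing_map])
  map_id d := ext_hom_ext fun x => by
    rw [extDesc_unit]
    exact congrArg _ ((congrArg (fun z => z.hom x) (P.map_id (op d.unop.right))).trans rfl)
  map_comp {d d' d''} i j := ext_hom_ext fun x => by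
    rw [extDesc_unit, ModuleCat.hom_comp, LinearMap.comp_apply, extDesc_unit]
    refine Eq.trans ?_ (extDesc_unit _ _ _ _).symm
    exact congrArg (extUnit (stalkRing ψ V d''))
      (P.map_comp_apply i.unop.right.op j.unop.right.op x)

/-- The morphism of diagrams given by a morphism of presheaves of modules. -/
def stalkDiagramMap {P Q : PresheafOfModules.{u} S} (f : P ⟶ Q) :
    stalkDiagram ψ V P ⟶ stalkDiagram ψ V Q where
  app d := (ext (stalkRing ψ V d)).map (f.app (op d.unop.right))
  naturality d d' i := ext_hom_ext fun x => by
    refine (congrArg ((ext (stalkRing ψ V d')).map (f.app (op d'.unop.right))).hom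
      (extDesc_unit _ _ _ x)).trans ((ext_map_unit _ _).trans (Eq.trans ?_ (congrArg
        ((stalkDiagram ψ V Q).map i).hom (ext_map_unit (f.app (op d.unop.right)) x)).symm))
    refine Eq.trans ?_ (extDesc_unit _ _ _ _).symm
    exact congrArg (extUnit (stalkRing ψ V d'))
      (PresheafOfModules.naturality_apply f i.unop.right.op x)

/-- Objectwise split monomorphisms stay split after extension of scalars, and a filtered colimit of
monomorphisms is a monomorphism. So the morphism on colimits extends to the injective module `E`. -/
lemma exists_extension_stalk {K P : PresheafOfModules.{u} S} (ι : K ⟶ P)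
    [IsFiltered (StructuredArrow V F)ᵒᵖ]
    (hι : ∀ W, ∃ r : P.obj W ⟶ K.obj W, ι.app W ≫ r = 𝟙 _) (E : ModuleCat.{u} (R.obj (op V)))
    [Injective E] (c : Cocone (stalkDiagram ψ V K)) (e : c.pt ⟶ E) :
    ∃ c' : stalkDiagram ψ V P ⟶ (Functor.const _).obj E,
      stalkDiagramMap ψ V ι ≫ c' = c.ι ≫ (Functor.const _).map e := by
  have (d : (StructuredArrow V F)ᵒᵖ) : Mono ((stalkDiagramMap ψ V ι).app d) := by
    obtain ⟨r, hr⟩ := hι (op d.unop.right)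
    have : (stalkDiagramMap ψ V ι).app d ≫ (ext (stalkRing ψ V d)).map r = 𝟙 _ :=
      ((ext (stalkRing ψ V d)).map_comp _ _).symm.trans
        ((congrArg _ hr).trans ((ext (stalkRing ψ V d)).map_id _))
    have : Mono ((stalkDiagramMap ψ V ι).app d ≫ (ext (stalkRing ψ V d)).map r) := by
      refine ⟨fun a b h => ?_⟩
      exact (Category.comp_id a).symm.trans ((congrArg (a ≫ ·) this).symm.trans
        (h.trans ((congrArg (b ≫ ·) this).trans (Category.comp_id b))))
    exact mono_of_mono ((stalkDiagramMap ψ V ι).app d) ((ext (stalkRing ψ V d)).map r)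
  have : Mono (stalkDiagramMap ψ V ι) := NatTrans.mono_of_mono_app _
  have : Mono (colim.map (stalkDiagramMap ψ V ι)) := inferInstance
  let g : colimit (stalkDiagram ψ V K) ⟶ E := colimit.desc _ c ≫ e
  refine ⟨(colimit.cocone (stalkDiagram ψ V P)).ι ≫ (Functor.const _).map
    (Injective.factorThru g (colim.map (stalkDiagramMap ψ V ι))), ?_⟩
  ext1
  ext1 d
  have h := Injective.comp_factorThru g (colim.map (stalkDiagramMap ψ V ι))
  have h₁ : (stalkDiagramMap ψ V ι).app d ≫ colimit.ι (stalkDiagram ψ V P) d =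
      colimit.ι (stalkDiagram ψ V K) d ≫ colim.map (stalkDiagramMap ψ V ι) :=
    (colimit.ι_map (stalkDiagramMap ψ V ι) d).symm
  have h₂ : colimit.ι (stalkDiagram ψ V K) d ≫ g = c.ι.app d ≫ e := by
    dsimp only [g]
    rw [← Category.assoc, colimit.ι_desc]
  change (stalkDiagramMap ψ V ι).app d ≫ colimit.ι (stalkDiagram ψ V P) d ≫ _ = c.ι.app d ≫ e
  rw [← Category.assoc, h₁, Category.assoc]
  exact (congrArg (colimit.ι (stalkDiagram ψ V K) d ≫ ·) h).trans h₂

end Extension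

section Coind

variable {C D : Type u} [SmallCategory C] [SmallCategory D] {R : Cᵒᵖ ⥤ RingCat.{u}}
  {S : Dᵒᵖ ⥤ RingCat.{u}} {F : D ⥤ C} (ψ : S ⟶ F.op ⋙ R)

lemma stalkDiagram_map_unit (V : C) (P : PresheafOfModules.{u} S)
    {d d' : (StructuredArrow V F)ᵒᵖ} (i : d ⟶ d') (x : P.obj (op d.unop.right)) :
    ((stalkDiagram ψ V P).map i).hom (extUnit (stalkRing ψ V d) x) =
      extUnit (stalkRing ψ V d') ((P.map i.unop.right.op).hom x) :=
  extDesc_unit _ _ _ _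

/-- The components of `stalkCocone`. -/
def stalkCoconeApp {K : PresheafOfModules.{u} S} (E : ∀ V, ModuleCat.{u} (R.obj V))
    (φ : K ⟶ (PresheafOfModules.pushforward ψ).obj (coind E)) (V : C)
    (d : (StructuredArrow V F)ᵒᵖ) : (stalkDiagram ψ V K).obj d ⟶ E (op V) :=
  extDesc (fun x => ((φ.app (op d.unop.right)).hom x :) (op V) d.unop.hom.op)
    (fun x y => congrFun (congrFun (map_add (φ.app (op d.unop.right)).hom x y) (op V)) _)
    (fun a x => congrFun (congrFun ((φ.app (op d.unop.right)).hom.map_smul a x) (op V)) _)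

lemma stalkCoconeApp_unit {K : PresheafOfModules.{u} S} (E : ∀ V, ModuleCat.{u} (R.obj V))
    (φ : K ⟶ (PresheafOfModules.pushforward ψ).obj (coind E)) (V : C)
    (d : (StructuredArrow V F)ᵒᵖ) (x : K.obj (op d.unop.right)) :
    (stalkCoconeApp ψ E φ V d).hom (extUnit (stalkRing ψ V d) x) =
      ((φ.app (op d.unop.right)).hom x :) (op V) d.unop.hom.op :=
  extDesc_unit _ _ _ _

/-- The cocone on the stalk diagram given by a morphism to the direct image of a coinduced
presheaf of modules. -/
def stalkCocone {K : PresheafOfModules.{u} S} (E : ∀ V, ModuleCat.{u} (R.obj V))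
    (φ : K ⟶ (PresheafOfModules.pushforward ψ).obj (coind E)) (V : C) :
    Cocone (stalkDiagram ψ V K) where
  pt := E (op V)
  ι :=
    { app := stalkCoconeApp ψ E φ V
      naturality := fun d d' i => ext_hom_ext fun x => by
        refine (congrArg (stalkCoconeApp ψ E φ V d').hom
          (stalkDiagram_map_unit ψ V K i x)).trans ?_
        refine (stalkCoconeApp_unit ψ E φ V d' _).trans
          (Eq.trans ?_ (stalkCoconeApp_unit ψ E φ V d x).symm)
        have h := congrFun (congrFun (PresheafOfModules.naturality_apply φ i.unop.right.op x)
          (op V)) d'.unop.hom.op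
        refine h.trans ?_
        have e : F.op.map i.unop.right.op ≫ d'.unop.hom.op = d.unop.hom.op :=
          Quiver.Hom.unop_inj (StructuredArrow.w i.unop)
        exact congrArg (((φ.app (op d.unop.right)).hom x :) (op V)) e }

/-- A morphism into the direct image of a coinduced presheaf amounts to a cocone with vertex `E V`
on the stalk diagram for each `V`, and these can be extended separately. Kernels of epimorphisms
onto objectwise projective presheaves are objectwise split, which is what `exists_extension_stalk`
needs. -/
lemma relInj_pushforward_coind [HasFiniteLimits D] [PreservesFiniteLimits F]
    (E : ∀ V, ModuleCat.{u} (R.obj V)) [∀ V, Injective (E V)] :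
    RelInj ((PresheafOfModules.pushforward ψ).obj (coind E)) := by
  intro P M q _ hP hM φ
  -- Preservation of finite limits makes the categories of structured arrows cofiltered, so the
  -- stalk diagrams are filtered.
  have := flat_of_preservesFiniteLimits F
  have (V : C) := exists_extension_stalk ψ V (kernel.ι q) (hM.exists_retraction q) (E (op V))
    (stalkCocone ψ E φ V) (𝟙 _)
  choose c hc using this
  let κ (W : Dᵒᵖ) (x : P.obj W) (V : Cᵒᵖ) (v : op (F.obj W.unop) ⟶ V) : E V :=
    ((c V.unop).app (op (StructuredArrow.mk (Y := W.unop) v.unop))).hom (extUnit (stalkRing ψ V.unop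
      (op (StructuredArrow.mk (Y := W.unop) v.unop))) x)
  refine ⟨
    { app := fun W => ModuleCat.ofHom (Y := ((PresheafOfModules.pushforward ψ).obj (coind E)).obj W)
        { toFun := fun x V v => κ W x V v
          map_add' := fun x y => by
            funext V v
            exact (congrArg (ModuleCat.Hom.hom _) (extUnit_add _ _)).trans (map_add _ _ _)
          map_smul' := fun a x => by
            funext V v
            exact (congrArg (ModuleCat.Hom.hom _) (extUnit_smul _ _)).trans
              (LinearMap.map_smul _ _ _) }
      naturality := fun {W W'} i => by
        refine ModuleCat.hom_ext (LinearMap.ext fun x => ?_)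
        funext V v
        let d : StructuredArrow V.unop F := StructuredArrow.mk (Y := W.unop) (v.unop ≫ F.map i.unop)
        let d' : StructuredArrow V.unop F := StructuredArrow.mk (Y := W'.unop) v.unop
        let j : d' ⟶ d := StructuredArrow.homMk i.unop rfl
        have h := congrArg (fun z => z.hom (extUnit (stalkRing ψ V.unop (op d)) x))
          ((c V.unop).naturality j.op)
        refine Eq.trans ?_ (h.trans ?_)
        · exact congrArg ((c V.unop).app (op d')).hom (stalkDiagram_map_unit ψ V.unop P j.op x).symm
        · rfl }, ?_⟩
  refine PresheafOfModules.hom_ext fun W => ModuleCat.hom_ext (LinearMap.ext fun x => ?_)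
  funext V v
  have h := congrArg (fun z => (z.app (op (StructuredArrow.mk (Y := W.unop) v.unop))).hom
    (extUnit (stalkRing ψ V.unop (op (StructuredArrow.mk (Y := W.unop) v.unop))) x)) (hc V.unop)
  refine Eq.trans ?_ (h.trans (extDesc_unit _ _ _ _))
  exact congrArg ((c V.unop).app (op (StructuredArrow.mk (Y := W.unop) v.unop))).hom
    (ext_map_unit _ _).symm

end Coind

lemma RelInj.of_retract {C : Type u} [SmallCategory C] {R : Cᵒᵖ ⥤ RingCat.{u}}
    {G G' : PresheafOfModules.{u} R} (i : G ⟶ G') (r : G' ⟶ G) (hir : i ≫ r = 𝟙 G)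
    (h : RelInj G') : RelInj G :=
  fun P M q _ hP hM φ => by
    obtain ⟨ψ, hψ⟩ := h q hP hM (φ ≫ i)
    exact ⟨ψ ≫ r, by rw [← Category.assoc, hψ, Category.assoc, hir, Category.comp_id]⟩

namespace RingedTopos

variable {X X' X'' : RingedTopos.{u}}

instance : PreservesFiniteLimits X.sh :=
  inferInstanceAs (PreservesFiniteLimits (PresheafOfModules.sheafification (𝟙 X.ring.obj)))

/-- An injective sheaf is injective as a presheaf because sheafification is exact. It is therefore a
retract of a coinduced presheaf, and this is preserved by direct images. -/
lemma good_of_injective (I : X.Mod) [Injective I] : Good I := by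
  intro X' f
  have : Injective (X.toPMod.obj I) := Injective.injective_of_adjoint X.shAdj I
  obtain ⟨E, hE, j, hj⟩ := exists_mono_coind (X.toPMod.obj I)
  let r : coind E ⟶ X.toPMod.obj I := Injective.factorThru (𝟙 _) j
  have hr : j ≫ r = 𝟙 _ := Injective.comp_factorThru _ _
  let Φ := PresheafOfModules.pushforward.{u} (F := f.F) (R := X.ring.obj) f.ringMap.hom
  have h := relInj_pushforward_coind (F := f.F) (R := X.ring.obj) f.ringMap.hom E
  exact RelInj.of_retract (G' := Φ.obj (coind E)) (Φ.map j) (Φ.map r)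
    ((Φ.map_comp j r).symm.trans ((congrArg Φ.map hr).trans (Φ.map_id _))) h

/-- The kernel of `q` is again objectwise projective and the sequence stays surjective on sections,
so `φ` lifts to the direct image of `S.X₂`. There it extends to `P`, and the extension is composed
with the map to `S.X₃`. -/
lemma Good.of_shortExact {S : ShortComplex X.Mod} (hS : S.ShortExact) (h₁ : Good S.X₁)
    (h₂ : Good S.X₂) : Good S.X₃ := by
  intro X' f P M q _ hP hM φ
  have := hS.mono_f
  have hex : (S.map f.pushP).Exact :=
    hS.exact.map_of_mono_of_preservesKernel _ inferInstance inferInstance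
  have : Mono (S.map f.pushP).f := inferInstanceAs (Mono (f.pushP.map S.f))
  obtain ⟨l, hl⟩ := exists_lift_of_relInj (S.map f.pushP) hex (h₁ f) (hP.kernel q hM) φ
    fun W x => surjective_app_of_good S hS h₁ (op (f.F.obj W.unop)) _
  obtain ⟨ξ, hξ⟩ := h₂ f q hP hM l
  exact ⟨ξ ≫ f.pushP.map S.g, by rw [← Category.assoc, hξ]; exact hl⟩

end RingedTopos

/-! ### Flat objects relative to a class of acyclic objects -/

section Flat

variable {𝒜 : Type u} [Category.{v} 𝒜] [Abelian 𝒜]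

/-- A class of objects that contains the injective objects and is closed under cokernels of
monomorphisms. -/
structure IsRightClass (G : ObjectProperty 𝒜) : Prop where
  injective : ∀ (I : 𝒜) [Injective I], G I
  shortExact : ∀ (S : ShortComplex 𝒜), S.ShortExact → G S.X₁ → G S.X₂ → G S.X₃

/-- The objects from which morphisms lift along epimorphisms with kernel in `G`. -/
def flat (G : ObjectProperty 𝒜) : ObjectProperty 𝒜 := fun M =>
  ∀ (S : ShortComplex 𝒜), S.ShortExact → G S.X₁ → ∀ φ : M ⟶ S.X₃, ∃ ψ : M ⟶ S.X₂, ψ ≫ S.g = φ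

variable {G : ObjectProperty 𝒜}

lemma flat_sigma {ι : Type w} (M : ι → 𝒜) [HasCoproduct M] (h : ∀ i, flat G (M i)) :
    flat G (∐ M) := fun S hS hG φ => by
  choose ψ hψ using fun i => h i S hS hG (Sigma.ι M i ≫ φ)
  exact ⟨Sigma.desc ψ, Sigma.hom_ext _ _ fun i => by simp [hψ]⟩

lemma flat_of_retract {M M' : 𝒜} (i : M ⟶ M') (r : M' ⟶ M) (hir : i ≫ r = 𝟙 M) (h : flat G M') :
    flat G M := fun S hS hG φ => by
  obtain ⟨ψ, hψ⟩ := h S hS hG (r ≫ φ)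
  exact ⟨i ≫ ψ, by rw [Category.assoc, hψ, ← Category.assoc, hir, Category.id_comp]⟩

lemma shortExact_of_mono {A B : 𝒜} (i : A ⟶ B) [Mono i] :
    (ShortComplex.mk i (cokernel.π i) (cokernel.condition i)).ShortExact :=
  { exact := ShortComplex.exact_cokernel i
    mono_f := inferInstanceAs (Mono i)
    epi_g := inferInstanceAs (Epi (cokernel.π i)) }

variable [EnoughInjectives 𝒜]

/-- Flatness of `S.X₃` means that its extensions by objects of `G` split. Extend `φ` into an
injective hull object of `A`; the obstruction to landing in `A` is a morphism from `S.X₃` to the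
cokernel, and flatness lifts it so that it can be subtracted. -/
lemma exists_extension_of_flat {S : ShortComplex 𝒜} (hS : S.ShortExact)
    (hM : flat G S.X₃) {A : 𝒜} (hA : G A) (φ : S.X₁ ⟶ A) : ∃ ψ : S.X₂ ⟶ A, S.f ≫ ψ = φ := by
  have := hS.mono_f
  have := hS.epi_g
  let ι := Injective.ι A
  let α := Injective.factorThru (φ ≫ ι) S.f
  have hα : S.f ≫ α = φ ≫ ι := Injective.comp_factorThru _ _
  have hαπ : S.f ≫ α ≫ cokernel.π ι = 0 := by
    rw [← Category.assoc, hα, Category.assoc, cokernel.condition, comp_zero]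
  obtain ⟨γ, hγ⟩ := hM _ (shortExact_of_mono ι) hA (hS.exact.desc (α ≫ cokernel.π ι) hαπ)
  dsimp at γ hγ
  have h : (α - S.g ≫ γ) ≫ cokernel.π ι = 0 := by
    rw [Preadditive.sub_comp, Category.assoc, hγ, hS.exact.g_desc, sub_self]
  refine ⟨Abelian.monoLift ι _ h, (cancel_mono ι).1 ?_⟩
  rw [Category.assoc, Abelian.monoLift_comp, Preadditive.comp_sub, hα, ← Category.assoc S.f, S.zero,
    zero_comp, sub_zero]

/-- This is dimension shifting. With `T.X₂` inside an injective `I`, the object `T.X₃` embeds in `I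
/ T.X₁`, which is in `G`. The morphism `φ` into it extends to `S.X₂`, lifts to `I` by flatness of
`S.X₂`, and on `S.X₁` the lift takes values in `T.X₂`. -/
lemma IsRightClass.flat_of_shortExact (hG : IsRightClass G) {S : ShortComplex 𝒜}
    (hS : S.ShortExact) (h₂ : flat G S.X₂) (h₃ : flat G S.X₃) : flat G S.X₁ := by
  intro T hT hA φ
  have := hT.mono_f
  have := hT.epi_g
  let ι := Injective.ι T.X₂
  have hU := shortExact_of_mono (T.f ≫ ι)
  let π := cokernel.π (T.f ≫ ι)
  have hπ : T.f ≫ ι ≫ π = 0 := by rw [← Category.assoc]; exact cokernel.condition _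
  let m : T.X₃ ⟶ cokernel (T.f ≫ ι) := hT.exact.desc (ι ≫ π) hπ
  have hm : T.g ≫ m = ι ≫ π := hT.exact.g_desc _ _
  have : Mono m := Preadditive.mono_of_cancel_zero _ fun {A} x hx => by
    obtain ⟨A', p, _, y, hy⟩ := surjective_up_to_refinements_of_epi T.g x
    have h₁ : (y ≫ ι) ≫ cokernel.π (T.f ≫ ι) = 0 := by
      rw [Category.assoc]
      change y ≫ ι ≫ π = 0
      rw [← hm, ← Category.assoc, ← hy, Category.assoc, hx, comp_zero]
    have h₂ : y = Abelian.monoLift _ _ h₁ ≫ T.f := by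
      rw [← cancel_mono ι, Category.assoc, Abelian.monoLift_comp]
    rw [← cancel_epi p, hy, h₂, Category.assoc, T.zero, comp_zero, comp_zero]
  obtain ⟨ξ, hξ⟩ := exists_extension_of_flat hS h₃
    (hG.shortExact _ hU hA (hG.injective (Injective.under T.X₂))) (φ ≫ m)
  obtain ⟨χ, hχ⟩ := h₂ _ hU hA ξ
  change χ ≫ π = ξ at hχ
  have hd : (T.f ≫ ι) ≫ cokernel.π ι = 0 := by
    rw [Category.assoc, cokernel.condition, comp_zero]
  let d := cokernel.desc (T.f ≫ ι) (cokernel.π ι) hd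
  have hπd : π ≫ d = cokernel.π ι := cokernel.π_desc _ _ _
  have hmd : m ≫ d = 0 := by
    rw [← cancel_epi T.g, ← Category.assoc, hm, Category.assoc, hπd, cokernel.condition, comp_zero]
  have h : (S.f ≫ χ) ≫ cokernel.π ι = 0 := by
    rw [← hπd, Category.assoc, ← Category.assoc χ, hχ, ← Category.assoc, hξ, Category.assoc, hmd,
      comp_zero]
  refine ⟨Abelian.monoLift ι _ h, (cancel_mono m).1 ?_⟩
  rw [Category.assoc, hm, ← Category.assoc, Abelian.monoLift_comp, Category.assoc, hχ, hξ]

end Flat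

/-! ### Left adjoints and flat objects. -/

section Functor

variable {𝒜 : Type u} [Category.{v} 𝒜] [Abelian 𝒜] {ℬ : Type u₁} [Category.{v₁} ℬ] [Abelian ℬ]

/-- A class of objects that is closed under small coproducts and retracts and has enough
objects. -/
structure IsFlatClass (P : ObjectProperty 𝒜) : Prop where
  sigma : ∀ {ι : Type} (M : ι → 𝒜) [HasCoproduct M], (∀ i, P (M i)) → P (∐ M)
  retract : ∀ {M M' : 𝒜} (i : M ⟶ M') (r : M' ⟶ M), i ≫ r = 𝟙 M → P M' → P M
  enough : ∀ M : 𝒜, ∃ (M' : 𝒜) (p : M' ⟶ M), P M' ∧ Epi p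

/-- A functor that preserves flat objects and the exactness of bounded above complexes of
flat objects. -/
structure IsFlatFunctor (L : 𝒜 ⥤ ℬ) [L.PreservesZeroMorphisms] (P : ObjectProperty 𝒜)
    (P' : ObjectProperty ℬ) : Prop where
  obj : ∀ M, P M → P' (L.obj M)
  acyclic : ∀ (K : CochainComplex 𝒜 ℤ), (∃ N : ℤ, ∀ q > N, IsZero (K.X q)) → (∀ q, P (K.X q)) →
    K.Acyclic → ((L.mapHomologicalComplex _).obj K).Acyclic

variable {G : ObjectProperty 𝒜} {G' : ObjectProperty ℬ}

section

variable {L : 𝒜 ⥤ ℬ} {R : ℬ ⥤ 𝒜} (adj : L ⊣ R)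
  (hR : ∀ S : ShortComplex ℬ, S.ShortExact → G' S.X₁ → G (R.obj S.X₁) ∧ Epi (R.map S.g))

include adj hR

lemma flat_leftAdjoint [R.PreservesZeroMorphisms] [PreservesFiniteLimits R] {M : 𝒜} (hM : flat G M) :
    flat G' (L.obj M) := by
  intro S hS hG φ
  have := hS.mono_f
  have h : (S.map R).ShortExact :=
    { exact := hS.exact.map_of_mono_of_preservesKernel _ inferInstance inferInstance
      mono_f := inferInstanceAs (Mono (R.map S.f))
      epi_g := (hR S hS hG).2 }
  obtain ⟨ψ, hψ⟩ := hM _ h (hR S hS hG).1 (adj.homEquiv _ _ φ)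
  exact ⟨(adj.homEquiv _ _).symm ψ, (adj.homEquiv_naturality_right_symm ψ S.g).symm.trans
    ((Equiv.symm_apply_eq _).2 hψ)⟩

/-- Only injectivity of `L.map S.f` is at stake. An embedding of `L.obj S.X₁` in an injective
corresponds to a morphism to an object of `G`, which extends to `S.X₂` by flatness of `S.X₃`; its
transpose extends the embedding. -/
lemma shortExact_map_leftAdjoint [L.PreservesZeroMorphisms] [PreservesFiniteColimits L]
    [EnoughInjectives 𝒜] [EnoughInjectives ℬ]
    (hG' : IsRightClass G') {S : ShortComplex 𝒜} (hS : S.ShortExact)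
    (hM : flat G S.X₃) : (S.map L).ShortExact := by
  have := hS.epi_g
  refine
    { exact := hS.exact.map_of_epi_of_preservesCokernel _ inferInstance inferInstance
      mono_f := ?_
      epi_g := inferInstanceAs (Epi (L.map S.g)) }
  let ι := Injective.ι (L.obj S.X₁)
  -- The hypothesis on `R` speaks of short exact sequences; the identity of the injective object
  -- with its zero cokernel gives the statement for a single object.
  have h := (hR _ (shortExact_of_mono (𝟙 (Injective.under (L.obj S.X₁))))
    (hG'.injective (Injective.under (L.obj S.X₁)))).1
  obtain ⟨ψ, hψ⟩ := exists_extension_of_flat hS hM h (adj.homEquiv _ _ ι)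
  have : L.map S.f ≫ (adj.homEquiv _ _).symm ψ = ι := by
    rw [← adj.homEquiv_naturality_left_symm, Equiv.symm_apply_eq]
    exact hψ
  have : Mono (L.map S.f ≫ (adj.homEquiv _ _).symm ψ) := by rw [this]; infer_instance
  exact mono_of_mono (L.map S.f) ((adj.homEquiv _ _).symm ψ)

end

lemma exact_of_shortExact {A B C D E : 𝒜} (p : A ⟶ B) [Epi p] (i : B ⟶ C) (q : C ⟶ D)
    (j : D ⟶ E) [Mono j] (w : i ≫ q = 0) (h : (ShortComplex.mk i q w).Exact) (f : A ⟶ C)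
    (g : C ⟶ E) (hf : p ≫ i = f) (hg : q ≫ j = g) (w' : f ≫ g = 0) :
    (ShortComplex.mk f g w').Exact := by
  subst hf hg
  have w'' : (p ≫ i) ≫ q = 0 := by rw [Category.assoc, w, comp_zero]
  let S := ShortComplex.mk (p ≫ i) q w''
  have hS : S.Exact := (ShortComplex.exact_iff_of_epi_of_isIso_of_mono
    (show S ⟶ ShortComplex.mk i q w from
      { τ₁ := p, τ₂ := 𝟙 _, τ₃ := 𝟙 _, comm₁₂ := by simp [S], comm₂₃ := by simp [S] })).2 h
  exact (ShortComplex.exact_iff_of_epi_of_isIso_of_mono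
    (show S ⟶ ShortComplex.mk (p ≫ i) (q ≫ j) w' from
      { τ₁ := 𝟙 _, τ₂ := 𝟙 _, τ₃ := j, comm₁₂ := by simp [S], comm₂₃ := by simp [S] })).1 hS

lemma shortExact_cycles (K : CochainComplex 𝒜 ℤ) (hK : K.Acyclic) (q : ℤ) :
    (ShortComplex.mk (K.iCycles q) (K.toCycles q (q + 1)) (by
      rw [← cancel_mono (K.iCycles (q + 1)), Category.assoc, K.toCycles_i, K.iCycles_d,
        zero_comp])).ShortExact := by
  have := (K.exactAt_iff_isZero_homology (q + 1)).1 (hK (q + 1))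
  have hπ : Epi (K.toCycles q (q + 1)) :=
    Preadditive.epi_of_isZero_cokernel' _ (K.homologyIsCokernel q (q + 1) (by simp)) this
  refine { exact := ?_, mono_f := inferInstanceAs (Mono (K.iCycles q)), epi_g := hπ }
  refine ShortComplex.exact_of_f_is_kernel _ ?_
  refine KernelFork.IsLimit.ofι' _ _ fun {A} x hx => ⟨K.liftCycles x (q + 1) (by simp) (by
    rw [← K.toCycles_i, ← Category.assoc]; dsimp at hx; rw [hx, zero_comp]), K.liftCycles_i _ _ _ _⟩

variable [EnoughInjectives 𝒜] [EnoughInjectives ℬ]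

/-- Descending induction from the degrees where `K` vanishes: the cycles in degree `q` are the
kernel of an epimorphism from the flat object `K.X q` to the cycles in degree `q + 1`. -/
lemma flat_cycles (hG : IsRightClass G) (K : CochainComplex 𝒜 ℤ)
    (hN : ∃ N : ℤ, ∀ q > N, IsZero (K.X q)) (hP : ∀ q, flat G (K.X q)) (hK : K.Acyclic) (q : ℤ) :
    flat G (K.cycles q) := by
  obtain ⟨N, hN⟩ := hN
  have h0 (A : 𝒜) (hA : IsZero A) : flat G A := fun S hS hG φ => ⟨0, hA.eq_of_src _ _⟩
  have h (m : ℕ) : ∀ q : ℤ, N < q + m → flat G (K.cycles q) := by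
    induction m with
    | zero => exact fun q hq => h0 _ (IsZero.of_mono (K.iCycles q) (hN q (by simpa using hq)))
    | succ m ih =>
      intro q hq
      exact hG.flat_of_shortExact (shortExact_cycles K hK q) (hP q)
        (ih (q + 1) (by push_cast at hq; linarith))
  exact h (N + 1 - q).toNat q (by have := Int.self_le_toNat (N + 1 - q); linarith)

/-- An acyclic complex is spliced from the short exact sequences of its cycles. These cycles are
flat, so `L` keeps each sequence exact and the spliced complex acyclic. -/
lemma isFlatFunctor_of_adjunction {L : 𝒜 ⥤ ℬ} {R : ℬ ⥤ 𝒜} (adj : L ⊣ R) [L.Additive] [R.Additive]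
    [PreservesFiniteColimits L] [PreservesFiniteLimits R] (hG : IsRightClass G)
    (hG' : IsRightClass G')
    (hR : ∀ S : ShortComplex ℬ, S.ShortExact → G' S.X₁ → G (R.obj S.X₁) ∧ Epi (R.map S.g)) :
    IsFlatFunctor L (flat G) (flat G') where
  obj _ := flat_leftAdjoint adj hR
  acyclic K hN hP hK := fun q => by
    obtain ⟨q, rfl⟩ : ∃ r, q = r + 1 := ⟨q - 1, by ring⟩
    have h (r : ℤ) := shortExact_map_leftAdjoint adj hR hG' (shortExact_cycles K hK r)
      (flat_cycles hG K hN hP hK (r + 1))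
    rw [HomologicalComplex.exactAt_iff' _ q (q + 1) (q + 1 + 1) (by simp) (by simp)]
    have := (h q).epi_g
    have := (h (q + 1 + 1)).mono_f
    have : Epi (L.map (K.toCycles q (q + 1))) := (h q).epi_g
    have : Mono (L.map (K.iCycles (q + 1 + 1))) := (h (q + 1 + 1)).mono_f
    exact exact_of_shortExact (L.map (K.toCycles q (q + 1))) (L.map (K.iCycles (q + 1)))
      (L.map (K.toCycles (q + 1) (q + 1 + 1))) (L.map (K.iCycles (q + 1 + 1))) _ (h (q + 1)).exact
      _ _ (by rw [← L.map_comp, K.toCycles_i]; rfl) (by rw [← L.map_comp, K.toCycles_i]; rfl) _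

end Functor

/-! ### Flat modules on ringed topoi and inverse images. -/

namespace RingedTopos

variable {X X' X'' : RingedTopos.{u}}

lemma isRightClass_good (X : RingedTopos.{u}) : IsRightClass (Good (X := X)) where
  injective I _ := good_of_injective I
  shortExact _ hS := Good.of_shortExact hS

lemma epi_of_surjective_app {N N' : X.Mod} (p : N ⟶ N')
    (h : ∀ U, Function.Surjective (p.val.app U)) : Epi p := by
  have : Epi (X.toPMod.map p) := PresheafOfModules.epi_of_surjective h
  exact X.toPMod.epi_of_epi_map this

variable (X) in
/-- The flat objects used to resolve modules over the structure sheaf. -/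
abbrev flat : ObjectProperty X.Mod := MultiFiltered.flat (Good (X := X))

/-- The direct image of a good sheaf is good. An epimorphism with good kernel is surjective on all
sections, so its direct image is an epimorphism as well. -/
lemma isFlatFunctor_pull (f : Hom X X') : IsFlatFunctor f.pull X'.flat X.flat :=
  isFlatFunctor_of_adjunction f.adj (isRightClass_good X') (isRightClass_good X)
    fun S hS hG => ⟨hG.push f, epi_of_surjective_app _ fun U =>
      surjective_app_of_good S hS hG (op (f.F.obj U.unop))⟩

/-- Enough objects are given by the sheaves associated with coproducts of free presheaves on
representables. A morphism out of one of them is a morphism of presheaves, which lifts by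
`exists_lift_of_relInj`. -/
lemma isFlatClass_flat (X : RingedTopos.{u}) : IsFlatClass X.flat where
  sigma M _ := flat_sigma M
  retract := flat_of_retract
  enough M := by
    let M' := X.toPMod.obj M
    refine ⟨X.sh.obj M'.freeYonedaCoproduct, X.sh.map M'.fromFreeYonedaCoproduct ≫
      X.shAdj.counit.app M, fun S hS hG φ => ?_, epi_comp _ _⟩
    have := hS.mono_f
    have hex : (S.map X.toPMod).Exact :=
      hS.exact.map_of_mono_of_preservesKernel _ inferInstance inferInstance
    have : Mono (S.map X.toPMod).f := inferInstanceAs (Mono (X.toPMod.map S.f))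
    obtain ⟨l, hl⟩ := exists_lift_of_relInj (S.map X.toPMod) hex hG.relInj
      (ObjProj.freeYonedaCoproduct M') (X.shAdj.homEquiv _ _ φ)
      fun W x => surjective_app_of_good S hS hG W _
    exact ⟨(X.shAdj.homEquiv _ _).symm l, (X.shAdj.homEquiv_naturality_right_symm l S.g).symm.trans
      ((Equiv.symm_apply_eq _).2 hl)⟩

end RingedTopos

/-! ### Flat resolutions of filtered complexes -/

section Steps

variable {n : ℕ} {𝒜 : Type u} [Category.{v} 𝒜] [Abelian 𝒜]

/-- The inclusion of a step. -/
def stepι (t : Steps n) (X : FiltObj n 𝒜) : (step n 𝒜 t).obj X ⟶ X.obj :=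
  match t with
  | none => 𝟙 X.obj
  | some (i, k) => (X.inter i k).arrow

instance (t : Steps n) (X : FiltObj n 𝒜) : Mono (stepι t X) :=
  match t with
  | none => inferInstanceAs (Mono (𝟙 X.obj))
  | some (i, k) => inferInstanceAs (Mono (X.inter i k).arrow)

lemma step_map_ι (t : Steps n) {X Y : FiltObj n 𝒜} (f : X ⟶ Y) :
    (step n 𝒜 t).map f ≫ stepι t Y = stepι t X ≫ f.1 :=
  match t with
  | none => (Category.comp_id f.1).trans (Category.id_comp f.1).symm
  | some (i, k) => Subobject.factorThru_arrow (Y.inter i k) _ (FiltObj.inter_factors f i k)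

lemma step_comp_incl {X Y : FiltObj n 𝒜} (t : Steps n) (f : X ⟶ Y) {W : 𝒜}
    (x : W ⟶ (step n 𝒜 t).obj X) (y : W ⟶ (step n 𝒜 t).obj Y) :
    x ≫ (step n 𝒜 t).map f = y ↔ (x ≫ stepι t X) ≫ f.1 = y ≫ stepι t Y := by
  rw [← cancel_mono (stepι t Y), Category.assoc, step_map_ι, Category.assoc]

/-- The morphisms to the underlying object that factor through a step. -/
def InStep (t : Steps n) (X : FiltObj n 𝒜) {W : 𝒜} (w : W ⟶ X.obj) : Prop :=
  ∃ w' : W ⟶ (step n 𝒜 t).obj X, w' ≫ stepι t X = w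

lemma inStep_none (X : FiltObj n 𝒜) {W : 𝒜} (w : W ⟶ X.obj) : InStep none X w :=
  ⟨w, Category.comp_id w⟩

lemma inStep_some (i : Fin n → Fin n) (k : Fin n → ℤ) (X : FiltObj n 𝒜) {W : 𝒜} (w : W ⟶ X.obj) :
    InStep (some (i, k)) X w ↔ ∀ j, (X.fil (i j) (k j)).Factors w := by
  have : (X.inter i k).Factors w ↔ ∀ j, (X.fil (i j) (k j)).Factors w := by
    unfold FiltObj.inter
    rw [Subobject.finset_inf_factors]
    simp
  rw [← this]
  exact ⟨fun ⟨w', h⟩ => (Subobject.factors_iff _ _).2 ⟨w', h⟩, fun h =>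
    ⟨(X.inter i k).factorThru w h, (X.inter i k).factorThru_arrow w h⟩⟩

lemma InStep.map {t : Steps n} {X Y : FiltObj n 𝒜} {W : 𝒜} {w : W ⟶ X.obj} (h : InStep t X w)
    (f : X ⟶ Y) : InStep t Y (w ≫ f.1) := by
  obtain ⟨w', rfl⟩ := h
  exact ⟨w' ≫ (step n 𝒜 t).map f, (step_comp_incl t f w' _).1 rfl |>.symm⟩

/-- The kernel of a morphism of filtered objects. -/
abbrev kernelFilt {X Y : FiltObj n 𝒜} (f : X ⟶ Y) : FiltObj n 𝒜 where
  obj := kernel f.1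
  fil i := ⟨fun k => (Subobject.pullback (kernel.ι f.1)).obj (X.fil i k), fun _ _ h =>
    (Subobject.pullback (kernel.ι f.1)).monotone ((X.fil i).monotone h)⟩

/-- The inclusion of the kernel. -/
def kernelFiltι {X Y : FiltObj n 𝒜} (f : X ⟶ Y) : kernelFilt f ⟶ X :=
  ⟨kernel.ι f.1, fun _ _ => (le_pullback_iff _ _ _).1 le_rfl⟩

lemma kernelFiltι_comp {X Y : FiltObj n 𝒜} (f : X ⟶ Y) : kernelFiltι f ≫ f = 0 :=
  FiltObj.hom_ext (kernel.condition f.1)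

lemma inStep_kernelFilt {X Y : FiltObj n 𝒜} (f : X ⟶ Y) (t : Steps n) {W : 𝒜}
    (w : W ⟶ kernel f.1) : InStep t (kernelFilt f) w ↔ InStep t X (w ≫ kernel.ι f.1) := by
  obtain _ | ⟨i, k⟩ := t
  · exact ⟨fun _ => inStep_none _ _, fun _ => inStep_none _ _⟩
  · rw [inStep_some, inStep_some]
    exact forall_congr' fun j => pullback_factors_iff _ _ _

lemma inStep_biprodFilt {X Y : FiltObj n 𝒜} (t : Steps n) {W : 𝒜} (x : W ⟶ X.obj) (y : W ⟶ Y.obj)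
    (hx : InStep t X x) (hy : InStep t Y y) : InStep t (biprodFilt X Y) (biprod.lift x y) := by
  obtain _ | ⟨i, k⟩ := t
  · exact inStep_none _ _
  · rw [inStep_some] at *
    intro j
    rw [biprodFilt_factors, biprod.lift_fst, biprod.lift_snd]
    exact ⟨hx j, hy j⟩

/-- A morphism of filtered objects that is an epimorphism on all steps. -/
def StepEpi {X Y : FiltObj n 𝒜} (p : X ⟶ Y) : Prop := ∀ t, Epi ((step n 𝒜 t).map p)

lemma StepEpi.exists_lift {X Y : FiltObj n 𝒜} {p : X ⟶ Y} (hp : StepEpi p) {t : Steps n} {W : 𝒜}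
    {y : W ⟶ Y.obj} (hy : InStep t Y y) :
    ∃ (W' : 𝒜) (e : W' ⟶ W) (_ : Epi e) (x : W' ⟶ X.obj), InStep t X x ∧ x ≫ p.1 = e ≫ y := by
  obtain ⟨y, rfl⟩ := hy
  have := hp t
  obtain ⟨W', e, he, x, hx⟩ := surjective_up_to_refinements_of_epi ((step n 𝒜 t).map p) y
  exact ⟨W', e, he, x ≫ stepι t X, ⟨x, rfl⟩,
    ((step_comp_incl t p x (e ≫ y)).1 hx.symm).trans (Category.assoc _ _ _)⟩

lemma step_exactAt (K : CochainComplex (FiltObj n 𝒜) ℤ) (t : Steps n) (q : ℤ)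
    (h : ∀ {W : 𝒜} (y : W ⟶ (K.X (q + 1)).obj), InStep t _ y →
      y ≫ (K.d (q + 1) (q + 1 + 1)).1 = 0 → ∃ (W' : 𝒜) (e : W' ⟶ W) (_ : Epi e)
        (x : W' ⟶ (K.X q).obj), InStep t _ x ∧ x ≫ (K.d q (q + 1)).1 = e ≫ y) :
    (((step n 𝒜 t).mapHomologicalComplex _).obj K).ExactAt (q + 1) := by
  rw [HomologicalComplex.exactAt_iff' _ q (q + 1) (q + 1 + 1) (by simp) (by simp),
    ShortComplex.exact_iff_exact_up_to_refinements]
  intro W y hy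
  obtain ⟨W', e, he, x, ⟨x, rfl⟩, hx⟩ := h (y ≫ stepι t _) ⟨y, rfl⟩
    (((step_comp_incl t (K.d (q + 1) (q + 1 + 1)) y 0).1 hy).trans zero_comp)
  exact ⟨W', e, he, x, ((step_comp_incl t (K.d q (q + 1)) x (e ≫ y)).2
    (hx.trans (Category.assoc _ _ _).symm)).symm⟩

/-- The lifting condition that makes `f` a filtered quasi-isomorphism. -/
def LiftsAt {P K : CochainComplex (FiltObj n 𝒜) ℤ} (f : P ⟶ K) (q : ℤ) : Prop :=
  ∀ (t : Steps n) {W : 𝒜} (x : W ⟶ (P.X (q + 1 + 1)).obj) (y : W ⟶ (K.X (q + 1)).obj),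
    InStep t _ x → InStep t _ y → x ≫ (P.d (q + 1 + 1) (q + 1 + 1 + 1)).1 = 0 →
    x ≫ (f.f (q + 1 + 1)).1 = y ≫ (K.d (q + 1) (q + 1 + 1)).1 →
    ∃ (W' : 𝒜) (e : W' ⟶ W) (_ : Epi e) (z : W' ⟶ (P.X (q + 1)).obj) (v : W' ⟶ (K.X q).obj),
      InStep t _ z ∧ InStep t _ v ∧ z ≫ (P.d (q + 1) (q + 1 + 1)).1 = e ≫ x ∧
        e ≫ y = z ≫ (f.f (q + 1)).1 + v ≫ (K.d q (q + 1)).1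

/-- The condition says that cycles of the cone lying in a step are boundaries up to refinement.
Applied to a cycle `x` whose image bounds, it gives injectivity on homology; applied with `x = 0`,
it gives surjectivity. -/
lemma fqis_of_liftsAt {P K : CochainComplex (FiltObj n 𝒜) ℤ} (f : P ⟶ K) (h : ∀ q, LiftsAt f q) :
    fqis n 𝒜 ((HomotopyCategory.quotient _ _).map f) := by
  rw [fqis_eq_qisFam]
  intro t
  rw [qis_quotient_iff, quasiIso_iff]
  have h₁ (q : ℤ) : Mono (HomologicalComplex.homologyMap
      (((step n 𝒜 t).mapHomologicalComplex _).map f) (q + 1 + 1)) := by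
    rw [HomologicalComplex.mono_homologyMap_iff_up_to_refinements _ (q + 1) (q + 1 + 1)
      (q + 1 + 1 + 1) (by simp) (by simp)]
    intro W x hx y hxy
    obtain ⟨W', e, he, z, v, ⟨z, rfl⟩, -, hz, -⟩ := h q t (x ≫ stepι t _)
      (y ≫ stepι t _) ⟨x, rfl⟩ ⟨y, rfl⟩
      (((step_comp_incl t (P.d (q + 1 + 1) (q + 1 + 1 + 1)) x 0).1 hx).trans zero_comp)
      (((step_comp_incl t _ x _).1 hxy).trans
        ((step_comp_incl t (K.d (q + 1) (q + 1 + 1)) y _).1 rfl).symm)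
    exact ⟨W', e, he, z, ((step_comp_incl t (P.d (q + 1) (q + 1 + 1)) z (e ≫ x)).2
      (hz.trans (Category.assoc _ _ _).symm)).symm⟩
  have h₂ (q : ℤ) : Epi (HomologicalComplex.homologyMap
      (((step n 𝒜 t).mapHomologicalComplex _).map f) (q + 1)) := by
    rw [HomologicalComplex.epi_homologyMap_iff_up_to_refinements _ q (q + 1) (q + 1 + 1) (by simp)
      (by simp)]
    intro W y hy
    obtain ⟨W', e, he, z, v, ⟨z, rfl⟩, ⟨v, rfl⟩, hz, hz'⟩ := h q t (0 : W ⟶ _)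
      (y ≫ stepι t _) ⟨0, zero_comp⟩ ⟨y, rfl⟩ zero_comp
      (zero_comp.trans (((step_comp_incl t (K.d (q + 1) (q + 1 + 1)) y 0).1 hy).trans
        zero_comp).symm)
    refine ⟨W', e, he, z, (step_comp_incl t (P.d (q + 1) (q + 1 + 1)) z 0).2
      (hz.trans (comp_zero.trans zero_comp.symm)), v, (cancel_mono (stepι t _)).1 ?_⟩
    refine (Category.assoc _ _ _).trans (hz'.trans (Eq.trans ?_ (Preadditive.add_comp _ _ _ _ _ _).symm))
    exact congrArg₂ (· + ·) ((step_comp_incl t (f.f (q + 1)) z _).1 rfl)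
      ((step_comp_incl t (K.d q (q + 1)) v _).1 rfl)
  intro q
  obtain ⟨q, rfl⟩ : ∃ r, q = r + 1 + 1 := ⟨q - 1 - 1, by ring⟩
  rw [quasiIsoAt_iff_isIso_homologyMap]
  have := h₁ q
  have := h₂ (q + 1)
  exact isIso_of_mono_of_epi _

end Steps

/-! ### Flat covers of filtered objects. -/

section Cover

variable {n : ℕ} {𝒜 : Type u} [Category.{v} 𝒜] [Abelian 𝒜]

/-- The filtered objects all of whose quotients by sums of steps are flat. -/
def flatFilt (n : ℕ) (P : ObjectProperty 𝒜) : ObjectProperty (FiltObj n 𝒜) := fun X =>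
  ∀ q, P ((sumQuot n 𝒜 q).obj X)

section SubSum

variable {T : Type} (M : T → 𝒜) [HasCoproduct M] (A B : Set T)

open Classical in
/-- The projector of a coproduct to a part. -/
def partProj : ∐ M ⟶ ∐ M := Sigma.desc fun t => if t ∈ A then Sigma.ι M t else 0

/-- A part of a coproduct. -/
def part : Subobject (∐ M) := imageSubobject (partProj M A)

variable {M A B}

lemma ι_partProj_of_mem {t : T} (h : t ∈ A) : Sigma.ι M t ≫ partProj M A = Sigma.ι M t := by
  simp [partProj, h]

lemma ι_partProj_of_notMem {t : T} (h : t ∉ A) : Sigma.ι M t ≫ partProj M A = 0 := by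
  simp [partProj, h]

lemma partProj_comp (h : A ⊆ B) : partProj M A ≫ partProj M B = partProj M A := by
  refine Sigma.hom_ext _ _ fun t => ?_
  by_cases ht : t ∈ A
  · rw [← Category.assoc, ι_partProj_of_mem ht, ι_partProj_of_mem (h ht)]
  · rw [← Category.assoc, ι_partProj_of_notMem ht, zero_comp]

lemma part_arrow_comp : (part M A).arrow ≫ partProj M A = (part M A).arrow := by
  unfold part
  rw [← cancel_epi (factorThruImageSubobject (partProj M A)), ← Category.assoc, imageSubobject_arrow_comp, partProj_comp subset_rfl]

lemma part_factors_iff {W : 𝒜} (f : W ⟶ ∐ M) : (part M A).Factors f ↔ f ≫ partProj M A = f := by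
  constructor
  · intro h
    rw [← (part M A).factorThru_arrow f h, Category.assoc, part_arrow_comp]
  · intro h
    rw [← h]
    exact Subobject.factors_of_factors_right _ (image_factors_self _)

lemma part_factors_ι {t : T} (h : t ∈ A) : (part M A).Factors (Sigma.ι M t) :=
  (part_factors_iff _).2 (ι_partProj_of_mem h)

lemma part_factors_comp {X : 𝒜} (S : Subobject X) (f : ∐ M ⟶ X) :
    S.Factors ((part M A).arrow ≫ f) ↔ ∀ t ∈ A, S.Factors (Sigma.ι M t ≫ f) := by
  unfold part
  rw [image_factors_iff]
  constructor
  · intro h t ht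
    rw [← ι_partProj_of_mem ht, Category.assoc]
    exact Subobject.factors_of_factors_right _ h
  · intro h
    rw [factors_iff_comp_cokernel]
    refine Sigma.hom_ext _ _ fun t => ?_
    rw [comp_zero]
    by_cases ht : t ∈ A
    · rw [← Category.assoc, ← Category.assoc, ι_partProj_of_mem ht, ← factors_iff_comp_cokernel]
      exact h t ht
    · rw [← Category.assoc, ← Category.assoc, ι_partProj_of_notMem ht, zero_comp, zero_comp]

lemma part_le_iff (S : Subobject (∐ M)) : part M A ≤ S ↔ ∀ t ∈ A, S.Factors (Sigma.ι M t) := by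
  have h := part_factors_comp (A := A) S (𝟙 (∐ M))
  simp only [Category.comp_id] at h
  rw [← h]
  exact ⟨fun h => Subobject.factors_of_le _ h (Subobject.factors_self _),
    fun h => Subobject.le_of_comm (S.factorThru _ h) (S.factorThru_arrow _ h)⟩

lemma part_mono (h : A ⊆ B) : part M A ≤ part M B :=
  (part_le_iff _).2 fun _ ht => part_factors_ι (h ht)

end SubSum

/-- The indices of the steps contained in the `l`-th step of the `a`-th filtration. -/
def below (a : Fin n) (l : ℤ) : Set (Steps n) :=
  {t | ∃ i k, t = some (i, k) ∧ ∃ j, i j = a ∧ k j ≤ l}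

lemma below_mono (a : Fin n) {l l' : ℤ} (h : l ≤ l') : below a l ⊆ below a l' := by
  rintro _ ⟨i, k, rfl, j, hj, hk⟩
  exact ⟨i, k, rfl, j, hj, hk.trans h⟩

/-- A coproduct of objects indexed by steps as a filtered object. -/
abbrev sigmaFilt (M : Steps n → 𝒜) [HasCoproduct M] : FiltObj n 𝒜 where
  obj := ∐ M
  fil a := ⟨fun l => part M (below a l), fun _ _ h => part_mono (below_mono a h)⟩

/-- The indices of the steps contained in a sum of steps. -/
def belowSum (q : Sums n) : Set (Steps n) := {t | ∃ (a : Fin n) (l : ℤ), q a = l ∧ t ∈ below a l}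

lemma sigmaFilt_sum (M : Steps n → 𝒜) [HasCoproduct M] (q : Sums n) :
    (sigmaFilt M).sum q = part M (belowSum q) := by
  refine le_antisymm ((sigmaFilt M).sum_le fun a => ?_) ((part_le_iff _).2 ?_)
  · generalize hc : q a = c
    induction c using WithBot.recBotCoe with
    | bot => exact bot_le
    | coe l => exact part_mono fun t ht => ⟨a, l, hc, ht⟩
  · rintro t ⟨a, l, hq, ht⟩
    have h := (sigmaFilt M).le_sum q a
    rw [hq] at h
    exact Subobject.factors_of_le _ h (part_factors_ι ht)

/-- A sum of steps of `sigmaFilt M` is a partial coproduct, hence a direct summand, and the quotient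
by it is a retract of the whole coproduct. -/
lemma flatFilt_sigmaFilt {P : ObjectProperty 𝒜} (hP : IsFlatClass P) (M : Steps n → 𝒜)
    [HasCoproduct M] (hM : ∀ t, P (M t)) : flatFilt n P (sigmaFilt M) := by
  intro q
  have hU := sigmaFilt_sum M q
  have h₁ : ((sigmaFilt M).sum q).arrow ≫ (𝟙 (∐ M) - partProj M (belowSum q)) = 0 := by
    rw [hU, Preadditive.comp_sub, part_arrow_comp, Category.comp_id, sub_self]
  have h₂ : partProj M (belowSum q) ≫ cokernel.π ((sigmaFilt M).sum q).arrow = 0 := by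
    rw [← factors_iff_comp_cokernel, hU]
    exact image_factors_self _
  have h₃ : cokernel.desc ((sigmaFilt M).sum q).arrow _ h₁ ≫
      cokernel.π ((sigmaFilt M).sum q).arrow = 𝟙 (cokernel ((sigmaFilt M).sum q).arrow) := by
    rw [← cancel_epi (cokernel.π ((sigmaFilt M).sum q).arrow), ← Category.assoc, cokernel.π_desc,
      Preadditive.sub_comp, h₂, Category.id_comp, sub_zero, Category.comp_id]
  exact hP.retract _ _ h₃ (hP.sigma M hM)

/-- Choose a flat cover of every intersection of steps and take the coproduct, filtered so that each
summand lies in the steps which visibly contain its intersection. The summand of index `t` then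
already covers the step of index `t`. -/
lemma exists_stepEpi {P : ObjectProperty 𝒜} (hP : IsFlatClass P) [HasCoproducts.{0} 𝒜]
    (X : FiltObj n 𝒜) : ∃ (Y : FiltObj n 𝒜) (p : Y ⟶ X), flatFilt n P Y ∧ StepEpi p := by
  choose M π hM hπ using fun t : Steps n => hP.enough ((step n 𝒜 t).obj X)
  let f : ∐ M ⟶ X.obj := Sigma.desc fun t => π t ≫ stepι t X
  have hf (t : Steps n) : Sigma.ι M t ≫ f = π t ≫ stepι t X := Sigma.ι_desc _ _
  let p : sigmaFilt M ⟶ X := ⟨f, fun a l => (part_factors_comp _ _).2 (by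
    rintro _ ⟨i, k, rfl, j, rfl, hk⟩
    rw [hf]
    exact Subobject.factors_of_le _ ((X.fil (i j)).monotone hk)
      ((inStep_some i k X _).1 ⟨_, rfl⟩ j))⟩
  refine ⟨sigmaFilt M, p, flatFilt_sigmaFilt hP M hM, fun t => ?_⟩
  have h : InStep t (sigmaFilt M) (Sigma.ι M t) := by
    obtain _ | ⟨i, k⟩ := t
    · exact inStep_none _ _
    · exact (inStep_some i k _ _).2 fun j => part_factors_ι ⟨i, k, rfl, j, rfl, le_rfl⟩
  obtain ⟨σ, hσ⟩ := h
  have h' : σ ≫ (step n 𝒜 t).map p = π t := (step_comp_incl t p σ (π t)).2 (by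
    rw [hσ]; exact hf t)
  have := hπ t
  have : Epi (σ ≫ (step n 𝒜 t).map p) := by rw [h']; exact hπ t
  exact epi_of_epi σ _

end Cover

/-! ### Construction of flat resolutions by descending induction on the degree. -/

section Resolution

variable {n : ℕ} {𝒜 : Type u} [Category.{v} 𝒜] [Abelian 𝒜]

lemma flatFilt_of_isZero {P : ObjectProperty 𝒜} (hP : IsFlatClass P) {X : FiltObj n 𝒜}
    (hX : IsZero X) : flatFilt n P X := fun q => by
  obtain ⟨M', p, h, -⟩ := hP.enough ((sumQuot n 𝒜 q).obj X)
  exact hP.retract 0 p (((sumQuot n 𝒜 q).map_isZero hX).eq_of_src _ _) h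

/-- The last stage in the construction of a flat resolution. -/
structure Stage (P : ObjectProperty 𝒜) {X : FiltObj n 𝒜} where
  /-- the last object -/
  A : FiltObj n 𝒜
  /-- the object before the last one -/
  A' : FiltObj n 𝒜
  /-- the differential -/
  d : A ⟶ A'
  /-- the comparison with the given complex -/
  f : A ⟶ X
  flat : flatFilt n P A

variable {P : ObjectProperty 𝒜} (hP : IsFlatClass P) [HasCoproducts.{0} 𝒜]

include hP in
-- The pairs `(x, y)` to be lifted form the kernel of `(x, y) ↦ (d x, f x - d y)`. The new object is
-- a flat cover of that kernel with its induced filtrations, an epimorphism on every step.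
lemma exists_next {X X' : FiltObj n 𝒜} (d : X' ⟶ X) (S : Stage P (X := X)) :
    ∃ (A : FiltObj n 𝒜) (δ : A ⟶ S.A) (g : A ⟶ X'), flatFilt n P A ∧ δ ≫ S.d = 0 ∧
      δ ≫ S.f = g ≫ d ∧ ∀ (t : Steps n) {W : 𝒜} (x : W ⟶ S.A.obj) (y : W ⟶ X'.obj),
        InStep t _ x → InStep t _ y → x ≫ S.d.1 = 0 → x ≫ S.f.1 = y ≫ d.1 →
        ∃ (W' : 𝒜) (e : W' ⟶ W) (_ : Epi e) (z : W' ⟶ A.obj), InStep t _ z ∧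
          z ≫ δ.1 = e ≫ x ∧ z ≫ g.1 = e ≫ y := by
  let fst : biprodFilt S.A X' ⟶ S.A := (biprodBicone S.A X').fst
  let snd : biprodFilt S.A X' ⟶ X' := (biprodBicone S.A X').snd
  let fst' : biprodFilt S.A' X ⟶ S.A' := (biprodBicone S.A' X).fst
  let snd' : biprodFilt S.A' X ⟶ X := (biprodBicone S.A' X).snd
  let inl' : S.A' ⟶ biprodFilt S.A' X := (biprodBicone S.A' X).inl
  let inr' : X ⟶ biprodFilt S.A' X := (biprodBicone S.A' X).inr
  let φ : biprodFilt S.A X' ⟶ biprodFilt S.A' X :=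
    fst ≫ S.d ≫ inl' + (fst ≫ S.f - snd ≫ d) ≫ inr'
  have hφ : φ.1 = (biprod.fst : S.A.obj ⊞ X'.obj ⟶ _) ≫ S.d.1 ≫ biprod.inl +
      ((biprod.fst : S.A.obj ⊞ X'.obj ⟶ _) ≫ S.f.1 -
        (biprod.snd : S.A.obj ⊞ X'.obj ⟶ _) ≫ d.1) ≫ biprod.inr := rfl
  obtain ⟨A, p, hA, hp⟩ := exists_stepEpi hP (kernelFilt φ)
  have hι : kernelFiltι φ ≫ φ = 0 := kernelFiltι_comp φ
  have h₁ : φ ≫ fst' = fst ≫ S.d := FiltObj.hom_ext (by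
    change φ.1 ≫ biprod.fst = (biprod.fst : S.A.obj ⊞ X'.obj ⟶ _) ≫ S.d.1
    rw [hφ]; simp)
  have h₂ : φ ≫ snd' = fst ≫ S.f - snd ≫ d := FiltObj.hom_ext (by
    change φ.1 ≫ biprod.snd = (biprod.fst : S.A.obj ⊞ X'.obj ⟶ _) ≫ S.f.1 -
        (biprod.snd : S.A.obj ⊞ X'.obj ⟶ _) ≫ d.1
    rw [hφ]; simp)
  refine ⟨A, p ≫ kernelFiltι φ ≫ fst, p ≫ kernelFiltι φ ≫ snd, hA, ?_, ?_, ?_⟩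
  · rw [Category.assoc, Category.assoc, ← h₁, ← Category.assoc (kernelFiltι φ), hι, zero_comp,
      comp_zero]
  · rw [← sub_eq_zero, Category.assoc, Category.assoc, Category.assoc, Category.assoc,
      ← Preadditive.comp_sub, ← Preadditive.comp_sub, ← h₂, ← Category.assoc (kernelFiltι φ), hι,
      zero_comp, comp_zero]
  · intro t W x y hx hy hxd hxy
    have hw : biprod.lift x y ≫ φ.1 = 0 := by
      rw [hφ]
      refine biprod.hom_ext _ _ ?_ ?_ <;> simp [hxd, hxy]
    obtain ⟨W', e, he, z, hz, hzp⟩ := hp.exists_lift (t := t)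
      ((inStep_kernelFilt φ t (kernel.lift φ.1 (biprod.lift x y) hw)).2 (by
        rw [kernel.lift_ι]; exact inStep_biprodFilt t x y hx hy))
    have hzι : z ≫ p.1 ≫ kernel.ι φ.1 = e ≫ biprod.lift x y := by
      rw [← Category.assoc, hzp, Category.assoc, kernel.lift_ι]
    refine ⟨W', e, he, z, hz, ?_, ?_⟩
    · change z ≫ p.1 ≫ kernel.ι φ.1 ≫ (biprod.fst : S.A.obj ⊞ X'.obj ⟶ _) = _
      have := hzι =≫ (biprod.fst : S.A.obj ⊞ X'.obj ⟶ _)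
      simpa using this
    · change z ≫ p.1 ≫ kernel.ι φ.1 ≫ (biprod.snd : S.A.obj ⊞ X'.obj ⟶ _) = _
      have := hzι =≫ (biprod.snd : S.A.obj ⊞ X'.obj ⟶ _)
      simpa using this

/-! ### From chain complexes indexed by natural numbers to bounded above cochain complexes. -/

section Reindex

variable {𝒟 : Type u} [Category.{v} 𝒟] [Preadditive 𝒟] (N : ℤ)

/-- The cochain complex given by a chain complex whose object in degree `0` is zero, the degree
`k` becoming the degree `N - k`. -/
def reindex (A : ChainComplex 𝒟 ℕ) : CochainComplex 𝒟 ℤ where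
  -- For `q > N` truncation gives the index `0`. As the object there is zero in the application, the
  -- complex vanishes in all degrees from `N` on.
  X q := A.X (N - q).toNat
  d q q' := if q + 1 = q' then A.d _ _ else 0
  shape _ _ h := if_neg h
  d_comp_d' q q' q'' _ _ := by
    split_ifs
    · exact A.d_comp_d _ _ _
    all_goals simp

lemma reindex_d (A : ChainComplex 𝒟 ℕ) (q : ℤ) :
    (reindex N A).d q (q + 1) = A.d (N - q).toNat (N - (q + 1)).toNat := if_pos rfl

/-- The chain complex with the object of degree `N - k` of a cochain complex in degree `k`. -/
def foldCx (K : CochainComplex 𝒟 ℤ) : ChainComplex 𝒟 ℕ where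
  X k := K.X (N - k)
  d i j := K.d _ _
  shape i j h := K.shape _ _ fun h' => h (by
    have : N - (i : ℤ) + 1 = N - j := h'
    change j + 1 = i
    omega)

/-- The components of the comparison of a cochain complex with the complex it is folded to. -/
def foldHom (K : CochainComplex 𝒟 ℤ) (q : ℤ) : (reindex N (foldCx N K)).X q ⟶ K.X q :=
  if h : q ≤ N then (K.XIsoOfEq (show N - ((N - q).toNat : ℤ) = q by omega)).hom else 0

variable {N} in
lemma foldHom_eq (K : CochainComplex 𝒟 ℤ) {q : ℤ} (h : q ≤ N) : foldHom N K q =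
    (K.XIsoOfEq (show N - ((N - q).toNat : ℤ) = q by omega)).hom := dif_pos h

variable {N} in
lemma isIso_foldHom (K : CochainComplex 𝒟 ℤ) {q : ℤ} (h : q ≤ N) : IsIso (foldHom N K q) := by
  rw [foldHom_eq K h]
  exact Iso.isIso_hom _

variable {N} in
lemma foldHom_comm (K : CochainComplex 𝒟 ℤ) {q : ℤ} (h : q + 1 ≤ N) :
    foldHom N K q ≫ K.d q (q + 1) =
      (foldCx N K).d (N - q).toNat (N - (q + 1)).toNat ≫ foldHom N K (q + 1) := by
  rw [foldHom_eq K h, foldHom_eq K (by omega : q ≤ N)]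
  exact (K.XIsoOfEq_hom_comp_d _ _).trans (K.d_comp_XIsoOfEq_hom _ _).symm

variable {N} in
/-- The morphism to a cochain complex given by a morphism to the complex it is folded to. -/
def reindexHom {A : ChainComplex 𝒟 ℕ} {K : CochainComplex 𝒟 ℤ} (f : A ⟶ foldCx N K)
    (hA : IsZero (A.X 0)) : reindex N A ⟶ K where
  f q := f.f (N - q).toNat ≫ foldHom N K q
  comm' q q' h := by
    obtain rfl : q + 1 = q' := h
    by_cases hq : q + 1 ≤ N
    · rw [reindex_d]
      exact (Category.assoc _ _ _).trans ((congrArg (f.f _ ≫ ·) (foldHom_comm K hq)).trans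
        ((Category.assoc _ _ _).symm.trans ((congrArg (· ≫ foldHom N K (q + 1))
          (f.comm _ _)).trans (Category.assoc _ _ _))))
    · have : (N - q).toNat = 0 := by omega
      refine IsZero.eq_of_src ?_ _ _
      change IsZero (A.X (N - q).toNat)
      rwa [this]

end Reindex

section

variable (K : CochainComplex (FiltObj n 𝒜) ℤ) (N : ℤ)

/-- The next stage in the construction of a flat resolution. -/
def Stage.next {X X' : FiltObj n 𝒜} (d : X' ⟶ X) (S : Stage P (X := X)) : Stage P (X := X') where
  A := (exists_next hP d S).choose
  A' := S.A
  d := (exists_next hP d S).choose_spec.choose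
  f := (exists_next hP d S).choose_spec.choose_spec.choose
  flat := (exists_next hP d S).choose_spec.choose_spec.choose_spec.1

include hP in
lemma Stage.next_spec {X X' : FiltObj n 𝒜} (d : X' ⟶ X) (S : Stage P (X := X)) :
    (S.next hP d).d ≫ S.d = 0 ∧ (S.next hP d).d ≫ S.f = (S.next hP d).f ≫ d ∧
      ∀ (t : Steps n) {W : 𝒜} (x : W ⟶ S.A.obj) (y : W ⟶ X'.obj),
        InStep t _ x → InStep t _ y → x ≫ S.d.1 = 0 → x ≫ S.f.1 = y ≫ d.1 →
        ∃ (W' : 𝒜) (e : W' ⟶ W) (_ : Epi e) (z : W' ⟶ (S.next hP d).A.obj), InStep t _ z ∧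
          z ≫ (S.next hP d).d.1 = e ≫ x ∧ z ≫ (S.next hP d).f.1 = e ≫ y :=
  (exists_next hP d S).choose_spec.choose_spec.choose_spec.2

open ZeroObject in
/-- The stages in the construction of a flat resolution. -/
def stages : ∀ k : ℕ, Stage P (X := K.X (N - k))
  -- Degree `N` of the resolution can be zero because the given complex is exact from degree `N` on.
  | 0 => ⟨0, 0, 0, 0, flatFilt_of_isZero hP (isZero_zero _)⟩
  | k + 1 => (stages k).next hP (K.d (N - (k + 1 : ℕ)) (N - k))

/-- The chain complex underlying a flat resolution. -/
def stageCx : ChainComplex (FiltObj n 𝒜) ℕ :=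
  ChainComplex.of (fun k => (stages hP K N k).A) (fun k => (stages hP K N (k + 1)).d)
    fun k => ((stages hP K N (k + 1)).next_spec hP _).1

lemma stageCx_d (k : ℕ) : (stageCx hP K N).d (k + 1) k = (stages hP K N (k + 1)).d :=
  ChainComplex.of_d (fun k => (stages hP K N k).A) (fun k => (stages hP K N (k + 1)).d) k

/-- The comparison of the flat resolution with the given complex. -/
def stageMap : stageCx hP K N ⟶ foldCx N K where
  f k := (stages hP K N k).f
  comm' i j h := by
    obtain rfl : j + 1 = i := h
    rw [stageCx_d]
    exact ((stages hP K N j).next_spec hP _).2.1.symm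

lemma stageCx_lift (a b c : ℕ) (ha : a = b + 1) (hc : c = b - 1) (t : Steps n) {W : 𝒜}
    (x : W ⟶ ((stageCx hP K N).X b).obj) (y : W ⟶ ((foldCx N K).X a).obj)
    (hx : InStep t _ x) (hy : InStep t _ y) (hxd : x ≫ ((stageCx hP K N).d b c).1 = 0)
    (hxy : x ≫ ((stageMap hP K N).f b).1 = y ≫ ((foldCx N K).d a b).1) :
    ∃ (W' : 𝒜) (e : W' ⟶ W) (_ : Epi e) (z : W' ⟶ ((stageCx hP K N).X a).obj), InStep t _ z ∧
      z ≫ ((stageCx hP K N).d a b).1 = e ≫ x ∧ z ≫ ((stageMap hP K N).f a).1 = e ≫ y := by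
  subst ha hc
  rw [stageCx_d]
  refine ((stages hP K N b).next_spec hP (K.d (N - (b + 1 : ℕ)) (N - b))).2.2 t x y hx hy ?_ hxy
  -- For `b = 0` truncated subtraction gives `c = 0`, so `hxd` says nothing; but the object after
  -- the initial stage is zero and the equation is automatic.
  obtain _ | b := b
  · exact (isZero_obj (isZero_zero (FiltObj n 𝒜))).eq_of_tgt _ _
  · rw [Nat.add_sub_cancel, stageCx_d] at hxd
    exact hxd

/-- As long as `q + 2 ≤ N`, the construction lifts the pair exactly and `v = 0` will do. Otherwise
the resolution is zero in degree `q + 2`, so `y` is a cycle in a degree where `K` is exact, and `z =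
0` will do. -/
lemma liftsAt_stageMap (hK : ∀ (t : Steps n), ∀ q ≥ N,
    (((step n 𝒜 t).mapHomologicalComplex _).obj K).ExactAt q) (q : ℤ) :
    LiftsAt (reindexHom (stageMap hP K N) (isZero_zero _)) q := by
  intro t W x y hx hy hxd hxy
  by_cases hq : q + 1 + 1 ≤ N
  · have h₁ := isIso_foldHom K (show q + 1 ≤ N by omega)
    have h₂ := isIso_foldHom K hq
    have e₁ : (inv (foldHom N K (q + 1))).1 ≫ (foldHom N K (q + 1)).1 = 𝟙 _ :=
      congrArg Subtype.val (IsIso.inv_hom_id (foldHom N K (q + 1)))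
    have : Mono (foldHom N K (q + 1 + 1)).1 :=
      inferInstanceAs (Mono ((forget n 𝒜).map (foldHom N K (q + 1 + 1))))
    have e₂ : (foldHom N K (q + 1)).1 ≫ (K.d (q + 1) (q + 1 + 1)).1 =
      ((foldCx N K).d _ _).1 ≫ (foldHom N K (q + 1 + 1)).1 :=
      congrArg Subtype.val (foldHom_comm K hq)
    rw [reindex_d] at hxd ⊢
    obtain ⟨W', e, he, z, hz, hzx, hzy⟩ := stageCx_lift hP K N _ _ _ (by omega) (by omega) t x
      (y ≫ (inv (foldHom N K (q + 1))).1) hx (hy.map _) hxd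
      ((cancel_mono (foldHom N K (q + 1 + 1)).1).1 (by
        refine (Category.assoc _ _ _).trans (hxy.trans ?_)
        refine Eq.trans ?_ ((congrArg (· ≫ (foldHom N K (q + 1 + 1)).1)
          (Category.assoc _ _ _)).trans (Category.assoc _ _ _)).symm
        refine congrArg (y ≫ ·) ?_
        refine Eq.trans ?_ ((congrArg ((inv (foldHom N K (q + 1))).1 ≫ ·) e₂).trans
          (Category.assoc _ _ _).symm)
        exact ((Category.assoc _ _ _).symm.trans ((congrArg (· ≫ (K.d (q + 1) (q + 1 + 1)).1)
          e₁).trans (Category.id_comp _))).symm))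
    refine ⟨W', e, he, z, 0, hz, ⟨0, zero_comp⟩, hzx, ?_⟩
    rw [zero_comp, add_zero]
    refine Eq.symm ((Category.assoc _ _ _).symm.trans
      ((congrArg (· ≫ (foldHom N K (q + 1)).1) hzy).trans ((Category.assoc _ _ _).trans ?_)))
    exact congrArg (e ≫ ·) ((Category.assoc _ _ _).trans ((congrArg (y ≫ ·) e₁).trans
      (Category.comp_id _)))
  · have h0 : IsZero ((reindex N (stageCx hP K N)).X (q + 1 + 1)) := by
      change IsZero ((stageCx hP K N).X (N - (q + 1 + 1)).toNat)
      have : (N - (q + 1 + 1)).toNat = 0 := by omega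
      rw [this]
      exact isZero_zero _
    have hx0 : x = 0 := (isZero_obj h0).eq_of_tgt _ _
    obtain ⟨y, rfl⟩ := hy
    have h := hK t (q + 1) (by omega)
    rw [HomologicalComplex.exactAt_iff' _ q (q + 1) (q + 1 + 1) (by simp) (by simp),
      ShortComplex.exact_iff_exact_up_to_refinements] at h
    obtain ⟨W', e, he, v, hv⟩ := h y ((step_comp_incl t (K.d (q + 1) (q + 1 + 1)) y 0).2 (by
      rw [← hxy, hx0, zero_comp, zero_comp]))
    refine ⟨W', e, he, 0, v ≫ stepι t _, ⟨0, zero_comp⟩, ⟨v, rfl⟩, ?_, ?_⟩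
    · rw [hx0, zero_comp, comp_zero]
    · rw [zero_comp, zero_add]
      exact (Category.assoc _ _ _).symm.trans
        ((step_comp_incl t (K.d q (q + 1)) v (e ≫ y)).1 hv.symm).symm

include hP in
lemma exists_flat_resolution (hK : ∃ N : ℤ, ∀ (t : Steps n), ∀ q ≥ N,
      (((step n 𝒜 t).mapHomologicalComplex _).obj K).ExactAt q) :
    ∃ (F : CochainComplex (FiltObj n 𝒜) ℤ) (f : F ⟶ K), (∃ N : ℤ, ∀ q > N, IsZero (F.X q)) ∧
      (∀ q, flatFilt n P (F.X q)) ∧ fqis n 𝒜 ((HomotopyCategory.quotient _ _).map f) := by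
  obtain ⟨N, hN⟩ := hK
  refine ⟨_, reindexHom (stageMap hP K N) (isZero_zero _), ⟨N, fun q hq => ?_⟩,
    fun q => (stages hP K N (N - q).toNat).flat, fqis_of_liftsAt _ (liftsAt_stageMap hP K N hN)⟩
  change IsZero ((stageCx hP K N).X (N - q).toNat)
  have : (N - q).toNat = 0 := by omega
  rw [this]
  exact isZero_zero _

end

end Resolution

/-! ### Flat resolutions of filtered complexes and calculus of right fractions. -/

section FlatResolution

variable {n : ℕ} {𝒜 : Type u} [Category.{v} 𝒜] [Abelian 𝒜] {P : ObjectProperty 𝒜}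

lemma exactAt_of_qis {Λ : FiltObj n 𝒜 ⥤ 𝒜} [Λ.Additive] {X Y : KF n 𝒜} (s : X ⟶ Y)
    (hs : qis Λ s) (q : ℤ) (hY : IsZero (Y.as.X q)) :
    ((Λ.mapHomologicalComplex (.up ℤ)).obj X.as).ExactAt q := by
  have h : IsZero (((Λ.mapHomologicalComplex (.up ℤ)).obj Y.as).homology q) := by
    rw [← HomologicalComplex.exactAt_iff_isZero_homology]
    exact ShortComplex.exact_of_isZero_X₂ _ (Λ.map_isZero hY)
  obtain ⟨f, rfl⟩ := (HomotopyCategory.quotient _ _).map_surjective s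
  have hf : QuasiIso ((Λ.mapHomologicalComplex (.up ℤ)).map f) := (qis_quotient_iff Λ f).1 hs
  rw [HomologicalComplex.exactAt_iff_isZero_homology]
  exact h.of_iso (asIso (HomologicalComplex.homologyMap
    ((Λ.mapHomologicalComplex (.up ℤ)).map f) q))

variable (n P) in
/-- Bounded above complexes of filtered objects whose quotients by sums of steps are flat. -/
def flatMinus : ObjectProperty (KFminus n 𝒜) := fun K => ∀ q, flatFilt n P (K.obj.as.X q)

variable (hP : IsFlatClass P)
include hP

/-- The complex `X` itself may be unbounded: exactness of its steps in large degrees suffices for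
the construction. This allows resolving the middle object of a roof formed in the unbounded homotopy
category. -/
lemma exists_flatMinus_of_fqis [HasCoproducts.{0} 𝒜] {X : KF n 𝒜} {K : KFminus n 𝒜}
    (s : X ⟶ K.obj) (hs : fqis n 𝒜 s) :
    ∃ (F : KFminus n 𝒜) (w : F.obj ⟶ X), fqis n 𝒜 w ∧ flatMinus n P F := by
  obtain ⟨N, hN⟩ := K.property
  rw [fqis_eq_qisFam] at hs
  obtain ⟨F, f, hF, hF', hf⟩ := exists_flat_resolution hP X.as
    ⟨N + 1, fun t q hq => exactAt_of_qis s (hs t) q (hN q (by omega))⟩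
  exact ⟨⟨⟨F⟩, hF⟩, (HomotopyCategory.quotient _ _).map f, hf, hF'⟩

lemma exists_flatMinus [HasCoproducts.{0} 𝒜] (K : KFminus n 𝒜) :
    ∃ (F : KFminus n 𝒜) (w : F ⟶ K), fqisMinus n 𝒜 w ∧ flatMinus n P F := by
  obtain ⟨F, w, hw, hF⟩ := exists_flatMinus_of_fqis hP (𝟙 K.obj) ((fqis n 𝒜).id_mem _)
  exact ⟨F, ObjectProperty.homMk w, hw, hF⟩

/-- Roofs are first formed among unbounded complexes. Their middle objects are filtered
quasi-isomorphic to bounded above complexes and can thus be replaced by bounded above flat ones. -/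
lemma hasRightCalculusOfFractions_fqisMinus [HasCoproducts.{0} 𝒜] :
    (fqisMinus n 𝒜).HasRightCalculusOfFractions where
  exists_rightFraction {X Y} φ := by
    obtain ⟨ψ, hψ⟩ := MorphismProperty.LeftFraction.exists_rightFraction
      (MorphismProperty.LeftFraction.mk φ.f.hom φ.s.hom φ.hs : (fqis n 𝒜).LeftFraction _ _)
    obtain ⟨F, w, hw, hF⟩ := exists_flatMinus_of_fqis hP ψ.s ψ.hs
    refine ⟨⟨(ObjectProperty.homMk (w ≫ ψ.s) : F ⟶ X), (fqis n 𝒜).comp_mem _ _ hw ψ.hs,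
      ObjectProperty.homMk (w ≫ ψ.f)⟩, ObjectProperty.hom_ext _ ?_⟩
    exact (Category.assoc _ _ _).trans ((congrArg (w ≫ ·) hψ).trans (Category.assoc _ _ _).symm)
  ext {X Y Y'} f g s hs h := by
    obtain ⟨X', t, ht, h'⟩ := MorphismProperty.HasRightCalculusOfFractions.ext (W := fqis n 𝒜)
      f.hom g.hom s.hom hs (congrArg (fun z => z.hom) h)
    obtain ⟨F, w, hw, hF⟩ := exists_flatMinus_of_fqis hP t ht
    refine ⟨F, (ObjectProperty.homMk (w ≫ t) : F ⟶ X), (fqis n 𝒜).comp_mem _ _ hw ht,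
      ObjectProperty.hom_ext _ ?_⟩
    exact (Category.assoc _ _ _).trans ((congrArg (w ≫ ·) h').trans (Category.assoc _ _ _).symm)

/-- A filtered complex is acyclic if morphisms from flat filtered objects to its cycles lift. -/
lemma acycFam_step_of_lift [HasCoproducts.{0} 𝒜] (K : CochainComplex (FiltObj n 𝒜) ℤ)
    (hK : ∀ (k : ℤ) (F : FiltObj n 𝒜) (p : F ⟶ K.X (k + 1)), flatFilt n P F →
      p ≫ K.d (k + 1) (k + 1 + 1) = 0 → ∃ h : F ⟶ K.X k, h ≫ K.d k (k + 1) = p)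
    (t : Steps n) (q : ℤ) : (((step n 𝒜 t).mapHomologicalComplex _).obj K).ExactAt (q + 1) := by
  refine step_exactAt K t q fun {W} y hy hyd => ?_
  -- A flat cover of the filtered kernel of the differential reduces the lifting of all cycles in a
  -- step to the lifting of one filtered morphism.
  obtain ⟨Y, p, hY, hp⟩ := exists_stepEpi hP (kernelFilt (K.d (q + 1) (q + 1 + 1)))
  obtain ⟨h, hh⟩ := hK q Y (p ≫ kernelFiltι _) hY
    ((Category.assoc _ _ _).trans ((congrArg (p ≫ ·) (kernelFiltι_comp _)).trans comp_zero))
  have hl : InStep t (kernelFilt (K.d (q + 1) (q + 1 + 1))) (kernel.lift _ y hyd) := by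
    rw [inStep_kernelFilt, kernel.lift_ι]
    exact hy
  obtain ⟨W', e, he, x, hx, hxe⟩ := hp.exists_lift hl
  refine ⟨W', e, he, x ≫ h.1, hx.map h, (Category.assoc _ _ _).trans ?_⟩
  refine (congrArg (x ≫ ·) (congrArg Subtype.val hh)).trans ?_
  refine (Category.assoc _ _ _).symm.trans
    ((congrArg (· ≫ kernel.ι (K.d (q + 1) (q + 1 + 1)).1) hxe).trans ((Category.assoc _ _ _).trans ?_))
  exact congrArg (e ≫ ·) (kernel.lift_ι _ _ _)

lemma flatFilt_of_biprod {X Y Z : FiltObj n 𝒜} (i₁ : X ⟶ Z) (i₂ : Y ⟶ Z) (p₁ : Z ⟶ X)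
    (p₂ : Z ⟶ Y) (h : p₁ ≫ i₁ + p₂ ≫ i₂ = 𝟙 Z) (hX : flatFilt n P X) (hY : flatFilt n P Y) :
    flatFilt n P Z := fun q => by
  let M : Bool → 𝒜 := fun b => bif b then (sumQuot n 𝒜 q).obj X else (sumQuot n 𝒜 q).obj Y
  have hM : ∀ b, P (M b) := fun b => by cases b; exacts [hY q, hX q]
  refine hP.retract ((sumQuot n 𝒜 q).map p₁ ≫ Sigma.ι M true + (sumQuot n 𝒜 q).map p₂ ≫
    Sigma.ι M false) (Sigma.desc fun b => match b with
      | true => (sumQuot n 𝒜 q).map i₁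
      | false => (sumQuot n 𝒜 q).map i₂) ?_ (hP.sigma M hM)
  rw [Preadditive.add_comp, Category.assoc, Category.assoc, Sigma.ι_desc, Sigma.ι_desc,
    ← Functor.map_comp, ← Functor.map_comp, ← Functor.map_add, h,
    CategoryTheory.Functor.map_id]

open CochainComplex in
lemma flatFilt_mappingCone {K L : CochainComplex (FiltObj n 𝒜) ℤ} (f : K ⟶ L)
    (hK : ∀ q, flatFilt n P (K.X q)) (hL : ∀ q, flatFilt n P (L.X q)) (q : ℤ) :
    flatFilt n P ((mappingCone f).X q) :=
  flatFilt_of_biprod hP _ _ _ _ (mappingCone.id_X f q (q + 1) rfl) (hK _) (hL _)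

end FlatResolution

/-! ### Left adjoints and quotients by sums of steps. -/

section LeftAdjoint

variable {n : ℕ} {𝒜 : Type u} [Category.{v} 𝒜] [Abelian 𝒜] {ℬ : Type u₁} [Category.{v₁} ℬ]
  [Abelian ℬ] {L : 𝒜 ⥤ ℬ} {R : ℬ ⥤ 𝒜} (adj : L ⊣ R)

lemma arrow_comp_eq_zero_iff {X Y : 𝒜} (S : Subobject X) (f : X ⟶ Y) :
    S.arrow ≫ f = 0 ↔ S ≤ kernelSubobject f := by
  constructor
  · exact le_kernelSubobject f S
  · intro h
    rw [← Subobject.ofLE_arrow h, Category.assoc, kernelSubobject_arrow_comp, comp_zero]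

include adj in
lemma map_comp_eq_zero_iff [L.Additive] {X Y : 𝒜} {Z : ℬ} (s : X ⟶ Y) (g : L.obj Y ⟶ Z) :
    L.map s ≫ g = 0 ↔ s ≫ adj.homEquiv _ _ g = 0 := by
  have : R.Additive := adj.right_adjoint_additive
  rw [← adj.homEquiv_naturality_left]
  have h : adj.homEquiv X Z 0 = 0 := by simp [Adjunction.homEquiv_unit]
  rw [← h, EmbeddingLike.apply_eq_iff_eq]

include adj in
-- A morphism kills a sum exactly when it kills every term. For one term, killing the image of `L`
-- of a step is the same as the transpose killing that step.
lemma mapFilt_sum_arrow_comp [L.Additive] (X : FiltObj n 𝒜) (q : Sums n) {Z : ℬ}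
    (g : L.obj X.obj ⟶ Z) :
    (((mapFilt n L).obj X).sum q).arrow ≫ g = 0 ↔ L.map (X.sum q).arrow ≫ g = 0 := by
  have e₁ := map_comp_eq_zero_iff adj (X.sum q).arrow g
  have e₂ := arrow_comp_eq_zero_iff (X.sum q) (adj.homEquiv _ _ g)
  refine (arrow_comp_eq_zero_iff _ g).trans (Iff.trans ?_ (e₁.trans e₂).symm)
  have key (i : Fin n) (a : WithBot ℤ) : ((mapFilt n L).obj X).filBot i a ≤ kernelSubobject g ↔
      X.filBot i a ≤ kernelSubobject (adj.homEquiv _ _ g) := by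
    induction a with
    | bot =>
      rw [FiltObj.filBot_bot, FiltObj.filBot_bot]
      exact ⟨fun _ => bot_le, fun _ => bot_le⟩
    | coe k =>
      rw [FiltObj.filBot_coe, FiltObj.filBot_coe, ← arrow_comp_eq_zero_iff (X.fil i k),
        ← map_comp_eq_zero_iff adj]
      refine (arrow_comp_eq_zero_iff (imageSubobject (L.map (X.fil i k).arrow)) g).symm.trans ?_
      constructor
      · intro h
        rw [← imageSubobject_arrow_comp (L.map (X.fil i k).arrow), Category.assoc, h, comp_zero]
      · intro h
        rw [← cancel_epi (factorThruImageSubobject (L.map (X.fil i k).arrow)), ← Category.assoc,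
          imageSubobject_arrow_comp, h, comp_zero]
  constructor
  · intro h
    exact X.sum_le fun i => (key i _).1 ((FiltObj.le_sum _ q i).trans h)
  · intro h
    exact ((mapFilt n L).obj X).sum_le fun i => (key i _).2 ((FiltObj.le_sum _ q i).trans h)

include adj in
lemma sum_condition [L.Additive] (X : FiltObj n 𝒜) (q : Sums n) :
    (((mapFilt n L).obj X).sum q).arrow ≫ L.map (cokernel.π (X.sum q).arrow) = 0 :=
  (mapFilt_sum_arrow_comp adj X q _).2
    (by rw [← L.map_comp, cokernel.condition, Functor.map_zero])

/-- The comparison of the quotients by sums of steps with the left adjoint of the quotients. -/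
def sumQuotHom [L.Additive] (X : FiltObj n 𝒜) (q : Sums n) :
    (sumQuot n ℬ q).obj ((mapFilt n L).obj X) ⟶ L.obj ((sumQuot n 𝒜 q).obj X) :=
  cokernel.desc _ (L.map (cokernel.π (X.sum q).arrow)) (sum_condition adj X q)

lemma π_sumQuotHom [L.Additive] (X : FiltObj n 𝒜) (q : Sums n) :
    cokernel.π (((mapFilt n L).obj X).sum q).arrow ≫ sumQuotHom adj X q =
      L.map (cokernel.π (X.sum q).arrow) :=
  cokernel.π_desc _ _ _

/-- Both objects are quotients of `L.obj X.obj`, the second because `L` preserves cokernels, and the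
previous lemmas show that the same morphisms factor through them. -/
lemma isIso_sumQuotHom [L.Additive] (X : FiltObj n 𝒜) (q : Sums n) : IsIso (sumQuotHom adj X q) := by
  have : L.IsLeftAdjoint := adj.isLeftAdjoint
  have h := isColimitOfHasCokernelOfPreservesColimit L (X.sum q).arrow
  have hc : L.map (X.sum q).arrow ≫ cokernel.π (((mapFilt n L).obj X).sum q).arrow = 0 :=
    (mapFilt_sum_arrow_comp adj X q _).1 (cokernel.condition _)
  let r : L.obj (cokernel (X.sum q).arrow) ⟶ cokernel (((mapFilt n L).obj X).sum q).arrow :=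
    h.desc (CokernelCofork.ofπ _ hc)
  have hr : L.map (cokernel.π (X.sum q).arrow) ≫ r =
    cokernel.π (((mapFilt n L).obj X).sum q).arrow := h.fac _ WalkingParallelPair.one
  have : Epi (L.map (cokernel.π (X.sum q).arrow)) := inferInstance
  refine ⟨r, (cancel_epi (cokernel.π (((mapFilt n L).obj X).sum q).arrow)).1 ?_,
    (cancel_epi (L.map (cokernel.π (X.sum q).arrow))).1 ?_⟩
  · exact (Category.assoc _ _ _).symm.trans ((congrArg (· ≫ r) (π_sumQuotHom adj X q)).trans
      (hr.trans (Category.comp_id _).symm))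
  · exact (Category.assoc _ _ _).symm.trans ((congrArg (· ≫ sumQuotHom adj X q) hr).trans
      ((π_sumQuotHom adj X q).trans (Category.comp_id _).symm))

/-- A left adjoint commutes with the quotients by sums of steps. -/
def sumQuotIso [L.Additive] (q : Sums n) :
    mapFilt n L ⋙ sumQuot n ℬ q ≅ sumQuot n 𝒜 q ⋙ L :=
  have := fun X => isIso_sumQuotHom (n := n) adj X q
  NatIso.ofComponents (fun X => asIso (sumQuotHom adj X q)) fun {X Y} f => by
    refine (cancel_epi (cokernel.π (((mapFilt n L).obj X).sum q).arrow)).1 ?_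
    have h₁ : cokernel.π (((mapFilt n L).obj X).sum q).arrow ≫
        (sumQuot n ℬ q).map ((mapFilt n L).map f) =
        L.map f.1 ≫ cokernel.π (((mapFilt n L).obj Y).sum q).arrow := kappa_π_app ((mapFilt n L).map f) q
    have h₂ : cokernel.π (X.sum q).arrow ≫ (sumQuot n 𝒜 q).map f =
      f.1 ≫ cokernel.π (Y.sum q).arrow := kappa_π_app f q
    refine (Category.assoc _ _ _).symm.trans ((congrArg (· ≫ sumQuotHom adj Y q) h₁).trans
      ((Category.assoc _ _ _).trans ((congrArg (L.map f.1 ≫ ·) (π_sumQuotHom adj Y q)).trans ?_)))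
    refine Eq.symm ((Category.assoc _ _ _).symm.trans
      ((congrArg (· ≫ L.map ((sumQuot n 𝒜 q).map f)) (π_sumQuotHom adj X q)).trans ?_))
    exact (L.map_comp _ _).symm.trans ((congrArg L.map h₂).trans (L.map_comp _ _))

variable {P : ObjectProperty 𝒜} {P' : ObjectProperty ℬ} [L.Additive]

include adj in
lemma flatFilt_mapFilt (hP' : IsFlatClass P') (hL : IsFlatFunctor L P P') {X : FiltObj n 𝒜}
    (hX : flatFilt n P X) : flatFilt n P' ((mapFilt n L).obj X) := fun q =>
  hP'.retract ((sumQuotIso adj q).hom.app X) ((sumQuotIso adj q).inv.app X)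
    ((sumQuotIso adj q).hom_inv_id_app X) (hL.obj _ (hX q))

include adj in
lemma acycFam_mapKF (hL : IsFlatFunctor L P P') (K : KF n 𝒜)
    (hK : isBoundedAbove n 𝒜 K) (hK' : ∀ q, flatFilt n P (K.as.X q))
    (h : acycFam (sumQuot n 𝒜) K) : acycFam (sumQuot n ℬ) ((mapKF n L).obj K) := fun q => by
  have hq := (acyc_iff (sumQuot n 𝒜 q ⋙ L) K).2 (hL.acyclic
    (((sumQuot n 𝒜 q).mapHomologicalComplex _).obj K.as)
    (hK.imp fun N hN p hp => (sumQuot n 𝒜 q).map_isZero (hN p hp)) (fun p => hK' p q)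
    ((acyc_iff _ _).1 (h q)))
  exact (acyc_iff _ _).2 ((acyc_iff (mapFilt n L ⋙ sumQuot n ℬ q) K).1
    (acyc_of_iso (sumQuotIso adj q).symm hq))

open CochainComplex in
include adj in
/-- A flat functor preserves filtered quasi-isomorphisms between flat complexes. -/
lemma fqis_mapKF_of_flat (hn : 1 ≤ n) (hn' : n ≤ 2) (hP : IsFlatClass P)
    (hL : IsFlatFunctor L P P') {X Y : KFminus n 𝒜} (s : X ⟶ Y) (hs : fqisMinus n 𝒜 s)
    (hX : flatMinus n P X) (hY : flatMinus n P Y) :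
    fqisMinus n ℬ ((mapKFminus n L).map s) := by
  obtain ⟨f, hf⟩ := (HomotopyCategory.quotient _ _).map_surjective s.hom
  have hT := HomotopyCategory.mappingCone_triangleh_distinguished f
  have hT' := (mapKF n L).map_distinguished _ hT
  have h₁ := qisFam_iff_of_distinguished (sumQuot n 𝒜) _ hT
  have h₂ := qisFam_iff_of_distinguished (sumQuot n ℬ) _ hT'
  change fqis n ℬ ((mapKF n L).map s.hom)
  change fqis n 𝒜 s.hom at hs
  rw [fqis_eq_qisFam_sumQuot hn hn'] at hs ⊢
  rw [← hf] at hs ⊢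
  -- The cone is bounded above, flat and acyclic, hence stays acyclic under `L`; and `mapKF n L`
  -- carries the cone triangle to a distinguished one.
  refine h₂.2 (acycFam_mapKF adj hL _ ?_ (flatFilt_mappingCone hP f hX hY) (h₁.1 hs))
  obtain ⟨N, hN⟩ := X.property
  obtain ⟨N', hN'⟩ := Y.property
  refine ⟨max N N', fun q hq => ?_⟩
  exact (mappingCone.isZero_X_iff f q).2 ⟨hN _ (by omega), hN' _ (by omega)⟩

end LeftAdjoint

/-! ### Right adjoints and intersections of steps. -/

section RightAdjoint

variable {n : ℕ} {𝒜 : Type u} [Category.{v} 𝒜] [Abelian 𝒜] {ℬ : Type u₁} [Category.{v₁} ℬ]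
  [Abelian ℬ] {L : ℬ ⥤ 𝒜} {R : 𝒜 ⥤ ℬ} (adj : L ⊣ R)

omit [Abelian 𝒜] in
-- A right adjoint preserves monomorphisms, so the image in the definition of the filtration is `R`
-- of the step itself, and factorisations correspond under adjunction.
lemma image_map_factors_iff {Y : 𝒜} (S : Subobject Y) {W : ℬ} (w : W ⟶ R.obj Y) :
    (imageSubobject (R.map S.arrow)).Factors w ↔ S.Factors ((adj.homEquiv _ _).symm w) := by
  have : R.IsRightAdjoint := adj.isRightAdjoint
  have hm : Mono (R.map S.arrow) := inferInstance
  constructor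
  · intro h
    have : IsIso (factorThruImageSubobject (R.map S.arrow)) :=
      have : Mono (factorThruImageSubobject (R.map S.arrow)) := by
        refine mono_of_mono_fac (imageSubobject_arrow_comp (R.map S.arrow))
      isIso_of_mono_of_epi _
    have e : (Subobject.factorThru _ w h ≫ inv (factorThruImageSubobject (R.map S.arrow))) ≫
        R.map S.arrow = w := by
      have h' : inv (factorThruImageSubobject (R.map S.arrow)) ≫ R.map S.arrow =
          (imageSubobject (R.map S.arrow)).arrow := by
        rw [IsIso.inv_comp_eq]
        exact (imageSubobject_arrow_comp _).symm
      rw [Category.assoc, h', Subobject.factorThru_arrow]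
    rw [← e, adj.homEquiv_naturality_right_symm]
    exact Subobject.factors_comp_arrow _
  · intro h
    have e : w = adj.homEquiv _ _ (Subobject.factorThru _ _ h) ≫ R.map S.arrow := by
      rw [← adj.homEquiv_naturality_right, Subobject.factorThru_arrow, Equiv.apply_symm_apply]
    rw [e]
    exact Subobject.factors_of_factors_right _ (image_factors_self _)

lemma inStep_mapFilt (t : Steps n) (X : FiltObj n 𝒜) {W : ℬ} (w : W ⟶ R.obj X.obj) :
    InStep t ((mapFilt n R).obj X) w ↔ InStep t X ((adj.homEquiv _ _).symm w) := by
  obtain _ | ⟨i, k⟩ := t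
  · exact ⟨fun _ => inStep_none _ _, fun _ => inStep_none _ _⟩
  · exact (inStep_some i k ((mapFilt n R).obj X) w).trans
      ((forall_congr' fun j => image_map_factors_iff adj _ w).trans (inStep_some _ _ _ _).symm)

include adj in
lemma inStep_mapFilt_map (t : Steps n) (X : FiltObj n 𝒜) :
    InStep t ((mapFilt n R).obj X) (R.map (stepι t X)) := by
  rw [inStep_mapFilt adj, ← Category.id_comp (R.map (stepι t X)),
    adj.homEquiv_naturality_right_symm]
  exact ⟨_, rfl⟩

/-- A right adjoint commutes with the intersections of steps. -/
def stepIso (t : Steps n) : step n 𝒜 t ⋙ R ≅ mapFilt n R ⋙ step n ℬ t :=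
  have : R.IsRightAdjoint := adj.isRightAdjoint
  have hm (X : FiltObj n 𝒜) : Mono (R.map (stepι t X)) := inferInstance
  have h₂ (X : FiltObj n 𝒜) : ∃ y, y ≫ R.map (stepι t X) = stepι t ((mapFilt n R).obj X) := by
    obtain ⟨z, hz⟩ := (inStep_mapFilt adj t X _).1 ⟨𝟙 _, Category.id_comp _⟩
    refine ⟨adj.homEquiv _ _ z, ?_⟩
    exact (adj.homEquiv_naturality_right _ _).symm.trans
      ((congrArg (adj.homEquiv _ _) hz).trans ((adj.homEquiv _ _).apply_symm_apply _))
  NatIso.ofComponents (fun X =>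
    { hom := (inStep_mapFilt_map adj t X).choose
      inv := (h₂ X).choose
      hom_inv_id := (cancel_mono (R.map (stepι t X))).1 ((Category.assoc _ _ _).trans
        ((congrArg (_ ≫ ·) (h₂ X).choose_spec).trans
          ((inStep_mapFilt_map adj t X).choose_spec.trans (Category.id_comp _).symm)))
      inv_hom_id := (cancel_mono (stepι t ((mapFilt n R).obj X))).1 ((Category.assoc _ _ _).trans
        ((congrArg (_ ≫ ·) (inStep_mapFilt_map adj t X).choose_spec).trans
          ((h₂ X).choose_spec.trans (Category.id_comp _).symm))) })
    fun {X Y} f => (cancel_mono (stepι t ((mapFilt n R).obj Y))).1 (by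
      refine (Category.assoc _ _ _).trans
        ((congrArg (_ ≫ ·) (inStep_mapFilt_map adj t Y).choose_spec).trans ?_)
      refine Eq.symm ((Category.assoc _ _ _).trans ((congrArg (_ ≫ ·)
        (step_map_ι t ((mapFilt n R).map f))).trans ((Category.assoc _ _ _).symm.trans
        ((congrArg (· ≫ R.map f.1) (inStep_mapFilt_map adj t X).choose_spec).trans ?_))))
      exact (R.map_comp _ _).symm.trans ((congrArg R.map (step_map_ι t f).symm).trans
        (R.map_comp _ _)))

include adj in
/-- An exact right adjoint preserves filtered quasi-isomorphisms. -/
lemma fqis_mapKF_of_exact [R.Additive] [PreservesFiniteColimits R] {X Y : KF n 𝒜} (s : X ⟶ Y)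
    (hs : fqis n 𝒜 s) : fqis n ℬ ((mapKF n R).map s) := by
  have : R.IsRightAdjoint := adj.isRightAdjoint
  obtain ⟨f, rfl⟩ := (HomotopyCategory.quotient _ _).map_surjective s
  have hT := HomotopyCategory.mappingCone_triangleh_distinguished f
  have hT' := (mapKF n R).map_distinguished _ hT
  have h₁ := qisFam_iff_of_distinguished (step n 𝒜) _ hT
  have h₂ := qisFam_iff_of_distinguished (step n ℬ) _ hT'
  rw [fqis_eq_qisFam] at hs ⊢
  refine h₂.2 fun t => (acyc_iff _ _).2 ((acyc_iff (mapFilt n R ⋙ step n ℬ t)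
    ((CochainComplex.mappingCone.triangleh f).obj₃)).1 (acyc_of_iso (stepIso adj t)
      ((acyc_iff (step n 𝒜 t ⋙ R) _).2 fun q => ?_)))
  have h := (acyc_iff _ _).1 (h₁.1 hs t) q
  exact h.map R

end RightAdjoint

/-! ### Change of the indices of filtrations. -/

section Twist

variable {n : ℕ} {𝒜 : Type u} [Category.{v} 𝒜] [Abelian 𝒜]

/-- A filtered object with the indices of the filtrations changed. -/
abbrev twistObj (ρ : Fin n → ℤ →o WithBot ℤ) (X : FiltObj n 𝒜) : FiltObj n 𝒜 where
  obj := X.obj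
  fil a := (X.filBot a).comp (ρ a)

/-- The functor changing the indices of the filtrations. -/
abbrev twist (ρ : Fin n → ℤ →o WithBot ℤ) : FiltObj n 𝒜 ⥤ FiltObj n 𝒜 where
  obj X := twistObj ρ X
  map {X Y} f := ⟨f.1, fun a l =>
    (le_pullback_iff f.1 (X.filBot a (ρ a l)) (Y.filBot a (ρ a l))).1
      (FiltObj.filBot_le_pullback f a (ρ a l))⟩
  map_id _ := rfl
  map_comp _ _ := rfl

instance (ρ : Fin n → ℤ →o WithBot ℤ) : (twist (𝒜 := 𝒜) ρ).Additive where

/-- The change of indices of sums of steps. -/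
def Sums.twist (ρ : Fin n → ℤ →o WithBot ℤ) (q : Sums n) : Sums n :=
  fun a => (q a).recBotCoe ⊥ (ρ a)

lemma twistObj_sum (ρ : Fin n → ℤ →o WithBot ℤ) (X : FiltObj n 𝒜) (q : Sums n) :
    (twistObj ρ X).sum q = X.sum (q.twist ρ) := by
  refine congrArg (fun f : Fin n → Subobject X.obj => Finset.univ.sup f) (funext fun a => ?_)
  change (twistObj ρ X).filBot a (q a) = X.filBot a ((q a).recBotCoe ⊥ (ρ a))
  induction q a using WithBot.recBotCoe <;> rfl

lemma le_pullback_id {X : 𝒜} {S T : Subobject X} (h : S ≤ T) :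
    S ≤ (Subobject.pullback (𝟙 X)).obj T := by
  rwa [Subobject.pullback_id]

lemma quoMap_id_comp_quoMap_id {X : 𝒜} {S T : Subobject X}
    (h : S ≤ (Subobject.pullback (𝟙 X)).obj T) (h' : T ≤ (Subobject.pullback (𝟙 X)).obj S) :
    quoMap (𝟙 X) h ≫ quoMap (𝟙 X) h' = 𝟙 _ := by
  rw [← cancel_epi (cokernel.π S.arrow), ← Category.assoc, π_quoMap, Category.assoc, π_quoMap,
    Category.id_comp, Category.id_comp, Category.comp_id]

/-- The quotients of a filtered object with changed indices. -/
def sumQuotTwistIso (ρ : Fin n → ℤ →o WithBot ℤ) (q : Sums n) :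
    twist ρ ⋙ sumQuot n 𝒜 q ≅ sumQuot n 𝒜 (q.twist ρ) :=
  NatIso.ofComponents (fun X =>
    { hom := quoMap (S := (twistObj ρ X).sum q) (T := X.sum (q.twist ρ)) (𝟙 X.obj)
        (le_pullback_id (twistObj_sum ρ X q).le)
      inv := quoMap (S := X.sum (q.twist ρ)) (T := (twistObj ρ X).sum q) (𝟙 X.obj)
        (le_pullback_id (twistObj_sum ρ X q).ge)
      hom_inv_id := quoMap_id_comp_quoMap_id _ _
      inv_hom_id := quoMap_id_comp_quoMap_id _ _ })
    fun {X Y} f => (cancel_epi (cokernel.π ((twistObj ρ X).sum q).arrow)).1 (by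
      have h₁ := kappa_π_app ((twist ρ).map f) q
      have h₂ := kappa_π_app f (q.twist ρ)
      have e (Z : FiltObj n 𝒜) : cokernel.π ((twistObj ρ Z).sum q).arrow ≫
          quoMap (S := (twistObj ρ Z).sum q) (T := Z.sum (q.twist ρ)) (𝟙 Z.obj)
            (le_pullback_id (twistObj_sum ρ Z q).le) = cokernel.π (Z.sum (q.twist ρ)).arrow :=
        (π_quoMap _ _).trans (Category.id_comp _)
      refine (Category.assoc _ _ _).symm.trans ((congrArg (· ≫ _) h₁).trans
        ((Category.assoc _ _ _).trans ((congrArg (f.1 ≫ ·) (e Y)).trans ?_)))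
      exact Eq.symm ((Category.assoc _ _ _).symm.trans ((congrArg (· ≫ _) (e X)).trans h₂)))

lemma flatFilt_twist {P : ObjectProperty 𝒜} (hP : IsFlatClass P) (ρ : Fin n → ℤ →o WithBot ℤ)
    {X : FiltObj n 𝒜} (hX : flatFilt n P X) : flatFilt n P (twistObj ρ X) := fun q =>
  hP.retract ((sumQuotTwistIso ρ q).hom.app X) ((sumQuotTwistIso ρ q).inv.app X)
    ((sumQuotTwistIso ρ q).hom_inv_id_app X) (hX _)

lemma acycFam_mapK_twist (ρ : Fin n → ℤ →o WithBot ℤ) {K : KF n 𝒜}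
    (h : acycFam (sumQuot n 𝒜) K) : acycFam (sumQuot n 𝒜) ((mapK (twist ρ)).obj K) := fun q =>
  (acyc_iff _ _).2 ((acyc_iff (twist ρ ⋙ sumQuot n 𝒜 q) K).1
    (acyc_of_iso (sumQuotTwistIso ρ q).symm (h (q.twist ρ))))

lemma fqis_mapK_twist (hn : 1 ≤ n) (hn' : n ≤ 2) (ρ : Fin n → ℤ →o WithBot ℤ) {X Y : KF n 𝒜}
    (s : X ⟶ Y) (hs : fqis n 𝒜 s) : fqis n 𝒜 ((mapK (twist ρ)).map s) := by
  obtain ⟨f, rfl⟩ := (HomotopyCategory.quotient _ _).map_surjective s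
  have hT := HomotopyCategory.mappingCone_triangleh_distinguished f
  have hT' := (mapK (twist ρ)).map_distinguished _ hT
  have h₁ := qisFam_iff_of_distinguished (sumQuot n 𝒜) _ hT
  have h₂ := qisFam_iff_of_distinguished (sumQuot n 𝒜) _ hT'
  rw [fqis_eq_qisFam_sumQuot hn hn'] at hs ⊢
  exact h₂.2 (acycFam_mapK_twist ρ (h₁.1 hs))

/-- The change of indices that corresponds to an intersection of steps. -/
def twistOf : Steps n → Fin n → ℤ →o WithBot ℤ
  -- All steps become zero, so every morphism out of the twist is filtered.
  | none => fun _ => ⟨fun _ => ⊥, fun _ _ _ => le_rfl⟩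
  | some (i, k) => fun a =>
    -- A filtered morphism out of the twist has to send the step `l - k j` of filtration `a` into
    -- step `l`, for every `j` with `i j = a`; these are the shifts by `k j` in the definition of
    -- the filtered `Hom`. If no such `j` exists, the supremum is `⊥` and imposes nothing.
    ⟨fun l => (Finset.univ.filter fun j => i j = a).sup fun j => ((l - k j : ℤ) : WithBot ℤ),
      fun _ _ h => Finset.sup_mono_fun fun _ _ => WithBot.coe_le_coe.2 (by omega)⟩

lemma filBot_sup_le {X : FiltObj n 𝒜} {a : Fin n} {ι : Type} (s : Finset ι) (g : ι → WithBot ℤ)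
    (S : Subobject X.obj) : X.filBot a (s.sup g) ≤ S ↔ ∀ j ∈ s, X.filBot a (g j) ≤ S := by
  rw [Finset.apply_sup_eq_sup_comp_of_linearOrder _ (X.filBot a).monotone (X.filBot_bot a),
    Finset.sup_le_iff]
  rfl

variable (B : Type w) [CommRing B] [Linear B 𝒜]

lemma mem_homSubgroup_twist_none (X Y : FiltObj n 𝒜) (f : X.obj ⟶ Y.obj) :
    f ∈ homSubgroup (twistObj (twistOf none) X) Y := fun i l =>
  (le_pullback_iff f (X.filBot i ⊥) (Y.fil i l)).1 bot_le

lemma mem_homSubgroup_twist_some (i : Fin n → Fin n) (k : Fin n → ℤ) (X Y : FiltObj n 𝒜)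
    (f : X.obj ⟶ Y.obj) : f ∈ homSubgroup (twistObj (twistOf (some (i, k))) X) Y ↔
      ∀ j, f ∈ homFil B X Y (i j) (k j) := by
  have h : f ∈ homSubgroup (twistObj (twistOf (some (i, k))) X) Y ↔ ∀ (a : Fin n) (l : ℤ),
      ∀ j ∈ Finset.univ.filter fun j => i j = a,
        X.filBot a ((l - k j : ℤ) : WithBot ℤ) ≤ (Subobject.pullback f).obj (Y.fil a l) :=
    forall_congr' fun a => forall_congr' fun l => by
      refine (le_pullback_iff f (X.filBot a (twistOf (some (i, k)) a l)) _).symm.trans ?_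
      change X.filBot a ((Finset.univ.filter fun j => i j = a).sup
        fun j => ((l - k j : ℤ) : WithBot ℤ)) ≤ _ ↔ _
      exact filBot_sup_le _ _ _
  rw [h]
  constructor
  · intro h j l
    have := h (i j) (l + k j) j (by simp)
    rw [add_sub_cancel_right] at this
    exact (le_pullback_iff f _ _).1 this
  · intro h a l j hj
    obtain rfl : i j = a := by simpa using hj
    have := h j (l - k j)
    rw [sub_add_cancel] at this
    exact (le_pullback_iff f _ _).2 this

end Twist

/-! ### Lifting cochains by means of homotopy classes. -/

section Generic

variable {𝒟 : Type u} [Category.{v} 𝒟] [Preadditive 𝒟]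

open CochainComplex HomComplex

lemma ofHom_comp_comp_ofHom_v {K K' L L' : CochainComplex 𝒟 ℤ} (f : K' ⟶ K) (g : L ⟶ L') {m : ℤ}
    (z : Cochain K L m) (p q : ℤ) (hpq : p + m = q) :
    (((Cochain.ofHom f).comp z (zero_add m)).comp (Cochain.ofHom g) (add_zero m)).v p q hpq =
      f.f p ≫ z.v p q hpq ≫ g.f q := by
  simp

/-- A morphism of `Hom` complexes that is bijective on homotopy classes in all degrees lifts. -/
lemma exists_cochain_lift {K K' L L' : CochainComplex 𝒟 ℤ} (f : K' ⟶ K) (g : L ⟶ L')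
    (H : ∀ m : ℤ, Function.Bijective fun φ : (HomotopyCategory.quotient _ _).obj K ⟶
      (HomotopyCategory.quotient _ _).obj (L⟦m⟧) =>
        (HomotopyCategory.quotient _ _).map f ≫ φ ≫ (HomotopyCategory.quotient _ _).map (g⟦m⟧'))
    {q q' q'' q₀ : ℤ} (h : q + 1 = q') (h' : q' + 1 = q'') (h₀ : q₀ + 1 = q)
    (x : Cochain K L q') (hx : δ q' q'' x = 0)
    (y : Cochain K' L' q) (hxy : ((Cochain.ofHom f).comp x (zero_add q')).comp (Cochain.ofHom g)
      (add_zero q') = δ q q' y) :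
    ∃ (z : Cochain K L q) (y' : Cochain K' L' q₀), δ q q' z = x ∧
      y = ((Cochain.ofHom f).comp z (zero_add q)).comp (Cochain.ofHom g) (add_zero q) +
        δ q₀ q y' := by
  have key {m : ℤ} (c : Cocycle K L m) :
      (HomotopyCategory.quotient _ _).map f ≫ CohomologyClass.toHom (.mk c) ≫
        (HomotopyCategory.quotient _ _).map (g⟦m⟧') =
      CohomologyClass.toHom (.mk ((c.precomp f).postcomp g)) := by
    rw [CohomologyClass.toHom_mk, CohomologyClass.toHom_mk, Cocycle.equivHomShift_symm_postcomp,
      Cocycle.equivHomShift_symm_precomp, Functor.map_comp, Functor.map_comp, Category.assoc]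
  let X : Cocycle K L q' := Cocycle.mk x q'' h' hx
  -- The image of the class of `x` is bounded by `y`, so injectivity makes `x` itself a coboundary.
  have hX : CohomologyClass.toHom (.mk X) = 0 := by
    apply (H q').1
    change (HomotopyCategory.quotient _ _).map f ≫ CohomologyClass.toHom (.mk X) ≫
        (HomotopyCategory.quotient _ _).map (g⟦q'⟧') = (HomotopyCategory.quotient _ _).map f ≫ 0 ≫
        (HomotopyCategory.quotient _ _).map (g⟦q'⟧')
    rw [key, zero_comp, comp_zero, CohomologyClass.toHom_mk_eq_zero_iff, mem_coboundaries_iff _ q h]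
    exact ⟨y, hxy.symm⟩
  rw [CohomologyClass.toHom_mk_eq_zero_iff, mem_coboundaries_iff _ q h] at hX
  obtain ⟨z, hz⟩ := hX
  have hz' : δ q q' z = x := hz
  -- What remains of `y` is a cocycle. By surjectivity its class comes from a cocycle on `K`, by
  -- which `z` is corrected without changing its coboundary.
  let Y : Cocycle K' L' q := Cocycle.mk
    (y - ((Cochain.ofHom f).comp z (zero_add q)).comp (Cochain.ofHom g) (add_zero q)) q' h
      (by rw [δ_sub, δ_comp_ofHom, δ_ofHom_comp, hz', hxy, sub_self])
  obtain ⟨φ, hφ⟩ := (H q).2 (CohomologyClass.toHom (.mk Y))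
  obtain ⟨c, rfl⟩ := (CohomologyClass.toHom_bijective K L q).2 φ
  obtain ⟨c, rfl⟩ := CohomologyClass.mk_surjective c
  change (HomotopyCategory.quotient _ _).map f ≫ CohomologyClass.toHom (.mk c) ≫
        (HomotopyCategory.quotient _ _).map (g⟦q⟧') = _ at hφ
  rw [key, ← sub_eq_zero, ← map_sub, ← CohomologyClass.mk_sub,
    CohomologyClass.toHom_mk_eq_zero_iff, mem_coboundaries_iff _ q₀ h₀] at hφ
  obtain ⟨b, hb⟩ := hφ
  have hb' : δ q₀ q b = ((Cochain.ofHom f).comp c.1 (zero_add q)).comp (Cochain.ofHom g)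
      (add_zero q) - (y - ((Cochain.ofHom f).comp z (zero_add q)).comp (Cochain.ofHom g)
        (add_zero q)) := hb
  refine ⟨z + c.1, -b, ?_, ?_⟩
  · rw [δ_add, hz', Cocycle.δ_eq_zero c, add_zero]
  · rw [δ_neg, hb', Cochain.comp_add, Cochain.add_comp]
    abel

end Generic

/-! ### Filtration steps of `Hom` complexes. -/

section HomCx

open CochainComplex HomComplex

variable {n : ℕ} {𝒜 : Type u} [Category.{v} 𝒜] [Abelian 𝒜] (B : Type v) [CommRing B] [Linear B 𝒜]

/-- The cochains in an intersection of steps. -/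
def stepCochain (E F : CochainComplex (FiltObj n 𝒜) ℤ) (m : ℤ) :
    Steps n → Submodule B (Cochain (und E) (und F) m)
  | none => ⊤
  | some (i, k) => ⨅ j, cochainFil B E F m (i j) (k j)

variable {B}

/-- This identifies a step of the `Hom` complex with a complex of filtered morphisms, whose
cohomology consists of homotopy classes of morphisms from the twisted complex to shifts. -/
lemma mem_stepCochain_iff {E F : CochainComplex (FiltObj n 𝒜) ℤ} {m : ℤ} {t : Steps n}
    (z : Cochain (und E) (und F) m) : z ∈ stepCochain B E F m t ↔ ∀ (p q : ℤ) (hpq : p + m = q),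
      z.v p q hpq ∈ homSubgroup (twistObj (twistOf t) (E.X p)) (F.X q) := by
  obtain _ | ⟨i, k⟩ := t
  · exact ⟨fun _ p q hpq => mem_homSubgroup_twist_none _ _ _, fun _ => Submodule.mem_top⟩
  · have h (p q : ℤ) (hpq : p + m = q) :=
      mem_homSubgroup_twist_some B i k (E.X p) (F.X q) (z.v p q hpq)
    change z ∈ ⨅ j, cochainFil B E F m (i j) (k j) ↔ _
    rw [Submodule.mem_iInf]
    exact ⟨fun H p q hpq => (h p q hpq).2 fun j => H j p q hpq,
      fun H j p q hpq => (h p q hpq).1 (H p q hpq) j⟩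

/-- The twist of a filtered complex. -/
abbrev twistCx (t : Steps n) (E : CochainComplex (FiltObj n 𝒜) ℤ) :
    CochainComplex (FiltObj n 𝒜) ℤ :=
  ((twist (twistOf t)).mapHomologicalComplex _).obj E

/-- The cochain in an intersection of steps given by a filtered cochain on the twist. -/
def ofTwist {t : Steps n} {E F : CochainComplex (FiltObj n 𝒜) ℤ} {m : ℤ}
    (c : Cochain (twistCx t E) F m) : Cochain (und E) (und F) m :=
  c.map (forget n 𝒜)

lemma ofTwist_mem {t : Steps n} {E F : CochainComplex (FiltObj n 𝒜) ℤ} {m : ℤ}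
    (c : Cochain (twistCx t E) F m) : ofTwist c ∈ stepCochain B E F m t :=
  (mem_stepCochain_iff _).2 fun p q hpq => (c.v p q hpq).2

lemma exists_ofTwist {t : Steps n} {E F : CochainComplex (FiltObj n 𝒜) ℤ} {m : ℤ}
    {z : Cochain (und E) (und F) m} (hz : z ∈ stepCochain B E F m t) :
    ∃ c : Cochain (twistCx t E) F m, ofTwist c = z :=
  ⟨Cochain.mk fun p q hpq => ⟨z.v p q hpq, (mem_stepCochain_iff z).1 hz p q hpq⟩, by
    ext p q hpq
    rfl⟩

lemma ofTwist_injective {t : Steps n} {E F : CochainComplex (FiltObj n 𝒜) ℤ} {m : ℤ}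
    {c c' : Cochain (twistCx t E) F m} (h : ofTwist c = ofTwist c') : c = c' := by
  ext p q hpq : 3
  exact Subtype.ext (congrArg (fun z : Cochain (und E) (und F) m => z.v p q hpq) h)

lemma ofTwist_δ {t : Steps n} {E F : CochainComplex (FiltObj n 𝒜) ℤ} {m m' : ℤ}
    (c : Cochain (twistCx t E) F m) : ofTwist (δ m m' c) = δ m m' (ofTwist c) :=
  (δ_map (n := m) (m := m') c (forget n 𝒜)).symm

lemma ofTwist_comp {t : Steps n} {E E' F F' : CochainComplex (FiltObj n 𝒜) ℤ} {m : ℤ}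
    (c : Cochain (twistCx t E) F m) (f : E' ⟶ E) (g : F ⟶ F') :
    ofTwist (((Cochain.ofHom (((twist (twistOf t)).mapHomologicalComplex _).map f)).comp c
      (zero_add m)).comp (Cochain.ofHom g) (add_zero m)) =
    ((Cochain.ofHom (undMap f)).comp (ofTwist c) (zero_add m)).comp (Cochain.ofHom (undMap g))
      (add_zero m) := by
  ext p q hpq
  exact (congrArg Subtype.val (ofHom_comp_comp_ofHom_v _ g c p q hpq)).trans
    (ofHom_comp_comp_ofHom_v (undMap f) (undMap g) (ofTwist c) p q hpq).symm

lemma subobjectModule_symm_factors_iff {M : Type v} [AddCommGroup M] [Module B M]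
    (p : Submodule B M) {W : ModuleCat.{v} B} (w : W ⟶ ModuleCat.of B M) :
    ((ModuleCat.subobjectModule (ModuleCat.of B M)).symm p).Factors w ↔ ∀ a, w.hom a ∈ p := by
  constructor
  · intro h a
    rw [← Subobject.factorThru_arrow _ w h]
    exact subobjectModule_symm_arrow_mem p _
  · intro h
    have : Mono (ModuleCat.ofHom p.subtype) :=
      (ModuleCat.mono_iff_injective _).2 p.injective_subtype
    exact (Subobject.mk_factors_iff (ModuleCat.ofHom p.subtype) w).2
      ⟨ModuleCat.ofHom (LinearMap.codRestrict p w.hom h), rfl⟩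

lemma inStep_homCx {E F : CochainComplex (FiltObj n 𝒜) ℤ} {m : ℤ} {t : Steps n}
    {W : ModuleCat.{v} B} (w : W ⟶ ((homCx B E F).X m).obj) :
    InStep t ((homCx B E F).X m) w ↔
      ∀ a, (w.hom a : Cochain (und E) (und F) m) ∈ stepCochain B E F m t := by
  obtain _ | ⟨i, k⟩ := t
  · exact ⟨fun _ _ => Submodule.mem_top (M := Cochain (und E) (und F) m),
      fun _ => inStep_none _ _⟩
  · refine (inStep_some i k ((homCx B E F).X m) w).trans ?_
    refine (forall_congr' fun j => subobjectModule_symm_factors_iff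
      (M := Cochain (und E) (und F) m) (cochainFil B E F m (i j) (k j)) w).trans ?_
    rw [forall_comm]
    exact forall_congr' fun a => (Submodule.mem_iInf _).symm

/-- If the maps on homotopy classes of morphisms from all twists are bijective, the map on filtered
complexes of homomorphisms is a filtered quasi-isomorphism. -/
lemma fqis_homCxMap {E E' F F' : CochainComplex (FiltObj n 𝒜) ℤ} (f : E' ⟶ E) (g : F ⟶ F')
    (H : ∀ (t : Steps n) (m : ℤ), Function.Bijective
      fun φ : (HomotopyCategory.quotient _ _).obj (twistCx t E) ⟶
          (HomotopyCategory.quotient _ _).obj (F⟦m⟧) =>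
        (HomotopyCategory.quotient _ _).map
          (((twist (twistOf t)).mapHomologicalComplex _).map f) ≫ φ ≫
          (HomotopyCategory.quotient _ _).map (g⟦m⟧')) :
    fqis n (ModuleCat.{v} B) ((HomotopyCategory.quotient _ _).map (homCxMap B f g)) := by
  refine fqis_of_liftsAt _ fun q t W x y hx hy hxd hxy => ?_
  rw [inStep_homCx] at hx hy
  have key (a : W) : ∃ (z : Cochain (und E) (und F) (q + 1)) (y' : Cochain (und E') (und F') q),
      z ∈ stepCochain B E F (q + 1) t ∧ y' ∈ stepCochain B E' F' q t ∧
      δ (q + 1) (q + 1 + 1) z = x.hom a ∧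
      (y.hom a : Cochain (und E') (und F') (q + 1)) =
        ((Cochain.ofHom (undMap f)).comp z (zero_add _)).comp (Cochain.ofHom (undMap g))
          (add_zero _) + δ q (q + 1) y' := by
    obtain ⟨x', hx'⟩ := exists_ofTwist (hx a)
    obtain ⟨y', hy'⟩ := exists_ofTwist (hy a)
    have h₁ : δ (q + 1 + 1) (q + 1 + 1 + 1)
        (x.hom a : Cochain (und E) (und F) (q + 1 + 1)) = 0 :=
      congrArg (fun z => z.hom a) hxd
    have h₂ : ((Cochain.ofHom (undMap f)).comp (x.hom a : Cochain (und E) (und F) (q + 1 + 1))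
        (zero_add _)).comp (Cochain.ofHom (undMap g)) (add_zero _) =
        δ (q + 1) (q + 1 + 1) (y.hom a : Cochain (und E') (und F') (q + 1)) :=
      congrArg (fun z => z.hom a) hxy
    obtain ⟨z, b, hz, hb⟩ := exists_cochain_lift _ g (H t) rfl rfl (rfl : q + 1 = q + 1) x'
      (ofTwist_injective (by
        rw [ofTwist_δ, hx', h₁]
        rfl)) y' (ofTwist_injective (by rw [ofTwist_comp, ofTwist_δ, hx', hy', h₂]))
    refine ⟨ofTwist z, ofTwist b, ofTwist_mem z, ofTwist_mem b, ?_, ?_⟩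
    · rw [← ofTwist_δ, hz, hx']
    · rw [← hy', hb, ← ofTwist_comp, ← ofTwist_δ]
      rfl
  -- The lifts chosen for single elements need not depend linearly on them. The free module on the
  -- underlying set of `W` covers `W`, and on it the choices extend linearly.
  choose z b hz hb h₁ h₂ using key
  refine ⟨ModuleCat.of B (W →₀ B), ModuleCat.ofHom (Finsupp.linearCombination B id), ?_,
    ModuleCat.ofHom (Finsupp.linearCombination B z), ModuleCat.ofHom (Finsupp.linearCombination B b),
    ?_, ?_, ?_, ?_⟩
  · refine (ModuleCat.epi_iff_surjective _).2 fun a => ⟨Finsupp.single a 1, ?_⟩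
    exact (Finsupp.linearCombination_single B _ _).trans (one_smul _ _)
  · refine (inStep_homCx _).2 fun a => ?_
    exact Submodule.sum_mem _ fun i _ => Submodule.smul_mem _ _ (hz i)
  · refine (inStep_homCx _).2 fun a => ?_
    exact Submodule.sum_mem _ fun i _ => Submodule.smul_mem _ _ (hb i)
  · refine ModuleCat.hom_ext (Finsupp.lhom_ext' fun a => LinearMap.ext_ring ?_)
    change δ (q + 1) (q + 1 + 1) (Finsupp.linearCombination B z (Finsupp.single a 1)) =
      x.hom (Finsupp.linearCombination B id (Finsupp.single a 1))
    rw [Finsupp.linearCombination_single, Finsupp.linearCombination_single, one_smul, one_smul]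
    exact h₁ a
  · refine ModuleCat.hom_ext (Finsupp.lhom_ext' fun a => LinearMap.ext_ring ?_)
    change y.hom (Finsupp.linearCombination B id (Finsupp.single a 1)) =
      ((Cochain.ofHom (undMap f)).comp (Finsupp.linearCombination B z (Finsupp.single a 1))
        (zero_add _)).comp (Cochain.ofHom (undMap g)) (add_zero _) +
        δ q (q + 1) (Finsupp.linearCombination B b (Finsupp.single a 1))
    rw [Finsupp.linearCombination_single, Finsupp.linearCombination_single,
      Finsupp.linearCombination_single, one_smul, one_smul, one_smul]
    exact h₂ a

end HomCx

/-! ### Shifts and twists of filtered complexes. -/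

section Shift

variable {n : ℕ} {𝒜 : Type u} [Category.{v} 𝒜] [Abelian 𝒜]

lemma fqis_shift {K L : CochainComplex (FiltObj n 𝒜) ℤ} (f : K ⟶ L)
    (hf : fqis n 𝒜 ((HomotopyCategory.quotient _ _).map f)) (m : ℤ) :
    fqis n 𝒜 ((HomotopyCategory.quotient _ _).map (f⟦m⟧')) := by
  have h : fqis n 𝒜 (((HomotopyCategory.quotient _ _).map f)⟦m⟧') := by
    rw [fqis_eq_qisFam, qisFam_eq_trW] at hf ⊢
    exact MorphismProperty.shift _ hf m
  let e := (HomotopyCategory.quotient (FiltObj n 𝒜) (.up ℤ)).commShiftIso m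
  have h' : (HomotopyCategory.quotient _ _).map (f⟦m⟧') ≫ e.hom.app L =
    e.hom.app K ≫ ((HomotopyCategory.quotient _ _).map f)⟦m⟧' := e.hom.naturality f
  refine (fqis n 𝒜).of_postcomp _ (e.hom.app L) (fqis_of_isIso _) ?_
  rw [h']
  exact (fqis n 𝒜).comp_mem _ _ (fqis_of_isIso _) h

/-- The shift of a bounded below complex. -/
def shiftPlus (I : KFplus n 𝒜) (m : ℤ) : KFplus n 𝒜 :=
  ⟨(HomotopyCategory.quotient _ _).obj (I.obj.as⟦m⟧), I.property.elim fun N hN =>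
    ⟨N - m, fun q hq => hN (q + m) (by omega)⟩⟩

lemma injPlus_shiftPlus {I : KFplus n 𝒜} (hI : injPlus n 𝒜 I) (m : ℤ) :
    injPlus n 𝒜 (shiftPlus I m) := fun p => hI (p + m)

/-- The shift of a bounded above complex. -/
def shiftMinus (E : KFminus n 𝒜) (m : ℤ) : KFminus n 𝒜 :=
  ⟨(HomotopyCategory.quotient _ _).obj (E.obj.as⟦m⟧), E.property.elim fun N hN =>
    ⟨N - m, fun q hq => hN (q + m) (by omega)⟩⟩

lemma flatMinus_shiftMinus {P : ObjectProperty 𝒜} {E : KFminus n 𝒜} (hE : flatMinus n P E)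
    (m : ℤ) : flatMinus n P (shiftMinus E m) := fun p => hE (p + m)

/-- The twist of a bounded above complex. -/
def twistMinus (E : KFminus n 𝒜) (t : Steps n) : KFminus n 𝒜 :=
  ⟨(HomotopyCategory.quotient _ _).obj (twistCx t E.obj.as), E.property.imp
    fun _ hN q hq => (twist (twistOf t)).map_isZero (hN q hq)⟩

lemma flatMinus_twistMinus {P : ObjectProperty 𝒜} (hP : IsFlatClass P) {E : KFminus n 𝒜}
    (hE : flatMinus n P E) (t : Steps n) : flatMinus n P (twistMinus E t) :=
  fun p => flatFilt_twist hP _ (hE p)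

lemma flatMinus_mapKFminus {ℬ : Type u₁} [Category.{v₁} ℬ] [Abelian ℬ] {L : 𝒜 ⥤ ℬ} {R : ℬ ⥤ 𝒜}
    (adj : L ⊣ R) [L.Additive] {P : ObjectProperty 𝒜} {P' : ObjectProperty ℬ}
    (hP' : IsFlatClass P') (hL : IsFlatFunctor L P P') {E : KFminus n 𝒜} (hE : flatMinus n P E) :
    flatMinus n P' ((mapKFminus n L).obj E) := fun p => flatFilt_mapFilt adj hP' hL (hE p)

end Shift

/-! ### `Hom` complexes with values in injective complexes. -/

section HomInjective

variable {n : ℕ} {𝒜 : Type u} [Category.{v} 𝒜] [Abelian 𝒜] (B : Type v) [CommRing B] [Linear B 𝒜]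

/-- Twists preserve filtered quasi-isomorphisms and shifts preserve injective complexes, so the
criterion `fqis_homCxMap` reduces to `bijective_comp_of_injPlus`. -/
lemma fqis_homFunctor_map_left (hn : 1 ≤ n) (hn' : n ≤ 2) {E E' : KF n 𝒜} (s : E' ⟶ E)
    (hs : fqis n 𝒜 s) (I : KFplus n 𝒜) (hI : injPlus n 𝒜 I) :
    fqis n (ModuleCat.{v} B) ((homFunctor n 𝒜 B).map (X := (op E, I.obj)) (Y := (op E', I.obj))
      (s.op, 𝟙 I.obj)) := by
  obtain ⟨f, rfl⟩ := (HomotopyCategory.quotient _ _).map_surjective s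
  have h := homFunctor_map_quotient B f (𝟙 I.obj.as)
  have h' : (HomotopyCategory.quotient _ _).map (𝟙 I.obj.as) = 𝟙 I.obj :=
    CategoryTheory.Functor.map_id _ _
  rw [h'] at h
  change fqis n (ModuleCat.{v} B) ((homFunctor n 𝒜 B).map (X := (op ((HomotopyCategory.quotient _
    _).obj E.as), (HomotopyCategory.quotient _ _).obj I.obj.as)) _)
  refine Eq.mpr (congrArg _ h) (fqis_homCxMap f (𝟙 I.obj.as) fun t m => ?_)
  have hb := bijective_comp_of_injPlus hn hn' _ (fqis_mapK_twist hn hn' (twistOf t) _ hs)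
    (shiftPlus I m) (injPlus_shiftPlus hI m)
  have e : (HomotopyCategory.quotient _ _).map ((𝟙 I.obj.as)⟦m⟧') =
      𝟙 ((HomotopyCategory.quotient _ _).obj (I.obj.as⟦m⟧)) :=
    (congrArg _ (CategoryTheory.Functor.map_id _ _)).trans (CategoryTheory.Functor.map_id _ _)
  refine Eq.mpr (congrArg Function.Bijective (funext fun φ => ?_)) hb
  exact congrArg (_ ≫ ·) ((congrArg (φ ≫ ·) e).trans (Category.comp_id φ))

lemma homFunctor_map_eq {E E' F F' : KF n 𝒜} (s : E' ⟶ E) (w : F ⟶ F') :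
    (homFunctor n 𝒜 B).map (X := (op E, F)) (Y := (op E', F')) (s.op, w) =
      (homFunctor n 𝒜 B).map (X := (op E, F)) (Y := (op E', F)) (s.op, 𝟙 F) ≫
        (homFunctor n 𝒜 B).map (X := (op E', F)) (Y := (op E', F')) (𝟙 _, w) := by
  rw [← Functor.map_comp]
  congr 1
  exact Prod.ext (Category.comp_id _).symm (Category.id_comp _).symm

/-- Pairs of a complex and a bounded below complex of injective objects. -/
def injPair (n : ℕ) (𝒜 : Type u) [Category.{v} 𝒜] [Abelian 𝒜] :
    ObjectProperty ((KF n 𝒜)ᵒᵖ × KFplus n 𝒜) := fun Z => injPlus n 𝒜 Z.2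

variable [HasProducts.{0} 𝒜] [EnoughInjectives 𝒜]

lemma exists_injPair (hn : 1 ≤ n) (hn' : n ≤ 2) (Z : (KF n 𝒜)ᵒᵖ × KFplus n 𝒜) :
    ∃ (Z' : (KF n 𝒜)ᵒᵖ × KFplus n 𝒜) (w : Z ⟶ Z'),
      ((fqis n 𝒜).op.prod (fqisPlus n 𝒜)) w ∧ injPair n 𝒜 Z' := by
  obtain ⟨I, w, hw, hI⟩ := exists_injective_resolution hn hn' Z.2
  exact ⟨(Z.1, I), (𝟙 _, w), ⟨(fqis n 𝒜).id_mem _, hw⟩, hI⟩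

omit [HasProducts.{0} 𝒜] [EnoughInjectives 𝒜] in
-- Between injective complexes a filtered quasi-isomorphism is already a homotopy equivalence, so
-- the second variable contributes an isomorphism and the first one is covered by
-- `fqis_homFunctor_map_left`.
lemma isIso_homFunctorPlus_map (hn : 1 ≤ n) (hn' : n ≤ 2) ⦃Z Z' : (KF n 𝒜)ᵒᵖ × KFplus n 𝒜⦄
    (f : Z ⟶ Z') (hZ : injPair n 𝒜 Z) (hZ' : injPair n 𝒜 Z')
    (hf : ((fqis n 𝒜).op.prod (fqisPlus n 𝒜)) f) :
    fqis n (ModuleCat.{v} B) ((homFunctorPlus n 𝒜 B).map f) := by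
  have h₁ : IsIso f.2 := isIso_of_injPlus hn hn' f.2 hf.2 hZ hZ'
  have h₂ : IsIso f.2.hom := inferInstanceAs (IsIso ((isBoundedBelow n 𝒜).ι.map f.2))
  have h₃ := fqis_homFunctor_map_left B hn hn' f.1.unop hf.1 Z.2 hZ
  have : IsIso (C := (KF n 𝒜)ᵒᵖ × KF n 𝒜) (X := (op Z'.1.unop, Z.2.obj))
      (Y := (op Z'.1.unop, Z'.2.obj)) (𝟙 _, f.2.hom) :=
    ⟨⟨(𝟙 _, inv f.2.hom), Prod.ext (Category.comp_id _) (IsIso.hom_inv_id _),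
      Prod.ext (Category.comp_id _) (IsIso.inv_hom_id _)⟩⟩
  exact Eq.mpr (congrArg _ (homFunctor_map_eq B f.1.unop f.2.hom))
    ((fqis n _).comp_mem _ _ h₃ (fqis_of_isIso _))

end HomInjective

/-! ### Adjunctions between homotopy categories. -/

section AdjunctionK

variable {𝒟 : Type u} [Category.{v} 𝒟] [Preadditive 𝒟] {𝒟' : Type u₁} [Category.{v₁} 𝒟']
  [Preadditive 𝒟'] {G : 𝒟 ⥤ 𝒟'} {H : 𝒟' ⥤ 𝒟} [G.Additive] [H.Additive] (adj : G ⊣ H)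

/-- The adjunction between homotopy categories of complexes given by an adjunction between additive
functors. -/
def adjK : mapK G ⊣ mapK H :=
  Adjunction.mkOfUnitCounit
    { unit :=
        { app := fun K => (NatTrans.mapHomotopyCategory adj.unit (.up ℤ)).app K
          naturality := fun K L f => by
            obtain ⟨f, rfl⟩ := (HomotopyCategory.quotient _ _).map_surjective f
            exact (NatTrans.mapHomotopyCategory adj.unit (.up ℤ)).naturality
              ((HomotopyCategory.quotient _ _).map f) }
      counit :=
        { app := fun K => (NatTrans.mapHomotopyCategory adj.counit (.up ℤ)).app K
          naturality := fun K L f => by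
            obtain ⟨f, rfl⟩ := (HomotopyCategory.quotient _ _).map_surjective f
            exact (NatTrans.mapHomotopyCategory adj.counit (.up ℤ)).naturality
              ((HomotopyCategory.quotient _ _).map f) }
      left_triangle := by
        ext K
        change (mapK G).map ((NatTrans.mapHomotopyCategory adj.unit (.up ℤ)).app K) ≫ 𝟙 _ ≫
          (NatTrans.mapHomotopyCategory adj.counit (.up ℤ)).app ((mapK G).obj K) = 𝟙 _
        refine (congrArg (_ ≫ ·) (Category.id_comp _)).trans ?_
        refine ((HomotopyCategory.quotient _ _).map_comp
          ((G.mapHomologicalComplex _).map ((NatTrans.mapHomologicalComplex adj.unit _).app K.as))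
          ((NatTrans.mapHomologicalComplex adj.counit _).app
            ((G.mapHomologicalComplex _).obj K.as))).symm.trans ?_
        refine (congrArg _ ?_).trans ((HomotopyCategory.quotient _ _).map_id _)
        ext p
        exact adj.left_triangle_components _
      right_triangle := by
        ext K
        change (NatTrans.mapHomotopyCategory adj.unit (.up ℤ)).app ((mapK H).obj K) ≫ 𝟙 _ ≫
          (mapK H).map ((NatTrans.mapHomotopyCategory adj.counit (.up ℤ)).app K) = 𝟙 _
        refine (congrArg (_ ≫ ·) (Category.id_comp _)).trans ?_
        refine ((HomotopyCategory.quotient _ _).map_comp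
          ((NatTrans.mapHomologicalComplex adj.unit _).app ((H.mapHomologicalComplex _).obj K.as))
          ((H.mapHomologicalComplex _).map
            ((NatTrans.mapHomologicalComplex adj.counit _).app K.as))).symm.trans ?_
        refine (congrArg _ ?_).trans ((HomotopyCategory.quotient _ _).map_id _)
        ext p
        exact adj.right_triangle_components _ }

end AdjunctionK

/-! ### Filtered adjunctions and morphisms out of flat complexes. -/

section AdjFilt

variable {n : ℕ} {𝒜 : Type u} [Category.{v} 𝒜] [Abelian 𝒜] {ℬ : Type u₁} [Category.{v₁} ℬ]
  [Abelian ℬ] {L : ℬ ⥤ 𝒜} {R : 𝒜 ⥤ ℬ} (adj : L ⊣ R)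

lemma adj_factors_iff {X : FiltObj n ℬ} {Y : FiltObj n 𝒜} (f : L.obj X.obj ⟶ Y.obj) (i : Fin n)
    (k l : ℤ) : (Y.fil i l).Factors ((((mapFilt n L).obj X).fil i k).arrow ≫ f) ↔
      (((mapFilt n R).obj Y).fil i l).Factors ((X.fil i k).arrow ≫ adj.homEquiv _ _ f) := by
  refine (image_factors_iff _ _ _).trans (Iff.symm ((image_map_factors_iff adj _ _).trans ?_))
  exact Iff.of_eq (congrArg _ ((adj.homEquiv_naturality_left_symm _ _).trans
    (congrArg (L.map _ ≫ ·) (Equiv.symm_apply_apply _ _))))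

/-- The adjunction between categories of filtered objects given by an adjunction. -/
def adjFilt : mapFilt n L ⊣ mapFilt n R :=
  Adjunction.mkOfHomEquiv
    { homEquiv := fun _ _ =>
        { toFun := fun f => ⟨adj.homEquiv _ _ f.1, fun i k => (adj_factors_iff adj _ i k k).1 (f.2 i k)⟩
          invFun := fun f => ⟨(adj.homEquiv _ _).symm f.1, fun i k =>
            (adj_factors_iff adj _ i k k).2 (Eq.mpr (congrArg (fun z => Subobject.Factors _ (_ ≫ z))
              ((adj.homEquiv _ _).apply_symm_apply f.1)) (f.2 i k))⟩
          left_inv := fun _ => Subtype.ext ((adj.homEquiv _ _).symm_apply_apply _)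
          right_inv := fun _ => Subtype.ext ((adj.homEquiv _ _).apply_symm_apply _) }
      homEquiv_naturality_left_symm := fun _ _ =>
        Subtype.ext (adj.homEquiv_naturality_left_symm _ _)
      homEquiv_naturality_right := fun _ _ => Subtype.ext (adj.homEquiv_naturality_right _ _) }

/-- The adjunction between categories of filtered complexes given by an adjunction. -/
def adjKF [L.Additive] [R.Additive] : mapKF n L ⊣ mapKF n R := adjK (adjFilt adj)

variable [L.Additive] [R.Additive] {P : ObjectProperty ℬ} {P' : ObjectProperty 𝒜}

include adj

/-- Morphisms from a flat complex to the direct image of an injective complex can be computed by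
any flat complex. -/
lemma bijective_comp_of_flat (hn : 1 ≤ n) (hn' : n ≤ 2) (hP : IsFlatClass P)
    (hL : IsFlatFunctor L P P') {X Y : KFminus n ℬ} (s : X ⟶ Y) (hs : fqisMinus n ℬ s)
    (hX : flatMinus n P X) (hY : flatMinus n P Y) (I : KFplus n 𝒜) (hI : injPlus n 𝒜 I) :
    Function.Bijective fun g : Y.obj ⟶ (mapKF n R).obj I.obj => s.hom ≫ g := by
  -- By adjunction the assertion concerns morphisms into `I` from the images under `L`, where `s`
  -- remains a filtered quasi-isomorphism since both complexes are flat.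
  have h := bijective_comp_of_injPlus hn hn' _ (fqis_mapKF_of_flat adj hn hn' hP hL s hs hX hY) I hI
  have e : (fun g : Y.obj ⟶ (mapKF n R).obj I.obj => s.hom ≫ g) =
      ((adjKF (n := n) adj).homEquiv _ _) ∘ (fun g => (mapKF n L).map s.hom ≫ g) ∘
        ((adjKF (n := n) adj).homEquiv _ _).symm := by
    funext g
    refine Eq.symm (((adjKF (n := n) adj).homEquiv_naturality_left _ _).trans ?_)
    exact congrArg (s.hom ≫ ·) (Equiv.apply_symm_apply _ _)
  rw [e]
  exact (Equiv.bijective _).comp (h.comp (Equiv.bijective _))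

/-- Morphisms from a flat complex to the direct image of an injective complex agree with those to
an injective resolution of this direct image. -/
lemma bijective_comp_resolution (hn : 1 ≤ n) (hn' : n ≤ 2) (hP : IsFlatClass P)
    (hL : IsFlatFunctor L P P') [HasCoproducts.{0} ℬ] {E : KFminus n ℬ} (hE : flatMinus n P E)
    (I : KFplus n 𝒜) (hI : injPlus n 𝒜 I) (J : KFplus n ℬ) (hJ : injPlus n ℬ J)
    (w : (mapKF n R).obj I.obj ⟶ J.obj) (hw : fqis n ℬ w) :
    Function.Bijective fun φ : E.obj ⟶ (mapKF n R).obj I.obj => φ ≫ w := by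
  constructor
  · intro φ₁ φ₂ h
    -- Two morphisms with equal composites agree after some filtered quasi-isomorphism to `E`. Its
    -- source can be made flat, and flat replacements of `E` lose nothing.
    obtain ⟨X', t, ht, h'⟩ := MorphismProperty.HasRightCalculusOfFractions.ext (W := fqis n ℬ)
      φ₁ φ₂ w hw h
    obtain ⟨F, v, hv, hF⟩ := exists_flatMinus_of_fqis hP t ht
    refine (bijective_comp_of_flat adj hn hn' hP hL (ObjectProperty.homMk (v ≫ t) : F ⟶ E)
      ((fqis n ℬ).comp_mem _ _ hv ht) hF hE I hI).1 ?_
    exact (Category.assoc _ _ _).trans ((congrArg (v ≫ ·) h').trans (Category.assoc _ _ _).symm)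
  · intro φ
    -- The formal quotient of `φ` by `w` is a roof whose middle object can be taken flat. Its
    -- numerator extends to `E`, and the resulting equation may be checked on the flat source
    -- because `J` is injective.
    obtain ⟨ψ, hψ⟩ := MorphismProperty.LeftFraction.exists_rightFraction
      (MorphismProperty.LeftFraction.mk φ w hw : (fqis n ℬ).LeftFraction _ _)
    obtain ⟨F, v, hv, hF⟩ := exists_flatMinus_of_fqis hP ψ.s ψ.hs
    have hs := (fqis n ℬ).comp_mem _ _ hv ψ.hs
    obtain ⟨g, hg⟩ := (bijective_comp_of_flat adj hn hn' hP hL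
      (ObjectProperty.homMk (v ≫ ψ.s) : F ⟶ E) hs hF hE I hI).2 (v ≫ ψ.f)
    refine ⟨g, (bijective_comp_of_injPlus hn hn' _ hs J hJ).1 ?_⟩
    refine (Category.assoc _ _ _).symm.trans ((congrArg (· ≫ w) hg).trans ?_)
    exact (Category.assoc _ _ _).trans ((congrArg (v ≫ ·) hψ.symm).trans (Category.assoc _ _ _).symm)

lemma bijective_comp_shift (hn : 1 ≤ n) (hn' : n ≤ 2) (hP : IsFlatClass P)
    (hL : IsFlatFunctor L P P') [HasCoproducts.{0} ℬ] {E : KFminus n ℬ} (hE : flatMinus n P E)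
    (I : KFplus n 𝒜) (hI : injPlus n 𝒜 I) (J : KFplus n ℬ) (hJ : injPlus n ℬ J)
    (w : mapCF R I.obj.as ⟶ J.obj.as) (hw : fqis n ℬ ((HomotopyCategory.quotient _ _).map w))
    (m : ℤ) : Function.Bijective fun φ : E.obj ⟶
      (HomotopyCategory.quotient _ _).obj ((mapCF R I.obj.as)⟦m⟧) =>
        φ ≫ (HomotopyCategory.quotient _ _).map (w⟦m⟧') := by
  let e : mapCF R (I.obj.as⟦m⟧) ≅ (mapCF R I.obj.as)⟦m⟧ :=
    (((mapFilt n R).mapHomologicalComplex (.up ℤ)).commShiftIso m).app I.obj.as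
  let e' := (HomotopyCategory.quotient _ _).mapIso e
  have h := bijective_comp_resolution adj hn hn' hP hL hE (shiftPlus I m) (injPlus_shiftPlus hI m)
    (shiftPlus J m) (injPlus_shiftPlus hJ m)
    (e'.hom ≫ (HomotopyCategory.quotient _ _).map (w⟦m⟧'))
    ((fqis n ℬ).comp_mem _ _ (@fqis_of_isIso _ _ _ _ _ _ e'.hom (Iso.isIso_hom e'))
      (fqis_shift w hw m))
  have h' : (fun φ : E.obj ⟶ (HomotopyCategory.quotient _ _).obj ((mapCF R I.obj.as)⟦m⟧) =>
      φ ≫ (HomotopyCategory.quotient _ _).map (w⟦m⟧')) =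
      (fun φ => φ ≫ e'.hom ≫ (HomotopyCategory.quotient _ _).map (w⟦m⟧')) ∘
        (fun φ => φ ≫ e'.inv) := by
    funext φ
    exact congrArg (φ ≫ ·) (e'.inv_hom_id_assoc _).symm |>.trans (Category.assoc _ _ _).symm
  rw [h']
  exact h.comp e'.symm.homToEquiv.bijective

end AdjFilt

/-! ### `Hom` complexes from flat complexes to direct images of injective complexes. -/

section HomFlat

variable {n : ℕ} {𝒜 : Type u} [Category.{v} 𝒜] [Abelian 𝒜] {ℬ : Type u₁} [Category.{v} ℬ]
  [Abelian ℬ] {L : ℬ ⥤ 𝒜} {R : 𝒜 ⥤ ℬ} (adj : L ⊣ R) [L.Additive] [R.Additive]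
  {P : ObjectProperty ℬ} {P' : ObjectProperty 𝒜}

include adj in
-- This is the substitute for injectivity of `R` applied to `I`: for flat `E` the plain `Hom`
-- complex into it agrees with the one into its injective resolution `J`. Twists of flat complexes
-- are flat, so all steps are covered.
lemma fqis_homFunctor_map_right (B : Type v) [CommRing B] [Linear B ℬ] (hn : 1 ≤ n) (hn' : n ≤ 2)
    (hP : IsFlatClass P) (hL : IsFlatFunctor L P P') [HasCoproducts.{0} ℬ] {E : KFminus n ℬ}
    (hE : flatMinus n P E) (I : KFplus n 𝒜) (hI : injPlus n 𝒜 I) (J : KFplus n ℬ)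
    (hJ : injPlus n ℬ J) (w : (mapKF n R).obj I.obj ⟶ J.obj) (hw : fqis n ℬ w) :
    fqis n (ModuleCat.{v} B) ((homFunctor n ℬ B).map (X := (op E.obj, (mapKF n R).obj I.obj))
      (Y := (op E.obj, J.obj)) (𝟙 _, w)) := by
  obtain ⟨w, rfl⟩ := (HomotopyCategory.quotient _ _).map_surjective w
  have h := homFunctor_map_quotient B (𝟙 E.obj.as) w
  have h' : (HomotopyCategory.quotient _ _).map (𝟙 E.obj.as) = 𝟙 E.obj :=
    CategoryTheory.Functor.map_id _ _
  rw [h'] at h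
  refine Eq.mpr (congrArg _ h) (fqis_homCxMap (𝟙 E.obj.as) w fun t m => ?_)
  have hb := bijective_comp_shift adj hn hn' hP hL (flatMinus_twistMinus hP hE t) I hI J hJ w hw m
  have e : (HomotopyCategory.quotient _ _).map
      (((twist (twistOf t)).mapHomologicalComplex _).map (𝟙 E.obj.as)) =
      𝟙 ((HomotopyCategory.quotient _ _).obj (twistCx t E.obj.as)) :=
    (congrArg _ (CategoryTheory.Functor.map_id _ _)).trans (CategoryTheory.Functor.map_id _ _)
  refine Eq.mpr (congrArg Function.Bijective (funext fun φ => ?_)) hb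
  exact (congrArg (· ≫ _) e).trans (Category.id_comp _)

end HomFlat

/-! ### Vanishing of morphisms to the third vertex of a triangle. -/

section Triangle

open Pretriangulated

/-- The composite of `φ` with the third map of the triangle, transposed along the shift, is killed
by `T.mor₁` and so is zero. Then `φ` comes from `T.obj₂`, hence from `T.obj₁`, and two consecutive
maps compose to zero. -/
lemma eq_zero_of_distinguished {C : Type u} [Category.{v} C] [Preadditive C] [HasZeroObject C]
    [HasShift C ℤ] [∀ m : ℤ, (shiftFunctor C m).Additive] [Pretriangulated C] (T : Triangle C)
    (hT : T ∈ distTriang C) {S : C} (h₁ : ∀ f : S⟦(-1 : ℤ)⟧ ⟶ T.obj₁, f ≫ T.mor₁ = 0 → f = 0)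
    (h₂ : ∀ g : S ⟶ T.obj₂, ∃ f, f ≫ T.mor₁ = g) (φ : S ⟶ T.obj₃) : φ = 0 := by
  let adj := (shiftEquiv' C (-1 : ℤ) 1 (by norm_num)).toAdjunction
  have h₀ (X Y : C) : (adj.homEquiv X Y).symm 0 = 0 := by
    exact (congrArg (· ≫ adj.counit.app Y) (Functor.map_zero (shiftFunctor C (-1 : ℤ)) _ _)).trans
      zero_comp
  have e : (adj.homEquiv S T.obj₁).symm (φ ≫ T.mor₃) = 0 := by
    refine h₁ _ ((adj.homEquiv_naturality_right_symm _ _).symm.trans ?_)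
    refine (congrArg _ ?_).trans (h₀ _ _)
    exact (Category.assoc _ _ _).trans ((congrArg (φ ≫ ·)
      (comp_distTriang_mor_zero₃₁ T hT)).trans comp_zero)
  have e' : φ ≫ T.mor₃ = 0 := (adj.homEquiv S T.obj₁).symm.injective (e.trans (h₀ _ _).symm)
  obtain ⟨g, rfl⟩ := T.coyoneda_exact₃ hT φ e'
  obtain ⟨f, rfl⟩ := h₂ g
  rw [Category.assoc, comp_distTriang_mor_zero₁₂ T hT, comp_zero]

end Triangle

/-! ### Direct images of injective resolutions. -/

section Push

variable {n : ℕ} {𝒜 : Type u} [Category.{v} 𝒜] [Abelian 𝒜] {ℬ : Type u₁} [Category.{v₁} ℬ]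
  [Abelian ℬ] {𝒞 : Type u₂} [Category.{v₂} 𝒞] [Abelian 𝒞]

lemma flatFilt_of_iso {P : ObjectProperty 𝒜} (hP : IsFlatClass P) {X Y : FiltObj n 𝒜} (e : X ≅ Y)
    (hY : flatFilt n P Y) : flatFilt n P X := fun q =>
  hP.retract ((sumQuot n 𝒜 q).map e.hom) ((sumQuot n 𝒜 q).map e.inv)
    (by rw [← Functor.map_comp, e.hom_inv_id, CategoryTheory.Functor.map_id]) (hY q)

/-- The bounded above complex with a single nonzero object. -/
def singleMinus (F : FiltObj n 𝒜) (k : ℤ) : KFminus n 𝒜 :=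
  ⟨(HomotopyCategory.quotient _ _).obj ((HomologicalComplex.single _ _ k).obj F), k, fun q hq =>
    HomologicalComplex.isZero_single_obj_X _ _ _ _ (by omega)⟩

lemma flatMinus_singleMinus {P : ObjectProperty 𝒜} (hP : IsFlatClass P) {F : FiltObj n 𝒜}
    (hF : flatFilt n P F) (k : ℤ) : flatMinus n P (singleMinus F k) := fun q => by
  by_cases h : q = k
  · exact flatFilt_of_iso hP (HomologicalComplex.singleObjXIsoOfEq (.up ℤ) k F q h) hF
  · exact flatFilt_of_isZero hP (HomologicalComplex.isZero_single_obj_X _ _ _ _ h)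

/-- The cycle `p` is a morphism from a complex concentrated in degree `k + 1`; a null-homotopy of it
has a component into `K.X k`, and that component is the lift. -/
lemma exists_lift_of_map_single_eq_zero (K : CochainComplex (FiltObj n 𝒜) ℤ) {k : ℤ}
    {F : FiltObj n 𝒜} (p : F ⟶ K.X (k + 1)) (hp : p ≫ K.d (k + 1) (k + 1 + 1) = 0)
    (h : ∀ φ : (singleMinus F (k + 1)).obj ⟶ (HomotopyCategory.quotient _ _).obj K, φ = 0) :
    ∃ h : F ⟶ K.X k, h ≫ K.d k (k + 1) = p := by
  let m : (HomologicalComplex.single _ (.up ℤ) (k + 1)).obj F ⟶ K :=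
    HomologicalComplex.mkHomFromSingle p fun q hq => by
      obtain rfl : k + 1 + 1 = q := hq
      exact hp
  have hm := h ((HomotopyCategory.quotient _ _).map m)
  let H := HomotopyCategory.homotopyOfEq m 0
    (hm.trans (Functor.map_zero (HomotopyCategory.quotient _ _) _ _).symm)
  have hc := H.comm (k + 1)
  rw [dNext_eq _ (show (ComplexShape.up ℤ).Rel (k + 1) (k + 1 + 1) from rfl),
    prevD_eq _ (show (ComplexShape.up ℤ).Rel k (k + 1) from rfl),
    HomologicalComplex.single_obj_d, zero_comp, zero_add, HomologicalComplex.zero_f, add_zero,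
    HomologicalComplex.mkHomFromSingle_f] at hc
  refine ⟨(HomologicalComplex.singleObjXSelf (.up ℤ) (k + 1) F).inv ≫ H.hom (k + 1) k, ?_⟩
  rw [Category.assoc, ← hc, Iso.inv_hom_id_assoc]

variable {L : ℬ ⥤ 𝒜} {R : 𝒜 ⥤ ℬ} (adj : L ⊣ R) [L.Additive] [R.Additive]
  {P : ObjectProperty ℬ} {P' : ObjectProperty 𝒜} {L' : 𝒞 ⥤ ℬ} {R' : ℬ ⥤ 𝒞} (adj' : L' ⊣ R')
  [L'.Additive] [R'.Additive] {P'' : ObjectProperty 𝒞}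

include adj adj' in
/-- A right adjoint of a flat functor preserves injective resolutions of direct images of injective
complexes. -/
lemma fqis_mapKF_resolution (hn : 1 ≤ n) (hn' : n ≤ 2) (hP : IsFlatClass P)
    (hL : IsFlatFunctor L P P') (hP'' : IsFlatClass P'') (hL' : IsFlatFunctor L' P'' P)
    [HasCoproducts.{0} ℬ] [HasCoproducts.{0} 𝒞] (I : KFplus n 𝒜) (hI : injPlus n 𝒜 I)
    (J : KFplus n ℬ) (hJ : injPlus n ℬ J) (w : (mapKF n R).obj I.obj ⟶ J.obj) (hw : fqis n ℬ w) :
    fqis n 𝒞 ((mapKF n R').map w) := by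
  -- Transposing along the second adjunction replaces the flat complex `S` by its image under `L'`,
  -- which is again flat.
  have hb (S : KFminus n 𝒞) (hS : flatMinus n P'' S) : Function.Bijective
      fun φ : S.obj ⟶ (mapKF n R').obj ((mapKF n R).obj I.obj) => φ ≫ (mapKF n R').map w := by
    have h := bijective_comp_resolution adj hn hn' hP hL (flatMinus_mapKFminus adj' hP hL' hS)
      I hI J hJ w hw
    have e : (fun φ : S.obj ⟶ (mapKF n R').obj ((mapKF n R).obj I.obj) =>
        φ ≫ (mapKF n R').map w) = ((adjKF (n := n) adj').homEquiv _ _) ∘ (fun φ => φ ≫ w) ∘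
          ((adjKF (n := n) adj').homEquiv _ _).symm := by
      funext φ
      refine Eq.symm (((adjKF (n := n) adj').homEquiv_naturality_right _ _).trans ?_)
      exact congrArg (· ≫ (mapKF n R').map w) (Equiv.apply_symm_apply _ _)
    rw [e]
    exact (Equiv.bijective _).comp (h.comp (Equiv.bijective _))
  obtain ⟨w, rfl⟩ := (HomotopyCategory.quotient _ _).map_surjective w
  let w' := ((mapFilt n R').mapHomologicalComplex (.up ℤ)).map w
  have hT := HomotopyCategory.mappingCone_triangleh_distinguished w'
  have h₁ := qisFam_iff_of_distinguished (step n 𝒞) _ hT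
  rw [fqis_eq_qisFam]
  refine h₁.2 fun t => (acyc_iff _ _).2 fun q => ?_
  obtain ⟨q, rfl⟩ : ∃ r, q = r + 1 := ⟨q - 1, by ring⟩
  -- Acyclicity of the cone is tested by flat objects in a single degree; the bijections `hb` leave
  -- no nonzero morphism from these to the cone.
  refine acycFam_step_of_lift hP'' (CochainComplex.mappingCone w') (fun k F p hF hp => ?_) t q
  refine exists_lift_of_map_single_eq_zero _ p hp
    (eq_zero_of_distinguished _ hT (fun f hf => ?_) fun g => ?_)
  · let e := ((HomotopyCategory.quotient (FiltObj n 𝒞) (.up ℤ)).commShiftIso (-1 : ℤ)).app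
      ((HomologicalComplex.single _ (.up ℤ) (k + 1)).obj F)
    have h0 : e.hom ≫ f = 0 := (hb (shiftMinus (singleMinus F (k + 1)) (-1))
      (flatMinus_shiftMinus (flatMinus_singleMinus hP'' hF _) _)).1
        ((Category.assoc _ _ _).trans ((congrArg (e.hom ≫ ·) hf).trans
          (comp_zero.trans zero_comp.symm)))
    exact (cancel_epi e.hom).1 (h0.trans comp_zero.symm)
  · exact (hb (singleMinus F (k + 1)) (flatMinus_singleMinus hP'' hF _)).2 g

end Push

/-! ### Existence of the derived functors. -/

section Existence

variable {n : ℕ} {𝒜 : Type u} [Category.{v} 𝒜] [Abelian 𝒜] {ℬ : Type u₁} [Category.{v} ℬ]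
  [Abelian ℬ]

lemma isIso_Qh_map {X Y : KF n 𝒜} {f : X ⟶ Y} (hf : fqis n 𝒜 f) : IsIso ((Qh n 𝒜).map f) :=
  (fqis n 𝒜).Q_inverts f hf

section RHom

variable [HasProducts.{0} 𝒜] [EnoughInjectives 𝒜] (hn : 1 ≤ n) (hn' : n ≤ 2) {B : Type v}
  [CommRing B]

include hn hn'

lemma hasLeftCalculusOfFractions_fqis_prod :
    ((fqis n 𝒜).op.prod (fqisPlus n 𝒜)).HasLeftCalculusOfFractions := by
  have := hasLeftCalculusOfFractions_fqisPlus (𝒜 := 𝒜) hn hn'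
  infer_instance

lemma nonempty_RHom (lin : Linear B 𝒜) : Nonempty (RHom n 𝒜 B lin) := by
  have := hasLeftCalculusOfFractions_fqis_prod (𝒜 := 𝒜) hn hn'
  have := hasRightDerivedFunctor_of_resolutions (exists_injPair (𝒜 := 𝒜) hn hn')
    (F := homFunctorPlus n 𝒜 B ⋙ Qh n (ModuleCat.{v} B))
    fun Z Z' f hZ hZ' hf => isIso_Qh_map (isIso_homFunctorPlus_map B hn hn' f hZ hZ' hf)
  exact ⟨{
    functor := (homFunctorPlus n 𝒜 B ⋙ Qh n (ModuleCat.{v} B)).totalRightDerived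
      ((Qh n 𝒜).op.prod (Qplus n 𝒜)) ((fqis n 𝒜).op.prod (fqisPlus n 𝒜))
    unit := (homFunctorPlus n 𝒜 B ⋙ Qh n (ModuleCat.{v} B)).totalRightDerivedUnit
      ((Qh n 𝒜).op.prod (Qplus n 𝒜)) ((fqis n 𝒜).op.prod (fqisPlus n 𝒜))
    isDerived := inferInstance }⟩

lemma RHom.isIso_unit {lin : Linear B 𝒜} (H : RHom n 𝒜 B lin) (Z : (KF n 𝒜)ᵒᵖ × KFplus n 𝒜)
    (hZ : injPair n 𝒜 Z) : IsIso (H.unit.app Z) := by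
  have := hasLeftCalculusOfFractions_fqis_prod (𝒜 := 𝒜) hn hn'
  exact (isRightDerivedFunctor_iff_of_resolutions (exists_injPair (𝒜 := 𝒜) hn hn')
    (F := homFunctorPlus n 𝒜 B ⋙ Qh n (ModuleCat.{v} B))
    (fun Z Z' f hZ hZ' hf => isIso_Qh_map (isIso_homFunctorPlus_map B hn hn' f hZ hZ' hf))
    H.unit).1 H.isDerived Z hZ

end RHom

section RightDerived

variable [HasProducts.{0} 𝒜] [EnoughInjectives 𝒜] (hn : 1 ≤ n) (hn' : n ≤ 2) {R : 𝒜 ⥤ ℬ}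
  [R.Additive]

omit [HasProducts.{0} 𝒜] [EnoughInjectives 𝒜] in
include hn hn' in
lemma isIso_Qplus_mapKFplus_map ⦃I J : KFplus n 𝒜⦄ (w : I ⟶ J) (hI : injPlus n 𝒜 I)
    (hJ : injPlus n 𝒜 J) (hw : fqisPlus n 𝒜 w) :
    IsIso ((mapKFplus n R ⋙ Qplus n ℬ).map w) := by
  have := isIso_of_injPlus hn hn' w hw hI hJ
  infer_instance

include hn hn'

variable (R) in
lemma nonempty_rightDerived : Nonempty (RightDerived n R) := by
  have := hasLeftCalculusOfFractions_fqisPlus (𝒜 := 𝒜) hn hn'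
  have := hasRightDerivedFunctor_of_resolutions (exists_injective_resolution (𝒜 := 𝒜) hn hn')
    (isIso_Qplus_mapKFplus_map hn hn' (R := R))
  exact ⟨{
    functor := (mapKFplus n R ⋙ Qplus n ℬ).totalRightDerived (Qplus n 𝒜) (fqisPlus n 𝒜)
    unit := (mapKFplus n R ⋙ Qplus n ℬ).totalRightDerivedUnit (Qplus n 𝒜) (fqisPlus n 𝒜)
    isDerived := inferInstance }⟩

lemma RightDerived.isIso_unit (RR : RightDerived n R) (I : KFplus n 𝒜) (hI : injPlus n 𝒜 I) :
    IsIso (RR.unit.app I) := by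
  have := hasLeftCalculusOfFractions_fqisPlus (𝒜 := 𝒜) hn hn'
  exact (isRightDerivedFunctor_iff_of_resolutions (exists_injective_resolution (𝒜 := 𝒜) hn hn')
    (isIso_Qplus_mapKFplus_map hn hn' (R := R)) RR.unit).1 RR.isDerived I hI

end RightDerived

section LeftDerived

variable [HasCoproducts.{0} ℬ] (hn : 1 ≤ n) (hn' : n ≤ 2) {L : ℬ ⥤ 𝒜} {R : 𝒜 ⥤ ℬ} (adj : L ⊣ R)
  [L.Additive] {P : ObjectProperty ℬ} {P' : ObjectProperty 𝒜} (hP : IsFlatClass P)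
  (hL : IsFlatFunctor L P P')

include hn hn' adj hP hL

omit [HasCoproducts.{0} ℬ] in
lemma isIso_Qminus_mapKFminus_map ⦃E F : KFminus n ℬ⦄ (s : E ⟶ F) (hE : flatMinus n P E)
    (hF : flatMinus n P F) (hs : fqisMinus n ℬ s) :
    IsIso ((mapKFminus n L ⋙ Qminus n 𝒜).map s) :=
  (fqisMinus n 𝒜).Q_inverts _ (fqis_mapKF_of_flat adj hn hn' hP hL s hs hE hF)

lemma nonempty_leftDerived : Nonempty (LeftDerived n L) := by
  have := hasRightCalculusOfFractions_fqisMinus (n := n) hP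
  have := hasLeftDerivedFunctor_of_resolutions (exists_flatMinus (n := n) hP)
    (isIso_Qminus_mapKFminus_map hn hn' adj hP hL)
  exact ⟨{
    functor := (mapKFminus n L ⋙ Qminus n 𝒜).totalLeftDerived (Qminus n ℬ) (fqisMinus n ℬ)
    counit := (mapKFminus n L ⋙ Qminus n 𝒜).totalLeftDerivedCounit (Qminus n ℬ) (fqisMinus n ℬ)
    isDerived := inferInstance }⟩

lemma LeftDerived.isIso_counit (LL : LeftDerived n L) (E : KFminus n ℬ) (hE : flatMinus n P E) :
    IsIso (LL.counit.app E) := by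
  have := hasRightCalculusOfFractions_fqisMinus (n := n) hP
  exact (isLeftDerivedFunctor_iff_of_resolutions (exists_flatMinus (n := n) hP)
    (isIso_Qminus_mapKFminus_map hn hn' adj hP hL) LL.counit).1 LL.isDerived E hE

end LeftDerived

end Existence

/-! ### Isomorphisms of filtered complexes and restriction of scalars. -/

section Iso

open CochainComplex HomComplex

variable {n : ℕ} {𝒜 : Type u} [Category.{v} 𝒜] [Abelian 𝒜]

lemma FiltObj.isIso_of_factors {X Y : FiltObj n 𝒜} (f : X ⟶ Y) [IsIso f.1]
    (h : ∀ i k, (X.fil i k).Factors ((Y.fil i k).arrow ≫ inv f.1)) : IsIso f :=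
  ⟨⟨inv f.1, h⟩, Subtype.ext (IsIso.hom_inv_id f.1), Subtype.ext (IsIso.inv_hom_id f.1)⟩

lemma isIso_quotient_map {K L : CochainComplex (FiltObj n 𝒜) ℤ} (f : K ⟶ L)
    (h : ∀ p, IsIso (f.f p)) : IsIso ((HomotopyCategory.quotient _ (.up ℤ)).map f) := by
  have := HomologicalComplex.Hom.isIso_of_components f
  infer_instance

section RestrictScalars

variable {B : Type v} [CommRing B] {B₁ : Type v} [CommRing B₁]

lemma factors_of_forall_mem_range {M W : ModuleCat.{v} B} (S : Subobject M) (w : W ⟶ M)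
    (h : ∀ a, ∃ b, S.arrow.hom b = w.hom a) : S.Factors w := by
  rw [factors_iff_comp_cokernel]
  ext a
  obtain ⟨b, hb⟩ := h a
  have hc := congrArg (fun f => f.hom b) (cokernel.condition S.arrow)
  change (cokernel.π S.arrow).hom (w.hom a) = 0
  rw [← hb]
  exact hc

lemma exists_subobjectModule_symm_arrow {M : Type v} [AddCommGroup M] [Module B M]
    (p : Submodule B M) {x : M} (hx : x ∈ p) :
    ∃ b, ((ModuleCat.subobjectModule (ModuleCat.of B M)).symm p).arrow.hom b = x := by
  have h := (subobjectModule_symm_factors_iff p (ModuleCat.ofHom p.subtype)).2 fun a => a.2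
  exact ⟨(Subobject.factorThru _ _ h).hom ⟨x, hx⟩,
    congrArg (fun f => f.hom ⟨x, hx⟩) (Subobject.factorThru_arrow _ _ h)⟩

variable [Linear B 𝒜] [Linear B₁ 𝒜] (σ : B →+* B₁)
  (hσ : ∀ {X Y : 𝒜} (b : B) (f : X ⟶ Y), σ b • f = b • f)

lemma isIso_resCochain (K L : CochainComplex 𝒜 ℤ) (m : ℤ) : IsIso (resCochain σ hσ K L m) := by
  refine (ConcreteCategory.isIso_iff_bijective _).2 ?_
  exact ⟨fun _ _ h => h, fun x => ⟨x, rfl⟩⟩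

lemma isIso_resHomCx_f (E F : CochainComplex (FiltObj n 𝒜) ℤ) (m : ℤ) :
    IsIso ((resHomCx σ hσ E F).f m) := by
  have h : IsIso ((resHomCx σ hσ E F).f m).1 := isIso_resCochain σ hσ (und E) (und F) m
  refine FiltObj.isIso_of_factors _ fun i k => ?_
  refine factors_of_forall_mem_range _ _ fun a => ?_
  obtain ⟨b, hb⟩ := exists_subobjectModule_symm_arrow (cochainFil B₁ E F m i k)
    (x := (((homCx B E F).X m).fil i k).arrow.hom a)
    (subobjectModule_symm_arrow_mem (cochainFil B E F m i k) a)
  let g := (ModuleCat.restrictScalars.{v} σ).map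
    ((ModuleCat.subobjectModule (ModuleCat.of B₁ (Cochain (und E) (und F) m))).symm
      (cochainFil B₁ E F m i k)).arrow
  refine ⟨(factorThruImageSubobject g).hom b, ?_⟩
  refine (congrArg (fun f => f.hom b) (imageSubobject_arrow_comp g)).trans ?_
  have hinj : Function.Injective ((resHomCx σ hσ E F).f m).1.hom :=
    ((ConcreteCategory.isIso_iff_bijective ((resHomCx σ hσ E F).f m).1).1 h).1
  apply hinj
  refine Eq.trans ?_ (congrArg (fun f => f.hom ((((homCx B E F).X m).fil i k).arrow.hom a))
    (IsIso.inv_hom_id ((resHomCx σ hσ E F).f m).1)).symm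
  exact hb

lemma isIso_resHom (E F : KF n 𝒜) : IsIso (resHom σ hσ E F) :=
  isIso_quotient_map _ (isIso_resHomCx_f σ hσ E.as F.as)

lemma resHom_naturality {E E' F F' : KF n 𝒜} (s : E' ⟶ E) (w : F ⟶ F') :
    (mapKF n (ModuleCat.restrictScalars.{v} σ)).map ((homFunctor n 𝒜 B₁).map
      (X := (op E, F)) (Y := (op E', F')) (s.op, w)) ≫ resHom σ hσ E' F' =
    resHom σ hσ E F ≫ (homFunctor n 𝒜 B).map (X := (op E, F)) (Y := (op E', F')) (s.op, w) := by
  have h : ((mapFilt n (ModuleCat.restrictScalars.{v} σ)).mapHomologicalComplex _).map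
      (homCxMap B₁ (Quot.out s) (Quot.out w)) ≫ resHomCx σ hσ E'.as F'.as =
      resHomCx σ hσ E.as F.as ≫ homCxMap B (Quot.out s) (Quot.out w) := by
    ext m : 1
    exact Subtype.ext (ModuleCat.hom_ext (LinearMap.ext fun z => rfl))
  exact ((HomotopyCategory.quotient _ _).map_comp _ _).symm.trans
    ((congrArg (HomotopyCategory.quotient _ _).map h).trans
      ((HomotopyCategory.quotient _ _).map_comp _ _))

/-- Restriction of scalars has adjoints on both sides, so it is exact and commutes with
intersections of steps. -/
lemma fqis_mapKF_restrictScalars {X Y : KF n (ModuleCat.{v} B₁)} (s : X ⟶ Y)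
    (hs : fqis n _ s) : fqis n _ ((mapKF n (ModuleCat.restrictScalars.{v} σ)).map s) := by
  have : (ModuleCat.restrictScalars.{v} σ).IsLeftAdjoint :=
    (ModuleCat.restrictCoextendScalarsAdj.{v} σ).isLeftAdjoint
  exact fqis_mapKF_of_exact (Adjunction.ofIsRightAdjoint (ModuleCat.restrictScalars.{v} σ)) s hs

variable (n) in
lemma restrictScalars_isInvertedBy : (fqis n (ModuleCat.{v} B₁)).IsInvertedBy
    (mapKF n (ModuleCat.restrictScalars.{v} σ) ⋙ Qh n (ModuleCat.{v} B)) := fun _ _ f hf =>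
  isIso_Qh_map (fqis_mapKF_restrictScalars σ f hf)

variable (n) in
/-- Restriction of scalars on derived categories. -/
def restrictDF : DF n (ModuleCat.{v} B₁) ⥤ DF n (ModuleCat.{v} B) :=
  Localization.lift _ (restrictScalars_isInvertedBy n σ) (Qh n (ModuleCat.{v} B₁))

variable (n) in
/-- The compatibility of restriction of scalars on derived categories with complexes. -/
def restrictDFIso : Qh n (ModuleCat.{v} B₁) ⋙ restrictDF n σ ≅
    mapKF n (ModuleCat.restrictScalars.{v} σ) ⋙ Qh n (ModuleCat.{v} B) :=
  Localization.fac _ (restrictScalars_isInvertedBy n σ) (Qh n (ModuleCat.{v} B₁))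

/-- The identification of the bifunctors given by restriction of scalars. -/
def resHomIso : (homFunctorPlus n 𝒜 B₁ ⋙ Qh n (ModuleCat.{v} B₁)) ⋙ restrictDF n σ ≅
    homFunctorPlus n 𝒜 B ⋙ Qh n (ModuleCat.{v} B) :=
  (Functor.isoWhiskerLeft (homFunctorPlus n 𝒜 B₁) (restrictDFIso n σ)) ≪≫
    Functor.isoWhiskerRight (NatIso.ofComponents
      (F := homFunctorPlus n 𝒜 B₁ ⋙ mapKF n (ModuleCat.restrictScalars.{v} σ))
      (G := homFunctorPlus n 𝒜 B)
      (fun Z => have := isIso_resHom σ hσ Z.1.unop Z.2.obj; asIso (resHom σ hσ Z.1.unop Z.2.obj))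
      fun f => resHom_naturality σ hσ f.1.unop f.2.hom) (Qh n (ModuleCat.{v} B))

/-- A unit that is invertible on injective pairs remains so after any further functor, so
restriction applied to the derived functor over `B₁` is derived. It is compared with the one over
`B` through the identification of the `Hom` complexes. -/
lemma exists_isRestriction [HasProducts.{0} 𝒜] [EnoughInjectives 𝒜] (hn : 1 ≤ n) (hn' : n ≤ 2)
    (H₁ : RHom n 𝒜 B₁ inferInstance) (H : RHom n 𝒜 B inferInstance) :
    ∃ c : H₁.functor ⋙ restrictDF n σ ≅ H.functor,
      RHom.IsRestriction σ hσ (restrictDFIso n σ) H₁ H c.hom := by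
  have := hasLeftCalculusOfFractions_fqis_prod (𝒜 := 𝒜) hn hn'
  let α : (homFunctorPlus n 𝒜 B₁ ⋙ Qh n (ModuleCat.{v} B₁)) ⋙ restrictDF n σ ⟶
      (Qh n 𝒜).op.prod (Qplus n 𝒜) ⋙ (H₁.functor ⋙ restrictDF n σ) :=
    Functor.whiskerRight H₁.unit (restrictDF n σ)
  have h₁ : (H₁.functor ⋙ restrictDF n σ).IsRightDerivedFunctor α
      ((fqis n 𝒜).op.prod (fqisPlus n 𝒜)) := by
    refine (isRightDerivedFunctor_iff_of_resolutions (exists_injPair (𝒜 := 𝒜) hn hn')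
      (fun Z Z' f hZ hZ' hf => ?_) α).2 fun Z hZ => ?_
    · have := isIso_Qh_map (isIso_homFunctorPlus_map B₁ hn hn' f hZ hZ' hf)
      exact inferInstanceAs (IsIso ((restrictDF n σ).map
        ((Qh n (ModuleCat.{v} B₁)).map ((homFunctorPlus n 𝒜 B₁).map f))))
    · have := H₁.isIso_unit hn hn' Z hZ
      exact inferInstanceAs (IsIso ((restrictDF n σ).map (H₁.unit.app Z)))
  have h₂ := H.isDerived
  refine ⟨Functor.rightDerivedNatIso _ _ α H.unit ((fqis n 𝒜).op.prod (fqisPlus n 𝒜))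
    (resHomIso σ hσ), fun E F => ?_⟩
  refine (Functor.rightDerivedNatTrans_app (H₁.functor ⋙ restrictDF n σ) H.functor α H.unit
    ((fqis n 𝒜).op.prod (fqisPlus n 𝒜)) (resHomIso σ hσ).hom (op E, F)).trans ?_
  exact Category.assoc _ _ _

end RestrictScalars

end Iso

/-! ### The adjunction isomorphism on filtered `Hom` complexes. -/

section Adj

open CochainComplex HomComplex

variable {n : ℕ} {𝒜 : Type u} [Category.{v} 𝒜] [Abelian 𝒜] {ℬ : Type u₁} [Category.{v} ℬ]
  [Abelian ℬ] {L : ℬ ⥤ 𝒜} {R : 𝒜 ⥤ ℬ} (adj : L ⊣ R) [L.Additive] [R.Additive]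
  (B : Type v) [CommRing B] [Linear B 𝒜] [Linear B ℬ] [R.Linear B]

omit [L.Additive] in
lemma adjLinear_mem_homFil_iff {X : FiltObj n ℬ} {Y : FiltObj n 𝒜} {i : Fin n} {k : ℤ}
    {f : L.obj X.obj ⟶ Y.obj} : adjLinear B adj X.obj Y.obj f ∈ homFil B X ((mapFilt n R).obj Y) i k ↔
      f ∈ homFil B ((mapFilt n L).obj X) Y i k :=
  forall_congr' fun l => (adj_factors_iff adj f i l (l + k)).symm

/-- The inverse of the adjunction map on cochains. -/
def adjCochainInv (E : CochainComplex (FiltObj n ℬ) ℤ) (F : CochainComplex (FiltObj n 𝒜) ℤ) (m : ℤ)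
    (z : Cochain (und E) (und (mapCF R F)) m) : Cochain (und (mapCF L E)) (und F) m :=
  Cochain.mk fun p q hpq => (adj.homEquiv (E.X p).obj (F.X q).obj).symm (z.v p q hpq)

lemma adjCochain_adjCochainInv (E : CochainComplex (FiltObj n ℬ) ℤ)
    (F : CochainComplex (FiltObj n 𝒜) ℤ) (m : ℤ) (z : Cochain (und E) (und (mapCF R F)) m) :
    adjCochain B adj E F m (adjCochainInv adj E F m z) = z := by
  ext p q hpq
  exact (adj.homEquiv (E.X p).obj (F.X q).obj).apply_symm_apply _

lemma adjCochain_bijective (E : CochainComplex (FiltObj n ℬ) ℤ)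
    (F : CochainComplex (FiltObj n 𝒜) ℤ) (m : ℤ) : Function.Bijective (adjCochain B adj E F m) :=
  ⟨fun z z' h => by
    ext p q hpq
    exact (adj.homEquiv (E.X p).obj (F.X q).obj).injective
      (congrArg (fun z : Cochain (und E) (und (mapCF R F)) m => z.v p q hpq) h),
    fun z => ⟨_, adjCochain_adjCochainInv adj B E F m z⟩⟩

lemma adjCochain_mem_iff {E : CochainComplex (FiltObj n ℬ) ℤ} {F : CochainComplex (FiltObj n 𝒜) ℤ}
    {m : ℤ} {i : Fin n} {k : ℤ} (z : Cochain (und (mapCF L E)) (und F) m) :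
    adjCochain B adj E F m z ∈ cochainFil B E (mapCF R F) m i k ↔
      z ∈ cochainFil B (mapCF L E) F m i k :=
  forall_congr' fun _ => forall_congr' fun _ => forall_congr' fun _ =>
    adjLinear_mem_homFil_iff adj B

lemma isIso_adjHomCx_f (E : CochainComplex (FiltObj n ℬ) ℤ) (F : CochainComplex (FiltObj n 𝒜) ℤ)
    (m : ℤ) : IsIso ((adjHomCx B adj E F).f m) := by
  have hb : Function.Bijective ((adjHomCx B adj E F).f m).1.hom :=
    adjCochain_bijective adj B E F m
  have h : IsIso ((adjHomCx B adj E F).f m).1 := (ConcreteCategory.isIso_iff_bijective _).2 hb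
  refine FiltObj.isIso_of_factors _ fun i k => ?_
  refine (subobjectModule_symm_factors_iff (cochainFil B (mapCF L E) F m i k) _).2 fun a => ?_
  refine (adjCochain_mem_iff adj B _).1 ?_
  have e : adjCochain B adj E F m (((((homCx B E (mapCF R F)).X m).fil i k).arrow ≫
      inv ((adjHomCx B adj E F).f m).1).hom a) =
        (((homCx B E (mapCF R F)).X m).fil i k).arrow.hom a :=
    congrArg (fun f => f.hom ((((homCx B E (mapCF R F)).X m).fil i k).arrow.hom a))
      (IsIso.inv_hom_id ((adjHomCx B adj E F).f m).1)
  exact Eq.mpr (congrArg (· ∈ cochainFil B E (mapCF R F) m i k) e)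
    (subobjectModule_symm_arrow_mem (cochainFil B E (mapCF R F) m i k) a)

lemma isIso_adjHom (E : KF n ℬ) (F : KF n 𝒜) : IsIso (adjHom B adj E F) := by
  refine isIso_quotient_map (adjHomCx B adj E.as F.as) fun m => ?_
  exact isIso_adjHomCx_f adj B E.as F.as m

lemma adjHomCx_naturality {E E' : CochainComplex (FiltObj n ℬ) ℤ}
    {F F' : CochainComplex (FiltObj n 𝒜) ℤ} (f : E' ⟶ E) (g : F ⟶ F') :
    homCxMap B (E := mapCF L E) (E' := mapCF L E')
        (((mapFilt n L).mapHomologicalComplex _).map f) g ≫ adjHomCx B adj E' F' =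
      adjHomCx B adj E F ≫ homCxMap B (F := mapCF R F) (F' := mapCF R F') f
        (((mapFilt n R).mapHomologicalComplex _).map g) := by
  let f' : mapCF L E' ⟶ mapCF L E := ((mapFilt n L).mapHomologicalComplex _).map f
  let g' : mapCF R F ⟶ mapCF R F' := ((mapFilt n R).mapHomologicalComplex _).map g
  ext m : 1
  refine Subtype.ext (ModuleCat.hom_ext (LinearMap.ext
    fun (z : Cochain (und (mapCF L E)) (und F) m) => ?_))
  change adjCochain B adj E' F' m
    (((Cochain.ofHom (undMap f')).comp z
      (zero_add m)).comp (Cochain.ofHom (undMap g)) (add_zero m)) =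
    ((Cochain.ofHom (undMap f)).comp (adjCochain B adj E F m z) (zero_add m)).comp
      (Cochain.ofHom (undMap g')) (add_zero m)
  ext p q hpq
  refine Eq.trans ?_ (ofHom_comp_comp_ofHom_v _ _ _ p q hpq).symm
  refine (congrArg (adj.homEquiv _ _) (ofHom_comp_comp_ofHom_v _ _ z p q hpq)).trans ?_
  exact (adj.homEquiv_naturality_left _ _).trans
    (congrArg ((f.f p).1 ≫ ·) (adj.homEquiv_naturality_right _ _))

lemma adjHom_naturality {E E' : KF n ℬ} {F F' : KF n 𝒜} (s : E' ⟶ E) (w : F ⟶ F') :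
    (homFunctor n 𝒜 B).map (X := (op ((mapKF n L).obj E), F)) (Y := (op ((mapKF n L).obj E'), F'))
      (((mapKF n L).map s).op, w) ≫ adjHom B adj E' F' =
    adjHom B adj E F ≫ (homFunctor n ℬ B).map (X := (op E, (mapKF n R).obj F))
      (Y := (op E', (mapKF n R).obj F')) (s.op, (mapKF n R).map w) := by
  obtain ⟨f, rfl⟩ := (HomotopyCategory.quotient _ _).map_surjective s
  obtain ⟨g, rfl⟩ := (HomotopyCategory.quotient _ _).map_surjective w
  have h₁ := homFunctor_map_quotient B (E := mapCF L _) (E' := mapCF L _)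
    (((mapFilt n L).mapHomologicalComplex _).map f) g
  have h₂ := homFunctor_map_quotient B (F := mapCF R _) (F' := mapCF R _) f
    (((mapFilt n R).mapHomologicalComplex _).map g)
  refine (congrArg (· ≫ adjHom B adj E' F') h₁).trans
    (Eq.trans ?_ (congrArg (adjHom B adj E F ≫ ·) h₂).symm)
  exact ((HomotopyCategory.quotient _ _).map_comp _ _).symm.trans
    ((congrArg (HomotopyCategory.quotient _ _).map (adjHomCx_naturality adj B f g)).trans
      ((HomotopyCategory.quotient _ _).map_comp _ _))

end Adj

/-- Common form of the naturality of `toRhomLeft` and `toRhomRight`: a unit followed by a map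
induced on derived categories. -/
lemma app_comp_map_naturality {C : Type u} [Category.{v} C] {D : Type u₁} [Category.{v₁} D]
    {𝒞 : Type u₂} [Category.{v₂} 𝒞] {G : C ⥤ 𝒞} {Q : C ⥤ D} {H : D ⥤ 𝒞} (η : G ⟶ Q ⋙ H)
    {a a' : C} {x x' : D} (f : a ⟶ a') (m : Q.obj a ⟶ x) (m' : Q.obj a' ⟶ x') (φ : x ⟶ x')
    (h : m ≫ φ = Q.map f ≫ m') :
    G.map f ≫ η.app a' ≫ H.map m' = (η.app a ≫ H.map m) ≫ H.map φ := by
  rw [Category.assoc, ← H.map_comp, h, H.map_comp]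
  exact (η.naturality_assoc f _)

/-! ### The canonical transformation -/

section Canonical

variable {n : ℕ} {𝒜 : Type u} [Category.{v} 𝒜] [Abelian 𝒜] {ℬ : Type u₁} [Category.{v} ℬ]
  [Abelian ℬ] {B : Type v} [CommRing B] {lin : Linear B 𝒜} {lin' : Linear B ℬ} {L : ℬ ⥤ 𝒜}
  {R : 𝒜 ⥤ ℬ} [L.Additive] [R.Additive]

/-- The functor `(E, F) ↦ Hom(L E, F)` with values in the filtered derived category. -/
def homLeft (n : ℕ) (B : Type v) [CommRing B] [Linear B 𝒜] (L : ℬ ⥤ 𝒜) [L.Additive] :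
    (KFminus n ℬ)ᵒᵖ × KFplus n 𝒜 ⥤ DF n (ModuleCat.{v} B) :=
  (mapKFminus n L ⋙ (isBoundedAbove n 𝒜).ι).op.prod (𝟭 _) ⋙ homFunctorPlus n 𝒜 B ⋙ Qh n _

/-- The functor `(E, F) ↦ Hom(E, R F)` with values in the filtered derived category. -/
def homRight (n : ℕ) (B : Type v) [CommRing B] [Linear B ℬ] (R : 𝒜 ⥤ ℬ) [R.Additive] :
    (KFminus n ℬ)ᵒᵖ × KFplus n 𝒜 ⥤ DF n (ModuleCat.{v} B) :=
  (isBoundedAbove n ℬ).ι.op.prod (mapKFplus n R) ⋙ homFunctorPlus n ℬ B ⋙ Qh n _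

/-- The natural transformation with components `toRhomLeft`. -/
def leftUnit (LL : LeftDerived n L) (H : RHom n 𝒜 B lin) :
    homLeft n B L ⟶ (Qminus n ℬ).op.prod (Qplus n 𝒜) ⋙ rhomLeft LL H where
  app Z := toRhomLeft LL H Z.1.unop Z.2
  naturality Z Z' f := by
    let τ : (Qminus n ℬ ⋙ LL.functor) ⋙ inclMinus n 𝒜 ⟶
        mapKFminus n L ⋙ (isBoundedAbove n 𝒜).ι ⋙ Qh n 𝒜 :=
      Functor.whiskerRight LL.counit (inclMinus n 𝒜) ≫
        Functor.whiskerLeft (mapKFminus n L) (inclMinusIso n 𝒜).hom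
    exact app_comp_map_naturality H.unit
      (((mapKFminus n L ⋙ (isBoundedAbove n 𝒜).ι).op.prod (𝟭 _)).map f) _ _
      (((LL.functor ⋙ inclMinus n 𝒜).op.prod (𝟭 _)).map
        (((Qminus n ℬ).op.prod (Qplus n 𝒜)).map f))
      (Prod.ext (Quiver.Hom.unop_inj (τ.naturality f.1.unop))
        ((Category.id_comp _).trans (Category.comp_id _).symm))

/-- The natural transformation with components `toRhomRight`. -/
def rightUnit (RR : RightDerived n R) (H : RHom n ℬ B lin') :
    homRight n B R ⟶ (Qminus n ℬ).op.prod (Qplus n 𝒜) ⋙ rhomRight RR H where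
  app Z := toRhomRight RR H Z.1.unop Z.2
  naturality Z Z' f := by
    exact app_comp_map_naturality H.unit
      (((isBoundedAbove n ℬ).ι.op.prod (mapKFplus n R)).map f) _ _
      (((inclMinus n ℬ).op.prod RR.functor).map (((Qminus n ℬ).op.prod (Qplus n 𝒜)).map f))
      (Prod.ext (Quiver.Hom.unop_inj ((inclMinusIso n ℬ).hom.naturality f.1.unop))
        (RR.unit.naturality f.2).symm)

/-- The adjunction isomorphism `Hom(L E, F) ≅ Hom(E, R F)`. -/
def homAdjIso (n : ℕ) (B : Type v) [CommRing B] [Linear B 𝒜] [Linear B ℬ] (adj : L ⊣ R)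
    [R.Linear B] : homLeft n B L ≅ homRight n B R :=
  NatIso.ofComponents
    (fun Z => (Qh n (ModuleCat.{v} B)).mapIso
      (@asIso _ _ _ _ (adjHom B adj Z.1.unop.obj Z.2.obj) (isIso_adjHom adj B _ _)))
    (fun f => ((Qh n (ModuleCat.{v} B)).map_comp _ _).symm.trans
      ((congrArg (Qh n (ModuleCat.{v} B)).map
        (adjHom_naturality adj B f.1.unop.hom f.2.hom)).trans
        ((Qh n (ModuleCat.{v} B)).map_comp _ _)))

/-- Pairs of a complex with flat filtration steps and a complex of injective filtered objects. -/
def flatInjPair (n : ℕ) (P : ObjectProperty ℬ) (𝒜 : Type u) [Category.{v} 𝒜] [Abelian 𝒜] :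
    ObjectProperty ((KFminus n ℬ)ᵒᵖ × KFplus n 𝒜) :=
  fun Z => flatMinus n P Z.1.unop ∧ injPlus n 𝒜 Z.2

variable {P : ObjectProperty ℬ} {P' : ObjectProperty 𝒜}

lemma exists_flatInjPair [HasProducts.{0} 𝒜] [EnoughInjectives 𝒜] [HasCoproducts.{0} ℬ]
    (hn : 1 ≤ n) (hn' : n ≤ 2) (hP : IsFlatClass P) (Z : (KFminus n ℬ)ᵒᵖ × KFplus n 𝒜) :
    ∃ (Z' : (KFminus n ℬ)ᵒᵖ × KFplus n 𝒜) (w : Z ⟶ Z'),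
      ((fqisMinus n ℬ).op.prod (fqisPlus n 𝒜)) w ∧ flatInjPair n P 𝒜 Z' := by
  obtain ⟨I, w, hw, hI⟩ := exists_injective_resolution hn hn' Z.2
  obtain ⟨F, s, hs, hF⟩ := exists_flatMinus hP Z.1.unop
  exact ⟨(op F, I), (s.op, w), ⟨hs, hw⟩, hF, hI⟩

lemma hasLeftCalculusOfFractions_fqisMinus_prod [HasProducts.{0} 𝒜] [EnoughInjectives 𝒜]
    [HasCoproducts.{0} ℬ] (hn : 1 ≤ n) (hn' : n ≤ 2) (hP : IsFlatClass P) :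
    ((fqisMinus n ℬ).op.prod (fqisPlus n 𝒜)).HasLeftCalculusOfFractions := by
  have := hasLeftCalculusOfFractions_fqisPlus (𝒜 := 𝒜) hn hn'
  have := hasRightCalculusOfFractions_fqisMinus (n := n) hP
  infer_instance

omit [R.Additive] in
lemma isIso_homLeft_map [Linear B 𝒜] (hn : 1 ≤ n) (hn' : n ≤ 2) (adj : L ⊣ R) (hP : IsFlatClass P)
    (hL : IsFlatFunctor L P P') ⦃Z Z' : (KFminus n ℬ)ᵒᵖ × KFplus n 𝒜⦄ (f : Z ⟶ Z')
    (hZ : flatInjPair n P 𝒜 Z) (hZ' : flatInjPair n P 𝒜 Z')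
    (hf : ((fqisMinus n ℬ).op.prod (fqisPlus n 𝒜)) f) : IsIso ((homLeft n B L).map f) :=
  isIso_Qh_map (isIso_homFunctorPlus_map B hn hn'
    (((mapKFminus n L ⋙ (isBoundedAbove n 𝒜).ι).op.prod (𝟭 _)).map f) hZ.2 hZ'.2
    ⟨fqis_mapKF_of_flat adj hn hn' hP hL f.1.unop hf.1 hZ'.1 hZ.1, hf.2⟩)

lemma isIso_homRight_map [Linear B 𝒜] [Linear B ℬ] (hn : 1 ≤ n) (hn' : n ≤ 2) (adj : L ⊣ R)
    [R.Linear B] (hP : IsFlatClass P)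
    (hL : IsFlatFunctor L P P') ⦃Z Z' : (KFminus n ℬ)ᵒᵖ × KFplus n 𝒜⦄ (f : Z ⟶ Z')
    (hZ : flatInjPair n P 𝒜 Z) (hZ' : flatInjPair n P 𝒜 Z')
    (hf : ((fqisMinus n ℬ).op.prod (fqisPlus n 𝒜)) f) : IsIso ((homRight n B R).map f) :=
  (NatIso.isIso_map_iff (homAdjIso n B adj) f).1 (isIso_homLeft_map hn hn' adj hP hL f hZ hZ' hf)

lemma isIso_prod {C : Type u} [Category.{v} C] {D : Type u₁} [Category.{v₁} D] {X Y : C × D}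
    (f : X ⟶ Y) (h₁ : IsIso f.1) (h₂ : IsIso f.2) : IsIso f :=
  (isIso_prod_iff C D).2 ⟨h₁, h₂⟩

variable [HasProducts.{0} 𝒜] [EnoughInjectives 𝒜] [HasCoproducts.{0} ℬ]

omit [R.Additive] in
-- At a flat complex and an injective complex both factors of `toRhomLeft` are invertible, namely
-- the unit of the derived `Hom` and the map induced by the counit of `LL`.
lemma isRightDerivedFunctor_rhomLeft (hn : 1 ≤ n) (hn' : n ≤ 2) (adj : L ⊣ R) (hP : IsFlatClass P)
    (hL : IsFlatFunctor L P P') (LL : LeftDerived n L) (H : RHom n 𝒜 B lin) :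
    (rhomLeft LL H).IsRightDerivedFunctor (leftUnit LL H)
      ((fqisMinus n ℬ).op.prod (fqisPlus n 𝒜)) := by
  have := hasLeftCalculusOfFractions_fqisMinus_prod (𝒜 := 𝒜) hn hn' hP
  refine (isRightDerivedFunctor_iff_of_resolutions (exists_flatInjPair (𝒜 := 𝒜) hn hn' hP)
    (isIso_homLeft_map hn hn' adj hP hL) (leftUnit LL H)).2 fun Z hZ => ?_
  have h₁ := H.isIso_unit hn hn' (op ((mapKF n L).obj Z.1.unop.obj), Z.2) hZ.2
  have h₂ := LL.isIso_counit hn hn' adj hP hL Z.1.unop hZ.1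
  exact @IsIso.comp_isIso _ _ _ _ _ _ _ h₁
    (@Functor.map_isIso _ _ _ _ _ _ _ _ (isIso_prod _
      (@isIso_op _ _ _ _ _ (@IsIso.comp_isIso _ _ _ _ _ _ _ inferInstance inferInstance))
      (IsIso.id _)))

omit [HasProducts.{0} 𝒜] [EnoughInjectives 𝒜] in
-- In the naturality square of the unit for an injective resolution of the direct image, the other
-- three sides are invertible: one by flatness of `E`, one because the resolution is injective, one
-- by localization.
lemma isIso_unit_of_flat [HasProducts.{0} ℬ] [EnoughInjectives ℬ] (hn : 1 ≤ n) (hn' : n ≤ 2)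
    (adj : L ⊣ R) (hP : IsFlatClass P)
    (hL : IsFlatFunctor L P P') (H : RHom n ℬ B lin') {E : KFminus n ℬ} (hE : flatMinus n P E)
    {I : KFplus n 𝒜} (hI : injPlus n 𝒜 I) : IsIso (H.unit.app (op E.obj, (mapKFplus n R).obj I)) := by
  obtain ⟨J, w, hw, hJ⟩ := exists_injective_resolution hn hn' ((mapKFplus n R).obj I)
  let f : ((op E.obj, (mapKFplus n R).obj I) : (KF n ℬ)ᵒᵖ × KFplus n ℬ) ⟶ (op E.obj, J) := (𝟙 _, w)
  have h₁ : IsIso ((homFunctorPlus n ℬ B ⋙ Qh n _).map f) :=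
    isIso_Qh_map (fqis_homFunctor_map_right adj B hn hn' hP hL hE I hI J hJ w.hom hw)
  have h₂ : IsIso (H.unit.app (op E.obj, J)) := H.isIso_unit hn hn' _ hJ
  have h₃ : IsIso (((Qh n ℬ).op.prod (Qplus n ℬ)).map f) := isIso_prod _
    (inferInstanceAs (IsIso ((Qh n ℬ).op.map (𝟙 (op E.obj))))) ((fqisPlus n ℬ).Q_inverts w hw)
  have h₄ : IsIso (((Qh n ℬ).op.prod (Qplus n ℬ) ⋙ H.functor).map f) :=
    inferInstanceAs (IsIso (H.functor.map (((Qh n ℬ).op.prod (Qplus n ℬ)).map f)))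
  have h₅ : IsIso (H.unit.app (op E.obj, (mapKFplus n R).obj I) ≫
      ((Qh n ℬ).op.prod (Qplus n ℬ) ⋙ H.functor).map f) := by
    rw [← H.unit.naturality f]
    infer_instance
  exact IsIso.of_isIso_comp_right _ (((Qh n ℬ).op.prod (Qplus n ℬ) ⋙ H.functor).map f)

lemma isRightDerivedFunctor_rhomRight [lin : Linear B 𝒜] [HasProducts.{0} ℬ] [EnoughInjectives ℬ]
    (hn : 1 ≤ n) (hn' : n ≤ 2) (adj : L ⊣ R) (hR : R.Linear B) (hP : IsFlatClass P)
    (hL : IsFlatFunctor L P P') (RR : RightDerived n R) (H : RHom n ℬ B lin') :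
    (rhomRight RR H).IsRightDerivedFunctor (rightUnit RR H)
      ((fqisMinus n ℬ).op.prod (fqisPlus n 𝒜)) := by
  have := hasLeftCalculusOfFractions_fqisMinus_prod (𝒜 := 𝒜) hn hn' hP
  refine (isRightDerivedFunctor_iff_of_resolutions (exists_flatInjPair (𝒜 := 𝒜) hn hn' hP)
    (isIso_homRight_map hn hn' adj hP hL) (rightUnit RR H)).2 fun Z hZ => ?_
  have h₁ := isIso_unit_of_flat hn hn' adj hP hL H hZ.1 hZ.2
  have h₂ := RR.isIso_unit hn hn' Z.2 hZ.2
  exact @IsIso.comp_isIso _ _ _ _ _ _ _ h₁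
    (@Functor.map_isIso _ _ _ _ _ _ _ _ (isIso_prod _ (@isIso_op _ _ _ _ _ inferInstance) h₂))

/-- Being canonical is exactly the equation that characterises the transformation induced on derived
functors by the adjunction isomorphism. That transformation is invertible because the adjunction map
is. -/
theorem exists_canonical [HasProducts.{0} ℬ] [EnoughInjectives ℬ]
    (hn : 1 ≤ n) (hn' : n ≤ 2) (adj : L ⊣ R) (hR : R.Linear B) (hP : IsFlatClass P)
    (hL : IsFlatFunctor L P P') (LL : LeftDerived n L) (RR : RightDerived n R)
    (H : RHom n 𝒜 B lin) (H' : RHom n ℬ B lin') :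
    ∃ θ : rhomLeft LL H ⟶ rhomRight RR H', IsIso θ ∧ IsCanonical adj hR LL RR H H' θ ∧
      ∀ θ' : rhomLeft LL H ⟶ rhomRight RR H', IsCanonical adj hR LL RR H H' θ' → θ' = θ := by
  have := isRightDerivedFunctor_rhomLeft hn hn' adj hP hL LL H
  have := isRightDerivedFunctor_rhomRight (lin := lin) hn hn' adj hR hP hL RR H'
  let θ : rhomLeft LL H ≅ rhomRight RR H' :=
    Functor.rightDerivedNatIso _ _ (leftUnit LL H) (rightUnit RR H')
      ((fqisMinus n ℬ).op.prod (fqisPlus n 𝒜)) (homAdjIso n B adj)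
  have hθ : IsCanonical adj hR LL RR H H' θ.hom := fun E F =>
    Functor.rightDerivedNatTrans_app _ _ (leftUnit LL H) (rightUnit RR H')
      ((fqisMinus n ℬ).op.prod (fqisPlus n 𝒜)) (homAdjIso n B adj).hom (op E, F)
  refine ⟨θ.hom, inferInstance, hθ, fun θ' hθ' => ?_⟩
  exact Functor.rightDerived_ext _ (leftUnit LL H) ((fqisMinus n ℬ).op.prod (fqisPlus n 𝒜)) _ _ _
    (NatTrans.ext (funext fun Z => (hθ' Z.1.unop Z.2).trans (hθ Z.1.unop Z.2).symm))

end Canonical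

/-! ### Transitivity -/

section MapFilt

variable {n : ℕ} {𝒜 : Type u} [Category.{v} 𝒜] [Abelian 𝒜] {ℬ : Type u₁} [Category.{v₁} ℬ]
  [Abelian ℬ] {𝒞 : Type u₂} [Category.{v₂} 𝒞] [Abelian 𝒞] {H : 𝒜 ⥤ ℬ} {G : ℬ ⥤ 𝒞} {T : 𝒜 ⥤ 𝒞}

/-- Since `H` preserves monomorphisms, its value on a step equals the image used in the filtration,
so forming images after each functor or only once gives the same steps. -/
lemma isIso_mapFiltToComp_app [H.PreservesMonomorphisms] (τ : T ≅ H ⋙ G) (X : FiltObj n 𝒜) :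
    IsIso ((mapFiltToComp τ.hom).app X) := by
  have : IsIso ((mapFiltToComp τ.hom).app X).1 := inferInstanceAs (IsIso (τ.hom.app X.obj))
  refine FiltObj.isIso_of_factors _ fun i k => ?_
  have e : inv ((mapFiltToComp τ.hom).app X).1 = τ.inv.app X.obj :=
    IsIso.inv_eq_of_hom_inv_id (τ.hom_inv_id_app X.obj)
  rw [e]
  change (imageSubobject (T.map (X.fil i k).arrow)).Factors
    ((imageSubobject (G.map (imageSubobject (H.map (X.fil i k).arrow)).arrow)).arrow ≫
      τ.inv.app X.obj)
  rw [image_factors_iff]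
  have : IsIso (factorThruImageSubobject (H.map (X.fil i k).arrow)) := by
    have := mono_of_mono_fac (imageSubobject_arrow_comp (H.map (X.fil i k).arrow))
    exact isIso_of_mono_of_epi _
  rw [← (IsIso.inv_comp_eq _).2 (imageSubobject_arrow_comp (H.map (X.fil i k).arrow)).symm,
    G.map_comp, Category.assoc, ← Functor.comp_map H G, τ.inv.naturality]
  exact Subobject.factors_of_factors_right _
    (Subobject.factors_of_factors_right _ (image_factors_self _))

lemma isIso_mapFiltOfComp_app [G.PreservesEpimorphisms] (σ : H ⋙ G ≅ T) (X : FiltObj n 𝒜) :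
    IsIso ((mapFiltOfComp σ.hom).app X) := by
  have : IsIso ((mapFiltOfComp σ.hom).app X).1 := inferInstanceAs (IsIso (σ.hom.app X.obj))
  refine FiltObj.isIso_of_factors _ fun i k => ?_
  have e : inv ((mapFiltOfComp σ.hom).app X).1 = σ.inv.app X.obj :=
    IsIso.inv_eq_of_hom_inv_id (σ.hom_inv_id_app X.obj)
  rw [e]
  change (imageSubobject (G.map (imageSubobject (H.map (X.fil i k).arrow)).arrow)).Factors
    ((imageSubobject (T.map (X.fil i k).arrow)).arrow ≫ σ.inv.app X.obj)
  rw [image_factors_iff, σ.inv.naturality, Functor.comp_map,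
    ← congrArg G.map (imageSubobject_arrow_comp (H.map (X.fil i k).arrow)), G.map_comp,
    ← Category.assoc]
  exact Subobject.factors_of_factors_right _ (image_factors_self _)

variable [H.Additive] [G.Additive] [T.Additive]

lemma isIso_mapKFplusToComp [H.PreservesMonomorphisms] (τ : T ≅ H ⋙ G) (K : KFplus n 𝒜) :
    IsIso (mapKFplusToComp τ.hom K) := by
  have h : IsIso ((NatTrans.mapHomotopyCategory (mapFiltToComp (n := n) τ.hom) (.up ℤ)).app K.obj) :=
    isIso_quotient_map _ fun p => isIso_mapFiltToComp_app τ (K.obj.as.X p)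
  have : IsIso ((isBoundedBelow n 𝒞).ι.map (mapKFplusToComp τ.hom K)) := h
  exact isIso_of_reflects_iso _ (isBoundedBelow n 𝒞).ι

lemma isIso_mapKFminusOfComp [G.PreservesEpimorphisms] (σ : H ⋙ G ≅ T) (K : KFminus n 𝒜) :
    IsIso (mapKFminusOfComp σ.hom K) := by
  have h : IsIso ((NatTrans.mapHomotopyCategory (mapFiltOfComp (n := n) σ.hom) (.up ℤ)).app K.obj) :=
    isIso_quotient_map _ fun p => isIso_mapFiltOfComp_app σ (K.obj.as.X p)
  have : IsIso ((isBoundedAbove n 𝒞).ι.map (mapKFminusOfComp σ.hom K)) := h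
  exact isIso_of_reflects_iso _ (isBoundedAbove n 𝒞).ι

lemma mapKFplusToComp_naturality (τ : T ⟶ H ⋙ G) {K K' : KFplus n 𝒜} (f : K ⟶ K') :
    (mapKFplus n T).map f ≫ mapKFplusToComp τ K' =
      mapKFplusToComp τ K ≫ (mapKFplus n G).map ((mapKFplus n H).map f) := by
  refine ObjectProperty.hom_ext _ ?_
  obtain ⟨g, hg⟩ := (HomotopyCategory.quotient _ _).map_surjective f.hom
  have h := (NatTrans.mapHomologicalComplex (mapFiltToComp (n := n) τ) (.up ℤ)).naturality g
  have h' := congrArg (HomotopyCategory.quotient _ _).map h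
  rw [Functor.map_comp, Functor.map_comp] at h'
  change (mapKF n T).map f.hom ≫ _ = _ ≫ (mapKF n G).map ((mapKF n H).map f.hom)
  rw [← hg]
  exact h'

lemma mapKFminusOfComp_naturality [G.PreservesEpimorphisms] (σ : H ⋙ G ⟶ T) {K K' : KFminus n 𝒜}
    (f : K ⟶ K') :
    (mapKFminus n G).map ((mapKFminus n H).map f) ≫ mapKFminusOfComp σ K' =
      mapKFminusOfComp σ K ≫ (mapKFminus n T).map f := by
  refine ObjectProperty.hom_ext _ ?_
  obtain ⟨g, hg⟩ := (HomotopyCategory.quotient _ _).map_surjective f.hom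
  have h := (NatTrans.mapHomologicalComplex (mapFiltOfComp (n := n) σ) (.up ℤ)).naturality g
  have h' := congrArg (HomotopyCategory.quotient _ _).map h
  rw [Functor.map_comp, Functor.map_comp] at h'
  change (mapKF n G).map ((mapKF n H).map f.hom) ≫ _ = _ ≫ (mapKF n T).map f.hom
  rw [← hg]
  exact h'

end MapFilt

/-! ### Composition of derived functors. -/

section Derived

variable {n : ℕ} {𝒜 : Type u} [Category.{v} 𝒜] [Abelian 𝒜] {ℬ : Type u₁} [Category.{v} ℬ]
  [Abelian ℬ] {𝒞 : Type u₂} [Category.{v} 𝒞] [Abelian 𝒞]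

section Right

variable {H : 𝒜 ⥤ ℬ} {G : ℬ ⥤ 𝒞} {T : 𝒜 ⥤ 𝒞} [H.Additive] [G.Additive] [T.Additive]

/-- The comparison of `T` with the composition of the derived functors of `H` and `G`. -/
def compUnit (τ : T ⟶ H ⋙ G) (RH : RightDerived n H) (RG : RightDerived n G) :
    mapKFplus n T ⋙ Qplus n 𝒞 ⟶ Qplus n 𝒜 ⋙ RH.functor ⋙ RG.functor where
  app K := (Qplus n 𝒞).map (mapKFplusToComp τ K) ≫ RG.unit.app ((mapKFplus n H).obj K) ≫
    RG.functor.map (RH.unit.app K)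
  naturality K K' f := by
    have h₁ := congrArg (Qplus n 𝒞).map (mapKFplusToComp_naturality τ f)
    rw [Functor.map_comp, Functor.map_comp] at h₁
    have h₂ := RG.unit.naturality ((mapKFplus n H).map f)
    have h₃ := congrArg RG.functor.map (RH.unit.naturality f)
    rw [Functor.map_comp, Functor.map_comp] at h₃
    exact ((reassoc_of% h₁) _).trans ((congrArg _ ((reassoc_of% h₂) _)).trans
      ((congrArg (fun x => _ ≫ _ ≫ x) h₃).trans (by simp only [Category.assoc]; rfl)))

/-- The comparison of the composition of the derived functors of `H` and `G` with `T`. -/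
def counitComp [G.PreservesEpimorphisms] (σ : H ⋙ G ⟶ T) (LH : LeftDerived n H)
    (LG : LeftDerived n G) :
    Qminus n 𝒜 ⋙ LH.functor ⋙ LG.functor ⟶ mapKFminus n T ⋙ Qminus n 𝒞 where
  app K := LG.functor.map (LH.counit.app K) ≫ LG.counit.app ((mapKFminus n H).obj K) ≫
    (Qminus n 𝒞).map (mapKFminusOfComp σ K)
  naturality K K' f := by
    have h₁ := congrArg (Qminus n 𝒞).map (mapKFminusOfComp_naturality σ f)
    rw [Functor.map_comp, Functor.map_comp] at h₁
    have h₂ := LG.counit.naturality ((mapKFminus n H).map f)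
    have h₃ := congrArg LG.functor.map (LH.counit.naturality f)
    rw [Functor.map_comp, Functor.map_comp] at h₃
    exact ((reassoc_of% h₃) _).trans ((congrArg _ ((reassoc_of% h₂) _)).trans
      ((congrArg (fun x => _ ≫ _ ≫ x) h₁).trans (by simp only [Category.assoc]; rfl)))

end Right

variable {L : ℬ ⥤ 𝒜} {R : 𝒜 ⥤ ℬ} (adj : L ⊣ R) [L.Additive] [R.Additive] {L' : 𝒞 ⥤ ℬ} {R' : ℬ ⥤ 𝒞}
  (adj' : L' ⊣ R') [L'.Additive] [R'.Additive] {P : ObjectProperty ℬ} {P' : ObjectProperty 𝒜}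
  {P'' : ObjectProperty 𝒞} {T : 𝒜 ⥤ 𝒞} {S : 𝒞 ⥤ 𝒜} [T.Additive] [S.Additive]

include adj adj' in
-- The composite is derived because its unit is invertible at an injective complex `I`. There `R`
-- applied to `I` may fail to be injective, but `R'` carries its injective resolution to a filtered
-- quasi-isomorphism, so the unit of `RR'` is invertible on it.
lemma exists_rightDerivedComp [HasProducts.{0} 𝒜] [EnoughInjectives 𝒜] [HasProducts.{0} ℬ]
    [EnoughInjectives ℬ] [HasCoproducts.{0} ℬ] [HasCoproducts.{0} 𝒞] (hn : 1 ≤ n) (hn' : n ≤ 2)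
    (hP : IsFlatClass P) (hL : IsFlatFunctor L P P') (hP'' : IsFlatClass P'')
    (hL' : IsFlatFunctor L' P'' P) (τ : T ≅ R ⋙ R') (RR : RightDerived n R)
    (RR' : RightDerived n R') (RT : RightDerived n T) :
    ∃ c : RT.functor ≅ RR.functor ⋙ RR'.functor, RightDerived.LiesOver τ.hom RR RR' RT c.hom := by
  have : R.PreservesMonomorphisms := R.preservesMonomorphisms_of_adjunction adj
  have := hasLeftCalculusOfFractions_fqisPlus (𝒜 := 𝒜) hn hn'
  have hu : (RR.functor ⋙ RR'.functor).IsRightDerivedFunctor (compUnit τ.hom RR RR')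
      (fqisPlus n 𝒜) := by
    refine (isRightDerivedFunctor_iff_of_resolutions
      (exists_injective_resolution (𝒜 := 𝒜) hn hn') (isIso_Qplus_mapKFplus_map hn hn' (R := T))
      (compUnit τ.hom RR RR')).2 fun I hI => ?_
    obtain ⟨J, w, hw, hJ⟩ := exists_injective_resolution hn hn' ((mapKFplus n R).obj I)
    have h₁ : IsIso ((mapKFplus n R' ⋙ Qplus n 𝒞).map w) := (fqisPlus n 𝒞).Q_inverts _
      (fqis_mapKF_resolution adj adj' hn hn' hP hL hP'' hL' I hI J hJ w.hom hw)
    have h₂ : IsIso ((Qplus n ℬ).map w) := (fqisPlus n ℬ).Q_inverts w hw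
    have h₃ : IsIso ((Qplus n ℬ ⋙ RR'.functor).map w) :=
      inferInstanceAs (IsIso (RR'.functor.map ((Qplus n ℬ).map w)))
    have h₄ : IsIso (RR'.unit.app J) := RR'.isIso_unit hn hn' J hJ
    have h₅ : IsIso (RR'.unit.app ((mapKFplus n R).obj I) ≫ (Qplus n ℬ ⋙ RR'.functor).map w) := by
      rw [← RR'.unit.naturality w]
      infer_instance
    have h₆ : IsIso (RR'.unit.app ((mapKFplus n R).obj I)) :=
      IsIso.of_isIso_comp_right _ ((Qplus n ℬ ⋙ RR'.functor).map w)
    have h₇ := RR.isIso_unit hn hn' I hI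
    have h₈ := isIso_mapKFplusToComp τ I
    exact @IsIso.comp_isIso _ _ _ _ _ _ _ inferInstance
      (@IsIso.comp_isIso _ _ _ _ _ _ _ h₆ inferInstance)
  have := RT.isDerived
  exact ⟨Functor.rightDerivedNatIso _ _ RT.unit (compUnit τ.hom RR RR') (fqisPlus n 𝒜) (Iso.refl _),
    fun K => (Functor.rightDerivedNatTrans_app _ _ RT.unit (compUnit τ.hom RR RR') (fqisPlus n 𝒜)
      (𝟙 _) K).trans (Category.id_comp _)⟩

omit [R.Additive] [R'.Additive] [T.Additive] in
include adj adj' in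
-- Here the situation is simpler: `L'` preserves flat complexes, so the counits of both derived
-- functors are invertible where they are needed.
lemma exists_leftDerivedComp [L.PreservesEpimorphisms] [HasCoproducts.{0} ℬ] [HasCoproducts.{0} 𝒞]
    (hn : 1 ≤ n) (hn' : n ≤ 2) (adjT : S ⊣ T)
    (hP : IsFlatClass P) (hL : IsFlatFunctor L P P') (hP'' : IsFlatClass P'')
    (hL' : IsFlatFunctor L' P'' P) (hS : IsFlatFunctor S P'' P') (σ : L' ⋙ L ≅ S)
    (LL : LeftDerived n L) (LL' : LeftDerived n L') (LS : LeftDerived n S) :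
    ∃ c : LL'.functor ⋙ LL.functor ≅ LS.functor,
      LeftDerived.LiesOver σ.hom LL' LL LS c.hom := by
  have := hasRightCalculusOfFractions_fqisMinus (n := n) hP''
  have hu : (LL'.functor ⋙ LL.functor).IsLeftDerivedFunctor (counitComp σ.hom LL' LL)
      (fqisMinus n 𝒞) := by
    refine (isLeftDerivedFunctor_iff_of_resolutions
      (exists_flatMinus (n := n) hP'') (isIso_Qminus_mapKFminus_map hn hn' adjT hP'' hS)
      (counitComp σ.hom LL' LL)).2 fun E hE => ?_
    have h₁ := LL'.isIso_counit hn hn' adj' hP'' hL' E hE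
    have h₂ := LL.isIso_counit hn hn' adj hP hL _ (flatMinus_mapKFminus adj' hP hL' hE)
    have h₃ := isIso_mapKFminusOfComp σ E
    exact @IsIso.comp_isIso _ _ _ _ _ _ _ inferInstance
      (@IsIso.comp_isIso _ _ _ _ _ _ _ h₂ inferInstance)
  have := LS.isDerived
  exact ⟨Functor.leftDerivedNatIso _ _ (counitComp σ.hom LL' LL) LS.counit (fqisMinus n 𝒞)
    (Iso.refl _), fun K => (Functor.leftDerivedNatTrans_app _ _ (counitComp σ.hom LL' LL) LS.counit
      (fqisMinus n 𝒞) (𝟙 _) K).trans (Category.comp_id _)⟩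

end Derived

open CochainComplex HomComplex

variable {n : ℕ} {𝒜 : Type u} [Category.{v} 𝒜] [Abelian 𝒜] {ℬ : Type u₁} [Category.{v} ℬ]
  [Abelian ℬ] {𝒞 : Type u₂} [Category.{v} 𝒞] [Abelian 𝒞] {B : Type v} [CommRing B]
  {lin : Linear B 𝒜} {lin' : Linear B ℬ} {lin'' : Linear B 𝒞}
  {L : ℬ ⥤ 𝒜} {R : 𝒜 ⥤ ℬ} (adj : L ⊣ R) [L.Additive] [R.Additive] {L' : 𝒞 ⥤ ℬ} {R' : ℬ ⥤ 𝒞}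
  (adj' : L' ⊣ R') [L'.Additive] [R'.Additive]
  {T : 𝒜 ⥤ 𝒞} {S : 𝒞 ⥤ 𝒜} [T.Additive] [S.Additive] (adjT : S ⊣ T)

omit [Abelian 𝒜] [Abelian ℬ] [Abelian 𝒞] [L.Additive] [R.Additive] [L'.Additive] [R'.Additive]
  [T.Additive] [S.Additive] in
-- The isomorphism of left adjoints is by definition the mate of `e`, so transposing in one step or
-- in two differs exactly by `e`.
lemma homEquiv_comp_leftAdjointCompIso (e : R ⋙ R' ≅ T) {X : 𝒞} {Y : 𝒜} (φ : S.obj X ⟶ Y) :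
    adjT.homEquiv X Y φ ≫ e.inv.app Y = adj'.homEquiv X (R.obj Y) (adj.homEquiv (L'.obj X) Y
      ((Adjunction.leftAdjointCompIso adj' adj adjT e).hom.app X ≫ φ)) := by
  have h := unit_conjugateEquiv adjT (adj'.comp adj)
    (Adjunction.leftAdjointCompIso adj' adj adjT e).hom X
  have h' : conjugateEquiv adjT (adj'.comp adj)
      (Adjunction.leftAdjointCompIso adj' adj adjT e).hom = e.inv :=
    Equiv.apply_symm_apply _ _
  rw [h'] at h
  rw [Adjunction.homEquiv_unit, Category.assoc, e.inv.naturality]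
  exact ((reassoc_of% h) _).trans ((congrArg _ ((R ⋙ R').map_comp _ _).symm).trans
    (((adj'.comp adj).homEquiv_unit _ _ _).symm.trans (by rw [Adjunction.comp_homEquiv]; rfl)))

section

variable [R.Linear B] [R'.Linear B] [T.Linear B] [L.PreservesEpimorphisms]

/-- Transitivity at the level of complexes, verified on the components of cochains; the derived
statement is deduced from it. -/
lemma adjHom_comp (e : R ⋙ R' ≅ T) (E : KF n 𝒞) (F : KF n 𝒜) :
    adjHom B adjT E F ≫ (homFunctor n 𝒞 B).map (X := (op E, (mapKF n T).obj F))
      (Y := (op E, (mapKF n R').obj ((mapKF n R).obj F)))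
      (𝟙 _, (NatTrans.mapHomotopyCategory (mapFiltToComp e.inv) (.up ℤ)).app F) =
    (homFunctor n 𝒜 B).map (X := (op ((mapKF n S).obj E), F))
      (Y := (op ((mapKF n L).obj ((mapKF n L').obj E)), F))
      (((NatTrans.mapHomotopyCategory (mapFiltOfComp
        (Adjunction.leftAdjointCompIso adj' adj adjT e).hom) (.up ℤ)).app E).op, 𝟙 _) ≫
      adjHom B adj ((mapKF n L').obj E) F ≫ adjHom B adj' E ((mapKF n R).obj F) := by
  let σ := (Adjunction.leftAdjointCompIso adj' adj adjT e).hom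
  let E₀ := E.as
  let F₀ := F.as
  let t : mapCF T F₀ ⟶ mapCF R' (mapCF R F₀) :=
    (NatTrans.mapHomologicalComplex (mapFiltToComp (n := n) e.inv) (.up ℤ)).app F₀
  let s : mapCF L (mapCF L' E₀) ⟶ mapCF S E₀ :=
    (NatTrans.mapHomologicalComplex (mapFiltOfComp (n := n) σ) (.up ℤ)).app E₀
  have key : adjHomCx B adjT E₀ F₀ ≫ homCxMap B (𝟙 E₀) t =
      homCxMap B s (𝟙 F₀) ≫ adjHomCx B adj (mapCF L' E₀) F₀ ≫ adjHomCx B adj' E₀ (mapCF R F₀) := by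
    ext m : 1
    refine Subtype.ext (ModuleCat.hom_ext (LinearMap.ext
      fun (z : Cochain (und (mapCF S E₀)) (und F₀) m) => ?_))
    change ((Cochain.ofHom (undMap (𝟙 E₀))).comp (adjCochain B adjT E₀ F₀ m z) (zero_add m)).comp
        (Cochain.ofHom (undMap t)) (add_zero m) =
      adjCochain B adj' E₀ (mapCF R F₀) m (adjCochain B adj (mapCF L' E₀) F₀ m
        (((Cochain.ofHom (undMap s)).comp z (zero_add m)).comp
          (Cochain.ofHom (undMap (𝟙 F₀))) (add_zero m)))
    ext p q hpq
    refine (ofHom_comp_comp_ofHom_v _ _ _ p q hpq).trans (Eq.trans ?_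
      (congrArg (fun x => adj'.homEquiv _ _ (adj.homEquiv _ _ x))
        (ofHom_comp_comp_ofHom_v _ _ z p q hpq)).symm)
    refine (Category.id_comp _).trans ((homEquiv_comp_leftAdjointCompIso adj adj' adjT e _).trans ?_)
    exact congrArg (fun x => adj'.homEquiv _ _ (adj.homEquiv _ _ (σ.app _ ≫ x)))
      (Category.comp_id (z.v p q hpq)).symm
  have h₁ := homFunctor_map_quotient B (𝟙 E₀) t
  have h₂ := homFunctor_map_quotient B s (𝟙 F₀)
  have i₁ : (HomotopyCategory.quotient _ _).map (𝟙 E₀) = 𝟙 E := CategoryTheory.Functor.map_id _ _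
  have i₂ : (HomotopyCategory.quotient _ _).map (𝟙 F₀) = 𝟙 F := CategoryTheory.Functor.map_id _ _
  rw [i₁] at h₁
  rw [i₂] at h₂
  refine (congrArg (adjHom B adjT E F ≫ ·) h₁).trans (Eq.trans ?_ (congrArg (· ≫
    adjHom B adj ((mapKF n L').obj E) F ≫ adjHom B adj' E ((mapKF n R).obj F)) h₂).symm)
  have h₃ := congrArg (HomotopyCategory.quotient _ (.up ℤ)).map key
  rw [Functor.map_comp, Functor.map_comp, Functor.map_comp] at h₃
  exact h₃

end

lemma comp_map_eq_of_app {C : Type u} [Category.{v} C] {D : Type u₁} [Category.{v₁} D]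
    {𝒞 : Type u₂} [Category.{v₂} 𝒞] {G : C ⥤ 𝒞} {Q : C ⥤ D} {H : D ⥤ 𝒞} (η : G ⟶ Q ⋙ H)
    {a a' : C} {x y z : D} (f : a ⟶ a') (m : Q.obj a ⟶ x) (m' : Q.obj a' ⟶ y) (φ : x ⟶ z)
    (ψ : y ⟶ z) (h : m ≫ φ = Q.map f ≫ m' ≫ ψ) :
    (η.app a ≫ H.map m) ≫ H.map φ = G.map f ≫ (η.app a' ≫ H.map m') ≫ H.map ψ := by
  rw [Category.assoc, ← H.map_comp, h, H.map_comp, H.map_comp, Category.assoc]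
  exact (η.naturality_assoc f _).symm

lemma comp_map_eq_of_comp_eq {D : Type u₁} [Category.{v₁} D]
    {𝒞 : Type u₂} [Category.{v₂} 𝒞] {H : D ⥤ 𝒞} {X : 𝒞} {w x y z : D} (η : X ⟶ H.obj w)
    (m : w ⟶ x) (m' : w ⟶ y) (φ : x ⟶ z) (ψ : y ⟶ z) (h : m ≫ φ = m' ≫ ψ) :
    (η ≫ H.map m) ≫ H.map φ = (η ≫ H.map m') ≫ H.map ψ := by
  rw [Category.assoc, ← H.map_comp, h, H.map_comp, Category.assoc]

/-- The formal part of transitivity: nine commutative faces, three of them expressing canonicity,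
two the conditions on `cR` and `cL`, one the adjunctions on complexes, and the rest naturality. -/
lemma paste_squares {C : Type u} [Category.{v} C] {X Y₁ Y₂ Y₃ Z₁ Z₂ Z₃ W₁ W₂ A A' A₂ A₃ V : C}
    {tS : X ⟶ Y₁} {θT : Y₁ ⟶ W₁} {aT : X ⟶ A} {tT : A ⟶ W₁} {hR : W₁ ⟶ V} {h₁ : A ⟶ A'}
    {tR' : A' ⟶ W₂} {m₂ : W₂ ⟶ V} {hL : Y₁ ⟶ Y₂} {h₂ : X ⟶ A₂} {tL : A₂ ⟶ Z₁} {m₁ : Z₁ ⟶ Y₂}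
    {θ : Y₂ ⟶ Y₃} {θ₁ : Z₁ ⟶ Z₂} {m₁' : Z₂ ⟶ Y₃} {a : A₂ ⟶ A₃} {tR : A₃ ⟶ Z₂} {tL' : A₃ ⟶ Z₃}
    {m₃ : Z₃ ⟶ Y₃} {θ' : Y₃ ⟶ V} {θ₂ : Z₃ ⟶ W₂} {a' : A₃ ⟶ A'}
    (s₁ : tS ≫ θT = aT ≫ tT) (s₂ : tT ≫ hR = h₁ ≫ tR' ≫ m₂) (s₃ : tS ≫ hL = h₂ ≫ tL ≫ m₁)
    (s₄ : m₁ ≫ θ = θ₁ ≫ m₁') (s₅ : tL ≫ θ₁ = a ≫ tR) (s₆ : tR ≫ m₁' = tL' ≫ m₃)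
    (s₇ : m₃ ≫ θ' = θ₂ ≫ m₂) (s₈ : tL' ≫ θ₂ = a' ≫ tR') (s₉ : aT ≫ h₁ = h₂ ≫ a ≫ a') :
    tS ≫ θT ≫ hR = tS ≫ hL ≫ θ ≫ θ' := by
  rw [reassoc_of% s₁, s₂, reassoc_of% s₉, reassoc_of% s₃, reassoc_of% s₄, reassoc_of% s₅,
    reassoc_of% s₆, s₇, reassoc_of% s₈]

lemma toRhomLeft_comp_canonical [R.Linear B] [R'.Linear B] [T.Linear B] [L.PreservesEpimorphisms]
    (e : R ⋙ R' ≅ T)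
    {LL : LeftDerived n L} {RR : RightDerived n R} {LL' : LeftDerived n L'} {RR' : RightDerived n R'}
    {LS : LeftDerived n S} {RT : RightDerived n T} {H : RHom n 𝒜 B lin} {H' : RHom n ℬ B lin'}
    {H'' : RHom n 𝒞 B lin''} {θ : rhomLeft LL H ⟶ rhomRight RR H'}
    {θ' : rhomLeft LL' H' ⟶ rhomRight RR' H''} {θT : rhomLeft LS H ⟶ rhomRight RT H''}
    (hθ : IsCanonical adj ‹_› LL RR H H' θ) (hθ' : IsCanonical adj' ‹_› LL' RR' H' H'' θ')
    (hθT : IsCanonical adjT ‹_› LS RT H H'' θT)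
    (cR : RT.functor ⟶ RR.functor ⋙ RR'.functor) (cL : LL'.functor ⋙ LL.functor ⟶ LS.functor)
    (hcR : RightDerived.LiesOver e.inv RR RR' RT cR)
    (hcL : LeftDerived.LiesOver (Adjunction.leftAdjointCompIso adj' adj adjT e).hom LL' LL LS cL)
    (E : KFminus n 𝒞) (F : KFplus n 𝒜) :
    toRhomLeft LS H E F ≫ θT.app (op ((Qminus n 𝒞).obj E), (Qplus n 𝒜).obj F) ≫
      H''.functor.map
        (X := (op ((inclMinus n 𝒞).obj ((Qminus n 𝒞).obj E)), RT.functor.obj ((Qplus n 𝒜).obj F)))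
        (Y := (op ((inclMinus n 𝒞).obj ((Qminus n 𝒞).obj E)),
          RR'.functor.obj (RR.functor.obj ((Qplus n 𝒜).obj F))))
        (𝟙 _, cR.app ((Qplus n 𝒜).obj F)) =
    toRhomLeft LS H E F ≫ H.functor.map
        (X := (op ((inclMinus n 𝒜).obj (LS.functor.obj ((Qminus n 𝒞).obj E))), (Qplus n 𝒜).obj F))
        (Y := (op ((inclMinus n 𝒜).obj (LL.functor.obj (LL'.functor.obj ((Qminus n 𝒞).obj E)))),
          (Qplus n 𝒜).obj F))
        (((inclMinus n 𝒜).map (cL.app ((Qminus n 𝒞).obj E))).op, 𝟙 _) ≫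
      θ.app (op (LL'.functor.obj ((Qminus n 𝒞).obj E)), (Qplus n 𝒜).obj F) ≫
      θ'.app (op ((Qminus n 𝒞).obj E), RR.functor.obj ((Qplus n 𝒜).obj F)) := by
  let σ := (Adjunction.leftAdjointCompIso adj' adj adjT e).hom
  have s₂ : toRhomRight RT H'' E F ≫ H''.functor.map
        (X := (op ((inclMinus n 𝒞).obj ((Qminus n 𝒞).obj E)), RT.functor.obj ((Qplus n 𝒜).obj F)))
        (Y := (op ((inclMinus n 𝒞).obj ((Qminus n 𝒞).obj E)),
          RR'.functor.obj (RR.functor.obj ((Qplus n 𝒜).obj F))))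
        (𝟙 _, cR.app ((Qplus n 𝒜).obj F)) =
      (Qh n (ModuleCat.{v} B)).map ((homFunctor n 𝒞 B).map (X := (op E.obj, (mapKF n T).obj F.obj))
        (Y := (op E.obj, (mapKF n R').obj ((mapKF n R).obj F.obj)))
        (𝟙 _, (NatTrans.mapHomotopyCategory (mapFiltToComp e.inv) (.up ℤ)).app F.obj)) ≫
      toRhomRight RR' H'' E ((mapKFplus n R).obj F) ≫ H''.functor.map
        (X := (op ((inclMinus n 𝒞).obj ((Qminus n 𝒞).obj E)),
          RR'.functor.obj ((Qplus n ℬ).obj ((mapKFplus n R).obj F))))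
        (Y := (op ((inclMinus n 𝒞).obj ((Qminus n 𝒞).obj E)),
          RR'.functor.obj (RR.functor.obj ((Qplus n 𝒜).obj F))))
        (𝟙 _, RR'.functor.map (RR.unit.app F)) := by
    refine comp_map_eq_of_app H''.unit (a := (op E.obj, (mapKFplus n T).obj F))
      (a' := (op E.obj, (mapKFplus n R').obj ((mapKFplus n R).obj F)))
      (𝟙 _, mapKFplusToComp e.inv F) _ _ _ _ ?_
    refine Prod.ext ?_ (hcR F)
    have h : ((inclMinusIso n 𝒞).hom.app E).op ≫ 𝟙 _ =
        (Qh n 𝒞).op.map (𝟙 (op E.obj)) ≫ ((inclMinusIso n 𝒞).hom.app E).op ≫ 𝟙 _ := by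
      rw [CategoryTheory.Functor.map_id]
      exact (Category.id_comp _).symm
    exact h
  have s₃ : toRhomLeft LS H E F ≫ H.functor.map
        (X := (op ((inclMinus n 𝒜).obj (LS.functor.obj ((Qminus n 𝒞).obj E))), (Qplus n 𝒜).obj F))
        (Y := (op ((inclMinus n 𝒜).obj (LL.functor.obj (LL'.functor.obj ((Qminus n 𝒞).obj E)))),
          (Qplus n 𝒜).obj F))
        (((inclMinus n 𝒜).map (cL.app ((Qminus n 𝒞).obj E))).op, 𝟙 _) =
      (Qh n (ModuleCat.{v} B)).map ((homFunctor n 𝒜 B).map (X := (op ((mapKF n S).obj E.obj), F.obj))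
        (Y := (op ((mapKF n L).obj ((mapKF n L').obj E.obj)), F.obj))
        (((NatTrans.mapHomotopyCategory (mapFiltOfComp σ) (.up ℤ)).app E.obj).op, 𝟙 _)) ≫
      toRhomLeft LL H ((mapKFminus n L').obj E) F ≫ (rhomLeft LL H).map
        (X := (op ((Qminus n ℬ).obj ((mapKFminus n L').obj E)), (Qplus n 𝒜).obj F))
        (Y := (op (LL'.functor.obj ((Qminus n 𝒞).obj E)), (Qplus n 𝒜).obj F))
        ((LL'.counit.app E).op, 𝟙 _) := by
    refine comp_map_eq_of_app H.unit (a := (op ((mapKF n S).obj E.obj), F))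
      (a' := (op ((mapKF n L).obj ((mapKF n L').obj E.obj)), F))
      ((mapKFminusOfComp σ E).hom.op, 𝟙 _) _ _ _ _ ?_
    refine Prod.ext (Quiver.Hom.unop_inj ?_) ?_
    · have h := congrArg (inclMinus n 𝒜).map (hcL E)
      rw [Functor.map_comp, Functor.map_comp, Functor.map_comp] at h
      have h' := (inclMinusIso n 𝒜).hom.naturality (mapKFminusOfComp σ E)
      exact ((Category.assoc _ _ _).symm.trans (congrArg (· ≫ _) h)).trans
        (((Category.assoc _ _ _).trans (congrArg (_ ≫ ·) ((Category.assoc _ _ _).trans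
          (congrArg (_ ≫ ·) h')))).trans ((congrArg (_ ≫ ·) (Category.assoc _ _ _).symm).trans
          (Category.assoc _ _ _).symm))
    · have h : 𝟙 ((Qplus n 𝒜).obj F) ≫ 𝟙 _ = (Qplus n 𝒜).map (𝟙 F) ≫ 𝟙 _ ≫ 𝟙 _ := by simp
      exact h
  have s₆ : toRhomRight RR H' ((mapKFminus n L').obj E) F ≫ (rhomRight RR H').map
        (X := (op ((Qminus n ℬ).obj ((mapKFminus n L').obj E)), (Qplus n 𝒜).obj F))
        (Y := (op (LL'.functor.obj ((Qminus n 𝒞).obj E)), (Qplus n 𝒜).obj F))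
        ((LL'.counit.app E).op, 𝟙 _) =
      toRhomLeft LL' H' E ((mapKFplus n R).obj F) ≫ (rhomLeft LL' H').map
        (X := (op ((Qminus n 𝒞).obj E), (Qplus n ℬ).obj ((mapKFplus n R).obj F)))
        (Y := (op ((Qminus n 𝒞).obj E), RR.functor.obj ((Qplus n 𝒜).obj F)))
        (𝟙 _, RR.unit.app F) := by
    refine comp_map_eq_of_comp_eq (H := H'.functor) _ _ _ _ _ (Prod.ext (Quiver.Hom.unop_inj ?_) ?_)
    · exact Eq.symm ((congrArg (· ≫ _) (CategoryTheory.Functor.map_id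
        (LL'.functor ⋙ inclMinus n ℬ) _)).trans (Category.id_comp _))
    · exact ((congrArg (_ ≫ ·) (CategoryTheory.Functor.map_id RR.functor _)).trans
        (Category.comp_id _)).trans (Category.id_comp _).symm
  have s₇ := θ'.naturality (X := (op ((Qminus n 𝒞).obj E), (Qplus n ℬ).obj ((mapKFplus n R).obj F)))
    (Y := (op ((Qminus n 𝒞).obj E), RR.functor.obj ((Qplus n 𝒜).obj F))) (𝟙 _, RR.unit.app F)
  have s₇' : (rhomRight RR' H'').map
      (X := (op ((Qminus n 𝒞).obj E), (Qplus n ℬ).obj ((mapKFplus n R).obj F)))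
      (Y := (op ((Qminus n 𝒞).obj E), RR.functor.obj ((Qplus n 𝒜).obj F))) (𝟙 _, RR.unit.app F) =
      H''.functor.map
        (X := (op ((inclMinus n 𝒞).obj ((Qminus n 𝒞).obj E)),
          RR'.functor.obj ((Qplus n ℬ).obj ((mapKFplus n R).obj F))))
        (Y := (op ((inclMinus n 𝒞).obj ((Qminus n 𝒞).obj E)),
          RR'.functor.obj (RR.functor.obj ((Qplus n 𝒜).obj F))))
        (𝟙 _, RR'.functor.map (RR.unit.app F)) :=
    congrArg H''.functor.map (Prod.ext (CategoryTheory.Functor.map_id (inclMinus n 𝒞).op _) rfl)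
  have s₉ := congrArg (Qh n (ModuleCat.{v} B)).map (adjHom_comp (B := B) adj adj' adjT e E.obj F.obj)
  rw [Functor.map_comp, Functor.map_comp, Functor.map_comp] at s₉
  exact paste_squares (hθT E F) s₂ s₃
    (θ.naturality (X := (op ((Qminus n ℬ).obj ((mapKFminus n L').obj E)), (Qplus n 𝒜).obj F))
      (Y := (op (LL'.functor.obj ((Qminus n 𝒞).obj E)), (Qplus n 𝒜).obj F))
      ((LL'.counit.app E).op, 𝟙 _))
    (hθ ((mapKFminus n L').obj E) F) s₆ (s₇.trans (congrArg (_ ≫ ·) s₇'))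
    (hθ' E ((mapKFplus n R).obj F)) s₉

/-- Both composites are transformations out of `rhomLeft LS H`, a derived functor, so they agree
once they agree after `leftUnit`; that is `toRhomLeft_comp_canonical`. -/
theorem canonical_comp [R.Linear B] [R'.Linear B] [T.Linear B] [L.PreservesEpimorphisms]
    [HasProducts.{0} 𝒜] [EnoughInjectives 𝒜] [HasCoproducts.{0} 𝒞] (hn : 1 ≤ n) (hn' : n ≤ 2)
    {P' : ObjectProperty 𝒜} {P'' : ObjectProperty 𝒞} (hP'' : IsFlatClass P'')
    (hS : IsFlatFunctor S P'' P') (e : R ⋙ R' ≅ T)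
    {LL : LeftDerived n L} {RR : RightDerived n R} {LL' : LeftDerived n L'} {RR' : RightDerived n R'}
    {LS : LeftDerived n S} {RT : RightDerived n T} {H : RHom n 𝒜 B lin} {H' : RHom n ℬ B lin'}
    {H'' : RHom n 𝒞 B lin''} {θ : rhomLeft LL H ⟶ rhomRight RR H'}
    {θ' : rhomLeft LL' H' ⟶ rhomRight RR' H''} {θT : rhomLeft LS H ⟶ rhomRight RT H''}
    (hθ : IsCanonical adj ‹_› LL RR H H' θ) (hθ' : IsCanonical adj' ‹_› LL' RR' H' H'' θ')
    (hθT : IsCanonical adjT ‹_› LS RT H H'' θT)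
    (cR : RT.functor ⟶ RR.functor ⋙ RR'.functor) (cL : LL'.functor ⋙ LL.functor ⟶ LS.functor)
    (hcR : RightDerived.LiesOver e.inv RR RR' RT cR)
    (hcL : LeftDerived.LiesOver (Adjunction.leftAdjointCompIso adj' adj adjT e).hom LL' LL LS cL)
    (E : DFminus n 𝒞) (F : DFplus n 𝒜) :
    θT.app (op E, F) ≫ H''.functor.map (X := (op ((inclMinus n 𝒞).obj E), RT.functor.obj F))
        (Y := (op ((inclMinus n 𝒞).obj E), RR'.functor.obj (RR.functor.obj F))) (𝟙 _, cR.app F) =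
      H.functor.map (X := (op ((inclMinus n 𝒜).obj (LS.functor.obj E)), F))
        (Y := (op ((inclMinus n 𝒜).obj (LL.functor.obj (LL'.functor.obj E))), F))
        (((inclMinus n 𝒜).map (cL.app E)).op, 𝟙 F) ≫
      θ.app (op (LL'.functor.obj E), F) ≫ θ'.app (op E, RR.functor.obj F) := by
  let G := (inclMinus n 𝒞).op.prod (RR.functor ⋙ RR'.functor) ⋙ H''.functor
  let γ₁ : rhomLeft LS H ⟶ G := θT ≫ Functor.whiskerRight
    (NatTrans.prod (𝟙 (inclMinus n 𝒞).op) cR) H''.functor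
  let γ₂ : rhomLeft LS H ⟶ G := Functor.whiskerRight
      (NatTrans.prod (NatTrans.op (Functor.whiskerRight cL (inclMinus n 𝒜))) (𝟙 (𝟭 _))) H.functor ≫
    Functor.whiskerLeft (LL'.functor.op.prod (𝟭 _)) θ ≫
    Functor.whiskerLeft ((𝟭 _).prod RR.functor) θ'
  have := isRightDerivedFunctor_rhomLeft hn hn' adjT hP'' hS LS H
  have h : γ₁ = γ₂ := by
    refine Functor.rightDerived_ext _ (leftUnit LS H) ((fqisMinus n 𝒞).op.prod (fqisPlus n 𝒜))
      _ _ _ (NatTrans.ext (funext fun ⟨⟨E⟩, F⟩ => ?_))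
    exact toRhomLeft_comp_canonical adj adj' adjT e hθ hθ' hθT cR cL hcR hcL E F
  exact congrArg (fun γ => γ.app (op E, F)) h

end MultiFiltered
end

/-! ### The adjunction formula for ringed topoi. -/

open MultiFiltered in
theorem theorem5p2 (n : ℕ) (hn : 1 ≤ n) (hn' : n ≤ 2) :
    -- the derived functors exist
    (∀ (X : RingedTopos.{u}) (B : Type u) [CommRing B] (ρ : B →+* X.Γ), Nonempty (X.RHom n ρ)) ∧
    (∀ (X X' : RingedTopos.{u}) (f : RingedTopos.Hom X X'),
      Nonempty (RightDerived n f.push) ∧ Nonempty (LeftDerived n f.pull)) ∧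
    -- the derived functor of `Hom` is compatible with restriction of scalars
    (∀ (B B₁ : Type u) [CommRing B] [CommRing B₁] (σ : B →+* B₁),
      ∃ (r : DF n (ModuleCat.{u} B₁) ⥤ DF n (ModuleCat.{u} B))
        (e : Qh n (ModuleCat.{u} B₁) ⋙ r ≅
          mapKF n (ModuleCat.restrictScalars.{u} σ) ⋙ Qh n (ModuleCat.{u} B)),
        ∀ (X : RingedTopos.{u}) (ρ : B₁ →+* X.Γ) (H₁ : X.RHom n ρ) (H : X.RHom n (ρ.comp σ)),
          ∃ c : H₁.functor ⋙ r ≅ H.functor,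
            RHom.IsRestriction σ (X.linear_comp σ ρ) e H₁ H c.hom) ∧
    -- there is exactly one canonical transformation, and it is an isomorphism
    (∀ (X X' : RingedTopos.{u}) (f : RingedTopos.Hom X X') (B : Type u) [CommRing B]
      (ρ : B →+* X.Γ) (ρ' : B →+* X'.Γ) (hf : f.mapΓ.comp ρ' = ρ)
      (LL : LeftDerived n f.pull) (RR : RightDerived n f.push)
      (H : X.RHom n ρ) (H' : X'.RHom n ρ'),
      ∃ θ : rhomLeft LL H ⟶ rhomRight RR H',
        IsIso θ ∧ IsCanonical f.adj (f.push_linear hf) LL RR H H' θ ∧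
        ∀ θ' : rhomLeft LL H ⟶ rhomRight RR H',
          IsCanonical f.adj (f.push_linear hf) LL RR H H' θ' → θ' = θ) ∧
    -- transitivity for `X ⟶ X' ⟶ X''`
    (∀ (X X' X'' : RingedTopos.{u}) (f : RingedTopos.Hom X X') (g : RingedTopos.Hom X' X'')
      (B : Type u) [CommRing B] (ρ : B →+* X.Γ) (ρ' : B →+* X'.Γ) (ρ'' : B →+* X''.Γ)
      (hf : f.mapΓ.comp ρ' = ρ) (hg : g.mapΓ.comp ρ'' = ρ') (hfg : (f.comp g).mapΓ.comp ρ'' = ρ)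
      (LLf : LeftDerived n f.pull) (RRf : RightDerived n f.push)
      (LLg : LeftDerived n g.pull) (RRg : RightDerived n g.push)
      (LLfg : LeftDerived n (f.comp g).pull) (RRfg : RightDerived n (f.comp g).push)
      (H : X.RHom n ρ) (H' : X'.RHom n ρ') (H'' : X''.RHom n ρ'')
      (θf : rhomLeft LLf H ⟶ rhomRight RRf H') (θg : rhomLeft LLg H' ⟶ rhomRight RRg H'')
      (θfg : rhomLeft LLfg H ⟶ rhomRight RRfg H''),
      IsCanonical f.adj (f.push_linear hf) LLf RRf H H' θf →
      IsCanonical g.adj (g.push_linear hg) LLg RRg H' H'' θg →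
      IsCanonical (f.comp g).adj ((f.comp g).push_linear hfg) LLfg RRfg H H'' θfg →
      ∃ (cR : RRfg.functor ≅ RRf.functor ⋙ RRg.functor)
        (cL : LLg.functor ⋙ LLf.functor ≅ LLfg.functor),
        RightDerived.LiesOver (f.pushComp g).inv RRf RRg RRfg cR.hom ∧
        LeftDerived.LiesOver (f.pullComp g).hom LLg LLf LLfg cL.hom ∧
        ∀ (E : DFminus n X''.Mod) (F : DFplus n X.Mod),
          θfg.app (op E, F) ≫ H''.functor.map
              (X := (op ((inclMinus n X''.Mod).obj E), RRfg.functor.obj F))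
              (Y := (op ((inclMinus n X''.Mod).obj E), RRg.functor.obj (RRf.functor.obj F)))
              (𝟙 _, cR.hom.app F) =
            H.functor.map
              (X := (op ((inclMinus n X.Mod).obj (LLfg.functor.obj E)), F))
              (Y := (op ((inclMinus n X.Mod).obj (LLf.functor.obj (LLg.functor.obj E))), F))
              (((inclMinus n X.Mod).map (cL.hom.app E)).op, 𝟙 F) ≫
            θf.app (op (LLg.functor.obj E), F) ≫ θg.app (op E, RRf.functor.obj F)) := by
  have hP (X : RingedTopos.{u}) := RingedTopos.isFlatClass_flat X
  refine ⟨fun X B _ ρ => nonempty_RHom hn hn' (X.linear ρ), fun X X' f =>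
    ⟨nonempty_rightDerived hn hn' f.push,
      nonempty_leftDerived hn hn' f.adj (hP X') (RingedTopos.isFlatFunctor_pull f)⟩,
    fun B B₁ _ _ σ => ⟨restrictDF n σ, restrictDFIso n σ, fun X ρ H₁ H =>
      let _ := X.linear ρ
      let _ := X.linear (ρ.comp σ)
      exists_isRestriction σ (X.linear_comp σ ρ) hn hn' H₁ H⟩, ?_, ?_⟩
  · intro X X' f B _ ρ ρ' hf LL RR H H'
    exact exists_canonical hn hn' f.adj (f.push_linear hf) (hP X') (RingedTopos.isFlatFunctor_pull f) LL RR H H'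
  · intro X X' X'' f g B _ ρ ρ' ρ'' hf hg hfg LLf RRf LLg RRg LLfg RRfg H H' H'' θf θg θfg hθf hθg
      hθfg
    obtain ⟨cR, hcR⟩ := exists_rightDerivedComp f.adj g.adj hn hn' (hP X') (RingedTopos.isFlatFunctor_pull f)
      (hP X'') (RingedTopos.isFlatFunctor_pull g) (f.pushComp g).symm RRf RRg RRfg
    obtain ⟨cL, hcL⟩ := exists_leftDerivedComp f.adj g.adj hn hn' (f.comp g).adj (hP X')
      (RingedTopos.isFlatFunctor_pull f) (hP X'') (RingedTopos.isFlatFunctor_pull g) (RingedTopos.isFlatFunctor_pull (f.comp g))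
      (f.pullComp g) LLf LLg LLfg
    let _ := X.linear ρ
    let _ := X'.linear ρ'
    let _ := X''.linear ρ''
    have := f.push_linear hf
    have := g.push_linear hg
    have := (f.comp g).push_linear hfg
    exact ⟨cR, cL, hcR, hcL, canonical_comp f.adj g.adj (f.comp g).adj hn hn' (hP X'')
      (RingedTopos.isFlatFunctor_pull (f.comp g)) (f.pushComp g) hθf hθg hθfg cR.hom cL.hom hcR hcL⟩
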